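/- Let $T>0$, $\mathbb T^3=\mathbb R^3/\mathbb Z^3$, and write $X^{s+}$ for membership in $X^{s+\epsilon}$ for some $\epsilon>0$. Let $\phi$ denote any radial $C^\infty$ compactly supported function on $\mathbb R^3$ with $\int\phi=1$ (a mollifier), $\phi_\epsilon(x)=\epsilon^{-3}\phi(x/\epsilon)$. A functional vorticity solution of the incompressible Euler equations is a pair $(u,\omega)$ with $u\in L^\infty((0,T);H^{1/2+}(\mathbb T^3;\mathbb R^3))$ of zero spatial mean, $\omega=\nabla\times u$, $\nabla\cdot u=\nabla\cdot\omega=0$ in the sense of distributions, and $$\int_0^T\langle\omega,\partial_t\psi\rangle\,dt+\int_0^T\langle u\otimes\omega-\omega\otimes u,\nabla\psi\rangle\,dt=0\qquad\text{for all }\psi\in\mathcal D(\mathbb T^3\times(0,T);\mathbb R^3),$$ where $\langle\cdot,\cdot\rangle$ denotes spatial duality brackets (extensions by continuity of the distributional bracket), $\langle u\otimes\omega,\nabla\psi\rangle=\langle\omega_j,u_i\partial_i\psi_j\rangle$ and $\langle\omega\otimes u,\nabla\psi\rangle=\langle\omega_i,u_j\partial_i\psi_j\rangle$. Put $\delta u(\xi;x,t)=u(x+\xi,t)-u(x,t)$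 and define $\delta\omega$ by duality, $\langle\delta\omega(\xi),\psi\rangle=\langle\omega,\psi(\cdot-\xi)-\psi\rangle$; thus $\langle\delta u(\delta\omega\cdot\delta u),\varphi\rangle=\langle\delta\omega,(\delta u\cdot\varphi)\delta u\rangle$ and $\langle\delta\omega|\delta u|^2,\varphi\rangle=\langle\delta\omega,|\delta u|^2\varphi\rangle$. **Proposition.** Let $(u,\omega)$ be a functional vorticity solution with $u\in L^3((0,T);W^{1/2+,3}(\mathbb T^3))$. Suppose there are $C\in L^1(0,T)$ and $\sigma\in L^\infty_{loc}(\mathbb R)$ with $\sigma(r)\to0$ as $r\to0^+$ such that, for almost every $t\in(0,T)$, all $\xi\in\mathbb T^3$ (represented in $[-\tfrac12,\tfrac12)^3$) and all $\varphi\in C^\infty(\mathbb T^3;\mathbb R^3)$, $$|\langle\delta u(\delta\omega\cdot\delta u),\varphi\rangle|\le C(t)|\xi|\sigma(|\xi|)\|\varphi\|_{W^{1/2,\infty}},\qquad |\langle\delta\omega|\delta u|^2,\varphi\rangle|\le C(t)|\xi|\sigma(|\xi|)\|\varphi\|_{W^{1/2,\infty}}.$$ Then the limits $$D_1(u,\omega)=\lim_{\epsilon\to0}\int_{\mathbb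 R^3}\nabla\phi_\epsilon(\xi)\cdot\delta u\,(\delta\omega\cdot\delta u)\,d\xi,\qquad D_2(u,\omega)=\lim_{\epsilon\to0}\int_{\mathbb R^3}\nabla\phi_\epsilon(\xi)\cdot\delta\omega\,|\delta u|^2\,d\xi$$ exist individually in $\mathcal D'(\mathbb T^3\times(0,T))$ for every mollifier $\phi$, and both are zero; here the integrals are understood weakly, i.e. tested against $\varphi\in\mathcal D(\mathbb T^3\times(0,T);\mathbb R)$ they are $\int_0^T\int_{\mathbb R^3}\langle\delta u(\delta\omega\cdot\delta u),\varphi\nabla\phi_\epsilon(\xi)\rangle\,d\xi\,dt$ and $\int_0^T\int_{\mathbb R^3}\langle\delta\omega|\delta u|^2,\varphi\nabla\phi_\epsilon(\xi)\rangle\,d\xi\,dt$, all brackets being well defined for almost every $t$ and the integrands integrable in $(\xi,t)$. Consequently the local helicity density $u\cdot\omega$ is conserved: there is a pressure $p\in L^{3/2}((0,T);W^{1/2+,3/2}(\mathbb T^3))$ of zero spatial mean with $\partial_tu+\nabla\cdot(u\otimes u)+\nabla p=0$ in $\mathcal D'(\mathbb T^3\times(0,T))$, and $$2\,\partial_t(u\cdot\omega)+2\,\nabla\cdot(p\,\omega)+\nabla\cdot\big[2(u\cdot\omega)u-|u|^2\omega\big]=0\qquad\text{in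 }\mathcal D'(\mathbb T^3\times(0,T)),$$ all products being well defined as distributions. -/

import Mathlib

open MeasureTheory Filter Topology Set
open scoped ENNReal

noncomputable section

namespace Helicity

/-- Three-dimensional Euclidean space. Functions on the torus `𝕋³ = ℝ³ / ℤ³` are treated as
`ℤ³`-periodic functions on it. -/
abbrev E3 : Type := EuclideanSpace ℝ (Fin 3)

/-- The `i`-th standard basis vector. -/
def basisVec (i : Fin 3) : E3 := EuclideanSpace.single i (1 : ℝ)

/-- Periodicity with respect to the lattice `ℤ³`. -/
def IsPeriodic {F : Type*} (f : E3 → F) : Prop :=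
  ∀ (x : E3) (i : Fin 3), f (x + basisVec i) = f x

/-- The fundamental cell `[0,1)³`; integrals over the torus are integrals over this cell. -/
def cell : Set E3 := {x | ∀ i, x i ∈ Ico (0 : ℝ) 1}

/-- The centred cell `[-1/2,1/2)³`. Each class of `ξ` modulo `ℤ³` has exactly one representative
here, and the Euclidean length of that representative is the distance of `ξ` to `0` in `𝕋³`. -/
def centredCell : Set E3 := {ξ | ∀ i, ξ i ∈ Ico (-(1 / 2) : ℝ) (1 / 2)}

/-! ### Sobolev spaces on the torus -/

/-- The Sobolev-Slobodeckij norm of `W^{s,p}(𝕋³)`, for `0 < s < 1` and `1 ≤ p < ∞`, with values in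
`[0,∞]`; for `p = 2` it is a norm of `H^s(𝕋³)`. -/
def sobolevNorm {F : Type*} [NormedAddCommGroup F] (s p : ℝ) (f : E3 → F) : ℝ≥0∞ :=
  ((∫⁻ x in cell, ‖f x‖ₑ ^ p) +
    ∫⁻ x in cell, ∫⁻ ξ in centredCell, ‖f (x + ξ) - f x‖ₑ ^ p / ‖ξ‖ₑ ^ (3 + s * p)) ^ (1 / p)

/-- `f ∈ L^r((0,T); W^{s+,p}(𝕋³))`: membership in `L^r((0,T); W^{s',p}(𝕋³))` for some `s' > s`
(for `0 ≤ s < 1`; as these spaces decrease in `s'`, one may take `s' < 1`). -/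
def MemLpSobolevPlus {F : Type*} [NormedAddCommGroup F] (T : ℝ) (r : ℝ≥0∞) (s p : ℝ)
    (f : ℝ → E3 → F) : Prop :=
  (∀ t, IsPeriodic (f t)) ∧
  AEStronglyMeasurable (fun z : ℝ × E3 => f z.1 z.2)
    ((volume.restrict (Ioo 0 T)).prod volume) ∧
  ∃ s' : ℝ, s < s' ∧ s' < 1 ∧
    eLpNorm (fun t => sobolevNorm s' p (f t)) r (volume.restrict (Ioo 0 T)) < ⊤

/-- The norm of `W^{1/2,∞}(𝕋³) = C^{0,1/2}(𝕋³)` (used for smooth periodic functions only, for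
which both suprema are finite). -/
def halfHolderNorm (φ : E3 → E3) : ℝ :=
  (⨆ x, ‖φ x‖) + ⨆ z : E3 × E3, ‖φ z.1 - φ z.2‖ / ‖z.1 - z.2‖ ^ (1 / 2 : ℝ)

/-! ### Test functions -/

/-- Smooth vector fields on the torus, `C^∞(𝕋³; ℝ³)`. -/
def testFields : Submodule ℝ (E3 → E3) where
  carrier := {f | ContDiff ℝ (⊤ : ℕ∞) f ∧ IsPeriodic f}
  add_mem' := fun {f g} hf hg =>
    ⟨hf.1.add hg.1, fun x i => by simp only [Pi.add_apply, hf.2 x i, hg.2 x i]⟩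
  zero_mem' := ⟨contDiff_const, fun _ _ => rfl⟩
  smul_mem' := fun c f hf =>
    ⟨hf.1.const_smul c, fun x i => by simp only [Pi.smul_apply, hf.2 x i]⟩

/-- Space-time test functions: `φ ∈ 𝒟(𝕋³ × (0,T); F)`. -/
structure IsTest {F : Type*} [NormedAddCommGroup F] [NormedSpace ℝ F] (T : ℝ)
    (φ : ℝ → E3 → F) : Prop where
  smooth : ContDiff ℝ (⊤ : ℕ∞) (fun z : ℝ × E3 => φ z.1 z.2)
  periodic : ∀ t, IsPeriodic (φ t)
  support : ∃ a b : ℝ, 0 < a ∧ b < T ∧ ∀ t, t ∉ Icc a b → ∀ x, φ t x = 0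

/-- The time derivative `∂_t φ (t, ·)`. -/
def timeDeriv {F : Type*} [NormedAddCommGroup F] [NormedSpace ℝ F] (φ : ℝ → E3 → F) (t : ℝ)
    (x : E3) : F :=
  deriv (fun τ => φ τ x) t

/-- `∂_j ψ_i (x)`. -/
def partialD (ψ : E3 → E3) (j i : Fin 3) (x : E3) : ℝ := fderiv ℝ ψ x (basisVec j) i

/-- The curl `∇ × ψ`. -/
def curl (ψ : E3 → E3) (x : E3) : E3 :=
  !₂[partialD ψ 1 2 x - partialD ψ 2 1 x,
     partialD ψ 2 0 x - partialD ψ 0 2 x,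
     partialD ψ 0 1 x - partialD ψ 1 0 x]

/-- The divergence `∇ · ψ`. -/
def div (ψ : E3 → E3) (x : E3) : ℝ := ∑ i, partialD ψ i i x

/-! ### Mollifiers, distributions and duality brackets -/

/-- Radial smooth compactly supported mollifiers of integral one. -/
structure IsMollifier (ρ : E3 → ℝ) : Prop where
  smooth : ContDiff ℝ (⊤ : ℕ∞) ρ
  compact : HasCompactSupport ρ
  radial : ∀ x y : E3, ‖x‖ = ‖y‖ → ρ x = ρ y
  integral_eq : ∫ x, ρ x = 1

/-- `ρ_ε(x) = ε⁻³ ρ(x / ε)`. -/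
def rescale (ρ : E3 → ℝ) (ε : ℝ) (x : E3) : ℝ := (ε ^ 3)⁻¹ * ρ (ε⁻¹ • x)

/-- The mollification `f * ρ_ε`. -/
def mollify (ρ : E3 → ℝ) (ε : ℝ) (f : E3 → E3) (x : E3) : E3 :=
  ∫ y, rescale ρ ε y • f (x - y)

/-- Vector-valued distributions on the torus: continuous linear functionals on
`C^∞(𝕋³; ℝ³)`. -/
structure VecDistribution where
  toLin : testFields →ₗ[ℝ] ℝ
  continuous' : ∃ (N : ℕ) (K : ℝ), ∀ ψ : testFields,
    |toLin ψ| ≤ K * ∑ n ∈ Finset.range (N + 1), ⨆ x, ‖iteratedFDeriv ℝ n (ψ : E3 → E3) x‖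

open Classical in
/-- The value of a distribution on a smooth periodic field (and `0` on anything else). -/
def VecDistribution.eval (w : VecDistribution) (ψ : E3 → E3) : ℝ :=
  if h : ψ ∈ testFields then w.toLin ⟨ψ, h⟩ else 0

/-- `⟨w, f⟩ = a`, where the bracket is the extension of the distribution `w` by continuity to a
field `f` which need not be smooth: `⟨w, f * ρ_η⟩ → a` as `η → 0`, for every mollifier `ρ`. If
`w` lies in the dual of a Sobolev or Besov space in which smooth functions are dense and `f` lies
in that space, this is the duality bracket between the two. -/
def HasBracket (w : VecDistribution) (f : E3 → E3) (a : ℝ) : Prop :=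
  ∀ ρ : E3 → ℝ, IsMollifier ρ →
    Tendsto (fun η : ℝ => w.eval (mollify ρ η f)) (𝓝[>] 0) (𝓝 a)

/-- The bracket `⟨w, f⟩` is defined. -/
def BracketDefined (w : VecDistribution) (f : E3 → E3) : Prop := ∃ a, HasBracket w f a

open Classical in
/-- The value of the bracket `⟨w, f⟩`. -/
def bracket (w : VecDistribution) (f : E3 → E3) : ℝ :=
  if h : BracketDefined w f then h.choose else 0

/-! ### Functional vorticity solutions -/

/-- Functional vorticity solutions `(u, ω)` of the incompressible Euler equations on
`𝕋³ × (0,T)`. The tensor pairings are `⟨u ⊗ ω, ∇ψ⟩ = ⟨ω, (u·∇)ψ⟩ = ∑ ⟨ω_j, u_i ∂_i ψ_j⟩` and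
`⟨ω ⊗ u, ∇ψ⟩ = ⟨ω, (∇ψ) u⟩ = ∑ ⟨ω_i, u_j ∂_i ψ_j⟩`. As usual for the velocity recovered from
its vorticity by the Biot-Savart law, `u` has zero mean. -/
structure IsFunctionalVorticitySolution (T : ℝ) (u : ℝ → E3 → E3) (ω : ℝ → VecDistribution) :
    Prop where
  regular : MemLpSobolevPlus T ⊤ (1 / 2) 2 u
  meanFree : ∀ᵐ t ∂(volume.restrict (Ioo 0 T)), ∫ x in cell, u t x = 0
  curl_eq : ∀ᵐ t ∂(volume.restrict (Ioo 0 T)), ∀ ψ : testFields,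
    (ω t).toLin ψ = ∫ x in cell, inner ℝ (u t x) (curl ψ x)
  div_u : ∀ᵐ t ∂(volume.restrict (Ioo 0 T)), ∀ χ : E3 → ℝ, ContDiff ℝ (⊤ : ℕ∞) χ → IsPeriodic χ →
    ∫ x in cell, inner ℝ (u t x) (gradient χ x) = 0
  div_omega : ∀ᵐ t ∂(volume.restrict (Ioo 0 T)), ∀ χ : E3 → ℝ, ContDiff ℝ (⊤ : ℕ∞) χ → IsPeriodic χ →
    (ω t).eval (gradient χ) = 0
  equation : ∀ ψ : ℝ → E3 → E3, IsTest T ψ →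
    (∫ t in Ioo 0 T, bracket (ω t) (timeDeriv ψ t)) +
    (∫ t in Ioo 0 T, bracket (ω t) (fun x =>
      fderiv ℝ (ψ t) x (u t x) -
        ContinuousLinearMap.adjoint (fderiv ℝ (ψ t) x) (u t x))) = 0

/-! ### Increments and defect terms -/

/-- `δf(ξ; x) = f(x + ξ) - f(x)`. -/
def incr (ξ : E3) (f : E3 → E3) (x : E3) : E3 := f (x + ξ) - f x

/-- `⟨δw(ξ), ψ⟩ := ⟨w, δψ(-ξ)⟩` is defined. -/
def IncrBracketDefined (w : VecDistribution) (ξ : E3) (ψ : E3 → E3) : Prop :=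
  BracketDefined w (incr (-ξ) ψ)

/-- `⟨δw(ξ), ψ⟩ := ⟨w, δψ(-ξ)⟩`. -/
def incrBracket (w : VecDistribution) (ξ : E3) (ψ : E3 → E3) : ℝ :=
  bracket w (incr (-ξ) ψ)

/-- The field `(δv · φ) δv`, so that `⟨δv (δw · δv), φ⟩ = ⟨δw, (δv · φ) δv⟩`. -/
def cubic₁ (v : E3 → E3) (ξ : E3) (φ : E3 → E3) (x : E3) : E3 :=
  (inner ℝ (incr ξ v x) (φ x) : ℝ) • incr ξ v x

/-- The field `|δv|² φ`, so that `⟨δw |δv|², φ⟩ = ⟨δw, |δv|² φ⟩`. -/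
def cubic₂ (v : E3 → E3) (ξ : E3) (φ : E3 → E3) (x : E3) : E3 :=
  ‖incr ξ v x‖ ^ 2 • φ x

/-- `⟨δv (δw · δv), φ⟩`. -/
def tripleBracket₁ (w : VecDistribution) (v : E3 → E3) (ξ : E3) (φ : E3 → E3) : ℝ :=
  incrBracket w ξ (cubic₁ v ξ φ)

/-- `⟨δw |δv|², φ⟩`. -/
def tripleBracket₂ (w : VecDistribution) (v : E3 → E3) (ξ : E3) (φ : E3 → E3) : ℝ :=
  incrBracket w ξ (cubic₂ v ξ φ)

/-- `D` is the distributional limit, as `ε → 0` and for every mollifier `ρ`, of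
`D_{1,ε} = ∫ ∇ρ_ε(ξ) · δu (δω · δu) dξ`, this integral of distributions being taken weakly:
`⟨D_{1,ε}, φ⟩ = ∫₀ᵀ ∫ ⟨δu (δω · δu), φ ∇ρ_ε(ξ)⟩ dξ dt`. The first two fields say that the
brackets and the integral are well defined. -/
structure IsDefect₁ (T : ℝ) (u : ℝ → E3 → E3) (ω : ℝ → VecDistribution)
    (D : (ℝ → E3 → ℝ) → ℝ) : Prop where
  defined : ∀ᵐ t ∂(volume.restrict (Ioo 0 T)), ∀ ξ : E3, ∀ φ ∈ testFields,
    IncrBracketDefined (ω t) ξ (cubic₁ (u t) ξ φ)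
  integrable : ∀ ρ, IsMollifier ρ → ∀ φ : ℝ → E3 → ℝ, IsTest T φ → ∀ ε : ℝ, 0 < ε →
    Integrable (fun z : ℝ × E3 =>
      tripleBracket₁ (ω z.1) (u z.1) z.2 (fun x => φ z.1 x • gradient (rescale ρ ε) z.2))
      ((volume.restrict (Ioo 0 T)).prod volume)
  limit : ∀ ρ, IsMollifier ρ → ∀ φ : ℝ → E3 → ℝ, IsTest T φ →
    Tendsto (fun ε : ℝ => ∫ t in Ioo 0 T, ∫ ξ : E3,
      tripleBracket₁ (ω t) (u t) ξ (fun x => φ t x • gradient (rescale ρ ε) ξ))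
      (𝓝[>] 0) (𝓝 (D φ))

/-- `D` is the distributional limit, as `ε → 0` and for every mollifier `ρ`, of
`D_{2,ε} = ∫ ∇ρ_ε(ξ) · δω |δu|² dξ`, in the same sense as for `IsDefect₁`. -/
structure IsDefect₂ (T : ℝ) (u : ℝ → E3 → E3) (ω : ℝ → VecDistribution)
    (D : (ℝ → E3 → ℝ) → ℝ) : Prop where
  defined : ∀ᵐ t ∂(volume.restrict (Ioo 0 T)), ∀ ξ : E3, ∀ φ ∈ testFields,
    IncrBracketDefined (ω t) ξ (cubic₂ (u t) ξ φ)
  integrable : ∀ ρ, IsMollifier ρ → ∀ φ : ℝ → E3 → ℝ, IsTest T φ → ∀ ε : ℝ, 0 < ε →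
    Integrable (fun z : ℝ × E3 =>
      tripleBracket₂ (ω z.1) (u z.1) z.2 (fun x => φ z.1 x • gradient (rescale ρ ε) z.2))
      ((volume.restrict (Ioo 0 T)).prod volume)
  limit : ∀ ρ, IsMollifier ρ → ∀ φ : ℝ → E3 → ℝ, IsTest T φ →
    Tendsto (fun ε : ℝ => ∫ t in Ioo 0 T, ∫ ξ : E3,
      tripleBracket₂ (ω t) (u t) ξ (fun x => φ t x • gradient (rescale ρ ε) ξ))
      (𝓝[>] 0) (𝓝 (D φ))

/-! ### Pressure and local conservation of helicity -/

/-- `p` is the pressure of `u`: it has zero mean and, as a distribution,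
`∂_t u + ∇ · (u ⊗ u) + ∇p = 0`. These two properties determine `p` almost everywhere. -/
structure IsPressure (T : ℝ) (u : ℝ → E3 → E3) (p : ℝ → E3 → ℝ) : Prop where
  regular : MemLpSobolevPlus T (3 / 2) (1 / 2) (3 / 2) p
  meanFree : ∀ᵐ t ∂(volume.restrict (Ioo 0 T)), ∫ x in cell, p t x = 0
  momentum : ∀ ζ : ℝ → E3 → E3, IsTest T ζ →
    ∫ t in Ioo 0 T, ∫ x in cell,
      (inner ℝ (u t x) (timeDeriv ζ t x) + inner ℝ (fderiv ℝ (ζ t) x (u t x)) (u t x) +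
        p t x * div (ζ t) x) = 0

/-- Local conservation of the helicity density `u · ω`: in `𝒟'(𝕋³ × (0,T))`,
`2 ∂_t (u · ω) + 2 ∇ · (p ω) + ∇ · (2 (u · ω) u - |u|² ω) = 0`,
all the products being defined as distributions and integrable in time. -/
structure ConservesLocalHelicity (T : ℝ) (u : ℝ → E3 → E3) (ω : ℝ → VecDistribution)
    (p : ℝ → E3 → ℝ) : Prop where
  defined : ∀ φ : ℝ → E3 → ℝ, IsTest T φ → ∀ᵐ t ∂(volume.restrict (Ioo 0 T)),
    BracketDefined (ω t) (fun x => timeDeriv φ t x • u t x) ∧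
    BracketDefined (ω t) (fun x => p t x • gradient (φ t) x) ∧
    BracketDefined (ω t) (fun x => (inner ℝ (u t x) (gradient (φ t) x) : ℝ) • u t x) ∧
    BracketDefined (ω t) (fun x => ‖u t x‖ ^ 2 • gradient (φ t) x)
  integrable : ∀ φ : ℝ → E3 → ℝ, IsTest T φ →
    IntegrableOn (fun t => bracket (ω t) (fun x => timeDeriv φ t x • u t x)) (Ioo 0 T) ∧
    IntegrableOn (fun t => bracket (ω t) (fun x => p t x • gradient (φ t) x)) (Ioo 0 T) ∧
    IntegrableOn (fun t => bracket (ω t)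
      (fun x => (inner ℝ (u t x) (gradient (φ t) x) : ℝ) • u t x)) (Ioo 0 T) ∧
    IntegrableOn (fun t => bracket (ω t) (fun x => ‖u t x‖ ^ 2 • gradient (φ t) x)) (Ioo 0 T)
  balance : ∀ φ : ℝ → E3 → ℝ, IsTest T φ →
    ∫ t in Ioo 0 T,
      (2 * bracket (ω t) (fun x => timeDeriv φ t x • u t x) +
        2 * bracket (ω t) (fun x => p t x • gradient (φ t) x) +
        (2 * bracket (ω t) (fun x => (inner ℝ (u t x) (gradient (φ t) x) : ℝ) • u t x) -
          bracket (ω t) (fun x => ‖u t x‖ ^ 2 • gradient (φ t) x))) = 0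

end Helicity

end

open MeasureTheory Filter Topology Set
open scoped ENNReal Pointwise

noncomputable section

namespace Helicity

open scoped Pointwise

/-! ### The torus as a fundamental domain -/

/-- Lebesgue measure on the fundamental cell. -/
abbrev cm : Measure E3 := volume.restrict cell

/-- The lattice `ℤ³`. -/
abbrev lattice : Submodule ℤ E3 :=
  Submodule.span ℤ (Set.range (EuclideanSpace.basisFun (Fin 3) ℝ).toBasis)

instance : VAddInvariantMeasure lattice E3 volume :=
  inferInstanceAs <| VAddInvariantMeasure lattice.toAddSubgroup E3 volume

lemma cell_eq_fundamentalDomain :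
    cell = ZSpan.fundamentalDomain (EuclideanSpace.basisFun (Fin 3) ℝ).toBasis := by
  ext x
  simp [cell, ZSpan.mem_fundamentalDomain]

lemma isAddFundamentalDomain_cell : IsAddFundamentalDomain lattice cell volume := by
  rw [cell_eq_fundamentalDomain]
  exact ZSpan.isAddFundamentalDomain _ _

lemma isAddFundamentalDomain_vadd_cell (a : E3) :
    IsAddFundamentalDomain lattice (a +ᵥ cell) volume :=
  isAddFundamentalDomain_cell.vadd_of_comm a

lemma measurableSet_cell : MeasurableSet cell := by
  rw [cell_eq_fundamentalDomain]
  exact ZSpan.fundamentalDomain_measurableSet _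

lemma IsPeriodic.lattice_vadd {F : Type*} {f : E3 → F} (hf : IsPeriodic f) (g : lattice) (x : E3) :
    f (g +ᵥ x) = f x := by
  have key : ∀ y ∈ lattice, ∀ x, f (x + y) = f x := by
    intro y hy
    induction hy using Submodule.span_induction with
    | mem y hy =>
      obtain ⟨i, rfl⟩ := hy
      intro x
      simpa [basisVec] using hf x i
    | zero => simp
    | add y z _ _ hy hz => intro x; rw [← add_assoc, hz, hy]
    | smul n y _ hy =>
      intro x
      induction n generalizing x with
      | zero => simp
      | succ n ih => rw [add_smul, one_smul, ← add_assoc, hy, ih]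
      | pred n ih =>
        have h := hy (x + (-(n : ℤ) - 1) • y)
        rw [← h, add_assoc, ← ih x]
        congr 2
        module
  have : g +ᵥ x = x + (g : E3) := by rw [add_comm]; rfl
  rw [this, key _ g.2]

lemma IsPeriodic.exists_mem_cell {F : Type*} {f : E3 → F} (hf : IsPeriodic f) (x : E3) :
    ∃ y ∈ cell, f y = f x := by
  obtain ⟨g, hg, -⟩ := ZSpan.exist_unique_vadd_mem_fundamentalDomain
    (EuclideanSpace.basisFun (Fin 3) ℝ).toBasis x
  exact ⟨g +ᵥ x, by rw [cell_eq_fundamentalDomain]; exact hg, hf.lattice_vadd g x⟩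

lemma IsPeriodic.comp_add {F : Type*} {f : E3 → F} (hf : IsPeriodic f) (a : E3) :
    IsPeriodic (fun x => f (x + a)) := fun x i => by
  change f (x + basisVec i + a) = f (x + a)
  rw [add_right_comm, hf]

lemma cell_subset_closedBall : cell ⊆ Metric.closedBall 0 2 := by
  intro x hx
  rw [mem_closedBall_zero_iff, EuclideanSpace.norm_eq]
  rw [Real.sqrt_le_left (by norm_num), Fin.sum_univ_three]
  have h : ∀ i, ‖x i‖ ^ 2 ≤ 1 := fun i => by
    have := hx i
    rw [Real.norm_eq_abs, sq_abs]
    nlinarith [this.1, this.2]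
  linarith [h 0, h 1, h 2]

lemma volume_cell : volume cell = 1 := by
  rw [cell_eq_fundamentalDomain]
  rw [measure_congr (ZSpan.fundamentalDomain_ae_parallelepiped _ volume)]
  simpa using (EuclideanSpace.basisFun (Fin 3) ℝ).volume_parallelepiped

instance : IsProbabilityMeasure cm := ⟨by simp [volume_cell]⟩

lemma map_add_restrict_cell (a : E3) :
    MeasurePreserving (fun x => x + a) cm (volume.restrict (a +ᵥ cell)) := by
  have h := (measurePreserving_add_right (volume : Measure E3) a).restrict_preimage_emb
    (MeasurableEquiv.addRight a).measurableEmbedding (a +ᵥ cell)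
  have e : (fun x => x + a) ⁻¹' (a +ᵥ cell) = cell := by
    ext x
    rw [Set.mem_preimage, Set.mem_vadd_set_iff_neg_vadd_mem]
    simp
  rwa [e] at h

lemma IsPeriodic.integral_add {F : Type*} [NormedAddCommGroup F] [NormedSpace ℝ F] {f : E3 → F}
    (hf : IsPeriodic f) (a : E3) : ∫ x in cell, f (x + a) = ∫ x in cell, f x := by
  rw [(map_add_restrict_cell a).integral_comp (MeasurableEquiv.addRight a).measurableEmbedding f]
  exact (isAddFundamentalDomain_vadd_cell a).setIntegral_eq isAddFundamentalDomain_cell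
    hf.lattice_vadd

lemma IsPeriodic.lintegral_add {f : E3 → ℝ≥0∞} (hf : IsPeriodic f) (a : E3) :
    ∫⁻ x in cell, f (x + a) = ∫⁻ x in cell, f x := by
  rw [(map_add_restrict_cell a).lintegral_comp_emb
    (MeasurableEquiv.addRight a).measurableEmbedding f]
  exact (isAddFundamentalDomain_vadd_cell a).setLIntegral_eq isAddFundamentalDomain_cell
    _ hf.lattice_vadd

lemma IsPeriodic.eLpNorm_add {f : E3 → ℝ} (hf : IsPeriodic f) (hm : AEStronglyMeasurable f volume)
    (q : ℝ≥0∞) (a : E3) : eLpNorm (fun x => f (x + a)) q cm = eLpNorm f q cm := by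
  have h1 : eLpNorm (fun x => f (x + a)) q cm = eLpNorm f q (volume.restrict (a +ᵥ cell)) :=
    eLpNorm_comp_measurePreserving (hm.restrict) (map_add_restrict_cell a)
  rw [h1]
  rcases eq_or_ne q 0 with rfl | hq0
  · simp
  rcases eq_or_ne q ⊤ with rfl | hq
  · simp only [eLpNorm_exponent_top, eLpNormEssSup]
    rw [(isAddFundamentalDomain_vadd_cell a).essSup_measure_restrict,
      isAddFundamentalDomain_cell.essSup_measure_restrict]
    all_goals intro g x; rw [hf.lattice_vadd]
  · rw [eLpNorm_eq_lintegral_rpow_enorm_toReal hq0 hq, eLpNorm_eq_lintegral_rpow_enorm_toReal hq0 hq]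
    congr 1
    exact (isAddFundamentalDomain_vadd_cell a).setLIntegral_eq isAddFundamentalDomain_cell
      _ (fun g x => by rw [hf.lattice_vadd])

lemma IsPeriodic.locallyIntegrable {F : Type*} [NormedAddCommGroup F] {f : E3 → F}
    (hf : IsPeriodic f) (hi : Integrable f cm) : LocallyIntegrable f volume := by
  intro x
  set c : E3 := x - !₂[(1 / 2 : ℝ), 1 / 2, 1 / 2] with hc
  refine ⟨c +ᵥ cell, ?_, ?_⟩
  · have : Metric.ball x (1 / 2) ⊆ c +ᵥ cell := by
      intro y hy
      rw [Set.mem_vadd_set_iff_neg_vadd_mem]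
      intro i
      have h1 : |y i - x i| < 1 / 2 := by
        have h2 : ‖(y - x) i‖ ≤ ‖y - x‖ := PiLp.norm_apply_le (y - x) i
        rw [mem_ball_iff_norm] at hy
        have := h2.trans_lt hy
        simpa using this
      have h2 : (-c +ᵥ y) i = y i - x i + 1 / 2 := by
        fin_cases i <;> simp [hc] <;> ring
      rw [h2, Set.mem_Ico]
      rw [abs_lt] at h1
      constructor <;> linarith
    exact Filter.mem_of_superset (Metric.ball_mem_nhds x (by norm_num)) this
  · exact ((isAddFundamentalDomain_vadd_cell c).integrableOn_iff isAddFundamentalDomain_cell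
      hf.lattice_vadd).2 hi

/-! ### Partial derivatives of scalar functions -/

/-- The partial derivative `∂_j f` of a scalar function. -/
def pd (j : Fin 3) (f : E3 → ℝ) (x : E3) : ℝ := fderiv ℝ f x (basisVec j)

/-- Smooth scalar functions. -/
abbrev CInf (f : E3 → ℝ) : Prop := ContDiff ℝ (⊤ : ℕ∞) f

lemma CInf.diff {f : E3 → ℝ} (hf : CInf f) : Differentiable ℝ f := hf.differentiable (by simp)

lemma CInf.pd {f : E3 → ℝ} (hf : CInf f) (j : Fin 3) : CInf (pd j f) :=
  (hf.fderiv_right (m := (⊤ : ℕ∞)) (by simp)).clm_apply contDiff_const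

lemma pd_add {f g : E3 → ℝ} (hf : CInf f) (hg : CInf g) (j : Fin 3) :
    pd j (fun x => f x + g x) = fun x => pd j f x + pd j g x := by
  ext x; simp [pd, fderiv_fun_add (hf.diff x) (hg.diff x)]

lemma pd_sub {f g : E3 → ℝ} (hf : CInf f) (hg : CInf g) (j : Fin 3) :
    pd j (fun x => f x - g x) = fun x => pd j f x - pd j g x := by
  ext x; simp [pd, fderiv_fun_sub (hf.diff x) (hg.diff x)]

lemma pd_mul {f g : E3 → ℝ} (hf : CInf f) (hg : CInf g) (j : Fin 3) :
    pd j (fun x => f x * g x) = fun x => f x * pd j g x + g x * pd j f x := by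
  ext x; simp [pd, fderiv_fun_mul (hf.diff x) (hg.diff x)]

lemma pd_const_mul {f : E3 → ℝ} (hf : CInf f) (c : ℝ) (j : Fin 3) :
    pd j (fun x => c * f x) = fun x => c * pd j f x := by
  ext x; simp [pd, fderiv_const_mul (hf.diff x)]

lemma pd_const (c : ℝ) (j : Fin 3) : pd j (fun _ => c) = fun _ => 0 := by
  ext x; simp [pd]

lemma pd_sum {ι : Type*} (s : Finset ι) {f : ι → E3 → ℝ} (hf : ∀ i ∈ s, CInf (f i)) (j : Fin 3) :
    pd j (fun x => ∑ i ∈ s, f i x) = fun x => ∑ i ∈ s, pd j (f i) x := by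
  ext x; simp [pd, fderiv_fun_sum (fun i hi => (hf i hi).diff x)]

lemma pd_comm {f : E3 → ℝ} (hf : CInf f) (i j : Fin 3) : pd i (pd j f) = pd j (pd i f) := by
  have key : ∀ i j x, pd i (pd j f) x = fderiv ℝ (fderiv ℝ f) x (basisVec i) (basisVec j) := by
    intro i j x
    have h : DifferentiableAt ℝ (fderiv ℝ f) x :=
      ((hf.fderiv_right (m := (⊤ : ℕ∞)) (by simp)).differentiable (by simp)) x
    simp only [pd]
    change fderiv ℝ (fun y => fderiv ℝ f y (basisVec j)) x (basisVec i) = _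
    rw [fderiv_clm_apply h (differentiableAt_const _)]
    simp
  ext x
  rw [key, key]
  exact (hf.contDiffAt.isSymmSndFDerivAt (by
    simp only [minSmoothness_of_isRCLikeNormedField]
    exact WithTop.coe_le_coe.2 (le_top : (2 : ℕ∞) ≤ ⊤))).eq _ _

lemma pd_periodic {f : E3 → ℝ} (hf : IsPeriodic f) (j : Fin 3) : IsPeriodic (pd j f) := by
  intro x i
  have h : f = fun y => f (y + basisVec i) := funext fun y => (hf y i).symm
  simp only [pd]
  conv_rhs => rw [h]
  rw [fderiv_comp_add_right]

/-- Smooth periodic scalar functions. -/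
structure SmP (f : E3 → ℝ) : Prop where
  smooth : CInf f
  per : IsPeriodic f

namespace SmP

variable {f g : E3 → ℝ}

lemma add (hf : SmP f) (hg : SmP g) : SmP (fun x => f x + g x) :=
  ⟨hf.1.add hg.1, fun x i => by rw [hf.2, hg.2]⟩

lemma sub (hf : SmP f) (hg : SmP g) : SmP (fun x => f x - g x) :=
  ⟨hf.1.sub hg.1, fun x i => by rw [hf.2, hg.2]⟩

lemma mul (hf : SmP f) (hg : SmP g) : SmP (fun x => f x * g x) :=
  ⟨hf.1.mul hg.1, fun x i => by rw [hf.2, hg.2]⟩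

lemma const (c : ℝ) : SmP (fun _ => c) := ⟨contDiff_const, fun _ _ => rfl⟩

lemma const_mul (c : ℝ) (hf : SmP f) : SmP (fun x => c * f x) := (const c).mul hf

lemma sum {ι : Type*} {s : Finset ι} {F : ι → E3 → ℝ} (hF : ∀ i ∈ s, SmP (F i)) :
    SmP (fun x => ∑ i ∈ s, F i x) :=
  ⟨ContDiff.sum fun i hi => (hF i hi).1, fun x i =>
    Finset.sum_congr rfl fun j hj => (hF j hj).2 x i⟩

lemma pd (hf : SmP f) (j : Fin 3) : SmP (pd j f) := ⟨hf.1.pd j, pd_periodic hf.2 j⟩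

lemma comp_add (hf : SmP f) (a : E3) : SmP (fun x => f (x + a)) :=
  ⟨hf.1.comp (contDiff_id.add contDiff_const), hf.2.comp_add a⟩

lemma continuous (hf : SmP f) : Continuous f := hf.1.continuous

end SmP

lemma IsPeriodic.exists_bound {F : Type*} [NormedAddCommGroup F] {f : E3 → F} (hf : IsPeriodic f)
    (hc : Continuous f) :
    ∃ C, 0 ≤ C ∧ ∀ x, ‖f x‖ ≤ C := by
  obtain ⟨C, hC⟩ := (isCompact_closedBall (0 : E3) 2).exists_bound_of_continuousOn hc.continuousOn
  have hx : ∀ x, ‖f x‖ ≤ C := fun x => by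
    obtain ⟨y, hy, h⟩ := hf.exists_mem_cell x
    rw [← h]; exact hC y (cell_subset_closedBall hy)
  exact ⟨C, (norm_nonneg _).trans (hx 0), hx⟩

lemma SmP.exists_bound {f : E3 → ℝ} (hf : SmP f) : ∃ C, 0 ≤ C ∧ ∀ x, |f x| ≤ C :=
  hf.per.exists_bound hf.continuous

lemma Continuous.integrable_cm {F : Type*} [NormedAddCommGroup F] {f : E3 → F}
    (hf : Continuous f) : Integrable f cm :=
  (hf.locallyIntegrable.integrableOn_isCompact (isCompact_closedBall (0 : E3) 2)).mono_set
    cell_subset_closedBall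

lemma SmP.integrable {f : E3 → ℝ} (hf : SmP f) : Integrable f cm := Continuous.integrable_cm hf.continuous

lemma Integrable.mul_smp {f g : E3 → ℝ} (hf : Integrable f cm) (hg : SmP g) :
    Integrable (fun x => f x * g x) cm := by
  obtain ⟨C, -, hC⟩ := hg.exists_bound
  exact hf.mul_bdd (c := C) hg.continuous.aestronglyMeasurable (Eventually.of_forall hC)

/-- The integral over the torus of a derivative vanishes. -/
lemma integral_pd {f : E3 → ℝ} (hf : SmP f) (j : Fin 3) : ∫ x in cell, pd j f x = 0 := by
  have hc := (hf.pd j).continuous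
  have h1 : ∀ x, ∫ s in (0:ℝ)..1, pd j f (x + s • basisVec j) = 0 := by
    intro x
    have hd : ∀ s ∈ uIcc (0:ℝ) 1, HasDerivAt (fun s : ℝ => f (x + s • basisVec j))
        (pd j f (x + s • basisVec j)) s := by
      intro s _
      have h := (hf.smooth.diff (x + s • basisVec j)).hasFDerivAt.comp_hasDerivAt s
        (((hasDerivAt_id s).smul_const (basisVec j)).const_add x)
      simpa [pd, Function.comp_def] using h
    rw [intervalIntegral.integral_eq_sub_of_hasDerivAt hd
      (Continuous.intervalIntegrable (by fun_prop) _ _)]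
    simp [hf.per x j]
  have h2 : ∫ x in cell, ∫ s in (0:ℝ)..1, pd j f (x + s • basisVec j) = 0 := by
    simp [h1]
  obtain ⟨C, -, hC⟩ := (hf.pd j).exists_bound
  simp only [intervalIntegral.integral_of_le zero_le_one] at h2
  rw [integral_integral_swap] at h2
  · simp only [(hf.pd j).per.integral_add] at h2
    simpa using h2
  · exact Integrable.of_bound (C := C) (Continuous.aestronglyMeasurable (by fun_prop))
      (Eventually.of_forall fun z => hC _)

lemma integral_pd_mul {f g : E3 → ℝ} (hf : SmP f) (hg : SmP g) (j : Fin 3) :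
    ∫ x in cell, pd j f x * g x = - ∫ x in cell, f x * pd j g x := by
  have h := integral_pd (hf.mul hg) j
  rw [pd_mul hf.1 hg.1, integral_add (hf.mul (hg.pd j)).integrable (hg.mul (hf.pd j)).integrable] at h
  simp only [mul_comm (g _)] at h
  linarith

/-! ### Convolution kernels -/

/-- Smooth compactly supported kernels. -/
structure Ker (K : E3 → ℝ) : Prop where
  smooth : CInf K
  compact : HasCompactSupport K

/-- Convolution of a scalar function with a kernel. -/
def cv (K f : E3 → ℝ) (x : E3) : ℝ := ∫ y, K y * f (x - y)

lemma cv_eq_convolution (K f : E3 → ℝ) :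
    cv K f = convolution K f (ContinuousLinearMap.mul ℝ ℝ) volume := rfl

namespace Ker

variable {K : E3 → ℝ}

lemma continuous (hK : Ker K) : Continuous K := hK.1.continuous

lemma integrable (hK : Ker K) : Integrable K volume :=
  hK.continuous.integrable_of_hasCompactSupport hK.compact

lemma pd (hK : Ker K) (j : Fin 3) : Ker (pd j K) :=
  ⟨hK.1.pd j, hK.2.fderiv_apply ℝ _⟩

lemma const_mul (hK : Ker K) (c : ℝ) : Ker (fun x => c * K x) :=
  ⟨contDiff_const.mul hK.1, hK.2.mul_left⟩

lemma integrable_mul (hK : Ker K) {f : E3 → ℝ} (hf : LocallyIntegrable f volume) (x : E3) :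
    Integrable (fun y => K y * f (x - y)) volume :=
  hK.compact.convolutionExists_left (ContinuousLinearMap.mul ℝ ℝ) hK.continuous hf x

lemma exists_radius (hK : Ker K) : ∃ R, 0 < R ∧ ∀ y, K y ≠ 0 → ‖y‖ ≤ R := by
  obtain ⟨R, hR⟩ := hK.compact.isCompact.isBounded.subset_closedBall (0 : E3)
  refine ⟨max R 1, by positivity, fun y hy => ?_⟩
  have := hR (subset_tsupport K hy)
  rw [mem_closedBall_zero_iff] at this
  exact this.trans (le_max_left _ _)

/-- A derivative of a kernel has integral zero. -/
lemma integral_pd (hK : Ker K) (j : Fin 3) : ∫ y, Helicity.pd j K y = 0 := by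
  have := integral_mul_fderiv_eq_neg_fderiv_mul_of_integrable (μ := volume) (f := fun _ : E3 => (1:ℝ))
    (g := K) (v := basisVec j) (by simp) (by simpa [Helicity.pd] using! (hK.pd j).integrable)
    (by simpa using hK.integrable) (fun _ _ => by fun_prop)
    (fun x _ => hK.1.diff x)
  simpa [Helicity.pd] using this

end Ker

lemma cv_smooth {K f : E3 → ℝ} (hK : Ker K) (hf : LocallyIntegrable f volume) : CInf (cv K f) := by
  rw [cv_eq_convolution]
  exact hK.compact.contDiff_convolution_left _ hK.smooth hf

lemma cv_periodic (K : E3 → ℝ) {f : E3 → ℝ} (hf : IsPeriodic f) : IsPeriodic (cv K f) := by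
  intro x i
  simp only [cv]
  congr 1; ext y
  rw [add_sub_right_comm, hf]

lemma cv_smp {K f : E3 → ℝ} (hK : Ker K) (hf : LocallyIntegrable f volume) (hp : IsPeriodic f) :
    SmP (cv K f) := ⟨cv_smooth hK hf, cv_periodic K hp⟩

lemma pd_cv {K f : E3 → ℝ} (hK : Ker K) (hf : LocallyIntegrable f volume) (j : Fin 3) :
    pd j (cv K f) = cv (pd j K) f := by
  ext x
  have hd := hK.compact.hasFDerivAt_convolution_left (ContinuousLinearMap.mul ℝ ℝ) (μ := volume)
    (hK.smooth.of_le (by simp)) hf x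
  simp only [pd, cv_eq_convolution]
  rw [hd.fderiv]
  rw [convolution, ContinuousLinearMap.integral_apply]
  · simp [convolution, pd]
  · have := (hK.compact.fderiv ℝ).convolutionExists_left
      ((ContinuousLinearMap.mul ℝ ℝ).precompL E3) (μ := volume)
      (hK.smooth.continuous_fderiv (by simp)) hf x
    exact this

lemma cv_pd {K f : E3 → ℝ} (hK : Ker K) (hf : CInf f) (j : Fin 3) :
    cv (pd j K) f = cv K (pd j f) := by
  ext x
  simp only [cv]
  have hf' : CInf (fun y => f (x - y)) := hf.comp (contDiff_const.sub contDiff_id)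
  have e : ∀ y, fderiv ℝ (fun y => f (x - y)) y (basisVec j) = - pd j f (x - y) := by
    intro y
    have := (hf.diff (x - y)).hasFDerivAt.comp y ((hasFDerivAt_id y).const_sub x)
    have h2 := this.fderiv
    change fderiv ℝ (f ∘ fun y => x - y) y (basisVec j) = _
    rw [h2]; simp [pd]
  have := integral_mul_fderiv_eq_neg_fderiv_mul_of_integrable (μ := volume)
    (f := fun y => f (x - y)) (g := K) (v := basisVec j) ?_ ?_ ?_
    (fun y _ => hf'.diff y) (fun x _ => hK.1.diff x)
  · simp only [e] at this
    simp only [neg_mul, integral_neg, neg_neg] at this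
    simp only [mul_comm (K _)]
    rw [← this]
    simp only [pd, mul_comm]
  · refine Continuous.integrable_of_hasCompactSupport ?_ (hK.compact.mul_left)
    exact (hf'.continuous_fderiv (by simp)).clm_apply continuous_const |>.mul hK.continuous
  · exact Continuous.integrable_of_hasCompactSupport
      (hf'.continuous.mul (hK.pd j).continuous) ((hK.pd j).compact.mul_left)
  · exact Continuous.integrable_of_hasCompactSupport
      (hf'.continuous.mul hK.continuous) (hK.compact.mul_left)

lemma CInf.locInt {f : E3 → ℝ} (hf : CInf f) : LocallyIntegrable f volume :=
  hf.continuous.locallyIntegrable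

lemma cv_add {K f g : E3 → ℝ} (hK : Ker K) (hf : LocallyIntegrable f volume)
    (hg : LocallyIntegrable g volume) :
    cv K (fun x => f x + g x) = fun x => cv K f x + cv K g x := by
  ext x
  simp only [cv, mul_add]
  exact integral_add (hK.integrable_mul hf x) (hK.integrable_mul hg x)

lemma cv_sub {K f g : E3 → ℝ} (hK : Ker K) (hf : LocallyIntegrable f volume)
    (hg : LocallyIntegrable g volume) :
    cv K (fun x => f x - g x) = fun x => cv K f x - cv K g x := by
  ext x
  simp only [cv, mul_sub]
  exact integral_sub (hK.integrable_mul hf x) (hK.integrable_mul hg x)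

lemma cv_const_mul (K f : E3 → ℝ) (c : ℝ) :
    cv K (fun x => c * f x) = fun x => c * cv K f x := by
  ext x
  simp only [cv, ← integral_const_mul]
  congr 1; ext y; ring

lemma cv_sum {ι : Type*} {s : Finset ι} {K : E3 → ℝ} {f : ι → E3 → ℝ} (hK : Ker K)
    (hf : ∀ i ∈ s, LocallyIntegrable (f i) volume) :
    cv K (fun x => ∑ i ∈ s, f i x) = fun x => ∑ i ∈ s, cv K (f i) x := by
  ext x
  simp only [cv, Finset.mul_sum]
  exact integral_finsetSum s fun i hi => hK.integrable_mul (hf i hi) x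

lemma cv_const_mul_ker (K f : E3 → ℝ) (c : ℝ) :
    cv (fun x => c * K x) f = fun x => c * cv K f x := by
  ext x
  simp only [cv, ← integral_const_mul, mul_assoc]

lemma cv_comp_add (K f : E3 → ℝ) (a : E3) :
    cv K (fun x => f (x + a)) = fun x => cv K f (x + a) := by
  ext x
  simp only [cv]
  congr 1; ext y; congr 2; abel

lemma aesm_comp_sub {f : E3 → ℝ} (hf : AEStronglyMeasurable f volume) :
    AEStronglyMeasurable (fun z : E3 × E3 => f (z.1 - z.2)) (cm.prod volume) :=
  (hf.comp_quasiMeasurePreserving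
    (quasiMeasurePreserving_sub (volume : Measure E3) (volume : Measure E3))).mono_ac
    (Measure.absolutelyContinuous_of_le Measure.restrict_le_self |>.prod Measure.AbsolutelyContinuous.rfl)

lemma integrable_cv_prod {K f g : E3 → ℝ} (hK : Ker K) (hfp : IsPeriodic f)
    (hf : Integrable f cm) (hg : Continuous g) (hgp : IsPeriodic g) :
    Integrable (fun z : E3 × E3 => K z.2 * f (z.1 - z.2) * g z.1) (cm.prod volume) := by
  obtain ⟨C, hC0, hC⟩ := hgp.exists_bound hg
  have hl := hfp.locallyIntegrable hf
  refine Integrable.mul_bdd (c := C) ?_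
    (hg.comp continuous_fst).aestronglyMeasurable (Eventually.of_forall fun z => hC _)
  have hm : AEStronglyMeasurable (fun z : E3 × E3 => K z.2 * f (z.1 - z.2)) (cm.prod volume) :=
    (hK.continuous.comp continuous_snd).aestronglyMeasurable.mul
      (aesm_comp_sub hl.aestronglyMeasurable)
  rw [integrable_prod_iff' hm]
  have hi : ∀ y, Integrable (fun x => f (x - y)) cm := fun y => by
    have := ((isAddFundamentalDomain_vadd_cell (-y)).integrableOn_iff isAddFundamentalDomain_cell
      hfp.lattice_vadd).2 hf
    have h2 := ((map_add_restrict_cell (-y)).integrable_comp_emb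
      (MeasurableEquiv.addRight (-y)).measurableEmbedding (g := f)).2 this
    simpa [Function.comp_def, sub_eq_add_neg] using h2
  constructor
  · exact Eventually.of_forall fun y => (hi y).const_mul (K y)
  · have e : ∀ y, ∫ x in cell, ‖K y * f (x - y)‖ = ‖K y‖ * ∫ x in cell, ‖f x‖ := by
      intro y
      simp only [norm_mul, integral_const_mul]
      congr 1
      have hn : IsPeriodic (fun x => ‖f x‖) := fun x i => congrArg norm (hfp x i)
      simpa [sub_eq_add_neg] using hn.integral_add (-y)
    simp only [e]
    exact hK.integrable.norm.mul_const _

/-- Convolution with an even kernel is symmetric. -/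
lemma integral_cv_mul {K f g : E3 → ℝ} (hK : Ker K) (he : ∀ x, K (-x) = K x) (hfp : IsPeriodic f)
    (hf : Integrable f cm) (hg : Continuous g) (hgp : IsPeriodic g) :
    ∫ x in cell, cv K f x * g x = ∫ x in cell, f x * cv K g x := by
  have h1 := integrable_cv_prod hK hfp hf hg hgp
  have h2 : Integrable (fun z : E3 × E3 => K z.2 * g (z.1 - z.2) * f z.1) (cm.prod volume) := by
    obtain ⟨C, hC0, hC⟩ := hgp.exists_bound hg
    have hA : Integrable (fun z : E3 × E3 => f z.1 * K z.2) (cm.prod volume) :=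
      hf.mul_prod hK.integrable
    have := hA.mul_bdd (c := C) (g := fun z : E3 × E3 => g (z.1 - z.2))
      (Continuous.aestronglyMeasurable (by fun_prop)) (Eventually.of_forall fun z => hC _)
    refine this.congr (Eventually.of_forall fun z => ?_)
    simp only; ring
  have e1 : ∫ x in cell, cv K f x * g x = ∫ y, ∫ x in cell, K y * f (x - y) * g x := by
    simp only [cv, ← integral_mul_const]
    exact integral_integral_swap h1
  have e2 : ∫ x in cell, f x * cv K g x = ∫ y, ∫ x in cell, K y * g (x - y) * f x := by
    simp only [mul_comm (f _), cv, ← integral_mul_const]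
    exact integral_integral_swap (f := fun x y => K y * g (x - y) * f x) h2
  rw [e1, e2, ← integral_neg_eq_self (fun y => ∫ x in cell, K y * g (x - y) * f x)]
  congr 1; ext y
  have hp : IsPeriodic (fun x => K y * f (x - y) * g x) := fun x i => by
    simp only [add_sub_right_comm, hfp _ i, hgp _ i]
  rw [← hp.integral_add y]
  congr 1; ext x
  simp only [he, add_sub_cancel_right, sub_neg_eq_add]; ring

/-- Minkowski's integral inequality for a weighted average of functions. -/
lemma eLpNorm_integral_le {F : E3 → E3 → ℝ} {K : E3 → ℝ}
    (hF : AEStronglyMeasurable (fun z : E3 × E3 => F z.1 z.2) (cm.prod volume))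
    (hKc : Measurable K) (hK : Integrable K volume) {q : ℝ≥0∞} (hq : 1 ≤ q) {M : ℝ≥0∞}
    (hM : ∀ y, K y ≠ 0 → eLpNorm (fun x => F x y) q cm ≤ M) :
    eLpNorm (fun x => ∫ y, K y * F x y) q cm ≤ ENNReal.ofReal (∫ y, |K y|) * M := by
  have hKn : ENNReal.ofReal (∫ y, |K y|) = ∫⁻ y, ‖K y‖ₑ := by
    rw [← ofReal_integral_norm_eq_lintegral_enorm hK]; rfl
  rw [hKn]
  have hpt : ∀ x, ‖∫ y, K y * F x y‖ₑ ≤ ∫⁻ y, ‖K y‖ₑ * ‖F x y‖ₑ := fun x =>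
    (enorm_integral_le_lintegral_enorm _).trans_eq (by simp [enorm_mul])
  have hKm : AEMeasurable (fun y => ‖K y‖ₑ) volume := hK.1.enorm
  rcases eq_or_ne q ⊤ with rfl | hqt
  · rw [eLpNorm_exponent_top]
    refine eLpNormEssSup_le_of_ae_enorm_bound ?_
    have h1 : ∀ᵐ x ∂cm, ∀ᵐ y ∂(volume : Measure E3), F x y = hF.mk _ (x, y) :=
      Measure.ae_ae_of_ae_prod hF.ae_eq_mk
    have h2 : ∀ᵐ y ∂(volume : Measure E3), ∀ᵐ x ∂cm, F x y = hF.mk _ (x, y) := by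
      have := Measure.measurePreserving_swap (μ := (volume : Measure E3)) (ν := cm)
        |>.quasiMeasurePreserving.ae hF.ae_eq_mk
      exact Measure.ae_ae_of_ae_prod this
    have h3 : ∀ᵐ y ∂(volume : Measure E3), ∀ᵐ x ∂cm, K y ≠ 0 → ‖hF.mk _ (x, y)‖ₑ ≤ M := by
      filter_upwards [h2] with y hy
      by_cases hKy : K y = 0
      · simp [hKy]
      have h4 := hM y hKy
      rw [eLpNorm_exponent_top] at h4
      filter_upwards [hy, ae_le_eLpNormEssSup (f := fun x => F x y) (μ := cm)] with x hx hx2 _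
      rw [← hx]; exact hx2.trans h4
    have hms : MeasurableSet {z : E3 × E3 | K z.1 ≠ 0 → ‖hF.mk _ (z.2, z.1)‖ₑ ≤ M} := by
      simp only [imp_iff_not_or, not_not, Set.ofPred_or]
      refine (measurableSet_eq_fun (hKc.comp measurable_fst) measurable_const).union
        (measurableSet_le ?_ measurable_const)
      exact (hF.stronglyMeasurable_mk.measurable.comp measurable_swap).enorm
    have h5 := (Measure.ae_ae_comm
      (p := fun y x => K y ≠ 0 → ‖hF.mk _ (x, y)‖ₑ ≤ M) hms).1 h3
    filter_upwards [h1, h5] with x hx hx5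
    refine (hpt x).trans ?_
    rw [← lintegral_mul_const'' _ hKm]
    refine lintegral_mono_ae ?_
    filter_upwards [hx, hx5] with y hy hy5
    by_cases hKy : K y = 0
    · simp [hKy]
    · gcongr
      rw [hy]; exact hy5 hKy
  · have hq0 : q ≠ 0 := (zero_lt_one.trans_le hq).ne'
    have hr1 : 1 ≤ q.toReal := by
      rw [← ENNReal.toReal_one]
      exact ENNReal.toReal_mono hqt hq
    set r := q.toReal with hr
    have hr0 : 0 < r := by linarith
    have hFm : AEMeasurable (fun z : E3 × E3 => ‖F z.1 z.2‖ₑ) (cm.prod volume) := hF.enorm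
    have hKp : AEMeasurable (fun z : E3 × E3 => ‖K z.2‖ₑ) (cm.prod volume) :=
      hKm.comp_quasiMeasurePreserving Measure.quasiMeasurePreserving_snd
    have hFx : ∀ᵐ x ∂cm, AEMeasurable (fun y => ‖F x y‖ₑ) volume := by
      filter_upwards [hF.prodMk_left] with x hx using hx.enorm
    have hH : ∀ᵐ x ∂cm, ‖∫ y, K y * F x y‖ₑ ^ r ≤
        (∫⁻ y, ‖K y‖ₑ) ^ (r - 1) * ∫⁻ y, ‖K y‖ₑ * ‖F x y‖ₑ ^ r := by
      filter_upwards [hFx] with x hx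
      have h := ENNReal.lintegral_mul_norm_pow_le hKm (hKm.mul (hx.pow_const r))
        (p := 1 - 1 / r) (q := 1 / r) (by rw [sub_nonneg, div_le_one hr0]; exact hr1)
        (by positivity) (by ring)
      have e : ∀ y, ‖K y‖ₑ ^ (1 - 1 / r) * (‖K y‖ₑ * ‖F x y‖ₑ ^ r) ^ (1 / r) =
          ‖K y‖ₑ * ‖F x y‖ₑ := by
        intro y
        rw [ENNReal.mul_rpow_of_nonneg _ _ (by positivity), ← ENNReal.rpow_mul,
          mul_one_div_cancel hr0.ne', ENNReal.rpow_one, ← mul_assoc,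
          ← ENNReal.rpow_add_of_nonneg _ _ (by rw [sub_nonneg, div_le_one hr0]; exact hr1)
            (by positivity)]
        simp
      simp only [Pi.mul_apply, e] at h
      refine (ENNReal.rpow_le_rpow ((hpt x).trans h) hr0.le).trans_eq ?_
      rw [ENNReal.mul_rpow_of_nonneg _ _ hr0.le, ← ENNReal.rpow_mul, ← ENNReal.rpow_mul,
        one_div_mul_cancel hr0.ne', ENNReal.rpow_one]
      congr 2
      field_simp
    rw [eLpNorm_eq_lintegral_rpow_enorm_toReal hq0 hqt, ← hr,
      one_div, ENNReal.rpow_inv_le_iff hr0]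
    calc ∫⁻ x in cell, ‖∫ y, K y * F x y‖ₑ ^ r
        ≤ ∫⁻ x in cell, (∫⁻ y, ‖K y‖ₑ) ^ (r - 1) * ∫⁻ y, ‖K y‖ₑ * ‖F x y‖ₑ ^ r :=
          lintegral_mono_ae hH
      _ = (∫⁻ y, ‖K y‖ₑ) ^ (r - 1) * ∫⁻ x in cell, ∫⁻ y, ‖K y‖ₑ * ‖F x y‖ₑ ^ r := by
          rw [lintegral_const_mul' _ _ (ENNReal.rpow_ne_top_of_nonneg (by linarith) ?_)]
          exact hK.2.ne
      _ = (∫⁻ y, ‖K y‖ₑ) ^ (r - 1) * ∫⁻ y, ‖K y‖ₑ * ∫⁻ x in cell, ‖F x y‖ₑ ^ r := by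
          rw [lintegral_lintegral_swap (hKp.mul (hFm.pow_const r))]
          congr 2; ext y
          rw [lintegral_const_mul' _ _ enorm_ne_top]
      _ ≤ (∫⁻ y, ‖K y‖ₑ) ^ (r - 1) * ∫⁻ y, ‖K y‖ₑ * M ^ r := by
          refine mul_le_mul' le_rfl (lintegral_mono fun y => ?_)
          by_cases hKy : K y = 0
          · simp [hKy]
          refine mul_le_mul' le_rfl ?_
          have := hM y hKy
          rwa [eLpNorm_eq_lintegral_rpow_enorm_toReal hq0 hqt, ← hr,
            one_div, ENNReal.rpow_inv_le_iff hr0] at this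
      _ = ((∫⁻ y, ‖K y‖ₑ) * M) ^ r := by
          rw [lintegral_mul_const'' _ hKm, ← mul_assoc, ENNReal.mul_rpow_of_nonneg _ _ hr0.le]
          congr 1
          conv_lhs => rw [← ENNReal.rpow_one (x := ∫⁻ y, ‖K y‖ₑ), ← ENNReal.rpow_mul, one_mul]
          rw [← ENNReal.rpow_add_of_nonneg _ _ (by linarith) zero_le_one]
          simp

/-! ### Rescaled kernels -/

section rescale

variable {K : E3 → ℝ} {ε : ℝ}

lemma Ker.rescale (hK : Ker K) (hε : 0 < ε) : Ker (rescale K ε) := by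
  constructor
  · exact contDiff_const.mul (hK.1.comp (contDiff_const_smul _))
  · exact (hK.2.comp_smul (inv_ne_zero hε.ne')).mul_left

lemma pd_rescale (hK : CInf K) (j : Fin 3) :
    pd j (rescale K ε) = fun x => ε⁻¹ * rescale (pd j K) ε x := by
  ext x
  have h1 : HasFDerivAt (fun x : E3 => K (ε⁻¹ • x))
      ((fderiv ℝ K (ε⁻¹ • x)).comp (ε⁻¹ • ContinuousLinearMap.id ℝ E3)) x :=
    (hK.diff (ε⁻¹ • x)).hasFDerivAt.comp x ((hasFDerivAt_id (𝕜 := ℝ) x).const_smul ε⁻¹)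
  have h2 := h1.const_mul (ε ^ 3)⁻¹
  simp only [pd, rescale]
  change fderiv ℝ (fun x => (ε ^ 3)⁻¹ * K (ε⁻¹ • x)) x _ = _
  rw [h2.fderiv]
  simp
  ring

lemma integral_rescale_aux (f : E3 → ℝ) (hε : 0 < ε) :
    ∫ x, (ε ^ 3)⁻¹ * f (ε⁻¹ • x) = ∫ x, f x := by
  rw [integral_const_mul, Measure.integral_comp_inv_smul]
  simp only [finrank_euclideanSpace, Fintype.card_fin, smul_eq_mul]
  rw [abs_of_pos (by positivity)]
  field_simp

lemma integral_rescale (hε : 0 < ε) : ∫ x, rescale K ε x = ∫ x, K x :=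
  integral_rescale_aux K hε

lemma integral_abs_rescale (hε : 0 < ε) : ∫ x, |rescale K ε x| = ∫ x, |K x| := by
  rw [← integral_rescale_aux (fun x => |K x|) hε]
  congr 1; ext x
  simp only [rescale, abs_mul]
  rw [abs_of_pos (a := (ε ^ 3)⁻¹) (by positivity)]

lemma rescale_support (hε : 0 < ε) {R : ℝ} (hR : ∀ y, K y ≠ 0 → ‖y‖ ≤ R) :
    ∀ y, rescale K ε y ≠ 0 → ‖y‖ ≤ R * ε := by
  intro y hy
  have h1 := hR (ε⁻¹ • y) (right_ne_zero_of_mul hy)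
  rw [norm_smul, norm_inv, Real.norm_of_nonneg hε.le, inv_mul_le_iff₀ hε] at h1
  linarith

lemma rescale_rescale (δ : ℝ) :
    rescale (rescale K δ) ε = rescale K (δ * ε) := by
  ext x
  simp only [rescale, smul_smul, mul_inv, mul_pow]
  ring

lemma rescale_even (he : ∀ x, K (-x) = K x) (x : E3) : rescale K ε (-x) = rescale K ε x := by
  simp [rescale, he]

end rescale

lemma IsMollifier.ker {ρ : E3 → ℝ} (h : IsMollifier ρ) : Ker ρ := ⟨h.smooth, h.compact⟩

lemma IsMollifier.even {ρ : E3 → ℝ} (h : IsMollifier ρ) (x : E3) : ρ (-x) = ρ x :=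
  h.radial _ _ (norm_neg x)

lemma pd_radial {g : ℝ → ℝ} (hg : Differentiable ℝ g) (i : Fin 3) :
    pd i (fun x => g (‖x‖ ^ 2)) = fun x => 2 * (x i * deriv g (‖x‖ ^ 2)) := by
  ext x
  have h := (hg (‖x‖ ^ 2)).hasDerivAt.comp_hasFDerivAt x
    (hasStrictFDerivAt_norm_sq x).hasFDerivAt
  simp only [pd]
  change fderiv ℝ (g ∘ fun x => ‖x‖ ^ 2) x _ = _
  rw [h.fderiv]
  simp [basisVec, EuclideanSpace.inner_single_right]
  ring

lemma CInf_coord (i : Fin 3) : CInf (fun x => x i) :=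
  (EuclideanSpace.proj (𝕜 := ℝ) i).contDiff

lemma pd_coord (i j : Fin 3) : pd i (fun x => x j) = fun _ => if i = j then 1 else 0 := by
  ext x
  have h : HasFDerivAt (fun x : E3 => x j) (EuclideanSpace.proj (𝕜 := ℝ) j) x :=
    (EuclideanSpace.proj (𝕜 := ℝ) j).hasFDerivAt
  simp only [pd]
  rw [h.fderiv]
  simp [basisVec, eq_comm]

lemma CInf_radial {g : ℝ → ℝ} (hg : ContDiff ℝ (⊤ : ℕ∞) g) : CInf (fun x => g (‖x‖ ^ 2)) :=
  hg.comp (contDiff_norm_sq ℝ)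

lemma laplacian_radial {g : ℝ → ℝ} (hg : ContDiff ℝ (⊤ : ℕ∞) g) (x : E3) :
    ∑ i, pd i (pd i (fun x => g (‖x‖ ^ 2))) x =
      6 * deriv g (‖x‖ ^ 2) + 4 * ‖x‖ ^ 2 * deriv (deriv g) (‖x‖ ^ 2) := by
  have hg' : ContDiff ℝ (⊤ : ℕ∞) (deriv g) := (contDiff_infty_iff_deriv.1 hg).2
  have hd : ∀ i, pd i (pd i (fun x => g (‖x‖ ^ 2))) x =
      2 * deriv g (‖x‖ ^ 2) + 4 * (x i) ^ 2 * deriv (deriv g) (‖x‖ ^ 2) := by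
    intro i
    rw [pd_radial (hg.differentiable (by simp)),
      pd_const_mul ((CInf_coord i).mul (CInf_radial hg')),
      pd_mul (CInf_coord i) (CInf_radial hg'), pd_coord,
      pd_radial (hg'.differentiable (by simp))]
    simp; ring
  simp only [hd, Fin.sum_univ_three]
  rw [EuclideanSpace.norm_sq_eq]
  simp only [Fin.sum_univ_three, Real.norm_eq_abs, sq_abs]
  ring

/-- A smooth step from `0` on `(-∞, 1/2]` to `1` on `[1, ∞)`. -/
def stepFun (t : ℝ) : ℝ := Real.smoothTransition (2 * t - 1)

lemma stepFun_smooth : ContDiff ℝ (⊤ : ℕ∞) stepFun :=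
  Real.smoothTransition.contDiff.comp ((contDiff_const.mul contDiff_id).sub contDiff_const)

lemma stepFun_zero {t : ℝ} (ht : t ≤ 1 / 2) : stepFun t = 0 :=
  Real.smoothTransition.zero_of_nonpos (by linarith)

lemma stepFun_one {t : ℝ} (ht : 1 ≤ t) : stepFun t = 1 :=
  Real.smoothTransition.one_of_one_le (by linarith)

/-- The function `t ^ (-3/2)`, cut off near the origin. -/
def cutPow (t : ℝ) : ℝ := t ^ (-(3 / 2) : ℝ) * stepFun t

lemma cutPow_smooth : ContDiff ℝ (⊤ : ℕ∞) cutPow := by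
  rw [contDiff_iff_contDiffAt]
  intro t
  rcases lt_or_ge t (1 / 2) with ht | ht
  · refine contDiffAt_const (c := (0:ℝ)) |>.congr_of_eventuallyEq ?_
    filter_upwards [Iio_mem_nhds ht] with s hs
    simp [cutPow, stepFun_zero (le_of_lt hs)]
  · exact (Real.contDiffAt_rpow_const_of_ne (by linarith)).mul stepFun_smooth.contDiffAt

/-- The profile of a regularisation of the Newton potential. -/
def newtonProfile (t : ℝ) : ℝ := 1 - (1 / 2) * ∫ s in (1:ℝ)..t, cutPow s

lemma newtonProfile_hasDerivAt (t : ℝ) : HasDerivAt newtonProfile (-(1 / 2) * cutPow t) t := by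
  have h := (cutPow_smooth.continuous.integral_hasStrictDerivAt 1 t).hasDerivAt
  have := (h.const_mul (1 / 2)).const_sub 1
  rw [← neg_mul] at this
  exact this

lemma deriv_newtonProfile : deriv newtonProfile = fun t => -(1 / 2) * cutPow t :=
  funext fun t => (newtonProfile_hasDerivAt t).deriv

lemma newtonProfile_smooth : ContDiff ℝ (⊤ : ℕ∞) newtonProfile := by
  rw [contDiff_infty_iff_deriv, deriv_newtonProfile]
  exact ⟨fun t => (newtonProfile_hasDerivAt t).differentiableAt, contDiff_const.mul cutPow_smooth⟩

lemma newtonProfile_eq {t : ℝ} (ht : 1 ≤ t) : newtonProfile t = t ^ (-(1 / 2) : ℝ) := by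
  have h : ∫ s in (1:ℝ)..t, cutPow s = ∫ s in (1:ℝ)..t, s ^ (-(3 / 2) : ℝ) := by
    refine intervalIntegral.integral_congr fun s hs => ?_
    rw [uIcc_of_le ht] at hs
    simp [cutPow, stepFun_one hs.1]
  rw [newtonProfile, h, integral_rpow (Or.inr ⟨by norm_num, by
    rw [uIcc_of_le ht]; intro h0; linarith [h0.1]⟩)]
  norm_num
  ring

/-- The density `-Δ` of the regularised Newton potential, as a function of `‖x‖²`. -/
def newtonDensity (t : ℝ) : ℝ := 3 * cutPow t + 2 * t * deriv cutPow t

lemma newtonDensity_smooth : ContDiff ℝ (⊤ : ℕ∞) newtonDensity :=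
  (contDiff_const.mul cutPow_smooth).add
    ((contDiff_const.mul contDiff_id).mul (contDiff_infty_iff_deriv.1 cutPow_smooth).2)

lemma newtonDensity_eq {t : ℝ} (ht : 0 < t) :
    newtonDensity t = 2 * t ^ (-(1 / 2) : ℝ) * deriv stepFun t := by
  have h1 : HasDerivAt cutPow ((-(3 / 2) * t ^ (-(3 / 2) - 1 : ℝ)) * stepFun t +
      t ^ (-(3 / 2) : ℝ) * deriv stepFun t) t :=
    (Real.hasDerivAt_rpow_const (Or.inl ht.ne')).mul
      (stepFun_smooth.differentiable (by simp) t).hasDerivAt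
  rw [newtonDensity, h1.deriv, cutPow]
  have e1 : t ^ (-(3 / 2) : ℝ) = t * t ^ (-(3 / 2) - 1 : ℝ) := by
    rw [Real.rpow_sub_one ht.ne']; field_simp
  have e2 : t ^ (-(1 / 2) : ℝ) = t * t ^ (-(3 / 2) : ℝ) := by
    rw [show (-(3 / 2) : ℝ) = -(1 / 2) - 1 by norm_num, Real.rpow_sub_one ht.ne']; field_simp
  rw [e2, e1]; ring

lemma deriv_stepFun_nonneg (t : ℝ) : 0 ≤ deriv stepFun t := by
  have : Monotone stepFun := fun a b hab => Real.smoothTransition.monotone (by linarith)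
  exact this.deriv_nonneg

lemma newtonDensity_nonneg {t : ℝ} (ht : 0 ≤ t) : 0 ≤ newtonDensity t := by
  rcases ht.eq_or_lt with rfl | ht
  · simp [newtonDensity, cutPow, stepFun_zero (show (0:ℝ) ≤ 1/2 by norm_num)]
  · rw [newtonDensity_eq ht]
    have := deriv_stepFun_nonneg t
    positivity

lemma newtonDensity_zero {t : ℝ} (ht : 1 < t) : newtonDensity t = 0 := by
  rw [newtonDensity_eq (by linarith)]
  have : deriv stepFun t = 0 := by
    have h : stepFun =ᶠ[𝓝 t] fun _ => 1 := by
      filter_upwards [Ioi_mem_nhds ht] with s hs using stepFun_one (le_of_lt hs)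
    rw [h.deriv_eq]; simp
  rw [this]; ring

lemma exists_newtonDensity_ne : ∃ t : ℝ, 0 < t ∧ newtonDensity t ≠ 0 := by
  obtain ⟨t, ht, h⟩ := exists_deriv_eq_slope stepFun (a := 1/2) (b := 1) (by norm_num)
    stepFun_smooth.continuous.continuousOn
    (stepFun_smooth.differentiable (by simp)).differentiableOn
  rw [stepFun_one le_rfl, stepFun_zero le_rfl] at h
  have ht0 : 0 < t := by linarith [ht.1]
  refine ⟨t, ht0, ?_⟩
  rw [newtonDensity_eq ht0, h]
  have := Real.rpow_pos_of_pos ht0 (-(1/2))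
  positivity

/-- There are a mollifier `χ` and a compactly supported `Θ` with `χ_{1/2} - χ = -ΔΘ`. -/
lemma exists_mollifier_potential : ∃ χ Θ : E3 → ℝ, IsMollifier χ ∧ Ker Θ ∧ (∀ x, Θ (-x) = Θ x) ∧
    ∀ x, rescale χ (1 / 2) x - χ x = - ∑ i, pd i (pd i Θ) x := by
  set G : E3 → ℝ := fun x => newtonDensity (‖x‖ ^ 2) with hG
  set H : E3 → ℝ := fun x => newtonProfile (‖x‖ ^ 2) with hH
  have hGs : CInf G := CInf_radial newtonDensity_smooth
  have hHs : CInf H := CInf_radial newtonProfile_smooth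
  have hGc : HasCompactSupport G := by
    refine HasCompactSupport.of_support_subset_isCompact (isCompact_closedBall (0 : E3) 1) ?_
    intro x hx
    by_contra hx'
    rw [mem_closedBall_zero_iff, not_le] at hx'
    exact hx (newtonDensity_zero (by nlinarith))
  have hc : 0 < ∫ x, G x := by
    obtain ⟨t, ht, hne⟩ := exists_newtonDensity_ne
    refine hGs.continuous.integral_pos_of_hasCompactSupport_nonneg_nonzero hGc
      (fun x => newtonDensity_nonneg (by positivity)) (x := Real.sqrt t • basisVec 0) ?_
    simp only [hG, norm_smul, basisVec, PiLp.norm_single, norm_one, mul_one,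
      Real.norm_eq_abs, sq_abs, Real.sq_sqrt ht.le]
    exact hne
  set c := ∫ x, G x with hcdef
  have hΔ : ∀ x, ∑ i, pd i (pd i H) x = - G x := by
    intro x
    rw [laplacian_radial newtonProfile_smooth, deriv_newtonProfile]
    simp only [hG, newtonDensity]
    rw [deriv_const_mul _ (cutPow_smooth.differentiable (by simp) _)]
    ring
  set H2 : E3 → ℝ := rescale H (1 / 2) with hH2
  have hH2s : CInf H2 := contDiff_const.mul (hHs.comp (contDiff_const_smul _))
  refine ⟨fun x => c⁻¹ * G x, fun x => c⁻¹ * ((1 / 4) * H2 x - H x), ⟨?_, ?_, ?_, ?_⟩, ⟨?_, ?_⟩, ?_, ?_⟩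
  · exact contDiff_const.mul hGs
  · exact hGc.mul_left
  · intro x y hxy; simp only [hG, hxy]
  · rw [integral_const_mul, inv_mul_cancel₀ hc.ne']
  · exact contDiff_const.mul ((contDiff_const.mul hH2s).sub hHs)
  · refine HasCompactSupport.of_support_subset_isCompact (isCompact_closedBall (0 : E3) 1) ?_
    intro x hx
    by_contra hx'
    rw [mem_closedBall_zero_iff, not_le] at hx'
    apply hx
    simp only [hH2, hH, rescale, norm_smul]
    have h0 : 0 < ‖x‖ := by linarith
    have e : ∀ r : ℝ, 0 < r → (r ^ 2) ^ (-(1 / 2) : ℝ) = r⁻¹ := by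
      intro r hr
      rw [← Real.rpow_natCast, ← Real.rpow_mul hr.le]
      norm_num
      rw [Real.rpow_neg_one]
    rw [newtonProfile_eq, newtonProfile_eq, e _ h0, e]
    · norm_num; field_simp; norm_num
    · norm_num; exact norm_pos_iff.1 h0
    · nlinarith
    · norm_num; nlinarith
  · intro x
    simp [hH2, hH, rescale]
  · intro x
    have hpp : ∀ i, pd i (pd i fun x => c⁻¹ * ((1 / 4) * H2 x - H x)) x =
        c⁻¹ * (rescale (pd i (pd i H)) (1 / 2) x - pd i (pd i H) x) := by
      intro i
      rw [pd_const_mul ((contDiff_const.mul hH2s).sub hHs), pd_sub (contDiff_const.mul hH2s) hHs,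
        pd_const_mul hH2s, hH2, pd_rescale hHs, pd_const_mul]
      · rw [pd_sub, pd_const_mul, pd_const_mul, pd_rescale (hHs.pd i)]
        · simp only; ring
        · exact contDiff_const.mul ((hHs.pd i).comp (contDiff_const_smul _))
        · exact contDiff_const.mul (contDiff_const.mul ((hHs.pd i).comp (contDiff_const_smul _)))
        · exact contDiff_const.mul (contDiff_const.mul (contDiff_const.mul ((hHs.pd i).comp (contDiff_const_smul _))))
        · exact hHs.pd i
      · exact (contDiff_const.mul (contDiff_const.mul (contDiff_const.mul ((hHs.pd i).comp (contDiff_const_smul _))))).sub (hHs.pd i)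
    simp only [hpp, ← Finset.mul_sum, Finset.sum_sub_distrib, hΔ]
    have : ∑ i, rescale (pd i (pd i H)) (1 / 2) x = - rescale G (1 / 2) x := by
      simp only [rescale, ← Finset.mul_sum, hΔ]; ring
    rw [this]
    simp only [rescale]; ring

/-! ### Nikolskii regularity of periodic functions -/

/-- The Nikolskii bounds `‖f‖_q ≤ A` and `‖f(· + ξ) - f‖_q ≤ A |ξ|^s` on the torus. -/
structure Nik (s : ℝ) (q : ℝ≥0∞) (A : ℝ) (f : E3 → ℝ) : Prop where
  per : IsPeriodic f
  meas : AEStronglyMeasurable f volume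
  nonneg : 0 ≤ A
  bd : eLpNorm f q cm ≤ ENNReal.ofReal A
  inc : ∀ ξ : E3, eLpNorm (fun x => f (x + ξ) - f x) q cm ≤ ENNReal.ofReal (A * ‖ξ‖ ^ s)

lemma aesm_shift {f : E3 → ℝ} (hf : AEStronglyMeasurable f volume) (a : E3) :
    AEStronglyMeasurable (fun x => f (x + a)) volume :=
  hf.comp_quasiMeasurePreserving (measurePreserving_add_right volume a).quasiMeasurePreserving

namespace Nik

variable {s : ℝ} {p q r : ℝ≥0∞} {A B : ℝ} {f g : E3 → ℝ}

lemma meas' (hf : Nik s q A f) : AEStronglyMeasurable f cm := hf.meas.restrict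

lemma meas_shift (hf : Nik s q A f) (a : E3) : AEStronglyMeasurable (fun x => f (x + a)) cm :=
  (aesm_shift hf.meas a).restrict

lemma mono (hf : Nik s q A f) (h : A ≤ B) : Nik s q B f where
  per := hf.per
  meas := hf.meas
  nonneg := hf.nonneg.trans h
  bd := hf.bd.trans (ENNReal.ofReal_le_ofReal h)
  inc ξ := (hf.inc ξ).trans (ENNReal.ofReal_le_ofReal (by gcongr))

lemma inc_le_two (hf : Nik s q A f) (hq : 1 ≤ q) (ξ : E3) :
    eLpNorm (fun x => f (x + ξ) - f x) q cm ≤ ENNReal.ofReal (2 * A) := by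
  refine (eLpNorm_sub_le (hf.meas_shift ξ) hf.meas' hq).trans ?_
  rw [hf.per.eLpNorm_add hf.meas, two_mul, ENNReal.ofReal_add hf.nonneg hf.nonneg]
  exact add_le_add hf.bd hf.bd

lemma mono_s {s' : ℝ} (hf : Nik s q A f) (hq : 1 ≤ q) (h0 : 0 ≤ s') (h : s' ≤ s) :
    Nik s' q (2 * A) f where
  per := hf.per
  meas := hf.meas
  nonneg := by linarith [hf.nonneg]
  bd := hf.bd.trans (ENNReal.ofReal_le_ofReal (by linarith [hf.nonneg]))
  inc ξ := by
    have hA := hf.nonneg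
    rcases le_total ‖ξ‖ 1 with h1 | h1
    · refine (hf.inc ξ).trans (ENNReal.ofReal_le_ofReal ?_)
      rcases eq_or_lt_of_le (norm_nonneg ξ) with h2 | h2
      · rw [← h2]
        rcases eq_or_lt_of_le h0 with h3 | h3
        · rw [← h3, Real.rpow_zero]
          have : (0:ℝ) ^ s ≤ 1 := Real.zero_rpow_le_one _
          nlinarith
        · rw [Real.zero_rpow h3.ne', Real.zero_rpow (h3.trans_le h).ne']; simp
      · have := Real.rpow_le_rpow_of_exponent_ge h2 h1 h
        have h4 : 0 ≤ ‖ξ‖ ^ s' := by positivity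
        nlinarith
    · refine (hf.inc_le_two hq ξ).trans (ENNReal.ofReal_le_ofReal ?_)
      have := Real.one_le_rpow h1 h0
      nlinarith

lemma mono_q (hf : Nik s q A f) (h : p ≤ q) : Nik s p A f where
  per := hf.per
  meas := hf.meas
  nonneg := hf.nonneg
  bd := (eLpNorm_le_eLpNorm_of_exponent_le h hf.meas').trans hf.bd
  inc ξ := (eLpNorm_le_eLpNorm_of_exponent_le h ((hf.meas_shift ξ).sub hf.meas')).trans (hf.inc ξ)

lemma zero : Nik s q 0 (fun _ => 0) where
  per := fun _ _ => rfl
  meas := aestronglyMeasurable_const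
  nonneg := le_rfl
  bd := by simp
  inc ξ := by simp

lemma neg (hf : Nik s q A f) : Nik s q A (fun x => - f x) where
  per := fun x i => by simp only [hf.per x i]
  meas := hf.meas.neg
  nonneg := hf.nonneg
  bd := by
    rw [show (fun x => - f x) = -f from rfl, eLpNorm_neg]; exact hf.bd
  inc ξ := by
    have : (fun x => - f (x + ξ) - - f x) = -(fun x => f (x + ξ) - f x) := by
      ext x; simp; ring
    rw [this, eLpNorm_neg]; exact hf.inc ξ

lemma const_mul (hf : Nik s q A f) (c : ℝ) : Nik s q (|c| * A) (fun x => c * f x) where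
  per := fun x i => by simp only [hf.per x i]
  meas := hf.meas.const_mul c
  nonneg := mul_nonneg (abs_nonneg c) hf.nonneg
  bd := by
    change eLpNorm (c • f) q cm ≤ _
    rw [eLpNorm_const_smul, ENNReal.ofReal_mul (abs_nonneg c), Real.enorm_eq_ofReal_abs]
    gcongr; exact hf.bd
  inc ξ := by
    have : (fun x => c * f (x + ξ) - c * f x) = c • (fun x => f (x + ξ) - f x) := by
      ext x; simp; ring
    rw [this, eLpNorm_const_smul, mul_assoc, ENNReal.ofReal_mul (abs_nonneg c),
      Real.enorm_eq_ofReal_abs]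
    gcongr; exact hf.inc ξ

lemma add (hf : Nik s q A f) (hg : Nik s q B g) (hq : 1 ≤ q) :
    Nik s q (A + B) (fun x => f x + g x) where
  per := fun x i => by simp only [hf.per x i, hg.per x i]
  meas := hf.meas.add hg.meas
  nonneg := add_nonneg hf.nonneg hg.nonneg
  bd := by
    refine (eLpNorm_add_le hf.meas' hg.meas' hq).trans ?_
    rw [ENNReal.ofReal_add hf.nonneg hg.nonneg]
    exact add_le_add hf.bd hg.bd
  inc ξ := by
    have : (fun x => f (x + ξ) + g (x + ξ) - (f x + g x)) =
      (fun x => f (x + ξ) - f x) + (fun x => g (x + ξ) - g x) := by ext x; simp; ring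
    rw [this, add_mul]
    refine (eLpNorm_add_le ((hf.meas_shift ξ).sub hf.meas') ((hg.meas_shift ξ).sub hg.meas') hq).trans ?_
    have := hf.nonneg
    have := hg.nonneg
    rw [ENNReal.ofReal_add (by positivity) (by positivity)]
    exact add_le_add (hf.inc ξ) (hg.inc ξ)

lemma sub (hf : Nik s q A f) (hg : Nik s q B g) (hq : 1 ≤ q) :
    Nik s q (A + B) (fun x => f x - g x) := by
  simpa [sub_eq_add_neg] using hf.add hg.neg hq

lemma mul [ENNReal.HolderTriple p q r] (hf : Nik s p A f) (hg : Nik s q B g) (hr : 1 ≤ r) :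
    Nik s r (2 * (A * B)) (fun x => f x * g x) where
  per := fun x i => by simp only [hf.per x i, hg.per x i]
  meas := hf.meas.mul hg.meas
  nonneg := by have := hf.nonneg; have := hg.nonneg; positivity
  bd := by
    have h1 := hf.nonneg
    have h2 := hg.nonneg
    refine (eLpNorm_smul_le_mul_eLpNorm (p := p) (q := q) (r := r) hg.meas' hf.meas').trans ?_
    refine (mul_le_mul' hf.bd hg.bd).trans ?_
    rw [← ENNReal.ofReal_mul h1]
    refine ENNReal.ofReal_le_ofReal ?_
    nlinarith [mul_nonneg h1 h2]
  inc ξ := by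
    have h1 := hf.nonneg
    have h2 := hg.nonneg
    have e : (fun x => f (x + ξ) * g (x + ξ) - f x * g x) =
      (fun x => f (x + ξ) - f x) • (fun x => g (x + ξ)) + f • (fun x => g (x + ξ) - g x) := by
      ext x; simp; ring
    have m1 := (hf.meas_shift ξ).sub hf.meas'
    have m2 := (hg.meas_shift ξ).sub hg.meas'
    rw [e]
    refine (eLpNorm_add_le (m1.smul (hg.meas_shift ξ)) (hf.meas'.smul m2) hr).trans ?_
    have k1 := eLpNorm_smul_le_mul_eLpNorm (p := p) (q := q) (r := r) (hg.meas_shift ξ) m1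
    have k2 := eLpNorm_smul_le_mul_eLpNorm (p := p) (q := q) (r := r) m2 hf.meas'
    rw [hg.per.eLpNorm_add hg.meas] at k1
    refine (add_le_add (k1.trans (mul_le_mul' (hf.inc ξ) hg.bd))
      (k2.trans (mul_le_mul' hf.bd (hg.inc ξ)))).trans ?_
    rw [← ENNReal.ofReal_mul (by positivity), ← ENNReal.ofReal_mul (by positivity),
      ← ENNReal.ofReal_add (by positivity) (by positivity)]
    refine ENNReal.ofReal_le_ofReal (le_of_eq ?_)
    ring

lemma shift (hf : Nik s q A f) (a : E3) : Nik s q A (fun x => f (x + a)) where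
  per := hf.per.comp_add a
  meas := aesm_shift hf.meas a
  nonneg := hf.nonneg
  bd := by rw [hf.per.eLpNorm_add hf.meas]; exact hf.bd
  inc ξ := by
    have hp : IsPeriodic (fun x => f (x + ξ) - f x) := fun x i => by
      simp only [add_right_comm _ (basisVec i), hf.per _ i]
    have := hp.eLpNorm_add ((aesm_shift hf.meas ξ).sub hf.meas) q a
    simp only [add_right_comm _ ξ a]
    rw [this]
    exact hf.inc ξ

lemma incr_per (hf : Nik s q A f) (ξ : E3) : IsPeriodic (fun x => f (x + ξ) - f x) := fun x i => by
  simp only [add_right_comm _ (basisVec i), hf.per _ i]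

lemma incr_meas (hf : Nik s q A f) (ξ : E3) :
    AEStronglyMeasurable (fun x => f (x + ξ) - f x) volume := (aesm_shift hf.meas ξ).sub hf.meas

lemma incr (hf : Nik s q A f) (hq : 1 ≤ q) (ξ : E3) :
    Nik s q (2 * A) (fun x => f (x + ξ) - f x) :=
  ((hf.shift ξ).sub hf hq).mono (by linarith)

/-- Increments trade regularity for smallness. -/
lemma incr_small {s' : ℝ} (hf : Nik s q A f) (hq : 1 ≤ q) (h0 : 0 ≤ s') (h : s' ≤ s) (ξ : E3) :
    Nik (s - s') q (2 * A * ‖ξ‖ ^ s') (fun x => f (x + ξ) - f x) where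
  per := hf.incr_per ξ
  meas := hf.incr_meas ξ
  nonneg := by have := hf.nonneg; positivity
  bd := (hf.mono_s hq h0 h).inc ξ
  inc ζ := by
    have hA := hf.nonneg
    have hsub : 0 ≤ s - s' := by linarith
    have e1 : eLpNorm (fun x => (f (x + ζ + ξ) - f (x + ζ)) - (f (x + ξ) - f x)) q cm ≤
        ENNReal.ofReal (2 * A * ‖ξ‖ ^ s) := by
      have m := hf.incr_meas ξ
      refine (eLpNorm_sub_le (aesm_shift m ζ).restrict m.restrict hq).trans ?_
      rw [(hf.incr_per ξ).eLpNorm_add m, ← two_mul, mul_assoc, ENNReal.ofReal_mul (by norm_num)]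
      refine mul_le_mul' (by simp) (hf.inc ξ)
    have e2 : eLpNorm (fun x => (f (x + ζ + ξ) - f (x + ζ)) - (f (x + ξ) - f x)) q cm ≤
        ENNReal.ofReal (2 * A * ‖ζ‖ ^ s) := by
      have m := hf.incr_meas ζ
      have e : (fun x => (f (x + ζ + ξ) - f (x + ζ)) - (f (x + ξ) - f x)) =
        (fun x => f (x + ξ + ζ) - f (x + ξ)) - (fun x => f (x + ζ) - f x) := by
        ext x; simp only [Pi.sub_apply, add_right_comm x ζ ξ]; ring
      rw [e]
      refine (eLpNorm_sub_le (aesm_shift m ξ).restrict m.restrict hq).trans ?_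
      rw [(hf.incr_per ζ).eLpNorm_add m, ← two_mul, mul_assoc, ENNReal.ofReal_mul (by norm_num)]
      refine mul_le_mul' (by simp) (hf.inc ζ)
    rcases le_total ‖ξ‖ ‖ζ‖ with h1 | h1
    · refine e1.trans (ENNReal.ofReal_le_ofReal ?_)
      have : ‖ξ‖ ^ s = ‖ξ‖ ^ s' * ‖ξ‖ ^ (s - s') := by
        rw [← Real.rpow_add_of_nonneg (norm_nonneg _) h0 hsub]; congr 1; ring
      rw [this, ← mul_assoc]
      gcongr
    · refine e2.trans (ENNReal.ofReal_le_ofReal ?_)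
      have : ‖ζ‖ ^ s = ‖ζ‖ ^ s' * ‖ζ‖ ^ (s - s') := by
        rw [← Real.rpow_add_of_nonneg (norm_nonneg _) h0 hsub]; congr 1; ring
      rw [this, ← mul_assoc]
      gcongr

lemma memLp (hf : Nik s q A f) : MemLp f q cm := ⟨hf.meas', hf.bd.trans_lt ENNReal.ofReal_lt_top⟩

lemma integrable (hf : Nik s q A f) (hq : 1 ≤ q) : Integrable f cm := hf.memLp.integrable hq

lemma locInt (hf : Nik s q A f) (hq : 1 ≤ q) : LocallyIntegrable f volume :=
  hf.per.locallyIntegrable (hf.integrable hq)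

/-- Lipschitz bounded periodic functions have every Nikolskii regularity up to one. -/
lemma of_lipschitz {C L : ℝ} (hs0 : 0 ≤ s) (hs : s ≤ 1) (hf : SmP f) (hC : ∀ x, |f x| ≤ C)
    (hL : ∀ x y, |f x - f y| ≤ L * ‖x - y‖) : Nik s ⊤ (2 * C + |L|) f := by
  have hC0 : 0 ≤ C := (abs_nonneg _).trans (hC 0)
  refine ⟨hf.per, hf.continuous.aestronglyMeasurable, by positivity, ?_, fun ξ => ?_⟩
  · rw [eLpNorm_exponent_top]
    refine eLpNormEssSup_le_of_ae_bound (Eventually.of_forall fun x => (hC x).trans ?_)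
    have := abs_nonneg L
    linarith
  · rw [eLpNorm_exponent_top]
    refine eLpNormEssSup_le_of_ae_bound (Eventually.of_forall fun x => ?_)
    rw [Real.norm_eq_abs]
    have hL' := abs_nonneg L
    rcases le_total ‖ξ‖ 1 with h1 | h1
    · have h2 := hL (x + ξ) x
      rw [add_sub_cancel_left] at h2
      have h3 : ‖ξ‖ ≤ ‖ξ‖ ^ s := by
        rcases eq_or_lt_of_le (norm_nonneg ξ) with h2 | h2
        · rw [← h2]; positivity
        · simpa using Real.rpow_le_rpow_of_exponent_ge h2 h1 hs
      calc |f (x + ξ) - f x| ≤ L * ‖ξ‖ := h2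
        _ ≤ |L| * ‖ξ‖ := by gcongr; exact le_abs_self L
        _ ≤ (2 * C + |L|) * ‖ξ‖ ^ s := by gcongr; linarith
    · have h2 : |f (x + ξ) - f x| ≤ 2 * C := by
        refine (abs_sub _ _).trans ?_
        linarith [hC (x + ξ), hC x]
      have h3 := Real.one_le_rpow h1 hs0
      nlinarith

lemma eLpNorm_cv_sub (hf : Nik s q A f) (hq : 1 ≤ q) (hs : 0 ≤ s) {K : E3 → ℝ} (hK : Ker K) {R : ℝ}
    (hR : ∀ y, K y ≠ 0 → ‖y‖ ≤ R) :
    eLpNorm (fun x => cv K f x - (∫ y, K y) * f x) q cm ≤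
      ENNReal.ofReal ((∫ y, |K y|) * (A * R ^ s)) := by
  have hl := hf.locInt hq
  have e : (fun x => cv K f x - (∫ y, K y) * f x) = fun x => ∫ y, K y * (f (x - y) - f x) := by
    ext x
    simp only [mul_sub]
    rw [integral_sub (hK.integrable_mul hl x) (hK.integrable.mul_const _), integral_mul_const]
    rfl
  rw [e, ENNReal.ofReal_mul (integral_nonneg fun y => abs_nonneg _)]
  refine eLpNorm_integral_le ?_ hK.continuous.measurable hK.integrable hq fun y hy => ?_
  · exact (aesm_comp_sub hf.meas).sub
      (hf.meas'.comp_quasiMeasurePreserving Measure.quasiMeasurePreserving_fst)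
  · have := hf.inc (-y)
    simp only [← sub_eq_add_neg, norm_neg] at this
    refine this.trans (ENNReal.ofReal_le_ofReal ?_)
    have := hf.nonneg
    have := hR y hy
    gcongr

lemma eLpNorm_cv_le {f : E3 → ℝ} (hp : IsPeriodic f) (hm : AEStronglyMeasurable f volume)
    (hq : 1 ≤ q) {K : E3 → ℝ} (hK : Continuous K) (hKi : Integrable K volume) :
    eLpNorm (cv K f) q cm ≤ ENNReal.ofReal (∫ y, |K y|) * eLpNorm f q cm := by
  refine eLpNorm_integral_le (F := fun x y => f (x - y)) (aesm_comp_sub hm) hK.measurable hKi hq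
    fun y hy => ?_
  have := hp.eLpNorm_add hm q (-y)
  simp only [← sub_eq_add_neg] at this
  exact this.le

lemma cv (hf : Nik s q A f) (hq : 1 ≤ q) {K : E3 → ℝ} (hK : Ker K) :
    Nik s q ((∫ y, |K y|) * A) (cv K f) where
  per := cv_periodic K hf.per
  meas := (cv_smooth hK (hf.locInt hq)).continuous.aestronglyMeasurable
  nonneg := mul_nonneg (integral_nonneg fun y => abs_nonneg _) hf.nonneg
  bd := by
    rw [ENNReal.ofReal_mul (integral_nonneg fun y => abs_nonneg _)]
    exact (eLpNorm_cv_le hf.per hf.meas hq hK.continuous hK.integrable).trans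
      (mul_le_mul' le_rfl hf.bd)
  inc ξ := by
    rw [mul_assoc, ENNReal.ofReal_mul (integral_nonneg fun y => abs_nonneg _)]
    have e : (fun x => Helicity.cv K f (x + ξ) - Helicity.cv K f x) =
        Helicity.cv K (fun x => f (x + ξ) - f x) := by
      rw [cv_sub hK ((hf.shift ξ).locInt hq) (hf.locInt hq), cv_comp_add]
    rw [e]
    exact (eLpNorm_cv_le (hf.incr_per ξ) (hf.incr_meas ξ) hq hK.continuous hK.integrable).trans
      (mul_le_mul' le_rfl (hf.inc ξ))

/-- Mollification converges with a rate in weaker Nikolskii classes. -/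
lemma cv_sub_self {s' : ℝ} (hf : Nik s q A f) (hq : 1 ≤ q) (h0 : 0 ≤ s') (h : s' ≤ s) {K : E3 → ℝ}
    (hK : Ker K) (hK1 : ∫ y, K y = 1) {R : ℝ} (hR0 : 0 < R) (hR1 : R ≤ 1)
    (hR : ∀ y, K y ≠ 0 → ‖y‖ ≤ R) :
    Nik s' q (2 * (∫ y, |K y|) * A * R ^ (s - s')) (fun x => Helicity.cv K f x - f x) where
  per := fun x i => by simp only [cv_periodic K hf.per x i, hf.per x i]
  meas := (cv_smooth hK (hf.locInt hq)).continuous.aestronglyMeasurable.sub hf.meas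
  nonneg := by
    have := hf.nonneg
    have : 0 ≤ ∫ y, |K y| := integral_nonneg fun y => abs_nonneg _
    positivity
  bd := by
    have h1 := hf.eLpNorm_cv_sub hq (h0.trans h) hK hR
    simp only [hK1, one_mul] at h1
    refine h1.trans (ENNReal.ofReal_le_ofReal ?_)
    have := hf.nonneg
    have : 0 ≤ ∫ y, |K y| := integral_nonneg fun y => abs_nonneg _
    have h2 : R ^ s ≤ R ^ (s - s') := Real.rpow_le_rpow_of_exponent_ge hR0 hR1 (by linarith)
    have h3 : 0 ≤ (∫ y, |K y|) * A := by positivity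
    have h4 : 0 ≤ R ^ (s - s') := by positivity
    nlinarith [mul_le_mul_of_nonneg_left h2 h3, mul_nonneg h3 h4]
  inc ξ := by
    have h1 := (hf.incr_small hq h0 h ξ).eLpNorm_cv_sub hq (by linarith) hK hR
    simp only [hK1, one_mul] at h1
    have e : (fun x => Helicity.cv K f (x + ξ) - f (x + ξ) - (Helicity.cv K f x - f x)) =
        fun x => Helicity.cv K (fun x => f (x + ξ) - f x) x - (f (x + ξ) - f x) := by
      rw [cv_sub hK ((hf.shift ξ).locInt hq) (hf.locInt hq), cv_comp_add]
      ext x; ring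
    rw [e]
    refine h1.trans (ENNReal.ofReal_le_ofReal (le_of_eq ?_))
    ring

end Nik

lemma SmP.lipschitz {f : E3 → ℝ} (hf : SmP f) : ∃ L, 0 ≤ L ∧ ∀ x y, |f x - f y| ≤ L * ‖x - y‖ := by
  have hp : IsPeriodic (fderiv ℝ f) := by
    intro x i
    have h : f = fun y => f (y + basisVec i) := funext fun y => (hf.per y i).symm
    conv_rhs => rw [h]
    rw [fderiv_comp_add_right]
  obtain ⟨L, hL0, hL⟩ := hp.exists_bound (hf.smooth.continuous_fderiv (by simp))
  refine ⟨L, hL0, fun x y => ?_⟩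
  exact Convex.norm_image_sub_le_of_norm_fderiv_le (𝕜 := ℝ) (s := univ)
    (fun x _ => hf.smooth.diff x) (fun x _ => hL x) convex_univ (mem_univ y) (mem_univ x)

lemma SmP.nik {f : E3 → ℝ} (hf : SmP f) {s : ℝ} (h0 : 0 ≤ s) (h1 : s ≤ 1) :
    ∃ A, Nik s ⊤ A f := by
  obtain ⟨C, -, hC⟩ := hf.exists_bound
  obtain ⟨L, -, hL⟩ := hf.lipschitz
  exact ⟨_, Nik.of_lipschitz h0 h1 hf hC hL⟩

lemma exists_common_le {ι : Type*} [Fintype ι] (B : ι → ℝ) : ∃ E, 0 ≤ E ∧ ∀ i, B i ≤ E :=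
  ⟨∑ i, |B i|, Finset.sum_nonneg fun _ _ => abs_nonneg _, fun i => (le_abs_self _).trans
    (Finset.single_le_sum (f := fun i => |B i|) (fun _ _ => abs_nonneg _) (Finset.mem_univ i))⟩

lemma exists_common_nik {f : Fin 3 → E3 → ℝ} (hf : ∀ j, SmP (f j)) {s : ℝ} (h0 : 0 ≤ s) (h1 : s ≤ 1) :
    ∃ B, ∀ j, Nik s ⊤ B (f j) := by
  choose B hB using fun j => (hf j).nik h0 h1
  obtain ⟨E, -, hE⟩ := exists_common_le B
  exact ⟨E, fun j => (hB j).mono (hE j)⟩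

/-! ### Convergence in Nikolskii classes -/

/-- `F n → f` in the Nikolskii class of exponents `s`, `q` along the filter `l`. -/
def NT {ι : Type*} (s : ℝ) (q : ℝ≥0∞) (l : Filter ι) (F : ι → E3 → ℝ) (f : E3 → ℝ) : Prop :=
  (∃ A, Nik s q A f) ∧ ∃ a : ι → ℝ, Tendsto a l (𝓝 0) ∧ ∀ᶠ n in l, Nik s q (a n) (fun x => F n x - f x)

namespace NT

variable {ι : Type*} {s : ℝ} {p q r : ℝ≥0∞} {l : Filter ι} {F G : ι → E3 → ℝ} {f g : E3 → ℝ}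

lemma const {A : ℝ} (hf : Nik s q A f) : NT s q l (fun _ => f) f :=
  ⟨⟨A, hf⟩, fun _ => 0, tendsto_const_nhds, Eventually.of_forall fun n => by simpa using Nik.zero⟩

lemma add (hF : NT s q l F f) (hG : NT s q l G g) (hq : 1 ≤ q) :
    NT s q l (fun n x => F n x + G n x) (fun x => f x + g x) := by
  obtain ⟨⟨A, hA⟩, a, ha, hFa⟩ := hF
  obtain ⟨⟨B, hB⟩, b, hb, hGb⟩ := hG
  refine ⟨⟨_, hA.add hB hq⟩, fun n => a n + b n, by simpa using ha.add hb, ?_⟩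
  filter_upwards [hFa, hGb] with n h1 h2
  have := h1.add h2 hq
  convert this using 2; ring

lemma const_mul (c : ℝ) (hF : NT s q l F f) :
    NT s q l (fun n x => c * F n x) (fun x => c * f x) := by
  obtain ⟨⟨A, hA⟩, a, ha, hFa⟩ := hF
  refine ⟨⟨_, hA.const_mul c⟩, fun n => |c| * a n, by simpa using ha.const_mul |c|, ?_⟩
  filter_upwards [hFa] with n h1
  have := h1.const_mul c
  convert this using 2; ring

lemma neg (hF : NT s q l F f) : NT s q l (fun n x => - F n x) (fun x => - f x) := by
  simpa using hF.const_mul (-1)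

lemma sub (hF : NT s q l F f) (hG : NT s q l G g) (hq : 1 ≤ q) :
    NT s q l (fun n x => F n x - G n x) (fun x => f x - g x) := by
  simpa [sub_eq_add_neg] using hF.add hG.neg hq

lemma sum {κ : Type*} (S : Finset κ) {F : κ → ι → E3 → ℝ} {f : κ → E3 → ℝ}
    (hF : ∀ k ∈ S, NT s q l (F k) (f k)) (hq : 1 ≤ q) :
    NT s q l (fun n x => ∑ k ∈ S, F k n x) (fun x => ∑ k ∈ S, f k x) := by
  classical
  induction S using Finset.induction_on with
  | empty => simpa using const Nik.zero
  | insert a S ha ih =>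
    simp only [Finset.sum_insert ha]
    exact (hF a (by simp)).add (ih fun k hk => hF k (by simp [hk])) hq

lemma mul [ENNReal.HolderTriple p q r] (hF : NT s p l F f) (hG : NT s q l G g)
    (hq : 1 ≤ q) (hr : 1 ≤ r) : NT s r l (fun n x => F n x * G n x) (fun x => f x * g x) := by
  obtain ⟨⟨A, hA⟩, a, ha, hFa⟩ := hF
  obtain ⟨⟨B, hB⟩, b, hb, hGb⟩ := hG
  refine ⟨⟨_, hA.mul hB hr⟩, fun n => 2 * (a n * (b n + B)) + 2 * (A * b n), ?_, ?_⟩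
  · have : Tendsto (fun n => 2 * (a n * (b n + B)) + 2 * (A * b n)) l
        (𝓝 (2 * (0 * (0 + B)) + 2 * (A * 0))) :=
      ((ha.mul (hb.add_const B)).const_mul 2).add ((hb.const_mul A).const_mul 2)
    simpa using this
  · filter_upwards [hFa, hGb] with n h1 h2
    have h3 : Nik s q (b n + B) (G n) := by simpa using h2.add hB hq
    have := (h1.mul (r := r) h3 hr).add (hA.mul (r := r) h2 hr) hr
    convert this using 2; ring

lemma shift (hF : NT s q l F f) (a : E3) : NT s q l (fun n x => F n (x + a)) (fun x => f (x + a)) := by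
  obtain ⟨⟨A, hA⟩, b, hb, hFb⟩ := hF
  refine ⟨⟨A, hA.shift a⟩, b, hb, ?_⟩
  filter_upwards [hFb] with n h using h.shift a

lemma cv (hF : NT s q l F f) (hq : 1 ≤ q) {K : E3 → ℝ} (hK : Ker K) :
    NT s q l (fun n => cv K (F n)) (cv K f) := by
  obtain ⟨⟨A, hA⟩, b, hb, hFb⟩ := hF
  refine ⟨⟨_, hA.cv hq hK⟩, fun n => (∫ y, |K y|) * b n, by simpa using hb.const_mul (∫ y, |K y|), ?_⟩
  filter_upwards [hFb] with n h
  have h2 := h.cv hq hK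
  have h3 : Nik s q (b n + A) (F n) := by simpa using h.add hA hq
  rwa [cv_sub hK (h3.locInt hq) (hA.locInt hq)] at h2

lemma nik (hF : NT s q l F f) (hq : 1 ≤ q) : ∃ A, Nik s q A f ∧ ∀ᶠ n in l, Nik s q A (F n) := by
  obtain ⟨⟨A, hA⟩, b, hb, hFb⟩ := hF
  refine ⟨A + 1, hA.mono (by linarith), ?_⟩
  filter_upwards [hFb, hb.eventually (gt_mem_nhds zero_lt_one)] with n h h2
  have h3 : Nik s q (b n + A) (F n) := by simpa using h.add hA hq
  exact h3.mono (by linarith)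

lemma comp {κ : Type*} {m : Filter κ} (hF : NT s q l F f) {φ : κ → ι} (hφ : Tendsto φ m l) :
    NT s q m (fun k => F (φ k)) f := by
  obtain ⟨hA, b, hb, hFb⟩ := hF
  exact ⟨hA, fun k => b (φ k), hb.comp hφ, hφ.eventually hFb⟩

lemma mono_q (hF : NT s q l F f) (h : p ≤ q) : NT s p l F f := by
  obtain ⟨⟨A, hA⟩, b, hb, hFb⟩ := hF
  exact ⟨⟨A, hA.mono_q h⟩, b, hb, hFb.mono fun n hn => hn.mono_q h⟩

end NT

lemma Nik.mollify {s s' : ℝ} {q : ℝ≥0∞} {A : ℝ} {f : E3 → ℝ} (hf : Nik s q A f) (hq : 1 ≤ q)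
    (h0 : 0 ≤ s') (h : s' < s) {K : E3 → ℝ} (hK : Ker K) (hK1 : ∫ y, K y = 1) :
    NT s' q (𝓝[>] 0) (fun ε => Helicity.cv (rescale K ε) f) f := by
  obtain ⟨R, hR0, hR⟩ := hK.exists_radius
  refine ⟨⟨_, hf.mono_s hq h0 h.le⟩,
    fun ε => 2 * (∫ y, |K y|) * A * (R * ε) ^ (s - s'), ?_, ?_⟩
  · have h1 : Tendsto (fun ε : ℝ => (R * ε) ^ (s - s')) (𝓝[>] 0) (𝓝 0) := by
      have h2 : ContinuousAt (fun ε : ℝ => (R * ε) ^ (s - s')) 0 :=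
        ContinuousAt.rpow_const (by fun_prop) (Or.inr (by linarith))
      have h3 := h2.tendsto
      rw [mul_zero, Real.zero_rpow (by linarith)] at h3
      exact h3.mono_left nhdsWithin_le_nhds
    simpa using h1.const_mul (2 * (∫ y, |K y|) * A)
  · have h1 : ∀ᶠ ε : ℝ in 𝓝[>] 0, ε < R⁻¹ :=
      eventually_nhdsWithin_of_eventually_nhds (gt_mem_nhds (by positivity))
    filter_upwards [h1, self_mem_nhdsWithin] with ε hε (hε0 : 0 < ε)
    have h2 := hf.cv_sub_self hq h0 h.le (hK.rescale hε0) (by rw [integral_rescale hε0, hK1])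
      (R := R * ε) (by positivity) ?_ (rescale_support hε0 hR)
    · rwa [integral_abs_rescale hε0] at h2
    · rw [lt_inv_comm₀ hε0 hR0] at hε
      have := mul_lt_mul_of_pos_right hε hε0
      rw [inv_mul_cancel₀ hε0.ne'] at this
      exact this.le

/-! ### The bilinear form `∫ g ∂_j h` on Nikolskii classes -/

/-- A fixed mollifier `χ` for which `χ_{1/2} - χ` is the Laplacian of a compactly supported
function. -/
def χ₀ : E3 → ℝ := exists_mollifier_potential.choose

/-- The potential of `χ - χ_{1/2}`. -/
def Θ₀ : E3 → ℝ := exists_mollifier_potential.choose_spec.choose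

lemma χ₀_moll : IsMollifier χ₀ := exists_mollifier_potential.choose_spec.choose_spec.1
lemma Θ₀_ker : Ker Θ₀ := exists_mollifier_potential.choose_spec.choose_spec.2.1
lemma Θ₀_even : ∀ x, Θ₀ (-x) = Θ₀ x := exists_mollifier_potential.choose_spec.choose_spec.2.2.1
lemma χ₀_sub : ∀ x, rescale χ₀ (1 / 2) x - χ₀ x = - ∑ i, pd i (pd i Θ₀) x :=
  exists_mollifier_potential.choose_spec.choose_spec.2.2.2

/-- The kernel of the dyadic mollification at scale `2^{-k}`. -/
def χk (k : ℕ) : E3 → ℝ := rescale χ₀ ((1 / 2) ^ k)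

lemma χk_ker (k : ℕ) : Ker (χk k) := χ₀_moll.ker.rescale (by positivity)

lemma χk_integral (k : ℕ) : ∫ x, χk k x = 1 := by
  rw [χk, integral_rescale (by positivity), χ₀_moll.integral_eq]

lemma χk_even (k : ℕ) (x : E3) : χk k (-x) = χk k x := rescale_even χ₀_moll.even x

/-- Dyadic mollification. -/
def sm (k : ℕ) (f : E3 → ℝ) : E3 → ℝ := cv (χk k) f

lemma dyadic_bounds {s : ℝ} (hs : 0 ≤ s) : ∃ C, 0 ≤ C ∧ ∀ {q : ℝ≥0∞}, 1 ≤ q → ∀ {A : ℝ} {f : E3 → ℝ},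
    Nik s q A f → ∀ k : ℕ,
      eLpNorm (fun x => sm k f x - f x) q cm ≤ ENNReal.ofReal (C * A * ((1 / 2) ^ k) ^ s) ∧
      eLpNorm (fun x => sm (k + 1) f x - sm k f x) q cm ≤
        ENNReal.ofReal (C * A * ((1 / 2) ^ k) ^ s) ∧
      ∀ j, eLpNorm (pd j (sm k f)) q cm ≤
        ENNReal.ofReal (C * A * (((1 / 2) ^ k) ^ s * 2 ^ k)) := by
  obtain ⟨R, hR0, hR⟩ := χ₀_moll.ker.exists_radius
  have hR' : ∀ j, ∃ R', 0 < R' ∧ ∀ y, pd j χ₀ y ≠ 0 → ‖y‖ ≤ R' := fun j =>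
    (χ₀_moll.ker.pd j).exists_radius
  choose R' hR'0 hR' using hR'
  set c0 := (∫ y, |χ₀ y|) * R ^ s with hc0
  set c1 := fun j => (∫ y, |pd j χ₀ y|) * R' j ^ s with hc1
  have hc0' : 0 ≤ c0 := mul_nonneg (integral_nonneg fun _ => abs_nonneg _) (by positivity)
  have hc1' : ∀ j, 0 ≤ c1 j := fun j =>
    mul_nonneg (integral_nonneg fun _ => abs_nonneg _) (Real.rpow_nonneg (hR'0 j).le _)
  refine ⟨2 * c0 + ∑ j, c1 j, add_nonneg (by positivity) (Finset.sum_nonneg fun j _ => hc1' j), ?_⟩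
  intro q hq A f hf k
  have hA := hf.nonneg
  have hsum : 0 ≤ ∑ j, c1 j := Finset.sum_nonneg fun j _ => hc1' j
  have base : ∀ k : ℕ, eLpNorm (fun x => sm k f x - f x) q cm ≤
      ENNReal.ofReal (c0 * A * ((1 / 2) ^ k) ^ s) := by
    intro k
    have := hf.eLpNorm_cv_sub hq hs (χk_ker k) (rescale_support (by positivity) hR)
    rw [χk_integral, χk, integral_abs_rescale (by positivity)] at this
    simp only [one_mul] at this
    refine this.trans (ENNReal.ofReal_le_ofReal (le_of_eq ?_))
    rw [Real.mul_rpow hR0.le (by positivity), hc0]; ring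
  have hd : ((1 / 2 : ℝ) ^ (k + 1)) ^ s ≤ ((1 / 2 : ℝ) ^ k) ^ s := by
    gcongr ?_ ^ s
    exact pow_le_pow_of_le_one (by norm_num) (by norm_num) (Nat.le_succ k)
  have hd0 : 0 ≤ ((1 / 2 : ℝ) ^ k) ^ s := by positivity
  have hm : ∀ k, AEStronglyMeasurable (sm k f) cm := fun k =>
    (cv_smooth (χk_ker k) (hf.locInt hq)).continuous.aestronglyMeasurable
  refine ⟨(base k).trans (ENNReal.ofReal_le_ofReal ?_), ?_, fun j => ?_⟩
  · gcongr; linarith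
  · have e : (fun x => sm (k + 1) f x - sm k f x) =
      (fun x => sm (k + 1) f x - f x) - (fun x => sm k f x - f x) := by ext x; simp
    rw [e]
    refine (eLpNorm_sub_le ((hm _).sub hf.meas') ((hm _).sub hf.meas') hq).trans ?_
    refine (add_le_add (base (k + 1)) (base k)).trans ?_
    rw [← ENNReal.ofReal_add (by positivity) (by positivity)]
    refine ENNReal.ofReal_le_ofReal ?_
    have h1 := mul_le_mul_of_nonneg_left hd (mul_nonneg hc0' hA)
    have h2 := mul_nonneg (mul_nonneg hsum hA) hd0
    nlinarith
  · have hδ : (0:ℝ) < (1 / 2) ^ k := by positivity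
    have e : pd j (sm k f) = (2 ^ k : ℝ) • fun x => cv (rescale (pd j χ₀) ((1 / 2) ^ k)) f x -
        (∫ y, rescale (pd j χ₀) ((1 / 2) ^ k) y) * f x := by
      rw [sm, pd_cv (χk_ker k) (hf.locInt hq), χk, pd_rescale χ₀_moll.smooth, cv_const_mul_ker,
        integral_rescale hδ, χ₀_moll.ker.integral_pd]
      ext x; simp
    have := hf.eLpNorm_cv_sub hq hs ((χ₀_moll.ker.pd j).rescale hδ) (rescale_support hδ (hR' j))
    rw [e, eLpNorm_const_smul, Real.enorm_eq_ofReal (by positivity)]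
    refine (mul_le_mul' le_rfl this).trans ?_
    rw [← ENNReal.ofReal_mul (by positivity)]
    refine ENNReal.ofReal_le_ofReal ?_
    rw [integral_abs_rescale hδ, Real.mul_rpow (hR'0 j).le hδ.le]
    have h1 : c1 j ≤ 2 * c0 + ∑ j, c1 j := by
      have := Finset.single_le_sum (f := c1) (fun j _ => hc1' j) (Finset.mem_univ j)
      linarith
    calc (2:ℝ) ^ k * ((∫ y, |pd j χ₀ y|) * (A * (R' j ^ s * ((1 / 2) ^ k) ^ s)))
        = c1 j * A * (((1 / 2) ^ k) ^ s * 2 ^ k) := by rw [hc1]; ring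
      _ ≤ _ := by gcongr

lemma abs_integral_mul_le {p q : ℝ≥0∞} [ENNReal.HolderConjugate p q] {f g : E3 → ℝ} {a b : ℝ}
    (hfm : AEStronglyMeasurable f cm) (hgm : AEStronglyMeasurable g cm)
    (ha : 0 ≤ a) (hb : 0 ≤ b) (hf : eLpNorm f p cm ≤ ENNReal.ofReal a)
    (hg : eLpNorm g q cm ≤ ENNReal.ofReal b) : |∫ x in cell, f x * g x| ≤ a * b := by
  have h1 := eLpNorm_smul_le_mul_eLpNorm (p := p) (q := q) (r := 1) hgm hfm
  have h2 := (h1.trans (mul_le_mul' hf hg))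
  rw [← ENNReal.ofReal_mul ha, eLpNorm_one_eq_lintegral_enorm] at h2
  have h3 := (enorm_integral_le_lintegral_enorm (μ := cm) (fun x => f x * g x)).trans h2
  rw [Real.enorm_eq_ofReal_abs] at h3
  exact (ENNReal.ofReal_le_ofReal_iff (by positivity)).1 h3

lemma integrable_mul_conj {p q : ℝ≥0∞} [ENNReal.HolderConjugate p q] {f g : E3 → ℝ}
    (hf : MemLp f p cm) (hg : MemLp g q cm) : Integrable (fun x => f x * g x) cm :=
  memLp_one_iff_integrable.1 (MemLp.smul (p := p) (q := q) (r := 1) hg hf)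

/-- The regularised form `∫ g_k ∂_j h_k`. -/
def bq (j : Fin 3) (k : ℕ) (g h : E3 → ℝ) : ℝ := ∫ x in cell, sm k g x * pd j (sm k h) x

/-- The extension by continuity of the form `∫ g ∂_j h`. -/
def bf (j : Fin 3) (g h : E3 → ℝ) : ℝ := limUnder atTop (fun k => bq j k g h)

lemma sm_smp {s : ℝ} {q : ℝ≥0∞} {A : ℝ} {f : E3 → ℝ} (hf : Nik s q A f) (hq : 1 ≤ q) (k : ℕ) :
    SmP (sm k f) := cv_smp (χk_ker k) (hf.locInt hq) hf.per

lemma bf_bounds {s : ℝ} (hs : 1 / 2 < s) : ∃ C, 0 ≤ C ∧ ∀ {p q : ℝ≥0∞} [ENNReal.HolderConjugate p q],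
    1 ≤ p → 1 ≤ q → ∀ {A B : ℝ} {g h : E3 → ℝ}, Nik s p A g → Nik s q B h → ∀ j,
      Tendsto (fun k => bq j k g h) atTop (𝓝 (bf j g h)) ∧ |bf j g h| ≤ C * (A * B) := by
  obtain ⟨C, hC0, hC⟩ := dyadic_bounds (s := s) (by linarith)
  set M := ∫ y, |χ₀ y| with hM
  have hM0 : 0 ≤ M := integral_nonneg fun _ => abs_nonneg _
  set r : ℝ := (1 / 2) ^ (2 * s - 1) with hr
  have hr0 : 0 < r := by positivity
  have hr1 : r < 1 := Real.rpow_lt_one (by norm_num) (by norm_num) (by linarith)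
  have h1r : 0 < 1 - r := by linarith
  refine ⟨M * C + 3 * C ^ 2 / (1 - r), by positivity, ?_⟩
  intro p q _ hp hq A B g h hg hh j
  have hA := hg.nonneg
  have hB := hh.nonneg
  have hgs := sm_smp hg hp
  have hhs := sm_smp hh hq
  have hstep : ∀ k, dist (bq j k g h) (bq j (k + 1) g h) ≤ (3 * C ^ 2 * (A * B)) * r ^ k := by
    intro k
    have e : bq j (k + 1) g h - bq j k g h =
        (∫ x in cell, (sm (k + 1) g x - sm k g x) * pd j (sm (k + 1) h) x) -
        ∫ x in cell, pd j (sm k g) x * (sm (k + 1) h x - sm k h x) := by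
      have ibp := integral_pd_mul (hgs k) ((hhs (k + 1)).sub (hhs k)) j
      rw [pd_sub (hhs (k + 1)).1 (hhs k).1] at ibp
      rw [ibp, sub_neg_eq_add, ← integral_add, bq, bq, ← integral_sub]
      · congr 1; ext x; ring
      · exact ((hgs _).mul ((hhs _).pd j)).integrable
      · exact ((hgs _).mul ((hhs _).pd j)).integrable
      · exact (((hgs _).sub (hgs _)).mul ((hhs _).pd j)).integrable
      · exact ((hgs _).mul (((hhs _).pd j).sub ((hhs _).pd j))).integrable
    rw [dist_comm, Real.dist_eq, e]
    have hd0 : 0 ≤ ((1 / 2 : ℝ) ^ k) ^ s := by positivity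
    have b1 := abs_integral_mul_le (p := p) (q := q) (a := C * A * ((1 / 2) ^ k) ^ s)
      (b := C * B * (((1 / 2) ^ (k + 1)) ^ s * 2 ^ (k + 1)))
      ((hgs (k + 1)).sub (hgs k)).continuous.aestronglyMeasurable
      ((hhs (k + 1)).pd j).continuous.aestronglyMeasurable (by positivity) (by positivity)
      (hC hp hg k).2.1 ((hC hq hh (k + 1)).2.2 j)
    have b2 := abs_integral_mul_le (p := p) (q := q) (b := C * B * ((1 / 2) ^ k) ^ s)
      (a := C * A * (((1 / 2) ^ k) ^ s * 2 ^ k))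
      ((hgs k).pd j).continuous.aestronglyMeasurable
      ((hhs (k + 1)).sub (hhs k)).continuous.aestronglyMeasurable (by positivity) (by positivity)
      ((hC hp hg k).2.2 j) (hC hq hh k).2.1
    have hd : ((1 / 2 : ℝ) ^ (k + 1)) ^ s ≤ ((1 / 2 : ℝ) ^ k) ^ s := by
      gcongr ?_ ^ s
      exact pow_le_pow_of_le_one (by norm_num) (by norm_num) (Nat.le_succ k)
    have hrk : r ^ k = ((1 / 2 : ℝ) ^ k) ^ s * ((1 / 2 : ℝ) ^ k) ^ s * 2 ^ k := by
      rw [← Real.rpow_add (by positivity), hr, ← Real.rpow_natCast (_ ^ (_:ℝ)),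
        ← Real.rpow_mul (by norm_num), ← Real.rpow_natCast (1/2), ← Real.rpow_mul (by norm_num)]
      have : (2:ℝ) ^ k = (1 / 2 : ℝ) ^ (-(k : ℝ)) := by
        rw [Real.rpow_neg (by norm_num), Real.rpow_natCast, one_div, inv_pow, inv_inv]
      rw [this, ← Real.rpow_add (by norm_num)]
      congr 1; ring
    refine (abs_sub _ _).trans ?_
    rw [hrk]
    have h2k : (2:ℝ) ^ (k + 1) = 2 * 2 ^ k := by ring
    rw [h2k] at b1
    have b1' : C * A * ((1 / 2) ^ k) ^ s * (C * B * (((1 / 2) ^ (k + 1)) ^ s * (2 * 2 ^ k))) ≤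
        C * A * ((1 / 2) ^ k) ^ s * (C * B * (((1 / 2) ^ k) ^ s * (2 * 2 ^ k))) := by gcongr
    calc _ ≤ C * A * ((1 / 2) ^ k) ^ s * (C * B * (((1 / 2) ^ k) ^ s * (2 * 2 ^ k))) +
          C * A * (((1 / 2) ^ k) ^ s * 2 ^ k) * (C * B * ((1 / 2) ^ k) ^ s) :=
          add_le_add (b1.trans b1') b2
      _ = _ := by ring
  have hcau := cauchySeq_of_le_geometric r _ hr1 hstep
  obtain ⟨L, hL⟩ := cauchySeq_tendsto_of_complete hcau
  have hlim : Tendsto (fun k => bq j k g h) atTop (𝓝 (bf j g h)) := by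
    rw [bf, hL.limUnder_eq]; exact hL
  refine ⟨hlim, ?_⟩
  have hdist := dist_le_of_le_geometric_of_tendsto₀ r _ hr1 hstep hlim
  have hb0 : |bq j 0 g h| ≤ (M * A) * (C * B) := by
    have n1 := (hg.cv hp (χk_ker 0)).bd
    have n2 := (hC hq hh 0).2.2 j
    have e : (∫ y, |χk 0 y|) = M := by rw [χk, integral_abs_rescale (by positivity)]
    rw [e] at n1
    simp only [pow_zero, Real.one_rpow, mul_one] at n2
    exact abs_integral_mul_le (p := p) (q := q) (hgs 0).continuous.aestronglyMeasurable
      ((hhs 0).pd j).continuous.aestronglyMeasurable (by positivity) (by positivity) n1 n2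
  rw [Real.dist_eq, abs_sub_comm] at hdist
  have : |bf j g h| ≤ |bf j g h - bq j 0 g h| + |bq j 0 g h| := by
    simpa using abs_add_le (bf j g h - bq j 0 g h) (bq j 0 g h)
  calc |bf j g h| ≤ 3 * C ^ 2 * (A * B) / (1 - r) + (M * A) * (C * B) := by linarith
    _ = _ := by field_simp; ring

section bilinear

variable {s : ℝ} {p q : ℝ≥0∞} [ENNReal.HolderConjugate p q] {A B A' B' : ℝ} {g h g' h' : E3 → ℝ}

lemma bf_tendsto (hs : 1 / 2 < s) (hp : 1 ≤ p) (hq : 1 ≤ q) (hg : Nik s p A g) (hh : Nik s q B h)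
    (j : Fin 3) : Tendsto (fun k => bq j k g h) atTop (𝓝 (bf j g h)) :=
  ((bf_bounds hs).choose_spec.2 hp hq hg hh j).1

lemma bf_antisymm (hs : 1 / 2 < s) (hp : 1 ≤ p) (hq : 1 ≤ q) (hg : Nik s p A g) (hh : Nik s q B h)
    (j : Fin 3) : bf j g h = - bf j h g := by
  have : ENNReal.HolderConjugate q p := ENNReal.HolderConjugate.symm
  have h1 := bf_tendsto hs hp hq hg hh j
  have h2 := (bf_tendsto hs hq hp hh hg j).neg
  refine tendsto_nhds_unique h1 (h2.congr fun k => ?_)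
  have := integral_pd_mul (sm_smp hg hp k) (sm_smp hh hq k) j
  simp only [bq]
  rw [← neg_eq_iff_eq_neg] at this
  rw [← this]
  simp only [mul_comm]

lemma bf_add_left (hs : 1 / 2 < s) (hp : 1 ≤ p) (hq : 1 ≤ q) (hg : Nik s p A g)
    (hg' : Nik s p A' g') (hh : Nik s q B h) (j : Fin 3) :
    bf j (fun x => g x + g' x) h = bf j g h + bf j g' h := by
  have h1 := (bf_tendsto hs hp hq hg hh j).add (bf_tendsto hs hp hq hg' hh j)
  refine tendsto_nhds_unique (bf_tendsto hs hp hq (hg.add hg' hp) hh j) (h1.congr fun k => ?_)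
  simp only [bq]
  have e : sm k (fun x => g x + g' x) = fun x => sm k g x + sm k g' x :=
    cv_add (χk_ker k) (hg.locInt hp) (hg'.locInt hp)
  rw [e, ← integral_add (((sm_smp hg hp k).mul ((sm_smp hh hq k).pd j)).integrable)
    (((sm_smp hg' hp k).mul ((sm_smp hh hq k).pd j)).integrable)]
  simp only [add_mul]

lemma bf_const_mul_left (hs : 1 / 2 < s) (hp : 1 ≤ p) (hq : 1 ≤ q) (hg : Nik s p A g)
    (hh : Nik s q B h) (c : ℝ) (j : Fin 3) :
    bf j (fun x => c * g x) h = c * bf j g h := by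
  have h1 := (bf_tendsto hs hp hq hg hh j).const_mul c
  refine tendsto_nhds_unique (bf_tendsto hs hp hq (hg.const_mul c) hh j) (h1.congr fun k => ?_)
  simp only [bq]
  have e : sm k (fun x => c * g x) = fun x => c * sm k g x := cv_const_mul _ _ _
  rw [e, ← integral_const_mul]
  simp only [mul_assoc]

lemma bf_add_right (hs : 1 / 2 < s) (hp : 1 ≤ p) (hq : 1 ≤ q) (hg : Nik s p A g)
    (hh : Nik s q B h) (hh' : Nik s q B' h') (j : Fin 3) :
    bf j g (fun x => h x + h' x) = bf j g h + bf j g h' := by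
  have : ENNReal.HolderConjugate q p := ENNReal.HolderConjugate.symm
  rw [bf_antisymm hs hp hq hg (hh.add hh' hq), bf_add_left hs hq hp hh hh' hg,
    bf_antisymm hs hp hq hg hh, bf_antisymm hs hp hq hg hh']
  ring

lemma bf_const_mul_right (hs : 1 / 2 < s) (hp : 1 ≤ p) (hq : 1 ≤ q) (hg : Nik s p A g)
    (hh : Nik s q B h) (c : ℝ) (j : Fin 3) :
    bf j g (fun x => c * h x) = c * bf j g h := by
  have : ENNReal.HolderConjugate q p := ENNReal.HolderConjugate.symm
  rw [bf_antisymm hs hp hq hg (hh.const_mul c), bf_const_mul_left hs hq hp hh hg,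
    bf_antisymm hs hp hq hg hh]
  ring

lemma NT.bf {ι : Type*} {l : Filter ι} {F G : ι → E3 → ℝ} (hs : 1 / 2 < s) (hp : 1 ≤ p)
    (hq : 1 ≤ q) (hF : NT s p l F g) (hG : NT s q l G h) (j : Fin 3) :
    Tendsto (fun n => Helicity.bf j (F n) (G n)) l (𝓝 (Helicity.bf j g h)) := by
  obtain ⟨C, hC0, hC⟩ := bf_bounds hs
  obtain ⟨⟨A, hA⟩, a, ha, hFa⟩ := hF
  obtain ⟨⟨B, hB⟩, b, hb, hGb⟩ := hG
  rw [tendsto_iff_dist_tendsto_zero]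
  have hz : Tendsto (fun n => C * (a n * (b n + B)) + C * (A * b n)) l (𝓝 0) := by
    have : Tendsto (fun n => C * (a n * (b n + B)) + C * (A * b n)) l
        (𝓝 (C * (0 * (0 + B)) + C * (A * 0))) :=
      ((ha.mul (hb.add_const B)).const_mul C).add ((hb.const_mul A).const_mul C)
    simpa using this
  refine squeeze_zero' (Eventually.of_forall fun n => dist_nonneg) ?_ hz
  filter_upwards [hFa, hGb] with n h1 h2
  have h3 : Nik s q (b n + B) (G n) := by simpa using h2.add hB hq
  have e1 := bf_add_left hs hp hq h1 hA h3 j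
  have e2 := bf_add_right hs hp hq hA h2 hB j
  simp only [sub_add_cancel] at e1 e2
  rw [Real.dist_eq, e1, e2]
  have b1 := (hC hp hq h1 h3 j).2
  have b2 := (hC hp hq hA h2 j).2
  calc _ = |Helicity.bf j (fun x => F n x - g x) (G n) + Helicity.bf j g (fun x => G n x - h x)| := by
        congr 1; ring
    _ ≤ _ := (abs_add_le _ _).trans (add_le_add b1 b2)

lemma sm_tendsto_int {k0 : ℝ} (hs : 0 < s) (hg : Nik s 1 A g) (hh : Nik k0 ⊤ B h) (hk0 : 0 < k0) :
    Tendsto (fun k => ∫ x in cell, sm k g x * sm k h x) atTop (𝓝 (∫ x in cell, g x * h x)) := by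
  obtain ⟨C, hC0, hC⟩ := dyadic_bounds hs.le
  obtain ⟨C', hC0', hC'⟩ := dyadic_bounds hk0.le
  set M := ∫ y, |χ₀ y| with hM
  have hM0 : 0 ≤ M := integral_nonneg fun _ => abs_nonneg _
  have hA := hg.nonneg
  have hB := hh.nonneg
  have hd : ∀ t : ℝ, 0 < t → Tendsto (fun k : ℕ => ((1 / 2 : ℝ) ^ k) ^ t) atTop (𝓝 0) := by
    intro t ht
    have h1 : Tendsto (fun k : ℕ => (1 / 2 : ℝ) ^ k) atTop (𝓝 0) :=
      tendsto_pow_atTop_nhds_zero_of_lt_one (by norm_num) (by norm_num)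
    have := h1.rpow_const (p := t) (Or.inr ht.le)
    rwa [Real.zero_rpow ht.ne'] at this
  rw [tendsto_iff_dist_tendsto_zero]
  have hz : Tendsto (fun k : ℕ => (C * A * ((1 / 2 : ℝ) ^ k) ^ s) * (M * B) +
      A * (C' * B * ((1 / 2 : ℝ) ^ k) ^ k0)) atTop (𝓝 0) := by
    have := (((hd s hs).const_mul (C * A)).mul_const (M * B)).add
      (((hd k0 hk0).const_mul (C' * B)).const_mul A)
    simpa using this
  refine squeeze_zero (fun n => dist_nonneg) (fun k => ?_) hz
  have hgs := sm_smp hg le_rfl k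
  have hhs := sm_smp hh le_top k
  have n1 := (hh.cv le_top (χk_ker k)).bd
  rw [show (∫ y, |χk k y|) = M by rw [χk, integral_abs_rescale (by positivity)]] at n1
  have b1 := abs_integral_mul_le (p := 1) (q := ⊤) (hgs.continuous.aestronglyMeasurable.sub hg.meas')
    hhs.continuous.aestronglyMeasurable (by positivity) (by positivity) (hC le_rfl hg k).1 n1
  have b2 := abs_integral_mul_le (p := 1) (q := ⊤) hg.meas'
    (hhs.continuous.aestronglyMeasurable.sub hh.meas') (by positivity) (by positivity) hg.bd
    (hC' le_top hh k).1
  rw [Real.dist_eq]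
  have i1 : Integrable (fun x => sm k g x * sm k h x) cm := (hgs.mul hhs).integrable
  have i2 : Integrable (fun x => g x * h x) cm := integrable_mul_conj (p := 1) (q := ⊤) hg.memLp hh.memLp
  have i3 : Integrable (fun x => g x * sm k h x) cm := Integrable.mul_smp (hg.integrable le_rfl) hhs
  have e : (∫ x in cell, sm k g x * sm k h x) - ∫ x in cell, g x * h x =
      (∫ x in cell, (sm k g - g) x * cv (χk k) h x) + ∫ x in cell, g x * (sm k h - h) x := by
    rw [← integral_sub i1 i2, ← integral_add]
    · congr 1; ext x; simp [sm]; ring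
    · exact (i1.sub i3).congr (ae_of_all _ fun x => by simp [sm]; ring)
    · exact (i3.sub i2).congr (ae_of_all _ fun x => by simp; ring)
  rw [e]
  exact (abs_add_le _ _).trans (add_le_add b1 b2)

lemma bf_smooth_right (hs : 1 / 2 < s) (hp : 1 ≤ p) (hg : Nik s p A g) (hh : SmP h)
    (j : Fin 3) : bf j g h = ∫ x in cell, g x * pd j h x := by
  obtain ⟨B, hB⟩ := (hh.pd j).nik (s := 1) zero_le_one le_rfl
  have h1 := sm_tendsto_int (by linarith) (hg.mono_q hp) hB one_pos
  rw [bf]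
  refine Tendsto.limUnder_eq (h1.congr fun k => ?_)
  simp only [bq, sm, pd_cv (χk_ker k) hh.smooth.locInt, cv_pd (χk_ker k) hh.smooth]

lemma bf_smooth_left (hs : 1 / 2 < s) (hq : 1 ≤ q) (hg : SmP g) (hh : Nik s q B h)
    (j : Fin 3) : bf j g h = - ∫ x in cell, pd j g x * h x := by
  obtain ⟨B, hB⟩ := (hg.pd j).nik (s := 1) zero_le_one le_rfl
  have h1 := (sm_tendsto_int (by linarith) (hh.mono_q hq) hB one_pos).neg
  simp only [mul_comm (pd j g _)]
  rw [bf]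
  refine Tendsto.limUnder_eq (h1.congr fun k => ?_)
  have := integral_pd_mul (cv_smp (χk_ker k) hg.smooth.locInt hg.per) (sm_smp hh hq k) j
  simp only [bq, sm] at this ⊢
  rw [← neg_eq_iff_eq_neg] at this
  rw [← this]
  simp only [pd_cv (χk_ker k) hg.smooth.locInt, cv_pd (χk_ker k) hg.smooth, mul_comm]

end bilinear

/-! ### The bracket of a curl with a field -/

lemma one_le_three : (1 : ℝ≥0∞) ≤ 3 := by norm_num

lemma one_le_three_half : (1 : ℝ≥0∞) ≤ 3 / 2 := by
  rw [ENNReal.le_div_iff_mul_le (by simp) (by simp)]; norm_num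

lemma three_half_inv : (3 / 2 : ℝ≥0∞)⁻¹ = 2 / 3 := by
  rw [ENNReal.inv_div (by simp) (by simp)]

lemma two_third_add : (3 : ℝ≥0∞)⁻¹ + 3⁻¹ = 2 / 3 := by
  rw [ENNReal.div_eq_inv_mul, mul_two]

instance : ENNReal.HolderTriple 3 3 (3 / 2) where
  inv_add_inv_eq_inv := by rw [three_half_inv, two_third_add]

instance : ENNReal.HolderConjugate 3 (3 / 2) where
  inv_add_inv_eq_inv := by
    rw [three_half_inv, ENNReal.div_eq_inv_mul, inv_one, mul_two, ← add_assoc]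
    have := ENNReal.inv_mul_cancel (a := 3) (by simp) (by simp)
    rw [show (3 : ℝ≥0∞)⁻¹ + 3⁻¹ + 3⁻¹ = 3⁻¹ * 3 by ring]
    exact this

/-- The components of the curl. -/
def curlS (f : Fin 3 → E3 → ℝ) : Fin 3 → E3 → ℝ :=
  ![fun x => pd 1 (f 2) x - pd 2 (f 1) x, fun x => pd 2 (f 0) x - pd 0 (f 2) x,
    fun x => pd 0 (f 1) x - pd 1 (f 0) x]

lemma curlS_smp {f : Fin 3 → E3 → ℝ} (hf : ∀ i, SmP (f i)) (i : Fin 3) : SmP (curlS f i) := by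
  fin_cases i
  · exact ((hf 2).pd 1).sub ((hf 1).pd 2)
  · exact ((hf 0).pd 2).sub ((hf 2).pd 0)
  · exact ((hf 1).pd 0).sub ((hf 0).pd 1)

/-- The extension by continuity of `∫ v · curl f = ∫ curl v · f`. -/
def Bc (v f : Fin 3 → E3 → ℝ) : ℝ :=
  bf 1 (v 0) (f 2) - bf 2 (v 0) (f 1) + (bf 2 (v 1) (f 0) - bf 0 (v 1) (f 2)) +
    (bf 0 (v 2) (f 1) - bf 1 (v 2) (f 0))

lemma integral_six {a b c d e f : E3 → ℝ} (ha : Integrable a cm) (hb : Integrable b cm)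
    (hc : Integrable c cm) (hd : Integrable d cm) (he : Integrable e cm) (hf : Integrable f cm) :
    ∫ x in cell, (a x - b x + (c x - d x) + (e x - f x)) =
      (∫ x in cell, a x) - (∫ x in cell, b x) + ((∫ x in cell, c x) - ∫ x in cell, d x) +
        ((∫ x in cell, e x) - ∫ x in cell, f x) := by
  have h1 := integral_add ((ha.sub hb).add (hc.sub hd)) (he.sub hf)
  have h2 := integral_add (ha.sub hb) (hc.sub hd)
  simp only [Pi.add_apply, Pi.sub_apply] at h1 h2
  rw [h1, h2, integral_sub ha hb, integral_sub hc hd, integral_sub he hf]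

section Bc

variable {s : ℝ} {p q : ℝ≥0∞} [ENNReal.HolderConjugate p q] {A B : ℝ} {v f : Fin 3 → E3 → ℝ}

lemma Bc_bound (hs : 1 / 2 < s) : ∃ C, 0 ≤ C ∧ ∀ {p q : ℝ≥0∞} [ENNReal.HolderConjugate p q],
    1 ≤ p → 1 ≤ q → ∀ {A B : ℝ} {v f : Fin 3 → E3 → ℝ}, (∀ i, Nik s p A (v i)) →
      (∀ i, Nik s q B (f i)) → |Bc v f| ≤ C * (A * B) := by
  obtain ⟨C, hC0, hC⟩ := bf_bounds hs
  refine ⟨6 * C, by positivity, ?_⟩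
  intro p q _ hp hq A B v f hv hf
  have h : ∀ j i k, |bf j (v i) (f k)| ≤ C * (A * B) := fun j i k => (hC hp hq (hv i) (hf k) j).2
  have h1 := abs_le.1 (h 1 0 2)
  have h2 := abs_le.1 (h 2 0 1)
  have h3 := abs_le.1 (h 2 1 0)
  have h4 := abs_le.1 (h 0 1 2)
  have h5 := abs_le.1 (h 0 2 1)
  have h6 := abs_le.1 (h 1 2 0)
  rw [Bc, abs_le]
  constructor <;> linarith [h1.1, h1.2, h2.1, h2.2, h3.1, h3.2, h4.1, h4.2, h5.1, h5.2, h6.1, h6.2]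

lemma Bc_tendsto {ι : Type*} {l : Filter ι} {V F : Fin 3 → ι → E3 → ℝ} (hs : 1 / 2 < s)
    (hp : 1 ≤ p) (hq : 1 ≤ q) (hV : ∀ i, NT s p l (V i) (v i)) (hF : ∀ i, NT s q l (F i) (f i)) :
    Tendsto (fun n => Bc (fun i => V i n) (fun i => F i n)) l (𝓝 (Bc v f)) := by
  have h : ∀ j i k, Tendsto (fun n => bf j (V i n) (F k n)) l (𝓝 (bf j (v i) (f k))) :=
    fun j i k => NT.bf hs hp hq (hV i) (hF k) j
  exact (((h 1 0 2).sub (h 2 0 1)).add ((h 2 1 0).sub (h 0 1 2))).add ((h 0 2 1).sub (h 1 2 0))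

lemma Bc_smooth_right (hs : 1 / 2 < s) (hp : 1 ≤ p) (hv : ∀ i, Nik s p A (v i))
    (hf : ∀ i, SmP (f i)) : Bc v f = ∫ x in cell, ∑ i, v i x * curlS f i x := by
  have i1 : ∀ i j k, Integrable (fun x => v i x * pd j (f k) x) cm := fun i j k =>
    Integrable.mul_smp ((hv i).integrable hp) ((hf k).pd j)
  simp only [Fin.sum_univ_three, curlS, Matrix.cons_val_zero, Matrix.cons_val_one, Matrix.cons_val,
    mul_sub]
  rw [integral_six (i1 _ _ _) (i1 _ _ _) (i1 _ _ _) (i1 _ _ _) (i1 _ _ _) (i1 _ _ _), Bc]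
  simp only [fun i k j => bf_smooth_right hs hp (hv i) (hf k) j]

lemma Bc_smooth_left (hs : 1 / 2 < s) (hq : 1 ≤ q) (hv : ∀ i, SmP (v i))
    (hf : ∀ i, Nik s q B (f i)) : Bc v f = ∫ x in cell, ∑ i, curlS v i x * f i x := by
  have i1 : ∀ i j k, Integrable (fun x => pd j (v i) x * f k x) cm := fun i j k => by
    simpa only [mul_comm] using Integrable.mul_smp ((hf k).integrable hq) ((hv i).pd j)
  simp only [Fin.sum_univ_three, curlS, Matrix.cons_val_zero, Matrix.cons_val_one, Matrix.cons_val,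
    sub_mul]
  rw [integral_six (i1 _ _ _) (i1 _ _ _) (i1 _ _ _) (i1 _ _ _) (i1 _ _ _) (i1 _ _ _), Bc]
  simp only [fun i k j => bf_smooth_left hs hq (hv i) (hf k) j]
  ring

end Bc

/-- The components of a vector field. -/
def co (V : E3 → E3) : Fin 3 → E3 → ℝ := fun i x => V x i

lemma locInt_of_co {V : E3 → E3} (h : ∀ i, LocallyIntegrable (co V i) volume) :
    LocallyIntegrable V volume := by
  have e : V = fun x => ∑ i, co V i x • basisVec i := by
    ext x j
    simp [co, basisVec, Pi.single_apply]
  rw [e]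
  refine locallyIntegrable_finsetSum _ fun i _ => ?_
  intro x
  obtain ⟨U, hU, hi⟩ := h i x
  exact ⟨U, hU, hi.smul_const _⟩

lemma co_mollify {ρ : E3 → ℝ} (hρ : Ker ρ) {η : ℝ} (hη : 0 < η) {V : E3 → E3}
    (h : ∀ i, LocallyIntegrable (co V i) volume) (i : Fin 3) :
    co (mollify ρ η V) i = cv (rescale ρ η) (co V i) := by
  ext x
  have hi : Integrable (fun y => rescale ρ η y • V (x - y)) volume :=
    (hρ.rescale hη).compact.convolutionExists_left (ContinuousLinearMap.lsmul ℝ ℝ)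
      (hρ.rescale hη).continuous (locInt_of_co h) x
  simp only [co, mollify, cv]
  have := (EuclideanSpace.proj i : E3 →L[ℝ] ℝ).integral_comp_comm hi
  simpa using this.symm

lemma mem_testFields_of_co {V : E3 → E3} (h : ∀ i, SmP (co V i)) : V ∈ testFields := by
  refine ⟨contDiff_euclidean.2 fun i => (h i).1, fun x i => ?_⟩
  ext j
  exact (h j).2 x i

lemma co_smp {V : E3 → E3} (h : V ∈ testFields) (i : Fin 3) : SmP (co V i) :=
  ⟨contDiff_euclidean.1 h.1 i, fun x j => by simp only [co, h.2 x j]⟩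

lemma partialD_eq {V : E3 → E3} (h : ContDiff ℝ (⊤ : ℕ∞) V) (j i : Fin 3) (x : E3) :
    partialD V j i x = pd j (co V i) x := by
  have hd : HasFDerivAt V (fderiv ℝ V x) x := (h.differentiable (by simp) x).hasFDerivAt
  have := (EuclideanSpace.proj i : E3 →L[ℝ] ℝ).hasFDerivAt.comp x hd
  simp only [pd, partialD]
  change _ = fderiv ℝ ((EuclideanSpace.proj i : E3 →L[ℝ] ℝ) ∘ V) x _
  rw [this.fderiv]
  rfl

lemma curl_eq_curlS {V : E3 → E3} (h : ContDiff ℝ (⊤ : ℕ∞) V) (i : Fin 3) (x : E3) :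
    curl V x i = curlS (co V) i x := by
  fin_cases i <;> simp [curl, curlS, partialD_eq h]

lemma inner_eq_sum (a b : E3) : inner ℝ a b = ∑ i, a i * b i := by
  rw [PiLp.inner_apply]
  simp [mul_comm]

/-- The distribution `w` is the curl of `V`. -/
def IsCurl (w : VecDistribution) (V : E3 → E3) : Prop :=
  ∀ ψ : testFields, w.toLin ψ = ∫ x in cell, inner ℝ (V x) (curl ψ x)

lemma IsCurl.eval {w : VecDistribution} {V : E3 → E3} (hw : IsCurl w V) {s : ℝ} (hs : 1 / 2 < s)
    {p : ℝ≥0∞} (hp : 1 ≤ p) {A : ℝ} (hV : ∀ i, Nik s p A (co V i)) {ψ : E3 → E3}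
    (hψ : ∀ i, SmP (co ψ i)) : w.eval ψ = Bc (co V) (co ψ) := by
  have hm := mem_testFields_of_co hψ
  rw [VecDistribution.eval, dif_pos hm, hw, Bc_smooth_right hs hp hV hψ]
  congr 1; ext x
  rw [inner_eq_sum]
  simp only [curl_eq_curlS hm.1, co]

lemma IsCurl.hasBracket {w : VecDistribution} {V : E3 → E3} (hw : IsCurl w V) {s : ℝ}
    (hs : 1 / 2 < s) {p q : ℝ≥0∞} [ENNReal.HolderConjugate p q] (hp : 1 ≤ p) (hq : 1 ≤ q) {A B : ℝ}
    (hV : ∀ i, Nik s p A (co V i)) {f : E3 → E3} (hf : ∀ i, Nik s q B (co f i)) :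
    HasBracket w f (Bc (co V) (co f)) := by
  intro ρ hρ
  have hs' : 1 / 2 < (s + 1 / 2) / 2 := by linarith
  have hs2 : (s + 1 / 2) / 2 < s := by linarith
  have hV' : ∀ i, Nik ((s + 1 / 2) / 2) p (2 * A) (co V i) := fun i =>
    (hV i).mono_s hp (by linarith) hs2.le
  have h1 := Bc_tendsto (l := 𝓝[>] (0:ℝ)) hs' hp hq (fun i => NT.const (hV' i))
    (fun i => (hf i).mollify hq (by linarith) hs2 hρ.ker hρ.integral_eq)
  refine h1.congr' ?_
  filter_upwards [self_mem_nhdsWithin] with η (hη : 0 < η)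
  have hl : ∀ i, LocallyIntegrable (co f i) volume := fun i => (hf i).locInt hq
  have hc : ∀ i, co (mollify ρ η f) i = cv (rescale ρ η) (co f i) := co_mollify hρ.ker hη hl
  rw [hw.eval hs hp hV fun i => by
    rw [hc i]; exact cv_smp (hρ.ker.rescale hη) (hl i) (hf i).per]
  rw [show co (mollify ρ η f) = fun i => cv (rescale ρ η) (co f i) from funext hc]

lemma bracket_eq {w : VecDistribution} {f : E3 → E3} {a : ℝ} (h : HasBracket w f a) :
    bracket w f = a := by
  have hd : BracketDefined w f := ⟨a, h⟩
  rw [bracket, dif_pos hd]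
  exact tendsto_nhds_unique (hd.choose_spec χ₀ χ₀_moll) (h χ₀ χ₀_moll)

/-! ### The local balance for smooth solenoidal fields -/

/-- The field `∇φ × f`. -/
def crossG (φ : E3 → ℝ) (f : Fin 3 → E3 → ℝ) : Fin 3 → E3 → ℝ :=
  ![fun x => pd 1 φ x * f 2 x - pd 2 φ x * f 1 x, fun x => pd 2 φ x * f 0 x - pd 0 φ x * f 2 x,
    fun x => pd 0 φ x * f 1 x - pd 1 φ x * f 0 x]

/-- The test field with which the momentum equation is tested. -/
def zeta (K φ : E3 → ℝ) (v : Fin 3 → E3 → ℝ) (i : Fin 3) (x : E3) : ℝ :=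
  2 * (φ x * curlS (fun i => cv K (v i)) i x) + crossG φ (fun i => cv K (v i)) i x +
    2 * curlS (fun i => cv K (fun y => φ y * v i y)) i x - cv K (crossG φ v i) x

/-- The derivative `(v · ∇) φ`. -/
def adv (φ : E3 → ℝ) (v : Fin 3 → E3 → ℝ) (x : E3) : ℝ := ∑ j, v j x * pd j φ x

/-- The square `|v|²`. -/
def sq (v : Fin 3 → E3 → ℝ) (x : E3) : ℝ := ∑ j, v j x * v j x

/-- The regularised helicity flux, as the field paired with the vorticity. -/
def fl (K φ : E3 → ℝ) (v : Fin 3 → E3 → ℝ) (i : Fin 3) (x : E3) : ℝ :=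
  v i x * (∑ j, v j x * cv K (pd j φ) x) - v i x * cv K (adv φ v) x +
    cv K (fun y => v i y * adv φ v y) x + adv φ v x * cv K (v i) x -
    1 / 2 * (sq v x * cv K (pd i φ) x) + 1 / 2 * (pd i φ x * cv K (sq v) x) -
    pd i φ x * ∑ j, v j x * cv K (v j) x

/-- The field `(δv · G φ) δv`. -/
def trip₁ (v : Fin 3 → E3 → ℝ) (φ : E3 → ℝ) (G : Fin 3 → ℝ) (ξ : E3) (i : Fin 3) (x : E3) : ℝ :=
  (∑ j, (v j (x + ξ) - v j x) * (φ x * G j)) * (v i (x + ξ) - v i x)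

/-- The field `|δv|² G φ`. -/
def trip₂ (v : Fin 3 → E3 → ℝ) (φ : E3 → ℝ) (G : Fin 3 → ℝ) (ξ : E3) (i : Fin 3) (x : E3) : ℝ :=
  (∑ j, (v j (x + ξ) - v j x) * (v j (x + ξ) - v j x)) * (φ x * G i)

lemma SmP.cv {K f : E3 → ℝ} (hf : SmP f) (hK : Ker K) : SmP (cv K f) :=
  cv_smp hK hf.smooth.locInt hf.per

lemma integral_cv_mul_smp {K f g : E3 → ℝ} (hK : Ker K) (he : ∀ x, K (-x) = K x) (hf : SmP f)
    (hg : SmP g) : ∫ x in cell, cv K f x * g x = ∫ x in cell, f x * cv K g x :=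
  integral_cv_mul hK he hf.per hf.integrable hg.continuous hg.per

lemma crossG_smp {φ : E3 → ℝ} {f : Fin 3 → E3 → ℝ} (hφ : SmP φ) (hf : ∀ i, SmP (f i)) (i : Fin 3) :
    SmP (crossG φ f i) := by
  fin_cases i
  · exact ((hφ.pd 1).mul (hf 2)).sub ((hφ.pd 2).mul (hf 1))
  · exact ((hφ.pd 2).mul (hf 0)).sub ((hφ.pd 0).mul (hf 2))
  · exact ((hφ.pd 0).mul (hf 1)).sub ((hφ.pd 1).mul (hf 0))

lemma adv_smp {φ : E3 → ℝ} {v : Fin 3 → E3 → ℝ} (hφ : SmP φ) (hv : ∀ i, SmP (v i)) :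
    SmP (adv φ v) := SmP.sum fun j _ => (hv j).mul (hφ.pd j)

lemma sq_smp {v : Fin 3 → E3 → ℝ} (hv : ∀ i, SmP (v i)) : SmP (sq v) :=
  SmP.sum fun j _ => (hv j).mul (hv j)

/-- Integration by parts for the curl. -/
lemma integral_curlS {f g : Fin 3 → E3 → ℝ} (hf : ∀ i, SmP (f i)) (hg : ∀ i, SmP (g i)) :
    ∫ x in cell, ∑ i, f i x * curlS g i x = ∫ x in cell, ∑ i, curlS f i x * g i x := by
  obtain ⟨A, hA⟩ := exists_common_nik hf zero_le_one le_rfl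
  obtain ⟨B, hB⟩ := exists_common_nik hg zero_le_one le_rfl
  have : (1 / 2 : ℝ) < 1 := by norm_num
  rw [← Bc_smooth_right (p := 1) this le_rfl (fun i => (hA i).mono_q le_top) hg,
    Bc_smooth_left (q := ⊤) this le_top hf hB]

/-- Transport by a solenoidal field. -/
lemma integral_transport {a : Fin 3 → E3 → ℝ} {P φ : E3 → ℝ} (ha : ∀ i, SmP (a i))
    (hdiv : ∀ x, ∑ j, pd j (a j) x = 0) (hP : SmP P) (hφ : SmP φ) :
    ∫ x in cell, P x * adv φ a x = - ∫ x in cell, φ x * ∑ j, a j x * pd j P x := by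
  have h : ∀ j, ∫ x in cell, pd j φ x * (a j x * P x) =
      - ∫ x in cell, φ x * (a j x * pd j P x + P x * pd j (a j) x) := by
    intro j
    rw [integral_pd_mul hφ ((ha j).mul hP), pd_mul (ha j).1 hP.1]
  have e1 : (fun x => P x * adv φ a x) = fun x => ∑ j, pd j φ x * (a j x * P x) := by
    ext x; simp only [adv, Finset.mul_sum]; exact Finset.sum_congr rfl fun j _ => by ring
  rw [e1, integral_finsetSum _ fun j _ => ((hφ.pd j).mul ((ha j).mul hP)).integrable]
  simp only [h]
  rw [Finset.sum_neg_distrib, ← integral_finsetSum _ fun j _ =>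
    (hφ.mul (((ha j).mul (hP.pd j)).add (hP.mul ((ha j).pd j)))).integrable]
  congr 2; ext x
  rw [← Finset.mul_sum, Finset.sum_add_distrib, ← Finset.mul_sum, hdiv]
  ring

lemma pd_even {K : E3 → ℝ} (hK : CInf K) (he : ∀ x, K (-x) = K x) (j : Fin 3) (x : E3) :
    pd j K (-x) = - pd j K x := by
  have h : K = fun y => K (-y) := funext fun y => (he y).symm
  have h1 : HasFDerivAt (fun y => K (-y)) ((fderiv ℝ K (-x)).comp (-ContinuousLinearMap.id ℝ E3)) x :=
    (hK.diff (-x)).hasFDerivAt.comp x (hasFDerivAt_id x).neg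
  rw [← h] at h1
  simp [pd, h1.fderiv]

lemma integral_pdK_shift {K : E3 → ℝ} (hK : CInf K) (he : ∀ x, K (-x) = K x) (j : Fin 3) (P : E3 → ℝ) (x : E3) :
    ∫ ξ, pd j K ξ * P (x + ξ) = - cv (pd j K) P x := by
  rw [← integral_neg_eq_self (fun ξ => pd j K ξ * P (x + ξ)), cv, ← integral_neg]
  congr 1; ext ξ
  rw [pd_even hK he, sub_eq_add_neg]; ring

/-- The value at `x` of `-∫ ∂_j K(ξ) δa δb δc dξ`. -/
def cubicE (K : E3 → ℝ) (j : Fin 3) (a b c : E3 → ℝ) (x : E3) : ℝ :=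
  cv (pd j K) (fun y => a y * b y * c y) x - a x * cv (pd j K) (fun y => b y * c y) x -
    b x * cv (pd j K) (fun y => a y * c y) x - c x * cv (pd j K) (fun y => a y * b y) x +
    a x * b x * cv (pd j K) c x + a x * c x * cv (pd j K) b x + b x * c x * cv (pd j K) a x

section cubic

variable {K a b c φ : E3 → ℝ}

lemma integral_cubic (hK : Ker K) (he : ∀ x, K (-x) = K x) (ha : SmP a) (hb : SmP b)
    (hc : SmP c) (j : Fin 3) (x : E3) :
    ∫ ξ, pd j K ξ * ((a (x + ξ) - a x) * (b (x + ξ) - b x) * (c (x + ξ) - c x)) =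
      - cubicE K j a b c x := by
  have hi : ∀ {P : E3 → ℝ}, SmP P → Integrable (fun ξ => pd j K ξ * P (x + ξ)) volume := by
    intro P hP
    refine Continuous.integrable_of_hasCompactSupport ?_ ((hK.pd j).compact.mul_right)
    exact (hK.pd j).continuous.mul (hP.continuous.comp (by fun_prop))
  have e : (fun ξ => pd j K ξ * ((a (x + ξ) - a x) * (b (x + ξ) - b x) * (c (x + ξ) - c x))) =
      fun ξ => pd j K ξ * ((fun y => a y * b y * c y) (x + ξ)) -
        a x * (pd j K ξ * (fun y => b y * c y) (x + ξ)) -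
        b x * (pd j K ξ * (fun y => a y * c y) (x + ξ)) -
        c x * (pd j K ξ * (fun y => a y * b y) (x + ξ)) +
        a x * b x * (pd j K ξ * c (x + ξ)) + a x * c x * (pd j K ξ * b (x + ξ)) +
        b x * c x * (pd j K ξ * a (x + ξ)) - a x * b x * c x * pd j K ξ := by
    ext ξ; ring
  have j1 := hi ((ha.mul hb).mul hc)
  have j2 := (hi (hb.mul hc)).const_mul (a x)
  have j3 := (hi (ha.mul hc)).const_mul (b x)
  have j4 := (hi (ha.mul hb)).const_mul (c x)
  have j5 := (hi hc).const_mul (a x * b x)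
  have j6 := (hi hb).const_mul (a x * c x)
  have j7 := (hi ha).const_mul (b x * c x)
  have j8 := (hK.pd j).integrable.const_mul (a x * b x * c x)
  have k1 := integral_sub (((((((j1.sub j2).sub j3).sub j4).add j5).add j6).add j7)) j8
  have k2 := integral_add ((((((j1.sub j2).sub j3).sub j4).add j5).add j6)) j7
  have k3 := integral_add (((((j1.sub j2).sub j3).sub j4).add j5)) j6
  have k4 := integral_add ((((j1.sub j2).sub j3).sub j4)) j5
  have k5 := integral_sub (((j1.sub j2).sub j3)) j4
  have k6 := integral_sub ((j1.sub j2)) j3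
  have k7 := integral_sub j1 j2
  simp only [Pi.add_apply, Pi.sub_apply] at k1 k2 k3 k4 k5 k6 k7
  simp only [e]
  rw [k1, k2, k3, k4, k5, k6, k7]
  have s1 := integral_pdK_shift hK.1 he j (fun y => a y * b y * c y) x
  have s2 := integral_pdK_shift hK.1 he j (fun y => b y * c y) x
  have s3 := integral_pdK_shift hK.1 he j (fun y => a y * c y) x
  have s4 := integral_pdK_shift hK.1 he j (fun y => a y * b y) x
  simp only [integral_const_mul, integral_pdK_shift hK.1 he j a, integral_pdK_shift hK.1 he j b,
    integral_pdK_shift hK.1 he j c, hK.integral_pd]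
  rw [s1, s2, s3, s4, cubicE]; ring

lemma integrable_cubic (hK : Ker K) (ha : SmP a) (hb : SmP b) (hc : SmP c) (hφ : SmP φ)
    (j : Fin 3) : Integrable (fun z : E3 × E3 => φ z.2 * (pd j K z.1 *
      ((a (z.2 + z.1) - a z.2) * (b (z.2 + z.1) - b z.2) * (c (z.2 + z.1) - c z.2))))
      ((volume : Measure E3).prod cm) := by
  obtain ⟨Ca, ha0, hCa⟩ := ha.exists_bound
  obtain ⟨Cb, hb0, hCb⟩ := hb.exists_bound
  obtain ⟨Cc, hc0, hCc⟩ := hc.exists_bound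
  have h1 : Integrable (fun z : E3 × E3 => pd j K z.1 * φ z.2) ((volume : Measure E3).prod cm) :=
    (hK.pd j).integrable.mul_prod hφ.integrable
  have hac := ha.continuous
  have hbc := hb.continuous
  have hcc := hc.continuous
  have h2 := h1.mul_bdd (c := (Ca + Ca) * (Cb + Cb) * (Cc + Cc)) (g := fun z : E3 × E3 =>
    (a (z.2 + z.1) - a z.2) * (b (z.2 + z.1) - b z.2) * (c (z.2 + z.1) - c z.2))
    (Continuous.aestronglyMeasurable (by fun_prop)) (ae_of_all _ fun z => by
      rw [norm_mul, norm_mul]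
      have d1 := (abs_sub (a (z.2 + z.1)) (a z.2)).trans (add_le_add (hCa _) (hCa _))
      have d2 := (abs_sub (b (z.2 + z.1)) (b z.2)).trans (add_le_add (hCb _) (hCb _))
      have d3 := (abs_sub (c (z.2 + z.1)) (c z.2)).trans (add_le_add (hCc _) (hCc _))
      simp only [Real.norm_eq_abs]
      gcongr)
  exact h2.congr (ae_of_all _ fun z => by simp only; ring)

lemma integral_integral_cubic (hK : Ker K) (he : ∀ x, K (-x) = K x) (ha : SmP a) (hb : SmP b)
    (hc : SmP c) (hφ : SmP φ) (j : Fin 3) :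
    ∫ ξ, ∫ x in cell, φ x * (pd j K ξ *
      ((a (x + ξ) - a x) * (b (x + ξ) - b x) * (c (x + ξ) - c x))) =
      - ∫ x in cell, φ x * cubicE K j a b c x := by
  rw [integral_integral_swap (f := fun ξ x => φ x * (pd j K ξ *
      ((a (x + ξ) - a x) * (b (x + ξ) - b x) * (c (x + ξ) - c x))))
      (integrable_cubic hK ha hb hc hφ j)]
  simp only [integral_const_mul, integral_cubic hK he ha hb hc, mul_neg, integral_neg]

lemma cubicE_smp (hK : Ker K) (ha : SmP a) (hb : SmP b) (hc : SmP c) (j : Fin 3) :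
    SmP (cubicE K j a b c) :=
  (((((((((ha.mul hb).mul hc).cv (hK.pd j)).sub (ha.mul ((hb.mul hc).cv (hK.pd j)))).sub
    (hb.mul ((ha.mul hc).cv (hK.pd j)))).sub (hc.mul ((ha.mul hb).cv (hK.pd j)))).add
    ((ha.mul hb).mul (hc.cv (hK.pd j)))).add ((ha.mul hc).mul (hb.cv (hK.pd j)))).add
    ((hb.mul hc).mul (ha.cv (hK.pd j))))

end cubic

lemma curlS_div {v : Fin 3 → E3 → ℝ} (hv : ∀ i, SmP (v i)) (x : E3) :
    ∑ j, pd j (curlS v j) x = 0 := by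
  simp only [Fin.sum_univ_three, curlS, Matrix.cons_val_zero, Matrix.cons_val_one, Matrix.cons_val]
  rw [pd_sub ((hv 2).1.pd 1) ((hv 1).1.pd 2), pd_sub ((hv 0).1.pd 2) ((hv 2).1.pd 0),
    pd_sub ((hv 1).1.pd 0) ((hv 0).1.pd 1), pd_comm (hv 2).1 0 1, pd_comm (hv 1).1 0 2,
    pd_comm (hv 0).1 1 2]
  ring

/-- The divergence of `v ⊗ v`. -/
def divT (v : Fin 3 → E3 → ℝ) (i : Fin 3) (x : E3) : ℝ := ∑ j, v j x * pd j (v i) x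

lemma divT_smp {v : Fin 3 → E3 → ℝ} (hv : ∀ i, SmP (v i)) (i : Fin 3) : SmP (divT v i) :=
  SmP.sum fun j _ => (hv j).mul ((hv i).pd j)

lemma curlS_divT {v : Fin 3 → E3 → ℝ} (hv : ∀ i, SmP (v i)) (hdiv : ∀ x, ∑ j, pd j (v j) x = 0)
    (i : Fin 3) (x : E3) :
    curlS (divT v) i x = ∑ j, (v j x * pd j (curlS v i) x - curlS v j x * pd j (v i) x) := by
  have hd := hdiv x
  rw [Fin.sum_univ_three] at hd
  have hp : ∀ k i, pd k (divT v i) x =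
      ∑ j, (v j x * pd k (pd j (v i)) x + pd j (v i) x * pd k (v j) x) := by
    intro k i
    have : pd k (divT v i) = fun x => ∑ j, pd k (fun x => v j x * pd j (v i) x) x :=
      pd_sum _ (fun j _ => ((hv j).mul ((hv i).pd j)).1) k
    rw [this]
    refine Finset.sum_congr rfl fun j _ => ?_
    rw [pd_mul (hv j).1 ((hv i).pd j).1]
  fin_cases i
  all_goals
    simp only [curlS, Fin.sum_univ_three, Matrix.cons_val_zero, Matrix.cons_val_one,
      Matrix.cons_val, Fin.zero_eta, Fin.mk_one, Fin.reduceFinMk, hp]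
    simp only [pd_sub ((hv 2).1.pd 1) ((hv 1).1.pd 2), pd_sub ((hv 0).1.pd 2) ((hv 2).1.pd 0),
      pd_sub ((hv 1).1.pd 0) ((hv 0).1.pd 1)]
    simp only [pd_comm (hv _).1 1 0, pd_comm (hv _).1 2 0, pd_comm (hv _).1 2 1]
  · linear_combination (pd 1 (v 2) x - pd 2 (v 1) x) * hd
  · linear_combination (pd 2 (v 0) x - pd 0 (v 2) x) * hd
  · linear_combination (pd 0 (v 1) x - pd 1 (v 0) x) * hd

lemma SmP.integral_add {f g : E3 → ℝ} (hf : SmP f) (hg : SmP g) :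
    ∫ x in cell, (f x + g x) = (∫ x in cell, f x) + ∫ x in cell, g x :=
  MeasureTheory.integral_add hf.integrable hg.integrable

lemma SmP.integral_four {f g h k : E3 → ℝ} (hf : SmP f) (hg : SmP g) (hh : SmP h) (hk : SmP k)
    (a b c d : ℝ) : ∫ x in cell, (a * f x + b * g x + c * h x + d * k x) =
      a * (∫ x in cell, f x) + b * (∫ x in cell, g x) + c * (∫ x in cell, h x) +
        d * ∫ x in cell, k x := by
  rw [SmP.integral_add (((hf.const_mul a).add (hg.const_mul b)).add (hh.const_mul c))
    (hk.const_mul d), SmP.integral_add ((hf.const_mul a).add (hg.const_mul b)) (hh.const_mul c),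
    SmP.integral_add (hf.const_mul a) (hg.const_mul b)]
  simp only [integral_const_mul]

lemma integral_flux_cv {K P φ : E3 → ℝ} {a : Fin 3 → E3 → ℝ} (hK : Ker K)
    (he : ∀ x, K (-x) = K x) (ha : ∀ i, SmP (a i)) (hP : SmP P) (hφ : SmP φ) :
    ∫ x in cell, P x * ∑ j, a j x * cv K (pd j φ) x =
      - ∫ x in cell, φ x * ∑ j, cv (pd j K) (fun y => a j y * P y) x := by
  have h : ∀ j, ∫ x in cell, a j x * P x * cv K (pd j φ) x =
      - ∫ x in cell, φ x * cv (pd j K) (fun y => a j y * P y) x := by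
    intro j
    rw [← integral_cv_mul_smp hK he ((ha j).mul hP) (hφ.pd j)]
    have := integral_pd_mul hφ (((ha j).mul hP).cv hK) j
    rw [pd_cv hK ((ha j).mul hP).1.locInt] at this
    rw [← this]
    simp only [mul_comm]
  have e1 : (fun x => P x * ∑ j, a j x * cv K (pd j φ) x) =
      fun x => ∑ j, a j x * P x * cv K (pd j φ) x := by
    ext x; simp only [Finset.mul_sum]; exact Finset.sum_congr rfl fun j _ => by ring
  rw [e1, integral_finsetSum _ fun j _ => (((ha j).mul hP).mul ((hφ.pd j).cv hK)).integrable]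
  simp only [h, Finset.mul_sum]
  rw [Finset.sum_neg_distrib, ← integral_finsetSum _ fun j _ =>
    (hφ.mul (((ha j).mul hP).cv (hK.pd j))).integrable]

section identity

variable {K φ : E3 → ℝ} {v : Fin 3 → E3 → ℝ}

lemma curlS_mul {φ : E3 → ℝ} {f : Fin 3 → E3 → ℝ} (hφ : SmP φ) (hf : ∀ i, SmP (f i)) (i : Fin 3)
    (x : E3) : curlS (fun i y => φ y * f i y) i x = φ x * curlS f i x + crossG φ f i x := by
  fin_cases i
  all_goals
    simp only [curlS, crossG, Matrix.cons_val_zero, Matrix.cons_val_one,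
      Matrix.cons_val, Fin.zero_eta, Fin.mk_one, Fin.reduceFinMk, pd_mul hφ.1 (hf _).1]
    ring

lemma curlS_cv {f : Fin 3 → E3 → ℝ} (hK : Ker K) (hf : ∀ i, SmP (f i)) (i : Fin 3) (x : E3) :
    curlS (fun i => cv K (f i)) i x = cv K (curlS f i) x := by
  have h : ∀ i j, pd j (cv K (f i)) = cv K (pd j (f i)) := fun i j => by
    rw [pd_cv hK (hf i).1.locInt, cv_pd hK (hf i).1]
  fin_cases i
  all_goals
    simp only [curlS, Matrix.cons_val_zero, Matrix.cons_val_one,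
      Matrix.cons_val, Fin.zero_eta, Fin.mk_one, Fin.reduceFinMk, h]
    rw [cv_sub hK ((hf _).pd _).1.locInt ((hf _).pd _).1.locInt]

lemma zeta_eq (hK : Ker K) (hφ : SmP φ) (hv : ∀ i, SmP (v i)) (i : Fin 3) (x : E3) :
    zeta K φ v i x = φ x * cv K (curlS v i) x + curlS (fun i y => φ y * cv K (v i) y) i x +
      curlS (fun i => cv K (fun y => φ y * v i y)) i x + cv K (fun y => φ y * curlS v i y) x := by
  have h1 : curlS (fun i => cv K (fun y => φ y * v i y)) i x =
      cv K (fun y => φ y * curlS v i y) x + cv K (crossG φ v i) x := by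
    rw [curlS_cv hK fun i => hφ.mul (hv i)]
    have := cv_add hK (hφ.mul (curlS_smp hv i)).1.locInt (crossG_smp hφ hv i).1.locInt
    rw [← congrFun this x]
    congr 1; ext y
    exact curlS_mul hφ hv i y
  rw [zeta, curlS_mul hφ (fun i => (hv i).cv hK), h1, curlS_cv hK hv]
  ring

lemma zeta_smp (hK : Ker K) (hφ : SmP φ) (hv : ∀ i, SmP (v i)) (i : Fin 3) :
    SmP (zeta K φ v i) := by
  have h : zeta K φ v i = fun x => 2 * (φ x * curlS (fun i => cv K (v i)) i x) +
      crossG φ (fun i => cv K (v i)) i x +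
      2 * curlS (fun i => cv K (fun y => φ y * v i y)) i x - cv K (crossG φ v i) x := rfl
  rw [h]
  exact ((((hφ.mul (curlS_smp (fun i => (hv i).cv hK) i)).const_mul 2).add
    (crossG_smp hφ (fun i => (hv i).cv hK) i)).add
    ((curlS_smp (fun i => (hφ.mul (hv i)).cv hK) i).const_mul 2)).sub ((crossG_smp hφ hv i).cv hK)

lemma integral_tensor {z : Fin 3 → E3 → ℝ} (hv : ∀ i, SmP (v i))
    (hdiv : ∀ x, ∑ j, pd j (v j) x = 0) (hz : ∀ i, SmP (z i)) :
    - ∫ x in cell, ∑ i, ∑ j, v i x * v j x * pd j (z i) x =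
      ∫ x in cell, ∑ i, divT v i x * z i x := by
  have h : ∀ i, ∫ x in cell, v i x * adv (z i) v x = - ∫ x in cell, z i x * divT v i x :=
    fun i => integral_transport hv hdiv (hv i) (hz i)
  have e1 : (fun x => ∑ i, ∑ j, v i x * v j x * pd j (z i) x) =
      fun x => ∑ i, v i x * adv (z i) v x := by
    ext x; simp only [adv, Finset.mul_sum, mul_assoc]
  rw [e1, integral_finsetSum _ fun i _ => ((hv i).mul (adv_smp (hz i) hv)).integrable]
  simp only [h, Finset.sum_neg_distrib, neg_neg]
  rw [← integral_finsetSum _ fun i _ => ((hz i).mul (divT_smp hv i)).integrable]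
  simp only [mul_comm]

/-- The integrand of the balance, before the commutators are reorganised. -/
def bal (K : E3 → ℝ) (v : Fin 3 → E3 → ℝ) (x : E3) : ℝ :=
  ∑ i, (divT v i x * cv K (curlS v i) x + curlS (divT v) i x * cv K (v i) x +
    v i x * cv K (curlS (divT v) i) x + curlS v i x * cv K (divT v i) x)

lemma integral_divT_zeta (hK : Ker K) (he : ∀ x, K (-x) = K x) (hφ : SmP φ)
    (hv : ∀ i, SmP (v i)) :
    ∫ x in cell, ∑ i, divT v i x * zeta K φ v i x = ∫ x in cell, φ x * bal K v x := by
  have hS := divT_smp hv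
  have hw := curlS_smp hv
  have hO := curlS_smp hS
  have hvK := fun i => (hv i).cv hK
  have f1 : SmP (fun x => ∑ i, divT v i x * (φ x * cv K (curlS v i) x)) :=
    SmP.sum fun i _ => (hS i).mul (hφ.mul ((hw i).cv hK))
  have f2 : SmP (fun x => ∑ i, divT v i x * curlS (fun i y => φ y * cv K (v i) y) i x) :=
    SmP.sum fun i _ => (hS i).mul (curlS_smp (fun i => hφ.mul (hvK i)) i)
  have f3 : SmP (fun x => ∑ i, divT v i x * curlS (fun i => cv K (fun y => φ y * v i y)) i x) :=
    SmP.sum fun i _ => (hS i).mul (curlS_smp (fun i => (hφ.mul (hv i)).cv hK) i)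
  have f4 : SmP (fun x => ∑ i, divT v i x * cv K (fun y => φ y * curlS v i y) x) :=
    SmP.sum fun i _ => (hS i).mul ((hφ.mul (hw i)).cv hK)
  have g2 : SmP (fun x => ∑ i, curlS (divT v) i x * (φ x * cv K (v i) x)) :=
    SmP.sum fun i _ => (hO i).mul (hφ.mul (hvK i))
  have g3 : SmP (fun x => ∑ i, φ x * v i x * cv K (curlS (divT v) i) x) :=
    SmP.sum fun i _ => (hφ.mul (hv i)).mul ((hO i).cv hK)
  have g4 : SmP (fun x => ∑ i, φ x * curlS v i x * cv K (divT v i) x) :=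
    SmP.sum fun i _ => (hφ.mul (hw i)).mul ((hS i).cv hK)
  have l1 := SmP.integral_four f1 f2 f3 f4 1 1 1 1
  have l2 := SmP.integral_four f1 g2 g3 g4 1 1 1 1
  simp only [one_mul] at l1 l2
  have s2 := integral_curlS hS (fun i => hφ.mul (hvK i))
  have s3 := integral_curlS hS (fun i => (hφ.mul (hv i)).cv hK)
  have s3' : ∫ x in cell, ∑ i, curlS (divT v) i x * cv K (fun y => φ y * v i y) x =
      ∫ x in cell, ∑ i, φ x * v i x * cv K (curlS (divT v) i) x := by
    rw [integral_finsetSum _ fun i _ => ((hO i).mul ((hφ.mul (hv i)).cv hK)).integrable,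
      integral_finsetSum _ fun i _ => ((hφ.mul (hv i)).mul ((hO i).cv hK)).integrable]
    refine Finset.sum_congr rfl fun i _ => ?_
    rw [← integral_cv_mul_smp hK he (hφ.mul (hv i)) (hO i)]
    simp only [mul_comm]
  have s4 : ∫ x in cell, ∑ i, divT v i x * cv K (fun y => φ y * curlS v i y) x =
      ∫ x in cell, ∑ i, φ x * curlS v i x * cv K (divT v i) x := by
    rw [integral_finsetSum _ fun i _ => ((hS i).mul ((hφ.mul (hw i)).cv hK)).integrable,
      integral_finsetSum _ fun i _ => ((hφ.mul (hw i)).mul ((hS i).cv hK)).integrable]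
    refine Finset.sum_congr rfl fun i _ => ?_
    rw [← integral_cv_mul_smp hK he (hφ.mul (hw i)) (hS i)]
    simp only [mul_comm]
  rw [s2, s3, s3', s4, ← l2] at l1
  refine Eq.trans ?_ (l1.trans ?_)
  · congr 1; ext x
    simp only [zeta_eq hK hφ hv, mul_add, Finset.sum_add_distrib]
  · congr 1; ext x
    simp only [bal, Fin.sum_univ_three]
    ring

/-- The part of the flux that is carried by `φ` after integration by parts. -/
def flN (K : E3 → ℝ) (v : Fin 3 → E3 → ℝ) (x : E3) : ℝ :=
  -(∑ j, cv (pd j K) (fun y => v j y * ∑ i, curlS v i y * v i y) x) +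
    (∑ j, v j x * pd j (cv K (fun y => ∑ i, curlS v i y * v i y)) x) -
    (∑ j, v j x * pd j (fun y => ∑ i, cv K (curlS v i) y * v i y) x) -
    (∑ j, v j x * pd j (fun y => ∑ i, curlS v i y * cv K (v i) y) x) +
    1 / 2 * (∑ j, cv (pd j K) (fun y => curlS v j y * sq v y) x) -
    1 / 2 * (∑ j, curlS v j x * pd j (cv K (sq v)) x) +
    ∑ j, curlS v j x * pd j (fun y => ∑ i, v i y * cv K (v i) y) x

lemma integral_flux (hK : Ker K) (he : ∀ x, K (-x) = K x) (hφ : SmP φ) (hv : ∀ i, SmP (v i))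
    (hdiv : ∀ x, ∑ j, pd j (v j) x = 0) :
    ∫ x in cell, ∑ i, curlS v i x * fl K φ v i x = ∫ x in cell, φ x * flN K v x := by
  have hw := curlS_smp hv
  have hwd := curlS_div hv
  have hvK := fun i => (hv i).cv hK
  have hwK := fun i => (hw i).cv hK
  have hP : SmP (fun y => ∑ i, curlS v i y * v i y) := SmP.sum fun i _ => (hw i).mul (hv i)
  have hP3 : SmP (fun y => ∑ i, cv K (curlS v i) y * v i y) :=
    SmP.sum fun i _ => (hwK i).mul (hv i)
  have hP4 : SmP (fun y => ∑ i, curlS v i y * cv K (v i) y) :=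
    SmP.sum fun i _ => (hw i).mul (hvK i)
  have hP7 : SmP (fun y => ∑ i, v i y * cv K (v i) y) := SmP.sum fun i _ => (hv i).mul (hvK i)
  have hsq := sq_smp hv
  have hav := adv_smp hφ hv
  have haw := adv_smp hφ hw
  have t1 := integral_flux_cv hK he hv hP hφ
  have t2 := integral_transport hv hdiv (hP.cv hK) hφ
  have t3 := integral_transport hv hdiv hP3 hφ
  have t4 := integral_transport hv hdiv hP4 hφ
  have t5 := integral_flux_cv hK he hw hsq hφ
  have t6 := integral_transport hw hwd (hsq.cv hK) hφ
  have t7 := integral_transport hw hwd hP7 hφ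
  rw [integral_cv_mul_smp hK he hP hav] at t2
  have t3' : ∫ x in cell, (∑ i, cv K (curlS v i) x * v i x) * adv φ v x =
      ∫ x in cell, ∑ i, curlS v i x * cv K (fun y => v i y * adv φ v y) x := by
    have e : (fun x => (∑ i, cv K (curlS v i) x * v i x) * adv φ v x) =
        fun x => ∑ i, cv K (curlS v i) x * (v i x * adv φ v x) := by
      ext x; simp only [Finset.sum_mul, mul_assoc]
    rw [e, integral_finsetSum _ fun i _ => ((hwK i).mul ((hv i).mul hav)).integrable,
      integral_finsetSum _ fun i _ => ((hw i).mul (((hv i).mul hav).cv hK)).integrable]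
    exact Finset.sum_congr rfl fun i _ => integral_cv_mul_smp hK he (hw i) ((hv i).mul hav)
  rw [t3'] at t3
  have f1 : SmP (fun x => (∑ i, curlS v i x * v i x) * ∑ j, v j x * cv K (pd j φ) x) :=
    hP.mul (SmP.sum fun j _ => (hv j).mul ((hφ.pd j).cv hK))
  have f2 : SmP (fun x => (∑ i, curlS v i x * v i x) * cv K (adv φ v) x) := hP.mul (hav.cv hK)
  have f3 : SmP (fun x => ∑ i, curlS v i x * cv K (fun y => v i y * adv φ v y) x) :=
    SmP.sum fun i _ => (hw i).mul (((hv i).mul hav).cv hK)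
  have f4 := hP4.mul hav
  have f5 : SmP (fun x => sq v x * ∑ j, curlS v j x * cv K (pd j φ) x) :=
    hsq.mul (SmP.sum fun j _ => (hw j).mul ((hφ.pd j).cv hK))
  have f6 := (hsq.cv hK).mul haw
  have f7 := hP7.mul haw
  have g1 : SmP (fun x => φ x * ∑ j, cv (pd j K) (fun y => v j y * ∑ i, curlS v i y * v i y) x) :=
    hφ.mul (SmP.sum fun j _ => ((hv j).mul hP).cv (hK.pd j))
  have g2 : SmP (fun x => φ x * ∑ j, v j x * pd j (cv K (fun y => ∑ i, curlS v i y * v i y)) x) :=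
    hφ.mul (SmP.sum fun j _ => (hv j).mul ((hP.cv hK).pd j))
  have g3 : SmP (fun x => φ x * ∑ j, v j x * pd j (fun y => ∑ i, cv K (curlS v i) y * v i y) x) :=
    hφ.mul (SmP.sum fun j _ => (hv j).mul (hP3.pd j))
  have g4 : SmP (fun x => φ x * ∑ j, v j x * pd j (fun y => ∑ i, curlS v i y * cv K (v i) y) x) :=
    hφ.mul (SmP.sum fun j _ => (hv j).mul (hP4.pd j))
  have g5 : SmP (fun x => φ x * ∑ j, cv (pd j K) (fun y => curlS v j y * sq v y) x) :=
    hφ.mul (SmP.sum fun j _ => ((hw j).mul hsq).cv (hK.pd j))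
  have g6 : SmP (fun x => φ x * ∑ j, curlS v j x * pd j (cv K (sq v)) x) :=
    hφ.mul (SmP.sum fun j _ => (hw j).mul ((hsq.cv hK).pd j))
  have g7 : SmP (fun x => φ x * ∑ j, curlS v j x * pd j (fun y => ∑ i, v i y * cv K (v i) y) x) :=
    hφ.mul (SmP.sum fun j _ => (hw j).mul (hP7.pd j))
  have l1 := SmP.integral_four f1 f2 f3 f4 1 (-1) 1 1
  have l2 := SmP.integral_four f5 f6 f7 f7 (-(1 / 2)) (1 / 2) (-1) 0
  have l3 := SmP.integral_add
    ((((f1.const_mul 1).add (f2.const_mul (-1))).add (f3.const_mul 1)).add (f4.const_mul 1))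
    ((((f5.const_mul (-(1 / 2))).add (f6.const_mul (1 / 2))).add (f7.const_mul (-1))).add
      (f7.const_mul 0))
  have m1 := SmP.integral_four g1 g2 g3 g4 (-1) 1 (-1) (-1)
  have m2 := SmP.integral_four g5 g6 g7 g7 (1 / 2) (-(1 / 2)) 1 0
  have m3 := SmP.integral_add
    ((((g1.const_mul (-1)).add (g2.const_mul 1)).add (g3.const_mul (-1))).add (g4.const_mul (-1)))
    ((((g5.const_mul (1 / 2)).add (g6.const_mul (-(1 / 2)))).add (g7.const_mul 1)).add
      (g7.const_mul 0))
  rw [m1, m2] at m3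
  rw [l1, l2, t1, t2, t3, t4, t5, t6, t7] at l3
  refine Eq.trans ?_ (l3.trans (Eq.trans ?_ (m3.symm.trans ?_)))
  · congr 1; ext x
    simp only [fl, Fin.sum_univ_three, adv]
    ring
  · ring
  · congr 1; ext x
    rw [flN]; ring

/-- The local balance is a pointwise commutator identity. -/
lemma bal_eq (hK : Ker K) (hv : ∀ i, SmP (v i)) (hdiv : ∀ x, ∑ j, pd j (v j) x = 0) (x : E3) :
    bal K v x + (∑ i, ∑ j, cubicE K j (v j) (curlS v i) (v i) x) -
      1 / 2 * (∑ i, ∑ j, cubicE K j (curlS v j) (v i) (v i) x) + flN K v x = 0 := by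
  have hw := curlS_smp hv
  have hwd := curlS_div hv
  have hvK := fun i => (hv i).cv hK
  have hwK := fun i => (hw i).cv hK
  have hP : SmP (fun y => ∑ i, curlS v i y * v i y) := SmP.sum fun i _ => (hw i).mul (hv i)
  have hsq := sq_smp hv
  have zv : ∑ j, cv (pd j K) (v j) x = 0 := by
    have h : ∀ j, cv (pd j K) (v j) x = cv K (pd j (v j)) x := fun j => by rw [cv_pd hK (hv j).1]
    simp only [h]
    rw [← congrFun (cv_sum hK fun j _ => ((hv j).pd j).1.locInt) x]
    simp [hdiv, cv]
  have zw : ∑ j, cv (pd j K) (curlS v j) x = 0 := by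
    have h : ∀ j, cv (pd j K) (curlS v j) x = cv K (pd j (curlS v j)) x :=
      fun j => by rw [cv_pd hK (hw j).1]
    simp only [h]
    rw [← congrFun (cv_sum hK fun j _ => ((hw j).pd j).1.locInt) x]
    simp [hwd, cv]
  have n1 : ∀ j, cv (pd j K) (fun y => v j y * ∑ i, curlS v i y * v i y) x =
      ∑ i, cv (pd j K) (fun y => v j y * curlS v i y * v i y) x := fun j => by
    rw [← congrFun (cv_sum (hK.pd j) fun i _ => (((hv j).mul (hw i)).mul (hv i)).1.locInt) x]
    congr 1; ext y; rw [Finset.mul_sum]; exact Finset.sum_congr rfl fun i _ => by ring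
  have n2 : ∀ j, pd j (cv K (fun y => ∑ i, curlS v i y * v i y)) x =
      ∑ i, cv (pd j K) (fun y => curlS v i y * v i y) x := fun j => by
    rw [pd_cv hK hP.1.locInt,
      ← congrFun (cv_sum (hK.pd j) fun i _ => ((hw i).mul (hv i)).1.locInt) x]
  have n3 : ∀ j, pd j (fun y => ∑ i, cv K (curlS v i) y * v i y) x =
      ∑ i, (cv K (curlS v i) x * pd j (v i) x + v i x * cv (pd j K) (curlS v i) x) := fun j => by
    rw [pd_sum _ fun i _ => ((hwK i).mul (hv i)).1]
    refine Finset.sum_congr rfl fun i _ => ?_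
    rw [pd_mul (hwK i).1 (hv i).1, pd_cv hK (hw i).1.locInt]
  have n4 : ∀ j, pd j (fun y => ∑ i, curlS v i y * cv K (v i) y) x =
      ∑ i, (curlS v i x * cv (pd j K) (v i) x + cv K (v i) x * pd j (curlS v i) x) := fun j => by
    rw [pd_sum _ fun i _ => ((hw i).mul (hvK i)).1]
    refine Finset.sum_congr rfl fun i _ => ?_
    rw [pd_mul (hw i).1 (hvK i).1, pd_cv hK (hv i).1.locInt]
  have n5 : ∀ j, cv (pd j K) (fun y => curlS v j y * sq v y) x =
      ∑ i, cv (pd j K) (fun y => curlS v j y * v i y * v i y) x := fun j => by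
    rw [← congrFun (cv_sum (hK.pd j) fun i _ => (((hw j).mul (hv i)).mul (hv i)).1.locInt) x]
    congr 1; ext y; rw [sq, Finset.mul_sum]; exact Finset.sum_congr rfl fun i _ => by ring
  have n6 : ∀ j, pd j (cv K (sq v)) x = ∑ i, cv (pd j K) (fun y => v i y * v i y) x := fun j => by
    rw [pd_cv hK hsq.1.locInt,
      ← congrFun (cv_sum (hK.pd j) fun i _ => ((hv i).mul (hv i)).1.locInt) x]
    rfl
  have n7 : ∀ j, pd j (fun y => ∑ i, v i y * cv K (v i) y) x =
      ∑ i, (v i x * cv (pd j K) (v i) x + cv K (v i) x * pd j (v i) x) := fun j => by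
    rw [pd_sum _ fun i _ => ((hv i).mul (hvK i)).1]
    refine Finset.sum_congr rfl fun i _ => ?_
    rw [pd_mul (hv i).1 (hvK i).1, pd_cv hK (hv i).1.locInt]
  have b1 : ∀ i, cv K (divT v i) x = ∑ j, cv (pd j K) (fun y => v j y * v i y) x := fun i => by
    have h : divT v i = fun x => ∑ j, pd j (fun y => v j y * v i y) x := by
      ext y
      have := hdiv y
      simp only [divT, Fin.sum_univ_three, pd_mul (hv _).1 (hv i).1] at this ⊢
      linear_combination (-(v i y)) * this
    rw [h, cv_sum hK fun j _ => (((hv j).mul (hv i)).pd j).1.locInt]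
    exact Finset.sum_congr rfl fun j _ => by rw [cv_pd hK ((hv j).mul (hv i)).1]
  have b2 : ∀ i, cv K (curlS (divT v) i) x = ∑ j, (cv (pd j K) (fun y => v j y * curlS v i y) x -
      cv (pd j K) (fun y => curlS v j y * v i y) x) := fun i => by
    have h : curlS (divT v) i = fun x => ∑ j, (pd j (fun y => v j y * curlS v i y) x -
        pd j (fun y => curlS v j y * v i y) x) := by
      ext y
      have h1 := hdiv y
      have h2 := hwd y
      rw [curlS_divT hv hdiv]
      simp only [Fin.sum_univ_three, pd_mul (hv _).1 (hw i).1, pd_mul (hw _).1 (hv i).1] at h1 h2 ⊢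
      linear_combination (-(curlS v i y)) * h1 + v i y * h2
    rw [h, cv_sum hK fun j _ => ((((hv j).mul (hw i)).pd j).sub (((hw j).mul (hv i)).pd j)).1.locInt]
    refine Finset.sum_congr rfl fun j _ => ?_
    rw [cv_sub hK (((hv j).mul (hw i)).pd j).1.locInt (((hw j).mul (hv i)).pd j).1.locInt,
      cv_pd hK ((hv j).mul (hw i)).1, cv_pd hK ((hw j).mul (hv i)).1]
  simp only [bal, flN, n1, n2, n3, n4, n5, n6, n7, b1, b2, curlS_divT hv hdiv, cubicE]
  have total : ∑ i, ∑ j, (curlS v i x * v i x * cv (pd j K) (v j) x -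
      1 / 2 * (v i x * v i x * cv (pd j K) (curlS v j) x)) = 0 := by
    refine Finset.sum_eq_zero fun i _ => ?_
    rw [Finset.sum_sub_distrib, ← Finset.mul_sum, zv, ← Finset.mul_sum, ← Finset.mul_sum, zw]
    simp
  rw [← total]
  simp only [divT, Fin.sum_univ_three]
  ring

end identity

/-! ### The local balance for rough solenoidal fields -/

lemma ae_of_ae_cm {P : E3 → Prop} (hP : IsPeriodic P) (h : ∀ᵐ x ∂cm, P x) : ∀ᵐ x, P x := by
  rw [ae_iff]
  refine isAddFundamentalDomain_cell.measure_zero_of_invariant _ (fun g => ?_) ?_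
  · ext x
    rw [Set.mem_vadd_set_iff_neg_vadd_mem, mem_ofPred_eq, mem_ofPred_eq, hP.lattice_vadd]
  · rw [ae_iff, Measure.restrict_apply₀' measurableSet_cell.nullMeasurableSet] at h
    exact h

lemma SmP.eq_zero_of_integral {f : E3 → ℝ} (hf : SmP f) (h : ∫ x in cell, f x * f x = 0) (x : E3) :
    f x = 0 := by
  have h1 : ∀ᵐ x ∂cm, f x * f x = 0 :=
    (integral_eq_zero_iff_of_nonneg (fun x => mul_self_nonneg (f x)) (hf.mul hf).integrable).1 h
  have h2 : f =ᵐ[volume] fun _ => 0 := by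
    refine ae_of_ae_cm (fun x i => by rw [hf.per]) ?_
    filter_upwards [h1] with x hx using mul_self_eq_zero.1 hx
  exact congrFun (hf.continuous.ae_eq_iff_eq volume continuous_const |>.1 h2) x

/-- Weakly solenoidal fields. -/
def WDiv (v : Fin 3 → E3 → ℝ) : Prop := ∀ χ, SmP χ → ∫ x in cell, ∑ i, v i x * pd i χ x = 0

lemma WDiv.cv {v : Fin 3 → E3 → ℝ} (h : WDiv v) (hp : ∀ i, IsPeriodic (v i))
    (hi : ∀ i, Integrable (v i) cm) {K : E3 → ℝ} (hK : Ker K) (he : ∀ x, K (-x) = K x) (x : E3) :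
    ∑ j, pd j (cv K (v j)) x = 0 := by
  have hl := fun i => (hp i).locallyIntegrable (hi i)
  have hs := fun i => cv_smp hK (hl i) (hp i)
  set g : E3 → ℝ := fun x => ∑ j, pd j (Helicity.cv K (v j)) x with hg
  have hgs : SmP g := SmP.sum fun j _ => (hs j).pd j
  refine hgs.eq_zero_of_integral ?_ x
  have h1 : ∀ j, ∫ x in cell, pd j (Helicity.cv K (v j)) x * g x =
      - ∫ x in cell, v j x * pd j (Helicity.cv K g) x := fun j => by
    rw [integral_pd_mul (hs j) hgs, pd_cv hK hgs.1.locInt, cv_pd hK hgs.1,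
      integral_cv_mul hK he (hp j) (hi j) (hgs.pd j).continuous (hgs.pd j).per]
  have h2 := h _ (hgs.cv hK)
  rw [integral_finsetSum _ fun i _ => Integrable.mul_smp (hi i) ((hgs.cv hK).pd i)] at h2
  have e : (fun x => g x * g x) = fun x => ∑ j, pd j (Helicity.cv K (v j)) x * g x := by
    ext x; rw [← Finset.sum_mul]
  rw [e, integral_finsetSum _ fun i _ => (((hs i).pd i).mul hgs).integrable]
  simp only [h1, Finset.sum_neg_distrib, h2, neg_zero]

/-- The increment of `f` by `-ξ`. -/
def dn (ξ : E3) (f : Fin 3 → E3 → ℝ) (i : Fin 3) (x : E3) : ℝ := f i (x + -ξ) - f i x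

/-- The gradient of the kernel. -/
def gr (K : E3 → ℝ) (ξ : E3) (j : Fin 3) : ℝ := pd j K ξ

section smooth

variable {K φ : E3 → ℝ} {v : Fin 3 → E3 → ℝ}

lemma incr_smp {f : E3 → ℝ} (hf : SmP f) (ξ : E3) : SmP (fun x => f (x + ξ) - f x) :=
  (hf.comp_add ξ).sub hf

lemma trip₁_smp (hφ : SmP φ) (hv : ∀ i, SmP (v i)) (G : Fin 3 → ℝ) (ξ : E3) (i : Fin 3) :
    SmP (trip₁ v φ G ξ i) :=
  (SmP.sum fun j _ => (incr_smp (hv j) ξ).mul (hφ.mul (SmP.const (G j)))).mul (incr_smp (hv i) ξ)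

lemma trip₂_smp (hφ : SmP φ) (hv : ∀ i, SmP (v i)) (G : Fin 3 → ℝ) (ξ : E3) (i : Fin 3) :
    SmP (trip₂ v φ G ξ i) :=
  (SmP.sum fun j _ => (incr_smp (hv j) ξ).mul (incr_smp (hv j) ξ)).mul (hφ.mul (SmP.const (G i)))

lemma dn_smp {f : Fin 3 → E3 → ℝ} (hf : ∀ i, SmP (f i)) (ξ : E3) (i : Fin 3) : SmP (dn ξ f i) :=
  incr_smp (hf i) (-ξ)

lemma Bc_smooth {f : Fin 3 → E3 → ℝ} (hv : ∀ i, SmP (v i)) (hf : ∀ i, SmP (f i)) :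
    Bc v f = ∫ x in cell, ∑ i, curlS v i x * f i x := by
  obtain ⟨B, hB⟩ := exists_common_nik hf zero_le_one le_rfl
  exact Bc_smooth_left (s := 1) (q := ⊤) (by norm_num) le_top hv hB

lemma Bc_dn {f : Fin 3 → E3 → ℝ} (hv : ∀ i, SmP (v i)) (hf : ∀ i, SmP (f i)) (ξ : E3) :
    Bc v (dn ξ f) = ∫ x in cell, ∑ i, (curlS v i (x + ξ) - curlS v i x) * f i x := by
  have hw := curlS_smp hv
  rw [Bc_smooth hv (dn_smp hf ξ)]
  have h1 : SmP (fun x => ∑ i, curlS v i x * f i (x + -ξ)) :=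
    SmP.sum fun i _ => (hw i).mul ((hf i).comp_add _)
  have h1' : SmP (fun x => ∑ i, curlS v i (x + ξ) * f i x) :=
    SmP.sum fun i _ => ((hw i).comp_add _).mul (hf i)
  have h2 : SmP (fun x => ∑ i, curlS v i x * f i x) := SmP.sum fun i _ => (hw i).mul (hf i)
  have e1 : (fun x => ∑ i, curlS v i x * dn ξ f i x) =
      fun x => (∑ i, curlS v i x * f i (x + -ξ)) - ∑ i, curlS v i x * f i x := by
    ext x; simp only [dn, mul_sub, Finset.sum_sub_distrib]
  have e2 : (fun x => ∑ i, (curlS v i (x + ξ) - curlS v i x) * f i x) =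
      fun x => (∑ i, curlS v i (x + ξ) * f i x) - ∑ i, curlS v i x * f i x := by
    ext x; simp only [sub_mul, Finset.sum_sub_distrib]
  rw [e1, e2, integral_sub h1.integrable h2.integrable, integral_sub h1'.integrable h2.integrable]
  congr 1
  rw [← h1.per.integral_add ξ]
  simp only [add_neg_cancel_right]

lemma Bc_trip₁ (hK : Ker K) (he : ∀ x, K (-x) = K x) (hφ : SmP φ) (hv : ∀ i, SmP (v i)) :
    Integrable (fun ξ => Bc v (dn ξ (trip₁ v φ (gr K ξ) ξ))) volume ∧
    ∫ ξ, Bc v (dn ξ (trip₁ v φ (gr K ξ) ξ)) =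
      - ∫ x in cell, φ x * ∑ i, ∑ j, cubicE K j (v j) (curlS v i) (v i) x := by
  have hw := curlS_smp hv
  have e : ∀ ξ, Bc v (dn ξ (trip₁ v φ (gr K ξ) ξ)) = ∑ i, ∑ j, ∫ x in cell, φ x * (pd j K ξ *
      ((v j (x + ξ) - v j x) * (curlS v i (x + ξ) - curlS v i x) * (v i (x + ξ) - v i x))) := by
    intro ξ
    have hs : ∀ i j, SmP (fun x => φ x * (pd j K ξ *
      ((v j (x + ξ) - v j x) * (curlS v i (x + ξ) - curlS v i x) * (v i (x + ξ) - v i x)))) :=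
      fun i j => hφ.mul ((SmP.const _).mul (((incr_smp (hv j) ξ).mul (incr_smp (hw i) ξ)).mul
        (incr_smp (hv i) ξ)))
    rw [Bc_dn hv (trip₁_smp hφ hv _ _)]
    simp only [← fun i => integral_finsetSum Finset.univ (fun j _ => (hs i j).integrable)]
    rw [← integral_finsetSum Finset.univ fun i _ => (SmP.sum fun j _ => hs i j).integrable]
    congr 1; ext x
    refine Finset.sum_congr rfl fun i _ => ?_
    simp only [trip₁, gr, Finset.mul_sum, Finset.sum_mul]
    exact Finset.sum_congr rfl fun j _ => by ring
  have hi : ∀ i j, Integrable (fun ξ => ∫ x in cell, φ x * (pd j K ξ *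
      ((v j (x + ξ) - v j x) * (curlS v i (x + ξ) - curlS v i x) * (v i (x + ξ) - v i x)))) volume :=
    fun i j => (integrable_cubic hK (hv j) (hw i) (hv i) hφ j).integral_prod_left
  simp only [e]
  refine ⟨integrable_finsetSum _ fun i _ => integrable_finsetSum _ fun j _ => hi i j, ?_⟩
  have hE := fun i j => cubicE_smp hK (hv j) (hw i) (hv i) j
  simp only [Finset.mul_sum]
  rw [integral_finsetSum _ fun i _ => integrable_finsetSum _ fun j _ => hi i j,
    integral_finsetSum _ fun i _ => (SmP.sum fun j _ => hφ.mul (hE i j)).integrable,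
    ← Finset.sum_neg_distrib]
  refine Finset.sum_congr rfl fun i _ => ?_
  rw [integral_finsetSum _ fun j _ => hi i j,
    integral_finsetSum _ fun j _ => (hφ.mul (hE i j)).integrable, ← Finset.sum_neg_distrib]
  exact Finset.sum_congr rfl fun j _ => integral_integral_cubic hK he (hv j) (hw i) (hv i) hφ j

lemma Bc_trip₂ (hK : Ker K) (he : ∀ x, K (-x) = K x) (hφ : SmP φ) (hv : ∀ i, SmP (v i)) :
    Integrable (fun ξ => Bc v (dn ξ (trip₂ v φ (gr K ξ) ξ))) volume ∧
    ∫ ξ, Bc v (dn ξ (trip₂ v φ (gr K ξ) ξ)) =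
      - ∫ x in cell, φ x * ∑ i, ∑ j, cubicE K j (curlS v j) (v i) (v i) x := by
  have hw := curlS_smp hv
  have e : ∀ ξ, Bc v (dn ξ (trip₂ v φ (gr K ξ) ξ)) = ∑ i, ∑ j, ∫ x in cell, φ x * (pd j K ξ *
      ((curlS v j (x + ξ) - curlS v j x) * (v i (x + ξ) - v i x) * (v i (x + ξ) - v i x))) := by
    intro ξ
    have hs : ∀ i j, SmP (fun x => φ x * (pd j K ξ *
      ((curlS v j (x + ξ) - curlS v j x) * (v i (x + ξ) - v i x) * (v i (x + ξ) - v i x)))) :=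
      fun i j => hφ.mul ((SmP.const _).mul (((incr_smp (hw j) ξ).mul (incr_smp (hv i) ξ)).mul
        (incr_smp (hv i) ξ)))
    rw [Bc_dn hv (trip₂_smp hφ hv _ _)]
    simp only [← fun i => integral_finsetSum Finset.univ (fun j _ => (hs i j).integrable)]
    rw [← integral_finsetSum Finset.univ fun i _ => (SmP.sum fun j _ => hs i j).integrable]
    congr 1; ext x
    rw [Finset.sum_comm]
    refine Finset.sum_congr rfl fun i _ => ?_
    simp only [trip₂, gr, Finset.mul_sum, Finset.sum_mul]
    exact Finset.sum_congr rfl fun j _ => by ring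
  have hi : ∀ i j, Integrable (fun ξ => ∫ x in cell, φ x * (pd j K ξ *
      ((curlS v j (x + ξ) - curlS v j x) * (v i (x + ξ) - v i x) * (v i (x + ξ) - v i x)))) volume :=
    fun i j => (integrable_cubic hK (hw j) (hv i) (hv i) hφ j).integral_prod_left
  simp only [e]
  refine ⟨integrable_finsetSum _ fun i _ => integrable_finsetSum _ fun j _ => hi i j, ?_⟩
  have hE := fun i j => cubicE_smp hK (hw j) (hv i) (hv i) j
  simp only [Finset.mul_sum]
  rw [integral_finsetSum _ fun i _ => integrable_finsetSum _ fun j _ => hi i j,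
    integral_finsetSum _ fun i _ => (SmP.sum fun j _ => hφ.mul (hE i j)).integrable,
    ← Finset.sum_neg_distrib]
  refine Finset.sum_congr rfl fun i _ => ?_
  rw [integral_finsetSum _ fun j _ => hi i j,
    integral_finsetSum _ fun j _ => (hφ.mul (hE i j)).integrable, ← Finset.sum_neg_distrib]
  exact Finset.sum_congr rfl fun j _ => integral_integral_cubic hK he (hw j) (hv i) (hv i) hφ j

lemma fl_smp (hK : Ker K) (hφ : SmP φ) (hv : ∀ i, SmP (v i)) (i : Fin 3) : SmP (fl K φ v i) := by
  have hav := adv_smp hφ hv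
  have hsq := sq_smp hv
  exact ((((((((hv i).mul (SmP.sum fun j _ => (hv j).mul ((hφ.pd j).cv hK))).sub
    ((hv i).mul (hav.cv hK))).add (((hv i).mul hav).cv hK)).add (hav.mul ((hv i).cv hK))).sub
    ((hsq.mul ((hφ.pd i).cv hK)).const_mul (1 / 2))).add
    (((hφ.pd i).mul (hsq.cv hK)).const_mul (1 / 2))).sub
    ((hφ.pd i).mul (SmP.sum fun j _ => (hv j).mul ((hv j).cv hK))))

lemma bal_smp (hK : Ker K) (hv : ∀ i, SmP (v i)) : SmP (bal K v) := by
  have hS := divT_smp hv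
  have hw := curlS_smp hv
  exact SmP.sum fun i _ => ((((hS i).mul ((hw i).cv hK)).add
    ((curlS_smp hS i).mul ((hv i).cv hK))).add ((hv i).mul ((curlS_smp hS i).cv hK))).add
    ((hw i).mul ((hS i).cv hK))

lemma balance_smooth (hK : Ker K) (he : ∀ x, K (-x) = K x) (hφ : SmP φ) (hv : ∀ i, SmP (v i))
    (hdiv : ∀ x, ∑ j, pd j (v j) x = 0) :
    - ∫ x in cell, ∑ i, ∑ j, v i x * v j x * pd j (zeta K φ v i) x =
      (∫ ξ, Bc v (dn ξ (trip₁ v φ (gr K ξ) ξ))) -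
        1 / 2 * (∫ ξ, Bc v (dn ξ (trip₂ v φ (gr K ξ) ξ))) - Bc v (fl K φ v) := by
  have hw := curlS_smp hv
  rw [integral_tensor hv hdiv (zeta_smp hK hφ hv), integral_divT_zeta hK he hφ hv,
    (Bc_trip₁ hK he hφ hv).2, (Bc_trip₂ hK he hφ hv).2, Bc_smooth hv (fl_smp hK hφ hv),
    integral_flux hK he hφ hv hdiv]
  have hfl : ∀ x, flN K v x = - bal K v x - (∑ i, ∑ j, cubicE K j (v j) (curlS v i) (v i) x) +
      1 / 2 * (∑ i, ∑ j, cubicE K j (curlS v j) (v i) (v i) x) := fun x => by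
    linear_combination bal_eq hK hv hdiv x
  have g1 := hφ.mul (bal_smp hK hv)
  have g2 : SmP (fun x => φ x * ∑ i, ∑ j, cubicE K j (v j) (curlS v i) (v i) x) :=
    hφ.mul (SmP.sum fun i _ => SmP.sum fun j _ => cubicE_smp hK (hv j) (hw i) (hv i) j)
  have g3 : SmP (fun x => φ x * ∑ i, ∑ j, cubicE K j (curlS v j) (v i) (v i) x) :=
    hφ.mul (SmP.sum fun i _ => SmP.sum fun j _ => cubicE_smp hK (hw j) (hv i) (hv i) j)
  have l := SmP.integral_four g1 g2 g3 g3 (-1) (-1) (1 / 2) 0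
  have e : (fun x => φ x * flN K v x) = fun x => -1 * (φ x * bal K v x) +
      -1 * (φ x * ∑ i, ∑ j, cubicE K j (v j) (curlS v i) (v i) x) +
      1 / 2 * (φ x * ∑ i, ∑ j, cubicE K j (curlS v j) (v i) (v i) x) +
      0 * (φ x * ∑ i, ∑ j, cubicE K j (curlS v j) (v i) (v i) x) := by
    ext x; rw [hfl]; ring
  rw [e, l]; ring

end smooth

section bounds

variable {s A B : ℝ} {K φ : E3 → ℝ} {v : Fin 3 → E3 → ℝ}

lemma Nik.mul_const {q : ℝ≥0∞} {f : E3 → ℝ} (hf : Nik s q A f) (c : ℝ) :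
    Nik s q (|c| * A) (fun x => f x * c) := by
  simpa only [mul_comm c] using hf.const_mul c

lemma Nik.sum {κ : Type*} {q : ℝ≥0∞} {S : Finset κ} {a : κ → ℝ} {f : κ → E3 → ℝ} (hq : 1 ≤ q)
    (hf : ∀ k ∈ S, Nik s q (a k) (f k)) : Nik s q (∑ k ∈ S, a k) (fun x => ∑ k ∈ S, f k x) := by
  classical
  induction S using Finset.induction_on with
  | empty => simpa using Nik.zero
  | insert k S hk ih =>
    simp only [Finset.sum_insert hk]
    exact (hf k (Finset.mem_insert_self k S)).add
      (ih fun k hk => hf k (Finset.mem_insert_of_mem hk)) hq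

lemma Nik.trip₁ (hv : ∀ i, Nik s 3 A (v i)) (hφ : Nik s ⊤ B φ) (G : Fin 3 → ℝ) (ξ : E3) (i : Fin 3) :
    Nik s (3 / 2) (16 * B * A ^ 2 * ∑ j, |G j|) (Helicity.trip₁ v φ G ξ i) := by
  have h := (Nik.sum one_le_three fun j (_ : j ∈ Finset.univ) =>
    ((hv j).incr one_le_three ξ).mul (r := 3) (hφ.mul_const (G j)) one_le_three).mul (r := 3 / 2)
    ((hv i).incr one_le_three ξ) one_le_three_half
  refine h.mono (le_of_eq ?_)
  rw [Finset.sum_mul, Finset.mul_sum, Finset.mul_sum]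
  exact Finset.sum_congr rfl fun j _ => by ring

lemma Nik.trip₂ (hv : ∀ i, Nik s 3 A (v i)) (hφ : Nik s ⊤ B φ) (G : Fin 3 → ℝ) (ξ : E3) (i : Fin 3) :
    Nik s (3 / 2) (48 * B * A ^ 2 * ∑ j, |G j|) (Helicity.trip₂ v φ G ξ i) := by
  have h := (Nik.sum one_le_three_half fun j (_ : j ∈ Finset.univ) =>
    ((hv j).incr one_le_three ξ).mul (r := 3 / 2) ((hv j).incr one_le_three ξ)
      one_le_three_half).mul (r := 3 / 2) (hφ.mul_const (G i)) one_le_three_half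
  refine h.mono ?_
  have hB := hφ.nonneg
  have h1 : |G i| ≤ ∑ j, |G j| :=
    Finset.single_le_sum (f := fun j => |G j|) (fun i _ => abs_nonneg _) (Finset.mem_univ i)
  calc _ = 48 * B * A ^ 2 * |G i| := by
        simp only [Finset.sum_const, Finset.card_univ, Fintype.card_fin]; simp; ring
    _ ≤ _ := by gcongr

lemma Nik.dn {q : ℝ≥0∞} {a : ℝ} (hq : 1 ≤ q) {f : Fin 3 → E3 → ℝ} (hf : ∀ i, Nik s q a (f i)) (ξ : E3) (i : Fin 3) :
    Nik s q (2 * a) (Helicity.dn ξ f i) := (hf i).incr hq (-ξ)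

end bounds

section limits

variable {ι : Type*} {l : Filter ι} {s : ℝ} {K φ : E3 → ℝ} {V : Fin 3 → ι → E3 → ℝ}
  {v : Fin 3 → E3 → ℝ}

lemma NT.incr {q : ℝ≥0∞} {F : ι → E3 → ℝ} {f : E3 → ℝ} (hF : NT s q l F f) (hq : 1 ≤ q) (ξ : E3) :
    NT s q l (fun n x => F n (x + ξ) - F n x) (fun x => f (x + ξ) - f x) := (hF.shift ξ).sub hF hq

lemma NT.trip₁ {B : ℝ} (hV : ∀ i, NT s 3 l (V i) (v i)) (hφ : Nik s ⊤ B φ) (G : Fin 3 → ℝ) (ξ : E3)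
    (i : Fin 3) : NT s (3 / 2) l (fun n => Helicity.trip₁ (fun i => V i n) φ G ξ i)
      (Helicity.trip₁ v φ G ξ i) :=
  NT.mul (r := 3 / 2) (NT.sum Finset.univ (fun j _ => NT.mul (r := 3) ((hV j).incr one_le_three ξ)
    (NT.const (hφ.mul_const (G j))) le_top one_le_three) one_le_three)
    ((hV i).incr one_le_three ξ) one_le_three one_le_three_half

lemma NT.trip₂ {B : ℝ} (hV : ∀ i, NT s 3 l (V i) (v i)) (hφ : Nik s ⊤ B φ) (G : Fin 3 → ℝ) (ξ : E3)
    (i : Fin 3) : NT s (3 / 2) l (fun n => Helicity.trip₂ (fun i => V i n) φ G ξ i)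
      (Helicity.trip₂ v φ G ξ i) :=
  NT.mul (r := 3 / 2) (NT.sum Finset.univ (fun j _ => NT.mul (r := 3 / 2) ((hV j).incr one_le_three ξ)
    ((hV j).incr one_le_three ξ) one_le_three one_le_three_half) one_le_three_half)
    (NT.const (hφ.mul_const (G i))) le_top one_le_three_half

lemma NT.adv {B : ℝ} (hV : ∀ i, NT s 3 l (V i) (v i)) (hφ : ∀ j, Nik s ⊤ B (pd j φ)) :
    NT s 3 l (fun n => Helicity.adv φ (fun i => V i n)) (Helicity.adv φ v) :=
  NT.sum Finset.univ (fun j _ => NT.mul (r := 3) (hV j) (NT.const (hφ j)) le_top one_le_three)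
    one_le_three

lemma NT.sq (hV : ∀ i, NT s 3 l (V i) (v i)) :
    NT s (3 / 2) l (fun n => Helicity.sq (fun i => V i n)) (Helicity.sq v) :=
  NT.sum Finset.univ (fun j _ => NT.mul (r := 3 / 2) (hV j) (hV j) one_le_three one_le_three_half)
    one_le_three_half

lemma NT.fl {B : ℝ} (hV : ∀ i, NT s 3 l (V i) (v i)) (hφ : ∀ j, Nik s ⊤ B (pd j φ)) (hK : Ker K)
    (i : Fin 3) : NT s (3 / 2) l (fun n => Helicity.fl K φ (fun i => V i n) i)
      (Helicity.fl K φ v i) := by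
  have h3 := one_le_three
  have h32 := one_le_three_half
  have hav := NT.adv hV hφ
  have hsq := NT.sq hV
  have hc : ∀ j, NT s ⊤ l (fun _ => pd j φ) (pd j φ) := fun j => NT.const (hφ j)
  have hu1 := NT.mul (r := 3 / 2) (hV i) (NT.sum Finset.univ (fun j _ =>
    NT.mul (r := 3) (hV j) ((hc j).cv le_top hK) le_top h3) h3) h3 h32
  have hu2 := NT.mul (r := 3 / 2) (hV i) (hav.cv h3 hK) h3 h32
  have hu3 := (NT.mul (r := 3 / 2) (hV i) hav h3 h32).cv h32 hK
  have hu4 := NT.mul (r := 3 / 2) hav ((hV i).cv h3 hK) h3 h32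
  have hu5 := (NT.mul (r := 3 / 2) hsq ((hc i).cv le_top hK) le_top h32).const_mul (1 / 2)
  have hu6 := (NT.mul (r := 3 / 2) (hc i) (hsq.cv h32 hK) h32 h32).const_mul (1 / 2)
  have hu7 := NT.mul (r := 3 / 2) (hc i) (NT.sum Finset.univ (fun j _ =>
    NT.mul (r := 3 / 2) (hV j) ((hV j).cv h3 hK) h3 h32) h32) h32 h32
  exact (((((hu1.sub hu2 h32).add hu3 h32).add hu4 h32).sub hu5 h32).add hu6 h32).sub hu7 h32

/-- Convergence of smooth functions together with their first derivatives. -/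
structure CT (s : ℝ) (q : ℝ≥0∞) (l : Filter ι) (F : ι → E3 → ℝ) (f : E3 → ℝ) : Prop where
  smooth : ∀ n, SmP (F n)
  smooth_lim : SmP f
  conv : NT s q l F f
  conv_pd : ∀ j, NT s q l (fun n => pd j (F n)) (pd j f)

namespace CT

variable {q : ℝ≥0∞} {F G : ι → E3 → ℝ} {f g : E3 → ℝ}

lemma add (hF : CT s q l F f) (hG : CT s q l G g) (hq : 1 ≤ q) :
    CT s q l (fun n x => F n x + G n x) (fun x => f x + g x) where
  smooth n := (hF.smooth n).add (hG.smooth n)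
  smooth_lim := hF.smooth_lim.add hG.smooth_lim
  conv := hF.conv.add hG.conv hq
  conv_pd j := by
    simp only [pd_add (hF.smooth _).1 (hG.smooth _).1, pd_add hF.smooth_lim.1 hG.smooth_lim.1]
    exact (hF.conv_pd j).add (hG.conv_pd j) hq

lemma sub (hF : CT s q l F f) (hG : CT s q l G g) (hq : 1 ≤ q) :
    CT s q l (fun n x => F n x - G n x) (fun x => f x - g x) where
  smooth n := (hF.smooth n).sub (hG.smooth n)
  smooth_lim := hF.smooth_lim.sub hG.smooth_lim
  conv := hF.conv.sub hG.conv hq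
  conv_pd j := by
    simp only [pd_sub (hF.smooth _).1 (hG.smooth _).1, pd_sub hF.smooth_lim.1 hG.smooth_lim.1]
    exact (hF.conv_pd j).sub (hG.conv_pd j) hq

lemma const_mul (hF : CT s q l F f) (c : ℝ) :
    CT s q l (fun n x => c * F n x) (fun x => c * f x) where
  smooth n := (hF.smooth n).const_mul c
  smooth_lim := hF.smooth_lim.const_mul c
  conv := hF.conv.const_mul c
  conv_pd j := by
    simp only [pd_const_mul (hF.smooth _).1, pd_const_mul hF.smooth_lim.1]
    exact (hF.conv_pd j).const_mul c

lemma smp_mul (hF : CT s q l F f) (hq : 1 ≤ q) (h0 : 0 ≤ s) (h1 : s ≤ 1) (hg : SmP g) :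
    CT s q l (fun n x => g x * F n x) (fun x => g x * f x) := by
  obtain ⟨A, hA⟩ := hg.nik h0 h1
  refine ⟨fun n => hg.mul (hF.smooth n), hg.mul hF.smooth_lim, ?_, fun j => ?_⟩
  · exact NT.mul (p := ⊤) (NT.const hA) hF.conv hq hq
  · obtain ⟨B, hB⟩ := (hg.pd j).nik h0 h1
    simp only [pd_mul hg.1 (hF.smooth _).1, pd_mul hg.1 hF.smooth_lim.1]
    exact (NT.mul (p := ⊤) (NT.const hA) (hF.conv_pd j) hq hq).add
      (NT.mul (q := ⊤) hF.conv (NT.const hB) le_top hq) hq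

end CT

lemma NT.ct_cv {q : ℝ≥0∞} {F : ι → E3 → ℝ} {f : E3 → ℝ} (hF : NT s q l F f) (hq : 1 ≤ q) (hK : Ker K)
    (hs : ∀ n, SmP (F n)) : CT s q l (fun n => Helicity.cv K (F n)) (Helicity.cv K f) where
  smooth n := (hs n).cv hK
  smooth_lim := by
    obtain ⟨⟨A, hA⟩, -⟩ := hF
    exact cv_smp hK (hA.locInt hq) hA.per
  conv := hF.cv hq hK
  conv_pd j := by
    have h := hF.cv hq (hK.pd j)
    obtain ⟨⟨A, hA⟩, -⟩ := hF
    simp only [pd_cv hK (hs _).1.locInt, pd_cv hK (hA.locInt hq)]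
    exact h

lemma NT.ct_pd_cv {q : ℝ≥0∞} {F : ι → E3 → ℝ} {f : E3 → ℝ} (hF : NT s q l F f) (hq : 1 ≤ q)
    (hK : Ker K) (hs : ∀ n, SmP (F n)) (j : Fin 3) :
    CT s q l (fun n => pd j (Helicity.cv K (F n))) (pd j (Helicity.cv K f)) := by
  have h := hF.ct_cv hq (hK.pd j) hs
  obtain ⟨⟨A, hA⟩, -⟩ := hF
  simp only [pd_cv hK (hs _).1.locInt, pd_cv hK (hA.locInt hq)]
  exact h

lemma CT.zeta (hV : ∀ i, NT s 3 l (V i) (v i)) (h0 : 0 ≤ s) (h1 : s ≤ 1)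
    (hs : ∀ i n, SmP (V i n)) (hφ : SmP φ) (hK : Ker K) (i : Fin 3) :
    CT s 3 l (fun n => Helicity.zeta K φ (fun i => V i n) i) (Helicity.zeta K φ v i) := by
  have h3 := one_le_three
  have c1 : ∀ j i, CT s 3 l (fun n => pd j (cv K (V i n))) (pd j (cv K (v i))) :=
    fun j i => (hV i).ct_pd_cv h3 hK (hs i) j
  have m : ∀ {f : E3 → ℝ}, SmP f → ∀ i, NT s 3 l (fun n x => f x * V i n x) (fun x => f x * v i x) :=
    fun hf i => by
      obtain ⟨A, hA⟩ := hf.nik h0 h1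
      exact NT.mul (p := ⊤) (NT.const hA) (hV i) h3 h3
  have c2 : ∀ j i, CT s 3 l (fun n => pd j (cv K (fun y => φ y * V i n y)))
      (pd j (cv K (fun y => φ y * v i y))) :=
    fun j i => (m hφ i).ct_pd_cv h3 hK (fun n => hφ.mul (hs i n)) j
  have c3 : ∀ j i, CT s 3 l (fun n x => pd j φ x * cv K (V i n) x) (fun x => pd j φ x * cv K (v i) x) :=
    fun j i => ((hV i).ct_cv h3 hK (hs i)).smp_mul h3 h0 h1 (hφ.pd j)
  have c4 : ∀ j k a b, CT s 3 l (fun n => cv K (fun x => pd j φ x * V a n x - pd k φ x * V b n x))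
      (cv K (fun x => pd j φ x * v a x - pd k φ x * v b x)) := fun j k a b =>
    ((m (hφ.pd j) a).sub (m (hφ.pd k) b) h3).ct_cv h3 hK
      fun n => ((hφ.pd j).mul (hs a n)).sub ((hφ.pd k).mul (hs b n))
  have key : ∀ j k a b, CT s 3 l (fun n x => 2 * (φ x * (pd j (cv K (V a n)) x - pd k (cv K (V b n)) x)) +
      (pd j φ x * cv K (V a n) x - pd k φ x * cv K (V b n) x) +
      2 * (pd j (cv K (fun y => φ y * V a n y)) x - pd k (cv K (fun y => φ y * V b n y)) x) -
      cv K (fun x => pd j φ x * V a n x - pd k φ x * V b n x) x)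
      (fun x => 2 * (φ x * (pd j (cv K (v a)) x - pd k (cv K (v b)) x)) +
      (pd j φ x * cv K (v a) x - pd k φ x * cv K (v b) x) +
      2 * (pd j (cv K (fun y => φ y * v a y)) x - pd k (cv K (fun y => φ y * v b y)) x) -
      cv K (fun x => pd j φ x * v a x - pd k φ x * v b x) x) := fun j k a b =>
    ((((((c1 j a).sub (c1 k b) h3).smp_mul h3 h0 h1 hφ).const_mul 2).add
      ((c3 j a).sub (c3 k b) h3) h3).add (((c2 j a).sub (c2 k b) h3).const_mul 2) h3).sub
      (c4 j k a b) h3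
  fin_cases i
  · exact key 1 2 2 1
  · exact key 2 0 0 2
  · exact key 0 1 1 0

end limits

lemma NT.tendsto_integral {ι : Type*} {l : Filter ι} {s : ℝ} {F : ι → E3 → ℝ} {f : E3 → ℝ}
    (hF : NT s 1 l F f) : Tendsto (fun n => ∫ x in cell, F n x) l (𝓝 (∫ x in cell, f x)) := by
  obtain ⟨B, hB, hFB⟩ := hF.nik le_rfl
  obtain ⟨-, a, ha, hFa⟩ := hF
  refine tendsto_integral_of_L1' f (hB.integrable le_rfl).1
    (hFB.mono fun n hn => hn.integrable le_rfl) ?_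
  have h0 : Tendsto (fun n => ENNReal.ofReal (a n)) l (𝓝 0) := by
    simpa using ENNReal.tendsto_ofReal ha
  exact tendsto_of_tendsto_of_tendsto_of_le_of_le' tendsto_const_nhds h0
    (Eventually.of_forall fun _ => zero_le) (hFa.mono fun n hn => hn.bd)

lemma Nik.sm_tendsto {s s' A : ℝ} {q : ℝ≥0∞} {f : E3 → ℝ} (hf : Nik s q A f) (hq : 1 ≤ q)
    (h0 : 0 ≤ s') (h : s' < s) : NT s' q atTop (fun n => sm n f) f := by
  refine (hf.mollify hq h0 h χ₀_moll.ker χ₀_moll.integral_eq).comp ?_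
  exact tendsto_nhdsWithin_iff.2 ⟨tendsto_pow_atTop_nhds_zero_of_lt_one (by norm_num) (by norm_num),
    Eventually.of_forall fun n => by simp⟩

section rough

variable {s A B : ℝ} {K φ : E3 → ℝ} {v : Fin 3 → E3 → ℝ}

lemma trip_bounds (hs : 1 / 2 < s) : ∃ C, 0 ≤ C ∧ ∀ {A B : ℝ} {φ : E3 → ℝ} {v : Fin 3 → E3 → ℝ},
    (∀ i, Nik s 3 A (v i)) → Nik s ⊤ B φ → ∀ (G : Fin 3 → ℝ) ξ,
      |Bc v (dn ξ (trip₁ v φ G ξ))| ≤ C * B * A ^ 3 * ∑ j, |G j| ∧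
      |Bc v (dn ξ (trip₂ v φ G ξ))| ≤ C * B * A ^ 3 * ∑ j, |G j| := by
  obtain ⟨C, hC0, hC⟩ := Bc_bound hs
  refine ⟨96 * C, by positivity, fun {A B φ v} hv hφ G ξ => ?_⟩
  have hA := (hv 0).nonneg
  have hB := hφ.nonneg
  have hG : 0 ≤ ∑ j, |G j| := Finset.sum_nonneg fun _ _ => abs_nonneg _
  have h1 := hC (p := 3) (q := 3 / 2) one_le_three one_le_three_half hv
    (Nik.dn one_le_three_half (Nik.trip₁ hv hφ G ξ) ξ)
  have h2 := hC (p := 3) (q := 3 / 2) one_le_three one_le_three_half hv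
    (Nik.dn one_le_three_half (Nik.trip₂ hv hφ G ξ) ξ)
  have : 0 ≤ C * B * A ^ 3 * ∑ j, |G j| := by positivity
  constructor <;> nlinarith

/-- The local balance of a rough solenoidal field. -/
lemma balance_rough (hs : 1 / 2 < s) (hs1 : s ≤ 1) (hv : ∀ i, Nik s 3 A (v i)) (hdiv : WDiv v)
    (hK : Ker K) (he : ∀ x, K (-x) = K x) (hφ : SmP φ) :
    - ∫ x in cell, ∑ i, ∑ j, v i x * v j x * pd j (zeta K φ v i) x =
      (∫ ξ, Bc v (dn ξ (trip₁ v φ (gr K ξ) ξ))) -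
        1 / 2 * (∫ ξ, Bc v (dn ξ (trip₂ v φ (gr K ξ) ξ))) - Bc v (fl K φ v) := by
  have h3 := one_le_three
  have h32 := one_le_three_half
  obtain ⟨r, hr, hrs⟩ := exists_between hs
  have hr0 : 0 ≤ r := by linarith
  have hr1 : r ≤ 1 := by linarith
  have hV : ∀ i, NT r 3 atTop (fun n => sm n (v i)) (v i) := fun i => (hv i).sm_tendsto h3 hr0 hrs
  have hVs : ∀ i n, SmP (sm n (v i)) := fun i n => sm_smp (hv i) h3 n
  have hVd : ∀ n x, ∑ j, pd j (sm n (v j)) x = 0 := fun n => hdiv.cv (fun i => (hv i).per)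
    (fun i => (hv i).integrable h3) (χk_ker n) (χk_even n)
  obtain ⟨B, hB⟩ := hφ.nik hr0 hr1
  obtain ⟨B', hB'⟩ := exists_common_nik hφ.pd hr0 hr1
  have hz := fun i => CT.zeta hV hr0 hr1 hVs hφ hK i
  choose a ha' ha using fun i => (hV i).nik h3
  obtain ⟨α, -, hα⟩ := exists_common_le a
  have hab : ∀ᶠ n in atTop, ∀ i, Nik r 3 α (sm n (v i)) := by
    filter_upwards [eventually_all.2 ha] with n hn i
    exact (hn i).mono (hα i)
  have hG : Integrable (fun ξ => ∑ j, |gr K ξ j|) volume :=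
    integrable_finsetSum _ fun j _ => (hK.pd j).integrable.abs
  obtain ⟨C, hC0, hC⟩ := trip_bounds hr
  have t0 : Tendsto (fun n => - ∫ x in cell, ∑ i, ∑ j, sm n (v i) x * sm n (v j) x *
      pd j (zeta K φ (fun i => sm n (v i)) i) x) atTop
      (𝓝 (- ∫ x in cell, ∑ i, ∑ j, v i x * v j x * pd j (zeta K φ v i) x)) := by
    refine Tendsto.neg (NT.tendsto_integral (s := r) (NT.sum Finset.univ (fun i _ =>
      NT.sum Finset.univ (fun j _ => NT.mul (p := 3 / 2) (q := 3)
        (NT.mul (p := 3) (q := 3) (hV i) (hV j) h3 h32) ((hz i).conv_pd j) h3 le_rfl) le_rfl) le_rfl))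
  have t1 : Tendsto (fun n => ∫ ξ, Bc (fun i => sm n (v i))
      (dn ξ (trip₁ (fun i => sm n (v i)) φ (gr K ξ) ξ))) atTop
      (𝓝 (∫ ξ, Bc v (dn ξ (trip₁ v φ (gr K ξ) ξ)))) := by
    refine tendsto_integral_filter_of_dominated_convergence
      (fun ξ => C * B * α ^ 3 * ∑ j, |gr K ξ j|) ?_ ?_ (hG.const_mul _) ?_
    · exact Eventually.of_forall fun n =>
        (Bc_trip₁ hK he hφ (fun i => hVs i n)).1.aestronglyMeasurable
    · filter_upwards [hab] with n hn
      exact ae_of_all _ fun ξ => (hC hn hB (gr K ξ) ξ).1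
    · refine ae_of_all _ fun ξ => Bc_tendsto hr h3 h32 hV fun i => ?_
      exact (NT.trip₁ hV hB (gr K ξ) ξ i).incr h32 (-ξ)
  have t2 : Tendsto (fun n => ∫ ξ, Bc (fun i => sm n (v i))
      (dn ξ (trip₂ (fun i => sm n (v i)) φ (gr K ξ) ξ))) atTop
      (𝓝 (∫ ξ, Bc v (dn ξ (trip₂ v φ (gr K ξ) ξ)))) := by
    refine tendsto_integral_filter_of_dominated_convergence
      (fun ξ => C * B * α ^ 3 * ∑ j, |gr K ξ j|) ?_ ?_ (hG.const_mul _) ?_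
    · exact Eventually.of_forall fun n =>
        (Bc_trip₂ hK he hφ (fun i => hVs i n)).1.aestronglyMeasurable
    · filter_upwards [hab] with n hn
      exact ae_of_all _ fun ξ => (hC hn hB (gr K ξ) ξ).2
    · refine ae_of_all _ fun ξ => Bc_tendsto hr h3 h32 hV fun i => ?_
      exact (NT.trip₂ hV hB (gr K ξ) ξ i).incr h32 (-ξ)
  have t3 : Tendsto (fun n => Bc (fun i => sm n (v i)) (fl K φ (fun i => sm n (v i)))) atTop
      (𝓝 (Bc v (fl K φ v))) :=
    Bc_tendsto (F := fun i n => fl K φ (fun i => sm n (v i)) i) hr h3 h32 hV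
      fun i => NT.fl hV hB' hK i
  refine tendsto_nhds_unique t0 (((t1.sub (t2.const_mul (1 / 2))).sub t3).congr fun n => ?_)
  exact (balance_smooth hK he hφ (fun i => hVs i n) (hVd n)).symm

end rough

/-! ### Sobolev and Nikolskii regularity -/

/-- The `p`-th power of the `L^p` norm of an increment. -/
def incPow (p : ℝ) (f : E3 → ℝ) (ξ : E3) : ℝ≥0∞ := ∫⁻ x in cell, ‖f (x + ξ) - f x‖ₑ ^ p

/-- The double integral in the Sobolev-Slobodeckij norm. -/
def gagliardo (s p : ℝ) (f : E3 → ℝ) : ℝ≥0∞ :=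
  ∫⁻ x in cell, ∫⁻ ξ in centredCell, ‖f (x + ξ) - f x‖ₑ ^ p / ‖ξ‖ₑ ^ (3 + s * p)

section

variable {s p : ℝ} {f g : E3 → ℝ}

lemma ball_subset_centredCell : Metric.ball (0 : E3) (1 / 2) ⊆ centredCell := by
  intro ξ hξ i
  rw [mem_ball_zero_iff] at hξ
  have h := (abs_lt.1 ((PiLp.norm_apply_le ξ i).trans_lt hξ))
  exact ⟨h.1.le, h.2⟩

lemma centredCell_subset_ball : centredCell ⊆ Metric.ball (0 : E3) 2 := by
  intro x hx
  rw [mem_ball_zero_iff, EuclideanSpace.norm_eq]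
  rw [Real.sqrt_lt' (by norm_num), Fin.sum_univ_three]
  have h : ∀ i, ‖x i‖ ^ 2 ≤ 1 := fun i => by
    have := hx i
    rw [Real.norm_eq_abs, sq_abs]
    nlinarith [this.1, this.2]
  linarith [h 0, h 1, h 2]

lemma aesm_comp_add_prod (hf : AEStronglyMeasurable f volume) :
    AEStronglyMeasurable (fun z : E3 × E3 => f (z.1 + z.2) - f z.1) (cm.prod volume) := by
  have h1 : AEStronglyMeasurable (fun z : E3 × E3 => f (z.1 + z.2) - f z.1)
      ((volume : Measure E3).prod volume) :=
    (hf.comp_quasiMeasurePreserving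
      (quasiMeasurePreserving_add (volume : Measure E3) (volume : Measure E3))).sub hf.comp_fst
  exact h1.mono_ac (Measure.absolutelyContinuous_of_le Measure.restrict_le_self |>.prod
    Measure.AbsolutelyContinuous.rfl)

lemma aemeasurable_incPow (hf : AEStronglyMeasurable f volume) (p : ℝ) :
    AEMeasurable (incPow p f) volume :=
  AEMeasurable.lintegral_prod_left' (f := fun z : E3 × E3 => ‖f (z.1 + z.2) - f z.1‖ₑ ^ p)
    ((aesm_comp_add_prod hf).enorm.pow_const p)

lemma gagliardo_eq (hf : AEStronglyMeasurable f volume) (s p : ℝ) :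
    gagliardo s p f = ∫⁻ ξ in centredCell, incPow p f ξ / ‖ξ‖ₑ ^ (3 + s * p) := by
  have h := (aesm_comp_add_prod hf).enorm.pow_const p
  rw [gagliardo, lintegral_lintegral_swap]
  · refine lintegral_congr fun ξ => ?_
    simp only [div_eq_mul_inv, incPow]
    refine lintegral_mul_const'' _ ?_
    exact ((aesm_shift hf ξ).sub hf).restrict.enorm.pow_const p
  · have h1 : AEMeasurable (fun z : E3 × E3 => ‖f (z.1 + z.2) - f z.1‖ₑ ^ p / ‖z.2‖ₑ ^ (3 + s * p))
        (cm.prod volume) :=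
      h.div ((measurable_enorm.comp measurable_snd).pow_const _).aemeasurable
    exact h1.mono_measure (Measure.prod_mono le_rfl Measure.restrict_le_self)

lemma incPow_add_le (hp : 1 ≤ p) (hf : AEStronglyMeasurable f volume) (hper : IsPeriodic f)
    (a b : E3) : incPow p f (a + b) ≤ 2 ^ (p - 1) * (incPow p f a + incPow p f b) := by
  have e : incPow p f b = ∫⁻ x in cell, ‖f (x + a + b) - f (x + a)‖ₑ ^ p := by
    rw [incPow, ← IsPeriodic.lintegral_add (f := fun x => ‖f (x + b) - f x‖ₑ ^ p) (fun x i => by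
      simp only [add_right_comm _ (basisVec i), hper _ i]) a]
  have hm : AEMeasurable (fun x => ‖f (x + a) - f x‖ₑ ^ p) cm :=
    ((aesm_shift hf a).sub hf).restrict.enorm.pow_const p
  rw [e]
  conv_rhs => rw [incPow]
  rw [← lintegral_add_left' hm, ← lintegral_const_mul' _ _ (by finiteness)]
  refine lintegral_mono fun x => ?_
  have h1 : ‖f (x + (a + b)) - f x‖ₑ ≤ ‖f (x + a) - f x‖ₑ + ‖f (x + a + b) - f (x + a)‖ₑ := by
    have := enorm_add_le (f (x + a) - f x) (f (x + a + b) - f (x + a))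
    rwa [show f (x + a) - f x + (f (x + a + b) - f (x + a)) = f (x + (a + b)) - f x by
      rw [add_assoc]; ring] at this
  exact (ENNReal.rpow_le_rpow h1 (by linarith)).trans
    (ENNReal.rpow_add_le_mul_rpow_add_rpow _ _ hp)

lemma incPow_zero (hp : 0 < p) : incPow p f 0 = 0 := by simp [incPow, hp]

lemma incPow_le_gagliardo (hp : 1 ≤ p) (hs : 0 ≤ s) (hf : AEStronglyMeasurable f volume)
    (hper : IsPeriodic f) {ξ : E3} (h0 : 0 < ‖ξ‖) (h1 : ‖ξ‖ ≤ 1 / 4) :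
    incPow p f ξ ≤ ENNReal.ofReal (2 ^ p * 2 ^ (3 + s * p) /
      (volume (Metric.ball (0 : E3) 1)).toReal * ‖ξ‖ ^ (s * p)) * gagliardo s p f := by
  set r := ‖ξ‖ with hr
  set J := ∫⁻ ζ in Metric.ball (0 : E3) (2 * r), incPow p f ζ with hJ
  have hsub : Metric.ball (0 : E3) (2 * r) ⊆ centredCell :=
    (Metric.ball_subset_ball (by linarith)).trans ball_subset_centredCell
  have hJ1 : J ≤ ENNReal.ofReal ((2 * r) ^ (3 + s * p)) * gagliardo s p f := by
    rw [gagliardo_eq hf]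
    refine le_trans ?_ (mul_le_mul_right (lintegral_mono_set hsub) _)
    rw [← lintegral_const_mul' _ _ ENNReal.ofReal_ne_top]
    refine setLIntegral_mono' measurableSet_ball fun ζ hζ => ?_
    rw [mem_ball_zero_iff] at hζ
    rcases eq_or_ne ζ 0 with rfl | hne
    · rw [incPow_zero (by linarith)]; exact zero_le
    · have hn : 0 < ‖ζ‖ := norm_pos_iff.2 hne
      have hpow : ‖ζ‖ₑ ^ (3 + s * p) = ENNReal.ofReal (‖ζ‖ ^ (3 + s * p)) := by
        rw [← ofReal_norm, ENNReal.ofReal_rpow_of_pos hn]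
      rw [hpow, ← mul_div_assoc, ENNReal.le_div_iff_mul_le
        (Or.inl (by rw [Ne, ENNReal.ofReal_eq_zero, not_le]; positivity))
        (Or.inl ENNReal.ofReal_ne_top), mul_comm]
      gcongr
  have hJ2 : volume (Metric.ball (0 : E3) r) * incPow p f ξ ≤ 2 ^ (p - 1) * (J + J) := by
    have hm := aemeasurable_incPow hf p
    have hm' : AEMeasurable (fun ζ => incPow p f (ξ - ζ)) volume :=
      hm.comp_quasiMeasurePreserving
        (Measure.measurePreserving_sub_left (volume : Measure E3) ξ).quasiMeasurePreserving
    calc volume (Metric.ball (0 : E3) r) * incPow p f ξ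
        = ∫⁻ ζ in Metric.ball (0 : E3) r, incPow p f ξ := by rw [setLIntegral_const, mul_comm]
      _ ≤ ∫⁻ ζ in Metric.ball (0 : E3) r, 2 ^ (p - 1) * (incPow p f ζ + incPow p f (ξ - ζ)) :=
          lintegral_mono fun ζ => by
            have := incPow_add_le hp hf hper ζ (ξ - ζ)
            rwa [add_sub_cancel] at this
      _ = 2 ^ (p - 1) * ((∫⁻ ζ in Metric.ball (0 : E3) r, incPow p f ζ) +
            ∫⁻ ζ in Metric.ball (0 : E3) r, incPow p f (ξ - ζ)) := by
          rw [lintegral_const_mul' _ _ (by finiteness), lintegral_add_left' hm.restrict]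
      _ ≤ 2 ^ (p - 1) * (J + J) := by
          gcongr
          · exact lintegral_mono_set (Metric.ball_subset_ball (by linarith))
          · rw [hJ, ← lintegral_indicator measurableSet_ball, ← lintegral_indicator measurableSet_ball,
              ← lintegral_sub_left_eq_self ((Metric.ball (0 : E3) (2 * r)).indicator _) ξ]
            refine lintegral_mono fun ζ => ?_
            by_cases hζ : ζ ∈ Metric.ball (0 : E3) r
            · have hζ' : ξ - ζ ∈ Metric.ball (0 : E3) (2 * r) := by
                rw [mem_ball_zero_iff] at hζ ⊢
                linarith [norm_sub_le ξ ζ]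
              rw [indicator_of_mem hζ, indicator_of_mem hζ']
            · rw [indicator_of_notMem hζ]; exact zero_le
  have hc0 : 0 < (volume (Metric.ball (0 : E3) 1)).toReal :=
    ENNReal.toReal_pos (Metric.measure_ball_pos _ _ one_pos).ne' measure_ball_lt_top.ne
  set c := (volume (Metric.ball (0 : E3) 1)).toReal with hc
  have hvol : volume (Metric.ball (0 : E3) r) = ENNReal.ofReal (r ^ 3 * c) := by
    rw [Measure.addHaar_ball volume (0 : E3) h0.le, finrank_euclideanSpace, Fintype.card_fin,
      ENNReal.ofReal_mul (by positivity), hc, ENNReal.ofReal_toReal measure_ball_lt_top.ne]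
  have h2 : (2 : ℝ≥0∞) ^ (p - 1) * (J + J) = ENNReal.ofReal (2 ^ p) * J := by
    rw [← two_mul, ← mul_assoc, ← ENNReal.ofReal_rpow_of_pos two_pos, ENNReal.ofReal_ofNat]
    congr 1
    have := ENNReal.rpow_add (p - 1) 1 (two_ne_zero) (ENNReal.ofNat_ne_top (n := 2))
    rw [sub_add_cancel, ENNReal.rpow_one] at this
    exact this.symm
  rw [hvol, h2] at hJ2
  have hpos : 0 < r ^ 3 * c := by positivity
  rw [mul_comm, ← ENNReal.le_div_iff_mul_le (Or.inl (by simpa using hpos))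
    (Or.inl ENNReal.ofReal_ne_top)] at hJ2
  refine hJ2.trans ?_
  rw [ENNReal.div_le_iff_le_mul (Or.inl (by simpa using hpos)) (Or.inl ENNReal.ofReal_ne_top)]
  refine (mul_le_mul_right hJ1 _).trans (le_of_eq ?_)
  rw [← mul_assoc, ← ENNReal.ofReal_mul (by positivity), mul_right_comm _ (gagliardo s p f),
    ← ENNReal.ofReal_mul (by positivity)]
  congr 2
  rw [Real.mul_rpow two_pos.le h0.le, Real.rpow_add h0, Real.rpow_ofNat]
  field_simp

lemma sobolevNorm_real (s p : ℝ) (f : E3 → ℝ) :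
    sobolevNorm s p f = ((∫⁻ x in cell, ‖f x‖ₑ ^ p) + gagliardo s p f) ^ (1 / p) := rfl

lemma eLpNorm_ofReal (hp : 1 ≤ p) (f : E3 → ℝ) :
    eLpNorm f (ENNReal.ofReal p) cm = (∫⁻ x in cell, ‖f x‖ₑ ^ p) ^ (1 / p) := by
  rw [eLpNorm_eq_lintegral_rpow_enorm_toReal (by simp; linarith) ENNReal.ofReal_ne_top,
    ENNReal.toReal_ofReal (by linarith)]

/-- Sobolev functions have Nikolskii regularity. -/
lemma sobolev_nik (hp : 1 ≤ p) (hs : 0 ≤ s) : ∃ C, 0 ≤ C ∧ ∀ f : E3 → ℝ, IsPeriodic f →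
    AEStronglyMeasurable f volume → sobolevNorm s p f < ⊤ →
      Nik s (ENNReal.ofReal p) (C * (sobolevNorm s p f).toReal) f := by
  set c := (volume (Metric.ball (0 : E3) 1)).toReal with hc
  set D := 2 ^ p * 2 ^ (3 + s * p) / c with hD
  have hD0 : 0 ≤ D := by positivity
  have hp0 : 0 < p := by linarith
  have hq : 1 ≤ ENNReal.ofReal p := by rw [← ENNReal.ofReal_one]; exact ENNReal.ofReal_le_ofReal hp
  refine ⟨1 + D ^ (1 / p) + 2 * 4 ^ s, by positivity, fun f hper hf hfin => ?_⟩
  set N := sobolevNorm s p f with hN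
  obtain ⟨n, hn⟩ : ∃ n, n = N.toReal := ⟨_, rfl⟩
  have hNr : N = ENNReal.ofReal n := by rw [hn, ENNReal.ofReal_toReal hfin.ne]
  rw [← hn]
  have hbd : eLpNorm f (ENNReal.ofReal p) cm ≤ N := by
    rw [eLpNorm_ofReal hp, hN, sobolevNorm_real]
    gcongr; exact le_self_add
  have hgag : (gagliardo s p f) ^ (1 / p) ≤ N := by
    rw [hN, sobolevNorm_real]; gcongr; exact le_add_self
  have hn0 : 0 ≤ n := hn ▸ ENNReal.toReal_nonneg
  have hC1 : n ≤ (1 + D ^ (1 / p) + 2 * 4 ^ s) * n := by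
    refine le_mul_of_one_le_left hn0 ?_
    have : 0 ≤ D ^ (1 / p) := by positivity
    have : (0:ℝ) ≤ 4 ^ s := by positivity
    linarith
  refine ⟨hper, hf, by positivity, hbd.trans ?_, fun ξ => ?_⟩
  · rw [hNr]; exact ENNReal.ofReal_le_ofReal hC1
  rcases (norm_nonneg ξ).eq_or_lt with h0 | h0
  · rw [norm_eq_zero.1 h0.symm]; simp
  rcases le_or_gt ‖ξ‖ (1 / 4) with h1 | h1
  · have h := incPow_le_gagliardo hp hs hf hper h0 h1
    rw [eLpNorm_ofReal hp]
    refine (ENNReal.rpow_le_rpow h (by positivity)).trans ?_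
    rw [ENNReal.mul_rpow_of_nonneg _ _ (by positivity)]
    refine (mul_le_mul_right hgag _).trans ?_
    rw [hNr, ENNReal.ofReal_rpow_of_nonneg (by positivity) (by positivity),
      ← ENNReal.ofReal_mul (by positivity)]
    refine ENNReal.ofReal_le_ofReal ?_
    rw [Real.mul_rpow hD0 (by positivity), ← Real.rpow_mul h0.le, mul_one_div,
      mul_div_cancel_right₀ _ hp0.ne']
    have : 0 ≤ (1 + 2 * (4:ℝ) ^ s) * (n * ‖ξ‖ ^ s) := by positivity
    nlinarith
  · refine (eLpNorm_sub_le (aesm_shift hf ξ).restrict hf.restrict hq).trans ?_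
    rw [hper.eLpNorm_add hf, ← two_mul]
    refine (mul_le_mul_right hbd 2).trans ?_
    rw [hNr, two_mul, ← ENNReal.ofReal_add hn0 hn0]
    refine ENNReal.ofReal_le_ofReal ?_
    have h4 : 1 ≤ 4 ^ s * ‖ξ‖ ^ s := by
      rw [← Real.mul_rpow (by norm_num) h0.le]
      exact Real.one_le_rpow (by linarith) hs
    have : 0 ≤ (1 + D ^ (1 / p)) * (n * ‖ξ‖ ^ s) := by positivity
    have h5 : n ≤ n * (4 ^ s * ‖ξ‖ ^ s) := le_mul_of_one_le_right hn0 h4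
    nlinarith

lemma lintegral_centredCell_finite {b : ℝ} (hb : 0 < b) :
    ∫⁻ ξ in centredCell, ‖ξ‖ₑ ^ (-3 + b) < ⊤ := by
  have h : IntegrableOn (fun ξ : E3 => ‖ξ‖ ^ (-(3 - b))) (Metric.ball 0 2) volume := by
    refine integrableOn_ball_of_norm_le_rpow (C := 1) (α := 3 - b) (by simp) (by simp [hb]) ?_ ?_
    · exact ae_of_all _ fun x => by
        rw [one_mul, Real.norm_of_nonneg (by positivity)]
    · exact (measurable_norm.pow_const _).aestronglyMeasurable
  refine (lintegral_mono_set centredCell_subset_ball).trans_lt ?_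
  refine lt_of_le_of_lt (le_of_eq ?_) h.2
  refine lintegral_congr_ae ?_
  filter_upwards [ae_restrict_of_ae (Measure.ae_ne volume (0 : E3))] with ξ hξ
  have hn : 0 < ‖ξ‖ := norm_pos_iff.2 hξ
  rw [← ofReal_norm, ENNReal.ofReal_rpow_of_pos hn, Real.enorm_of_nonneg (by positivity)]
  congr 2; ring

/-- Nikolskii regularity gives slightly weaker Sobolev regularity. -/
lemma nik_sobolev (hp : 1 ≤ p) {s' : ℝ} (h : s' < s) : ∃ C : ℝ, 0 ≤ C ∧ ∀ {A : ℝ} {f : E3 → ℝ},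
    Nik s (ENNReal.ofReal p) A f → sobolevNorm s' p f ≤ ENNReal.ofReal (C * A) := by
  have hp0 : 0 < p := by linarith
  have hb : 0 < (s - s') * p := mul_pos (by linarith) hp0
  have hI := lintegral_centredCell_finite hb
  set I := ∫⁻ ξ in centredCell, ‖ξ‖ₑ ^ (-3 + (s - s') * p) with hIdef
  refine ⟨(1 + I.toReal) ^ (1 / p), by positivity, fun {A f} hf => ?_⟩
  have hA := hf.nonneg
  have e : ∀ g : E3 → ℝ, ∫⁻ x in cell, ‖g x‖ₑ ^ p = (eLpNorm g (ENNReal.ofReal p) cm) ^ p := by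
    intro g
    rw [eLpNorm_ofReal hp, ← ENNReal.rpow_mul, one_div_mul_cancel hp0.ne', ENNReal.rpow_one]
  have h1 : ∫⁻ x in cell, ‖f x‖ₑ ^ p ≤ ENNReal.ofReal A ^ p := by
    rw [e]; exact ENNReal.rpow_le_rpow hf.bd hp0.le
  have h2 : gagliardo s' p f ≤ ENNReal.ofReal A ^ p * I := by
    rw [gagliardo_eq hf.meas, hIdef, ← lintegral_const_mul' _ _ (by finiteness)]
    refine lintegral_mono_ae ?_
    filter_upwards [ae_restrict_of_ae (Measure.ae_ne volume (0 : E3))] with ξ hξ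
    have hn : 0 < ‖ξ‖ := norm_pos_iff.2 hξ
    have h3 : incPow p f ξ ≤ (ENNReal.ofReal (A * ‖ξ‖ ^ s)) ^ p := by
      rw [incPow, e (fun x => f (x + ξ) - f x)]; exact ENNReal.rpow_le_rpow (hf.inc ξ) hp0.le
    rw [← ofReal_norm, ENNReal.ofReal_rpow_of_pos hn, ENNReal.ofReal_rpow_of_pos hn]
    rw [ENNReal.div_le_iff_le_mul (Or.inl (by rw [Ne, ENNReal.ofReal_eq_zero, not_le]; positivity))
      (Or.inl ENNReal.ofReal_ne_top)]
    refine h3.trans (le_of_eq ?_)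
    rw [ENNReal.ofReal_mul hA, ENNReal.mul_rpow_of_nonneg _ _ hp0.le, mul_assoc,
      ← ENNReal.ofReal_mul (by positivity)]
    congr 1
    rw [ENNReal.ofReal_rpow_of_nonneg (by positivity) hp0.le, ← Real.rpow_mul hn.le,
      ← Real.rpow_add hn]
    congr 2; ring
  have h3 : (∫⁻ x in cell, ‖f x‖ₑ ^ p) + gagliardo s' p f ≤
      ENNReal.ofReal ((1 + I.toReal) * A ^ p) := by
    refine (add_le_add h1 h2).trans (le_of_eq ?_)
    rw [ENNReal.ofReal_mul (by positivity), ENNReal.ofReal_add one_pos.le ENNReal.toReal_nonneg,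
      ENNReal.ofReal_one, ENNReal.ofReal_toReal hI.ne, ENNReal.ofReal_rpow_of_nonneg hA hp0.le]
    ring
  rw [sobolevNorm_real]
  refine (ENNReal.rpow_le_rpow h3 (by positivity)).trans (le_of_eq ?_)
  rw [ENNReal.ofReal_rpow_of_nonneg (by positivity) (by positivity),
    Real.mul_rpow (by positivity) (by positivity), ← Real.rpow_mul hA, mul_one_div_cancel hp0.ne',
    Real.rpow_one]

end

lemma sobolevNorm_congr {F : Type*} [NormedAddCommGroup F] {s p : ℝ} {f g : E3 → F}
    (h : f =ᵐ[volume] g) : sobolevNorm s p f = sobolevNorm s p g := by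
  have h1 : ∫⁻ x in cell, ‖f x‖ₑ ^ p = ∫⁻ x in cell, ‖g x‖ₑ ^ p :=
    lintegral_congr_ae (ae_restrict_of_ae (h.mono fun x hx => by simp only [hx]))
  have h2 : ∀ᵐ x, f x = g x ∧ ∀ᵐ ξ, f (x + ξ) = g (x + ξ) := by
    filter_upwards [h] with x hx
    exact ⟨hx, (measurePreserving_add_left volume x).quasiMeasurePreserving.ae_eq_comp h⟩
  rw [sobolevNorm, sobolevNorm, h1]
  congr 2
  refine lintegral_congr_ae (ae_restrict_of_ae (h2.mono fun x hx => ?_))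
  refine lintegral_congr_ae (ae_restrict_of_ae (hx.2.mono fun ξ hξ => ?_))
  simp only [hx.1, hξ]

lemma aemeasurable_sobolevNorm {α F : Type*} [MeasurableSpace α] {μ : Measure α} [SFinite μ]
    [NormedAddCommGroup F] {s p : ℝ} {f : α → E3 → F}
    (hf : AEStronglyMeasurable (fun z : α × E3 => f z.1 z.2) (μ.prod volume)) :
    AEMeasurable (fun a => sobolevNorm s p (f a)) μ := by
  obtain ⟨g, hg, hfg⟩ := hf
  have h1 : ∀ᵐ a ∂μ, sobolevNorm s p (f a) = sobolevNorm s p (fun x => g (a, x)) := by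
    filter_upwards [Measure.ae_ae_of_ae_prod hfg] with a ha using sobolevNorm_congr ha
  refine AEMeasurable.congr ?_ (h1.mono fun a ha => ha.symm)
  refine Measurable.aemeasurable ?_
  have m1 : Measurable (fun a => ∫⁻ x in cell, ‖g (a, x)‖ₑ ^ p) :=
    Measurable.lintegral_prod_right' (f := fun z : α × E3 => ‖g z‖ₑ ^ p) (hg.enorm.pow_const p)
  have m3 : Measurable (fun z : (α × E3) × E3 => ‖g (z.1.1, z.1.2 + z.2) - g (z.1.1, z.1.2)‖ₑ ^ p /
      ‖z.2‖ₑ ^ (3 + s * p)) := by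
    have a1 : StronglyMeasurable (fun z : (α × E3) × E3 => g (z.1.1, z.1.2 + z.2)) :=
      hg.comp_measurable (by fun_prop)
    have a2 : StronglyMeasurable (fun z : (α × E3) × E3 => g (z.1.1, z.1.2)) :=
      hg.comp_measurable (by fun_prop)
    exact ((a1.sub a2).enorm.pow_const p).div ((measurable_enorm.comp measurable_snd).pow_const _)
  have m2 : Measurable (fun a => ∫⁻ x in cell, ∫⁻ ξ in centredCell,
      ‖g (a, x + ξ) - g (a, x)‖ₑ ^ p / ‖ξ‖ₑ ^ (3 + s * p)) :=
    Measurable.lintegral_prod_right' (f := fun z : α × E3 => ∫⁻ ξ in centredCell,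
      ‖g (z.1, z.2 + ξ) - g (z.1, z.2)‖ₑ ^ p / ‖ξ‖ₑ ^ (3 + s * p)) m3.lintegral_prod_right'
  exact (m1.add m2).pow_const _

/-! ### Joint measurability -/

lemma cv_congr {K f g : E3 → ℝ} (h : f =ᵐ[volume] g) : cv K f = cv K g := by
  ext x
  refine integral_congr_ae ?_
  filter_upwards [(Measure.measurePreserving_sub_left (volume : Measure E3)
    x).quasiMeasurePreserving.ae_eq_comp h] with y hy
  exact congrArg (K y * ·) hy

/-- Joint measurability of a family of functions. -/
def JM {α : Type*} [MeasurableSpace α] (μ : Measure α) (f : α → E3 → ℝ) : Prop :=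
  AEStronglyMeasurable (fun z : α × E3 => f z.1 z.2) (μ.prod volume)

namespace JM

variable {α : Type*} [MeasurableSpace α] {μ : Measure α} {f g : α → E3 → ℝ}

lemma add (hf : JM μ f) (hg : JM μ g) : JM μ (fun a x => f a x + g a x) :=
  AEStronglyMeasurable.add hf hg

lemma sub (hf : JM μ f) (hg : JM μ g) : JM μ (fun a x => f a x - g a x) :=
  AEStronglyMeasurable.sub hf hg

lemma mul (hf : JM μ f) (hg : JM μ g) : JM μ (fun a x => f a x * g a x) :=
  AEStronglyMeasurable.mul hf hg

lemma const_mul (c : ℝ) (hf : JM μ f) : JM μ (fun a x => c * f a x) :=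
  AEStronglyMeasurable.const_mul hf c

lemma sum {ι : Type*} {S : Finset ι} {F : ι → α → E3 → ℝ} (hF : ∀ i ∈ S, JM μ (F i)) :
    JM μ (fun a x => ∑ i ∈ S, F i a x) :=
  Finset.aestronglyMeasurable_fun_sum S hF

lemma of_left {c : α → ℝ} [SFinite μ] (hc : AEStronglyMeasurable c μ) : JM μ (fun a _ => c a) := hc.comp_fst

lemma to_cm (hf : JM μ f) : AEStronglyMeasurable (fun z : α × E3 => f z.1 z.2) (μ.prod cm) :=
  hf.mono_ac (Measure.AbsolutelyContinuous.rfl.prod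
    (Measure.absolutelyContinuous_of_le Measure.restrict_le_self))

lemma congr (hf : JM μ f) (h : ∀ᵐ a ∂μ, ∀ x, f a x = g a x) : JM μ g := by
  refine AEStronglyMeasurable.congr hf ?_
  have := Measure.quasiMeasurePreserving_fst (μ := μ) (ν := (volume : Measure E3)) |>.ae h
  exact this.mono fun z hz => hz z.2

lemma integral_cell (hf : JM μ f) : AEStronglyMeasurable (fun a => ∫ x in cell, f a x) μ :=
  AEStronglyMeasurable.integral_prod_right' (f := fun z : α × E3 => f z.1 z.2) hf.to_cm

lemma ae_meas (hf : JM μ f) : ∀ᵐ a ∂μ, AEStronglyMeasurable (f a) volume := by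
  obtain ⟨g, hg, hfg⟩ := hf
  filter_upwards [Measure.ae_ae_of_ae_prod hfg] with a ha
  exact ⟨fun x => g (a, x), hg.comp_measurable measurable_prodMk_left, ha⟩

lemma cv (hf : JM μ f) {K : E3 → ℝ} (hK : Continuous K) : JM μ (fun a => Helicity.cv K (f a)) := by
  obtain ⟨g, hg, hfg⟩ := hf
  have h1 : ∀ᵐ a ∂μ, ∀ x, Helicity.cv K (fun x => g (a, x)) x = Helicity.cv K (f a) x := by
    filter_upwards [Measure.ae_ae_of_ae_prod hfg] with a ha x
    exact congrFun (cv_congr (EventuallyEq.symm ha)) x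
  refine congr (f := fun a => Helicity.cv K (fun x => g (a, x))) ?_ h1
  refine StronglyMeasurable.aestronglyMeasurable ?_
  have h2 : StronglyMeasurable (fun w : (α × E3) × E3 => K w.2 * g (w.1.1, w.1.2 - w.2)) :=
    (hK.stronglyMeasurable.comp_measurable measurable_snd).mul (hg.comp_measurable (by fun_prop))
  exact h2.integral_prod_right'

lemma shift (hf : JM μ f) {ξ : α → E3} (hξ : Measurable ξ) : JM μ (fun a x => f a (x + ξ a)) := by
  obtain ⟨g, hg, hfg⟩ := hf
  refine ⟨fun z => g (z.1, z.2 + ξ z.1), hg.comp_measurable (by fun_prop), ?_⟩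
  obtain ⟨N, hN, hNm, hN0⟩ := exists_measurable_superset_of_null hfg
  have hN' : μ.prod volume ((fun z : α × E3 => (z.1, z.2 + ξ z.1)) ⁻¹' N) = 0 := by
    have hmm : Measurable (fun z : α × E3 => (z.1, z.2 + ξ z.1)) := by fun_prop
    rw [Measure.measure_prod_null (hmm hNm)]
    filter_upwards [Measure.measure_ae_null_of_prod_null hN0] with a ha
    exact (measurePreserving_add_right (volume : Measure E3)
      (ξ a)).quasiMeasurePreserving.preimage_null ha
  refine measure_mono_null (fun z hz => ?_) hN'
  exact hN (show (z.1, z.2 + ξ z.1) ∈ _ from hz)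

lemma comp_fst [SFinite μ] {β : Type*} [MeasurableSpace β] {ν : Measure β} [SFinite ν] (hf : JM μ f) :
    JM (μ.prod ν) (fun b => f b.1) :=
  AEStronglyMeasurable.comp_quasiMeasurePreserving hf (MeasureTheory.QuasiMeasurePreserving.prodMap
    Measure.quasiMeasurePreserving_fst (Measure.QuasiMeasurePreserving.id (volume : Measure E3)))

variable {s : ℝ} {p q : ℝ≥0∞} [ENNReal.HolderConjugate p q]

lemma bf (hs : 1 / 2 < s) (hp : 1 ≤ p) (hq : 1 ≤ q) (hf : JM μ f) (hg : JM μ g)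
    (hfn : ∀ᵐ a ∂μ, ∃ A, Nik s p A (f a)) (hgn : ∀ᵐ a ∂μ, ∃ A, Nik s q A (g a)) (j : Fin 3) :
    AEStronglyMeasurable (fun a => Helicity.bf j (f a) (g a)) μ := by
  refine aestronglyMeasurable_of_tendsto_ae atTop (f := fun k a => bq j k (f a) (g a)) (fun k => ?_) ?_
  · have h := ((hf.cv (χk_ker k).continuous).mul (hg.cv ((χk_ker k).pd j).continuous)).integral_cell
    refine h.congr ?_
    filter_upwards [hgn] with a ha
    obtain ⟨B, hB⟩ := ha
    rw [bq, sm, sm, pd_cv (χk_ker k) (hB.locInt hq)]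
  · filter_upwards [hfn, hgn] with a ha hb
    obtain ⟨A, hA⟩ := ha
    obtain ⟨B, hB⟩ := hb
    exact bf_tendsto hs hp hq hA hB j

lemma Bc {V F : Fin 3 → α → E3 → ℝ} (hs : 1 / 2 < s) (hp : 1 ≤ p) (hq : 1 ≤ q)
    (hV : ∀ i, JM μ (V i)) (hF : ∀ i, JM μ (F i))
    (hVn : ∀ᵐ a ∂μ, ∃ A, ∀ i, Nik s p A (V i a)) (hFn : ∀ᵐ a ∂μ, ∃ A, ∀ i, Nik s q A (F i a)) :
    AEStronglyMeasurable (fun a => Helicity.Bc (fun i => V i a) (fun i => F i a)) μ := by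
  have h : ∀ j i k, AEStronglyMeasurable (fun a => Helicity.bf j (V i a) (F k a)) μ := fun j i k =>
    JM.bf hs hp hq (hV i) (hF k) (hVn.mono fun a ⟨A, hA⟩ => ⟨A, hA i⟩)
      (hFn.mono fun a ⟨A, hA⟩ => ⟨A, hA k⟩) j
  exact (((h 1 0 2).sub (h 2 0 1)).add ((h 2 1 0).sub (h 0 1 2))).add ((h 0 2 1).sub (h 1 2 0))

end JM

/-! ### Kernels at large scale -/

lemma Ker.exists_lipschitz {K : E3 → ℝ} (hK : Ker K) :
    ∃ L, 0 ≤ L ∧ ∀ x y, |K x - K y| ≤ L * ‖x - y‖ := by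
  obtain ⟨C, hC⟩ := ContDiff.lipschitzWith_of_hasCompactSupport hK.compact hK.smooth (by simp)
  refine ⟨C, C.2, fun x y => ?_⟩
  have := hC.dist_le_mul x y
  rwa [Real.dist_eq, dist_eq_norm] at this

lemma integral_shift_sub_le {K : E3 → ℝ} (hK : Ker K) : ∃ C, 0 ≤ C ∧ ∀ R : ℝ, 1 ≤ R → ∀ z : E3,
    ‖z‖ ≤ 2 → ∫ y, |rescale K R y - rescale K R (y + z)| ≤ C / R := by
  obtain ⟨L, hL0, hL⟩ := hK.exists_lipschitz
  obtain ⟨ρ, hρ0, hρ⟩ := hK.exists_radius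
  set V := (volume (Metric.closedBall (0 : E3) (ρ + 2))).toReal with hV
  refine ⟨2 * L * V, by positivity, fun R hR z hz => ?_⟩
  have hR0 : 0 < R := by linarith
  have e : (fun y => |rescale K R y - rescale K R (y + z)|) =
      fun y => (R ^ 3)⁻¹ * (fun u => |K u - K (u + R⁻¹ • z)|) (R⁻¹ • y) := by
    ext y
    simp only [rescale, smul_add]
    rw [← mul_sub, abs_mul, abs_of_pos (a := (R ^ 3)⁻¹) (by positivity)]
  rw [e, integral_rescale_aux (fun u => |K u - K (u + R⁻¹ • z)|) hR0]
  have hw : ‖R⁻¹ • z‖ ≤ 2 / R := by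
    rw [norm_smul, norm_inv, Real.norm_of_nonneg hR0.le, inv_mul_eq_div]; gcongr
  have hw2 : ‖R⁻¹ • z‖ ≤ 2 := hw.trans (div_le_self (by norm_num) hR)
  have hb : ∀ u, |K u - K (u + R⁻¹ • z)| ≤
      (Metric.closedBall (0 : E3) (ρ + 2)).indicator (fun _ => L * (2 / R)) u := by
    intro u
    by_cases hu : u ∈ Metric.closedBall (0 : E3) (ρ + 2)
    · rw [indicator_of_mem hu]
      refine (hL _ _).trans ?_
      rw [sub_add_cancel_left, norm_neg]
      gcongr
    · rw [indicator_of_notMem hu]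
      rw [mem_closedBall_zero_iff, not_le] at hu
      have h1 : K u = 0 := by
        by_contra h
        linarith [hρ u h]
      have h2 : K (u + R⁻¹ • z) = 0 := by
        by_contra h
        have := norm_sub_le (u + R⁻¹ • z) (R⁻¹ • z)
        rw [add_sub_cancel_right] at this
        linarith [hρ _ h]
      rw [h1, h2]; simp
  calc ∫ u, |K u - K (u + R⁻¹ • z)|
      ≤ ∫ u, (Metric.closedBall (0 : E3) (ρ + 2)).indicator (fun _ => L * (2 / R)) u := by
        refine integral_mono_of_nonneg (ae_of_all _ fun u => abs_nonneg _) ?_ (ae_of_all _ hb)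
        exact (integrable_indicator_iff measurableSet_closedBall).2
          (integrableOn_const measure_closedBall_lt_top.ne)
    _ = 2 * L * V / R := by
        rw [integral_indicator measurableSet_closedBall, setIntegral_const, smul_eq_mul]
        simp only [measureReal_def]
        rw [← hV]; ring

lemma integral_cell_cv {K f : E3 → ℝ} (hK : Ker K) (he : ∀ x, K (-x) = K x) (hp : IsPeriodic f)
    (hf : Integrable f cm) : ∫ x in cell, cv K f x = (∫ y, K y) * ∫ x in cell, f x := by
  have h := integral_cv_mul hK he hp hf (g := fun _ => (1:ℝ)) continuous_const (fun _ _ => rfl)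
  simp only [mul_one] at h
  rw [h, mul_comm, ← integral_mul_const]
  simp [cv]

/-- Averages over large scales are close to the mean. -/
lemma eLpNorm_cv_large {K : E3 → ℝ} (hK : Ker K) (he : ∀ x, K (-x) = K x) : ∃ C, 0 ≤ C ∧
    ∀ R : ℝ, 1 ≤ R → ∀ {q : ℝ≥0∞}, 1 ≤ q → ∀ {f : E3 → ℝ}, IsPeriodic f →
      AEStronglyMeasurable f volume → Integrable f cm →
      eLpNorm (fun x => cv (rescale K R) f x - (∫ y, K y) * ∫ y in cell, f y) q cm ≤
        ENNReal.ofReal (C / R) * eLpNorm f q cm := by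
  obtain ⟨C, hC0, hC⟩ := integral_shift_sub_le hK
  refine ⟨C, hC0, fun R hR {q} hq {f} hp hm hi => ?_⟩
  have hR0 : 0 < R := by linarith
  have hKR := hK.rescale hR0
  have hl := hp.locallyIntegrable hi
  set κ := rescale K R with hκ
  have hg := cv_smp hKR hl hp
  set G : E3 → E3 → ℝ := fun x z => cv κ f x - cv κ f (x + z) with hG
  have e : (fun x => cv κ f x - (∫ y, K y) * ∫ y in cell, f y) =
      fun x => ∫ z, cell.indicator (fun _ => (1:ℝ)) z * G x z := by
    ext x
    have h1 : (fun z => cell.indicator (fun _ => (1:ℝ)) z * G x z) = cell.indicator (fun z => G x z) := by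
      ext z; by_cases hz : z ∈ cell <;> simp [hz]
    rw [h1, integral_indicator measurableSet_cell, hG]
    simp only
    have h2 : Integrable (fun z => cv κ f (x + z)) cm :=
      Continuous.integrable_cm (hg.continuous.comp (by fun_prop))
    rw [integral_sub (integrable_const _) h2, integral_const]
    have h3 : ∫ z in cell, cv κ f (x + z) = ∫ z in cell, cv κ f z := by
      rw [← hg.per.integral_add x]; simp only [add_comm x]
    rw [h3, integral_cell_cv hKR (rescale_even he) hp hi, hκ, integral_rescale hR0]
    simp
  rw [e]
  have hind : Integrable (cell.indicator (fun _ => (1:ℝ))) (volume : Measure E3) :=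
    (integrable_indicator_iff measurableSet_cell).2 (integrableOn_const (by simp [volume_cell]))
  have h := eLpNorm_integral_le (F := G) (K := cell.indicator (fun _ => (1:ℝ)))
    (Continuous.aestronglyMeasurable (by
      have := hg.continuous
      simp only [hG]; fun_prop)) (measurable_const.indicator measurableSet_cell) hind hq
    (M := ENNReal.ofReal (C / R) * eLpNorm f q cm) (fun z hz => by
      have hz' : z ∈ cell := by
        by_contra h; simp [h] at hz
      have hz2 : ‖z‖ ≤ 2 := mem_closedBall_zero_iff.1 (cell_subset_closedBall hz')
      have hK' : Ker (fun y => κ y - κ (y + z)) := by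
        refine ⟨hKR.1.sub (hKR.1.comp (contDiff_id.add contDiff_const)), ?_⟩
        exact hKR.2.sub (hKR.2.comp_homeomorph (Homeomorph.addRight z))
      have e2 : (fun x => G x z) = cv (fun y => κ y - κ (y + z)) f := by
        ext x
        have s1 : cv κ f (x + z) = ∫ y, κ (y + z) * f (x - y) := by
          rw [cv, ← integral_add_right_eq_self _ z]
          congr 1; ext y; congr 2; abel
        have s2 : Integrable (fun y => κ (y + z) * f (x - y)) volume := by
          have := (hKR.integrable_mul hl (x + z)).comp_add_right z
          refine this.congr (ae_of_all _ fun y => ?_)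
          simp only; congr 2; abel
        simp only [hG, s1]
        rw [cv, cv, ← integral_sub (hKR.integrable_mul hl x) s2]
        congr 1; ext y; ring
      rw [e2]
      refine (Nik.eLpNorm_cv_le hp hm hq hK'.continuous hK'.integrable).trans ?_
      gcongr
      exact hC R hR z hz2)
  refine h.trans (le_of_eq ?_)
  have h1 : ∫ y, |cell.indicator (fun _ => (1:ℝ)) y| = 1 := by
    have : (fun y => |cell.indicator (fun _ => (1:ℝ)) y|) = cell.indicator (fun _ => (1:ℝ)) := by
      ext z; by_cases hz : z ∈ cell <;> simp [hz]
    rw [this, integral_indicator measurableSet_cell]; simp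
  rw [h1, ENNReal.ofReal_one, one_mul]

/-! ### Absolutely convergent series of functions -/

/-- The pointwise sum of a series of functions. -/
def ser {α : Type*} (U : ℕ → α → ℝ) (x : α) : ℝ :=
  limUnder atTop (fun N => ∑ n ∈ Finset.range N, U n x)

lemma ser_spec {U : ℕ → E3 → ℝ} {c : ℕ → ℝ} {q : ℝ≥0∞} (hq : 1 ≤ q)
    (hU : ∀ n, AEStronglyMeasurable (U n) cm) (hc : ∀ n, 0 ≤ c n) (hs : Summable c)
    (hb : ∀ n, eLpNorm (U n) q cm ≤ ENNReal.ofReal (c n)) :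
    (∀ᵐ x ∂cm, Tendsto (fun N => ∑ n ∈ Finset.range N, U n x) atTop (𝓝 (ser U x))) ∧
    eLpNorm (ser U) q cm ≤ ENNReal.ofReal (∑' n, c n) ∧
    ∀ g, SmP g → HasSum (fun n => ∫ x in cell, U n x * g x) (∫ x in cell, ser U x * g x) := by
  have hL1 : ∀ n, eLpNorm (U n) 1 cm ≤ ENNReal.ofReal (c n) := fun n =>
    (eLpNorm_le_eLpNorm_of_exponent_le hq (hU n)).trans (hb n)
  have hfin : ∫⁻ x in cell, ∑' n, ‖U n x‖ₑ ≠ ⊤ := by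
    rw [lintegral_tsum fun n => (hU n).enorm]
    have : ∑' n, ∫⁻ x in cell, ‖U n x‖ₑ ≤ ∑' n, ENNReal.ofReal (c n) :=
      ENNReal.tsum_le_tsum fun n => by rw [← eLpNorm_one_eq_lintegral_enorm]; exact hL1 n
    exact ne_top_of_le_ne_top (by rw [← ENNReal.ofReal_tsum_of_nonneg hc hs]; finiteness) this
  have hsum : ∀ᵐ x ∂cm, Summable (fun n => U n x) := by
    filter_upwards [ae_lt_top' (AEMeasurable.tsum fun n => (hU n).enorm) hfin] with x hx
    refine Summable.of_norm ?_
    have : Summable (fun n => ‖U n x‖₊) := ENNReal.tsum_coe_ne_top_iff_summable.1 hx.ne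
    exact NNReal.summable_coe.2 this
  have hser : ∀ᵐ x ∂cm, ser U x = ∑' n, U n x := by
    filter_upwards [hsum] with x hx using hx.hasSum.tendsto_sum_nat.limUnder_eq
  have hlim : ∀ᵐ x ∂cm, Tendsto (fun N => ∑ n ∈ Finset.range N, U n x) atTop (𝓝 (ser U x)) := by
    filter_upwards [hsum, hser] with x hx h2
    rw [h2]; exact hx.hasSum.tendsto_sum_nat
  refine ⟨hlim, ?_, fun g hg => ?_⟩
  · refine (Lp.eLpNorm_lim_le_liminf_eLpNorm
      (fun N => Finset.aestronglyMeasurable_fun_sum _ fun n _ => hU n) _ hlim).trans ?_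
    refine liminf_le_of_le (by isBoundedDefault) fun b hb' => ?_
    obtain ⟨N, hN⟩ := hb'.exists
    have e : (fun a => ∑ n ∈ Finset.range N, U n a) = ∑ n ∈ Finset.range N, U n := by
      ext x; simp
    rw [e] at hN
    refine hN.trans ((eLpNorm_sum_le (fun n _ => hU n) hq).trans ?_)
    · refine (Finset.sum_le_sum fun n _ => hb n).trans ?_
      rw [← ENNReal.ofReal_sum_of_nonneg fun n _ => hc n]
      exact ENNReal.ofReal_le_ofReal (hs.sum_le_tsum _ fun n _ => hc n)
  · obtain ⟨B, hB0, hB⟩ := hg.exists_bound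
    have hUi : ∀ n, Integrable (U n) cm := fun n =>
      memLp_one_iff_integrable.1 ⟨hU n, (hL1 n).trans_lt ENNReal.ofReal_lt_top⟩
    have h := hasSum_integral_of_summable_integral_norm (μ := cm)
      (F := fun n x => U n x * g x) (fun n => Integrable.mul_smp (hUi n) hg) (by
        refine Summable.of_nonneg_of_le (fun n => integral_nonneg fun x => norm_nonneg _)
          (fun n => ?_) (hs.mul_right B)
        have h1 : ∫ x in cell, ‖U n x‖ ≤ c n := by
          have := hL1 n
          rw [eLpNorm_one_eq_lintegral_enorm, ← ofReal_integral_norm_eq_lintegral_enorm (hUi n)] at this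
          exact (ENNReal.ofReal_le_ofReal_iff (hc n)).1 this
        calc ∫ x in cell, ‖U n x * g x‖ ≤ ∫ x in cell, ‖U n x‖ * B := by
              refine integral_mono (Integrable.mul_smp (hUi n) hg).norm ((hUi n).norm.mul_const B)
                fun x => ?_
              simp only [norm_mul]
              exact mul_le_mul_of_nonneg_left (hB x) (norm_nonneg _)
          _ = (∫ x in cell, ‖U n x‖) * B := integral_mul_const _ _
          _ ≤ c n * B := by gcongr)
    have e : ∫ x in cell, ∑' n, U n x * g x = ∫ x in cell, ser U x * g x := by
      refine integral_congr_ae ?_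
      filter_upwards [hser] with x hx
      rw [hx, tsum_mul_right]
    rwa [e] at h

/-! ### The second order Riesz transforms -/

/-- The dyadic blocks, at scales `2^{-n}` and `2^{n+1}`, of convolution with the homogeneous kernel
generated by `κ`. -/
def blk (κ : E3 → ℝ) (n : ℕ) (h : E3 → ℝ) (x : E3) : ℝ :=
  cv (rescale κ ((1 / 2) ^ n)) h x + cv (rescale κ (2 ^ (n + 1))) h x

/-- Convolution with the homogeneous kernel generated by `κ`. -/
def rz (κ : E3 → ℝ) (h : E3 → ℝ) : E3 → ℝ := ser (fun n => blk κ n h)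

section rz

variable {κ h : E3 → ℝ} {s A : ℝ} {q : ℝ≥0∞}

lemma blk_smp (hκ : Ker κ) (hq : 1 ≤ q) (hh : Nik s q A h) (n : ℕ) : SmP (blk κ n h) :=
  (cv_smp (hκ.rescale (by positivity)) (hh.locInt hq) hh.per).add
    (cv_smp (hκ.rescale (by positivity)) (hh.locInt hq) hh.per)

lemma blk_bound (hκ : Ker κ) (he : ∀ x, κ (-x) = κ x) (h0 : ∫ x, κ x = 0) (hs : 0 ≤ s) (hs1 : s ≤ 1) :
    ∃ C, 0 ≤ C ∧ ∀ {q : ℝ≥0∞}, 1 ≤ q → ∀ {A : ℝ} {h : E3 → ℝ}, Nik s q A h → ∀ n,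
      eLpNorm (blk κ n h) q cm ≤ ENNReal.ofReal (C * A * ((1 / 2) ^ s) ^ n) := by
  obtain ⟨ρ, hρ0, hρ⟩ := hκ.exists_radius
  obtain ⟨C, hC0, hC⟩ := eLpNorm_cv_large hκ he
  set M := ∫ y, |κ y| with hM
  have hM0 : 0 ≤ M := integral_nonneg fun _ => abs_nonneg _
  refine ⟨M * ρ ^ s + C, by positivity, fun {q} hq {A h} hh n => ?_⟩
  have hA := hh.nonneg
  have k1 : Ker (rescale κ ((1 / 2) ^ n)) := hκ.rescale (by positivity)
  have k2 : Ker (rescale κ (2 ^ (n + 1))) := hκ.rescale (by positivity)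
  have b1 := hh.eLpNorm_cv_sub hq hs k1 (rescale_support (by positivity) hρ)
  rw [integral_rescale (by positivity), h0, integral_abs_rescale (by positivity)] at b1
  have b2 := hC (2 ^ (n + 1)) (one_le_pow₀ one_le_two) hq hh.per hh.meas (hh.integrable hq)
  rw [h0] at b2
  simp only [zero_mul, sub_zero] at b1 b2
  have m1 : AEStronglyMeasurable (cv (rescale κ ((1 / 2) ^ n)) h) cm :=
    (cv_smp k1 (hh.locInt hq) hh.per).continuous.aestronglyMeasurable
  have m2 : AEStronglyMeasurable (cv (rescale κ (2 ^ (n + 1))) h) cm :=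
    (cv_smp k2 (hh.locInt hq) hh.per).continuous.aestronglyMeasurable
  refine (eLpNorm_add_le m1 m2 hq).trans ((add_le_add b1 (b2.trans (mul_le_mul_right hh.bd _))).trans ?_)
  rw [← ENNReal.ofReal_mul (by positivity), ← ENNReal.ofReal_add (by positivity) (by positivity)]
  refine ENNReal.ofReal_le_ofReal ?_
  have e1 : (ρ * (1 / 2) ^ n) ^ s = ρ ^ s * ((1 / 2) ^ s) ^ n := by
    rw [Real.mul_rpow hρ0.le (by positivity), ← Real.rpow_natCast, ← Real.rpow_mul (by norm_num),
      ← Real.rpow_natCast, ← Real.rpow_mul (by norm_num), mul_comm s]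
  have e2 : C / 2 ^ (n + 1) ≤ C * ((1 / 2) ^ s) ^ n := by
    rw [div_eq_mul_inv]
    refine mul_le_mul_of_nonneg_left ?_ hC0
    calc ((2:ℝ) ^ (n + 1))⁻¹ ≤ (1 / 2) ^ n := by
          rw [one_div, inv_pow]
          exact inv_anti₀ (by positivity) (pow_le_pow_right₀ one_le_two (Nat.le_succ n))
      _ ≤ ((1 / 2) ^ s) ^ n := by
          refine pow_le_pow_left₀ (by norm_num) ?_ n
          conv_lhs => rw [← Real.rpow_one (1 / 2)]
          exact Real.rpow_le_rpow_of_exponent_ge (by norm_num) (by norm_num) hs1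
  rw [e1]
  have := mul_le_mul_of_nonneg_right e2 hA
  nlinarith

/-- The summability of the blocks, and the bound for the sum. -/
lemma rz_spec (hκ : Ker κ) (he : ∀ x, κ (-x) = κ x) (h0 : ∫ x, κ x = 0) (hs : 0 < s) (hs1 : s ≤ 1) :
    ∃ C, 0 ≤ C ∧ ∀ {q : ℝ≥0∞}, 1 ≤ q → ∀ {A : ℝ} {h : E3 → ℝ}, Nik s q A h →
      (∀ᵐ x, Tendsto (fun N => ∑ n ∈ Finset.range N, blk κ n h x) atTop (𝓝 (rz κ h x))) ∧
      eLpNorm (rz κ h) q cm ≤ ENNReal.ofReal (C * A) ∧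
      ∀ g, SmP g → HasSum (fun n => ∫ x in cell, blk κ n h x * g x)
        (∫ x in cell, rz κ h x * g x) := by
  obtain ⟨C, hC0, hC⟩ := blk_bound hκ he h0 hs.le hs1
  have hr : ((1 / 2 : ℝ) ^ s) < 1 := Real.rpow_lt_one (by norm_num) (by norm_num) hs
  have hg := summable_geometric_of_lt_one (by positivity) hr
  refine ⟨C * ∑' n : ℕ, ((1 / 2 : ℝ) ^ s) ^ n, by positivity, fun {q} hq {A h} hh => ?_⟩
  have hA := hh.nonneg
  have key := ser_spec hq (fun n => (blk_smp hκ hq hh n).continuous.aestronglyMeasurable)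
    (fun n => by positivity) (hg.mul_left (C * A)) (hC hq hh)
  refine ⟨ae_of_ae_cm (fun x i => ?_) key.1, ?_, key.2.2⟩
  · have : ∀ n, blk κ n h (x + basisVec i) = blk κ n h x := fun n => (blk_smp hκ hq hh n).per x i
    simp only [rz, ser, this]
  · rw [tsum_mul_left] at key
    refine key.2.1.trans (ENNReal.ofReal_le_ofReal (le_of_eq ?_)); ring

lemma rz_nik (hκ : Ker κ) (he : ∀ x, κ (-x) = κ x) (h0 : ∫ x, κ x = 0) {s' : ℝ} (hs' : 0 ≤ s')
    (hs : s' < s) (hs1 : s ≤ 1) : ∃ C, 0 ≤ C ∧ ∀ {q : ℝ≥0∞}, 1 ≤ q → ∀ {A : ℝ} {h : E3 → ℝ},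
      Nik s q A h → Nik s' q (C * A) (rz κ h) := by
  obtain ⟨C, hC0, hC⟩ := rz_spec hκ he h0 (s := s - s') (by linarith) (by linarith)
  obtain ⟨D, hD0, hD⟩ := rz_spec hκ he h0 (s := s) (by linarith) hs1
  refine ⟨2 * C + D, by positivity, fun {q} hq {A h} hh => ?_⟩
  have hA := hh.nonneg
  have hsm := blk_smp hκ hq hh
  have hm : StronglyMeasurable (rz κ h) :=
    StronglyMeasurable.limUnder fun N => (Finset.stronglyMeasurable_fun_sum _ fun n _ =>
      (hsm n).continuous.stronglyMeasurable)
  have hper : IsPeriodic (rz κ h) := fun x i => by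
    have : ∀ n, blk κ n h (x + basisVec i) = blk κ n h x := fun n => (hsm n).per x i
    simp only [rz, ser, this]
  refine ⟨hper, hm.aestronglyMeasurable, by positivity, (hD hq hh).2.1.trans ?_, fun ξ => ?_⟩
  · exact ENNReal.ofReal_le_ofReal (by nlinarith)
  · have hi := hh.incr_small hq hs' hs.le ξ
    have h1 := (hD hq hh).1
    have h1' := (measurePreserving_add_right (volume : Measure E3) ξ).quasiMeasurePreserving.ae h1
    have h2 := (hC hq hi).1
    have e : (fun x => rz κ h (x + ξ) - rz κ h x) =ᵐ[cm] rz κ (fun x => h (x + ξ) - h x) := by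
      refine ae_restrict_of_ae ?_
      filter_upwards [h1, h1', h2] with x a b c
      refine tendsto_nhds_unique (b.sub a) (c.congr fun N => ?_)
      rw [← Finset.sum_sub_distrib]
      refine Finset.sum_congr rfl fun n _ => ?_
      have l := hh.locInt hq
      have l' := (hh.shift ξ).locInt hq
      have e1 := congrFun (cv_sub (hκ.rescale (ε := (1 / 2) ^ n) (by positivity)) l' l) x
      have e2 := congrFun (cv_sub (hκ.rescale (ε := 2 ^ (n + 1)) (by positivity)) l' l) x
      simp only [cv_comp_add] at e1 e2
      simp only [blk, e1, e2]; ring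
    rw [eLpNorm_congr_ae e]
    refine (hC hq hi).2.1.trans (ENNReal.ofReal_le_ofReal ?_)
    have : 0 ≤ D * A * ‖ξ‖ ^ s' := by positivity
    nlinarith

lemma integral_rz (hκ : Ker κ) (he : ∀ x, κ (-x) = κ x) (h0 : ∫ x, κ x = 0) (hs : 0 < s)
    (hs1 : s ≤ 1) (hq : 1 ≤ q) (hh : Nik s q A h) : ∫ x in cell, rz κ h x = 0 := by
  obtain ⟨C, hC0, hC⟩ := rz_spec hκ he h0 hs hs1
  have h1 := (hC hq hh).2.2 _ (SmP.const 1)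
  simp only [mul_one] at h1
  refine h1.unique ?_
  convert! hasSum_zero using 2 with n
  have k1 : Ker (rescale κ ((1 / 2) ^ n)) := hκ.rescale (by positivity)
  have k2 : Ker (rescale κ (2 ^ (n + 1))) := hκ.rescale (by positivity)
  simp only [blk]
  rw [integral_add (cv_smp k1 (hh.locInt hq) hh.per).integrable
    (cv_smp k2 (hh.locInt hq) hh.per).integrable,
    integral_cell_cv k1 (rescale_even he) hh.per (hh.integrable hq),
    integral_cell_cv k2 (rescale_even he) hh.per (hh.integrable hq),
    integral_rescale (by positivity), integral_rescale (by positivity), h0]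
  simp

end rz

/-- The kernels of the second order Riesz transforms. -/
def rk (i j : Fin 3) : E3 → ℝ := pd i (pd j Θ₀)

lemma rk_ker (i j : Fin 3) : Ker (rk i j) := (Θ₀_ker.pd j).pd i

lemma rk_integral (i j : Fin 3) : ∫ x, rk i j x = 0 := (Θ₀_ker.pd j).integral_pd i

lemma pd_odd {K : E3 → ℝ} (hK : CInf K) (he : ∀ x, K (-x) = - K x) (j : Fin 3) (x : E3) :
    pd j K (-x) = pd j K x := by
  have h : K = fun y => - K (-y) := funext fun y => by rw [he, neg_neg]
  have h1 : HasFDerivAt (fun y => - K (-y))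
      (-(fderiv ℝ K (-x)).comp (-ContinuousLinearMap.id ℝ E3)) x :=
    ((hK.diff (-x)).hasFDerivAt.comp x (hasFDerivAt_id x).neg).neg
  rw [← h] at h1
  simp [pd, h1.fderiv]

lemma rk_even (i j : Fin 3) (x : E3) : rk i j (-x) = rk i j x :=
  pd_odd (Θ₀_ker.pd j).1 (pd_even Θ₀_ker.1 Θ₀_even j) i x

lemma rescale_pd_pd {K : E3 → ℝ} (hK : CInf K) {R : ℝ} (hR : 0 < R) (i j : Fin 3) :
    rescale (pd i (pd j K)) R = fun x => R ^ 2 * pd i (pd j (rescale K R)) x := by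
  have h : CInf (rescale (pd j K) R) := contDiff_const.mul ((hK.pd j).comp (contDiff_const_smul _))
  rw [pd_rescale hK, pd_const_mul h, pd_rescale (hK.pd j)]
  ext x; field_simp

lemma χ₀_rescale_sub {R : ℝ} (hR : 0 < R) : (fun y => rescale χ₀ R y - rescale χ₀ (1 / 2 * R) y) =
    fun y => ∑ k, R ^ 2 * pd k (pd k (rescale Θ₀ R)) y := by
  ext y
  have h1 := χ₀_sub (R⁻¹ • y)
  have h2 : rescale χ₀ (1 / 2 * R) y = (R ^ 3)⁻¹ * rescale χ₀ (1 / 2) (R⁻¹ • y) := by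
    rw [← rescale_rescale]; rfl
  have h3 : ∀ k, R ^ 2 * pd k (pd k (rescale Θ₀ R)) y = (R ^ 3)⁻¹ * pd k (pd k Θ₀) (R⁻¹ • y) := by
    intro k
    rw [← congrFun (rescale_pd_pd Θ₀_ker.1 hR k k) y]; rfl
  rw [h2]
  simp only [h3, ← Finset.mul_sum]
  rw [rescale]
  linear_combination (-(R ^ 3)⁻¹) * h1

/-- The potential of the difference of two mollifications. -/
def pot (R : ℝ) (f : E3 → ℝ) (x : E3) : ℝ := R ^ 2 * cv (rescale Θ₀ R) f x

lemma pot_smp {R : ℝ} (hR : 0 < R) {f : E3 → ℝ} (hf : SmP f) : SmP (pot R f) :=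
  (hf.cv (Θ₀_ker.rescale hR)).const_mul _

lemma cv_sub_cv {R : ℝ} (hR : 0 < R) {f : E3 → ℝ} (hf : SmP f) (x : E3) :
    cv (rescale χ₀ R) f x - cv (rescale χ₀ (1 / 2 * R)) f x = ∑ k, pd k (pd k (pot R f)) x := by
  have hΘ := Θ₀_ker.rescale hR
  have k1 := (χ₀_moll.ker.rescale hR).integrable_mul hf.1.locInt x
  have k2 := (χ₀_moll.ker.rescale (ε := 1 / 2 * R) (by positivity)).integrable_mul hf.1.locInt x
  have e3 : cv (rescale χ₀ R) f x - cv (rescale χ₀ (1 / 2 * R)) f x =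
      cv (fun y => rescale χ₀ R y - rescale χ₀ (1 / 2 * R) y) f x := by
    simp only [cv, sub_mul]
    rw [integral_sub k1 k2]
  rw [e3, χ₀_rescale_sub hR]
  have e4 : cv (fun y => ∑ k, R ^ 2 * pd k (pd k (rescale Θ₀ R)) y) f x =
      ∑ k, cv (fun y => R ^ 2 * pd k (pd k (rescale Θ₀ R)) y) f x := by
    simp only [cv, Finset.sum_mul]
    exact integral_finsetSum _ fun k _ =>
      (((hΘ.pd k).pd k).const_mul (R ^ 2)).integrable_mul hf.1.locInt x
  rw [e4]
  refine Finset.sum_congr rfl fun k _ => ?_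
  have e5 : pot R f = fun x => R ^ 2 * cv (rescale Θ₀ R) f x := rfl
  rw [e5, pd_const_mul (hf.cv hΘ).1, pd_const_mul ((hf.cv hΘ).pd k).1, cv_const_mul_ker,
    pd_cv hΘ hf.1.locInt, pd_cv (hΘ.pd k) hf.1.locInt]

lemma poisson_kernel {a : E3 → ℝ} (ha : SmP a) {R : ℝ} (hR : 0 < R) (i j : Fin 3) (x : E3) :
    cv (rescale (rk i j) R) (fun x => ∑ k, pd k (pd k a) x) x =
      cv (rescale χ₀ R) (pd i (pd j a)) x - cv (rescale χ₀ (1 / 2 * R)) (pd i (pd j a)) x := by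
  have hΘ := Θ₀_ker.rescale hR
  have hg : SmP (pd i (pd j a)) := (ha.pd j).pd i
  rw [cv_sub_cv hR hg,
    congrFun (cv_sum ((rk_ker i j).rescale hR) fun k _ => ((ha.pd k).pd k).1.locInt) x]
  refine Finset.sum_congr rfl fun k _ => ?_
  have e : pot R (pd i (pd j a)) = fun x => R ^ 2 * cv (rescale Θ₀ R) (pd i (pd j a)) x := rfl
  rw [e, pd_const_mul (hg.cv hΘ).1, pd_const_mul ((hg.cv hΘ).pd k).1, pd_cv hΘ hg.1.locInt,
    pd_cv (hΘ.pd k) hg.1.locInt, cv_pd (hΘ.pd k) hg.1, cv_pd hΘ (hg.pd k).1, rk,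
    rescale_pd_pd Θ₀_ker.1 hR, cv_const_mul_ker, cv_pd (hΘ.pd j) ((ha.pd k).pd k).1,
    cv_pd hΘ (((ha.pd k).pd k).pd i).1, pd_comm ((ha.pd k).pd k).1 j i, pd_comm (ha.pd k).1 j k,
    pd_comm ((ha.pd k).pd j).1 i k, pd_comm ha.1 j k, pd_comm (ha.pd j).1 i k]

lemma tendsto_integral_cv_small {s A : ℝ} {q : ℝ≥0∞} {h g : E3 → ℝ} (hs : 0 < s) (hq : 1 ≤ q)
    (hh : Nik s q A h) (hg : SmP g) :
    Tendsto (fun N : ℕ => ∫ x in cell, h x * cv (rescale χ₀ ((1 / 2) ^ N)) g x) atTop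
      (𝓝 (∫ x in cell, h x * g x)) := by
  obtain ⟨B, hB⟩ := hg.nik le_rfl zero_le_one
  have h1 := (hh.mono_q hq).sm_tendsto le_rfl le_rfl hs
  have h2 := NT.tendsto_integral (NT.mul (p := 1) (q := ⊤) h1 (NT.const hB) le_top le_rfl)
  refine h2.congr fun N => ?_
  exact integral_cv_mul (χ₀_moll.ker.rescale (by positivity)) (rescale_even χ₀_moll.even) hh.per
    (hh.integrable hq) hg.continuous hg.per

lemma tendsto_integral_cv_large {s A : ℝ} {q : ℝ≥0∞} {h g : E3 → ℝ} (hq : 1 ≤ q)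
    (hh : Nik s q A h) (hg : SmP g) :
    Tendsto (fun N : ℕ => ∫ x in cell, h x * cv (rescale χ₀ (2 ^ N)) g x) atTop
      (𝓝 ((∫ x in cell, h x) * ∫ x in cell, g x)) := by
  have hi := hh.integrable hq
  obtain ⟨D, hD0, hD⟩ := eLpNorm_cv_large χ₀_moll.ker χ₀_moll.even
  obtain ⟨B, hB0, hB⟩ := hg.exists_bound
  have hb : ∀ N : ℕ, |(∫ x in cell, h x * cv (rescale χ₀ (2 ^ N)) g x) -
      (∫ x in cell, h x) * ∫ x in cell, g x| ≤ D / 2 ^ N * A * B := by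
    intro N
    have hk : Ker (rescale χ₀ (2 ^ N)) := χ₀_moll.ker.rescale (by positivity)
    have hc := cv_smp hk (hh.locInt hq) hh.per
    have h1 := hD (2 ^ N) (one_le_pow₀ one_le_two) le_rfl hh.per hh.meas hi
    rw [χ₀_moll.integral_eq, one_mul] at h1
    have h2 := h1.trans (mul_le_mul_right (hh.mono_q hq).bd _)
    rw [← ENNReal.ofReal_mul (by positivity)] at h2
    have h3 : eLpNorm g ⊤ cm ≤ ENNReal.ofReal B := by
      rw [eLpNorm_exponent_top]
      exact eLpNormEssSup_le_of_ae_bound (ae_of_all _ hB)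
    have h4 := abs_integral_mul_le (p := 1) (q := ⊤)
      (hc.continuous.sub continuous_const).aestronglyMeasurable
      hg.continuous.aestronglyMeasurable (mul_nonneg (by positivity) hh.nonneg) hB0 h2 h3
    have e : ∫ x in cell, (cv (rescale χ₀ (2 ^ N)) h x - ∫ y in cell, h y) * g x =
        (∫ x in cell, h x * cv (rescale χ₀ (2 ^ N)) g x) - (∫ x in cell, h x) * ∫ x in cell, g x := by
      simp only [sub_mul]
      rw [integral_sub (hc.mul hg).integrable (hg.integrable.const_mul _), integral_const_mul,
        integral_cv_mul hk (rescale_even χ₀_moll.even) hh.per hi hg.continuous hg.per]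
    rw [← e]; exact h4
  rw [tendsto_iff_norm_sub_tendsto_zero]
  refine squeeze_zero (fun _ => norm_nonneg _) hb ?_
  have : Tendsto (fun N : ℕ => D * A * B * (1 / 2) ^ N) atTop (𝓝 (D * A * B * 0)) :=
    (tendsto_pow_atTop_nhds_zero_of_lt_one (by norm_num) (by norm_num)).const_mul _
  rw [mul_zero] at this
  refine this.congr fun N => ?_
  rw [one_div, inv_pow]; field_simp

/-- The weak Poisson equation. -/
lemma rz_poisson {s A : ℝ} {q : ℝ≥0∞} {h a : E3 → ℝ} (hs : 0 < s) (hs1 : s ≤ 1) (hq : 1 ≤ q)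
    (hh : Nik s q A h) (ha : SmP a) (i j : Fin 3) :
    ∫ x in cell, rz (rk i j) h x * ∑ k, pd k (pd k a) x =
      - ∫ x in cell, h x * pd i (pd j a) x := by
  obtain ⟨C, hC0, hC⟩ := rz_spec (rk_ker i j) (rk_even i j) (rk_integral i j) hs hs1
  have hL : SmP (fun x => ∑ k, pd k (pd k a) x) := SmP.sum fun k _ => (ha.pd k).pd k
  have hg : SmP (pd i (pd j a)) := (ha.pd j).pd i
  have hi := hh.integrable hq
  set Φ : ℝ → ℝ := fun R => ∫ x in cell, h x * cv (rescale χ₀ R) (pd i (pd j a)) x with hΦ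
  have hker : ∀ {R : ℝ}, 0 < R → ∫ x in cell, cv (rescale (rk i j) R) h x *
      ∑ k, pd k (pd k a) x = Φ R - Φ (1 / 2 * R) := by
    intro R hR
    rw [integral_cv_mul ((rk_ker i j).rescale hR) (rescale_even (rk_even i j)) hh.per hi
      hL.continuous hL.per]
    simp only [poisson_kernel ha hR, mul_sub]
    exact integral_sub (Integrable.mul_smp hi (hg.cv (χ₀_moll.ker.rescale hR)))
      (Integrable.mul_smp hi (hg.cv (χ₀_moll.ker.rescale (by positivity))))
  have hblk : ∀ n, ∫ x in cell, blk (rk i j) n h x * ∑ k, pd k (pd k a) x =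
      (Φ ((1 / 2) ^ n) - Φ ((1 / 2) ^ (n + 1))) + (Φ (2 ^ (n + 1)) - Φ (2 ^ n)) := by
    intro n
    have k1 : Ker (rescale (rk i j) ((1 / 2) ^ n)) := (rk_ker i j).rescale (by positivity)
    have k2 : Ker (rescale (rk i j) (2 ^ (n + 1))) := (rk_ker i j).rescale (by positivity)
    simp only [blk, add_mul]
    rw [integral_add ((cv_smp k1 (hh.locInt hq) hh.per).mul hL).integrable
      ((cv_smp k2 (hh.locInt hq) hh.per).mul hL).integrable, hker (by positivity),
      hker (by positivity)]
    congr 3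
    · rw [pow_succ']
    · rw [pow_succ']; ring
  have hsum : ∀ N, ∑ n ∈ Finset.range N, ∫ x in cell, blk (rk i j) n h x * ∑ k, pd k (pd k a) x =
      Φ (2 ^ N) - Φ ((1 / 2) ^ N) := by
    intro N
    simp only [hblk, Finset.sum_add_distrib]
    rw [Finset.sum_range_sub' (fun n => Φ ((1 / 2) ^ n)), Finset.sum_range_sub (fun n => Φ (2 ^ n))]
    simp
  have t := ((hC hq hh).2.2 _ hL).tendsto_sum_nat
  simp only [hsum] at t
  have t2 := tendsto_integral_cv_large hq hh hg
  rw [integral_pd (ha.pd j), mul_zero] at t2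
  rw [tendsto_nhds_unique t (t2.sub (tendsto_integral_cv_small hs hq hh hg)), zero_sub]

/-! ### Uniform bounds for convolutions and adjoint kernels -/

lemma exists_cell_nhds (x : E3) : ∃ c : E3, c +ᵥ cell ∈ 𝓝 x := by
  set c : E3 := x - !₂[(1 / 2 : ℝ), 1 / 2, 1 / 2] with hc
  refine ⟨c, Filter.mem_of_superset (Metric.ball_mem_nhds x (ε := 1 / 2) (by norm_num))
    fun y hy => ?_⟩
  rw [Set.mem_vadd_set_iff_neg_vadd_mem]
  intro i
  have h1 : |y i - x i| < 1 / 2 := by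
    have h2 : ‖(y - x) i‖ ≤ ‖y - x‖ := PiLp.norm_apply_le (y - x) i
    rw [mem_ball_iff_norm] at hy
    simpa using h2.trans_lt hy
  have h2 : (-c +ᵥ y) i = y i - x i + 1 / 2 := by
    fin_cases i <;> simp [hc] <;> ring
  rw [h2, Set.mem_Ico]
  rw [abs_lt] at h1
  constructor <;> linarith

lemma lintegral_biUnion_finset_le {ι : Type*} (t : Finset ι) (S : ι → Set E3) (f : E3 → ℝ≥0∞) :
    ∫⁻ y in ⋃ x ∈ t, S x, f y ≤ ∑ x ∈ t, ∫⁻ y in S x, f y := by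
  classical
  induction t using Finset.induction_on with
  | empty => simp
  | insert a t ha ih =>
    rw [Finset.set_biUnion_insert, Finset.sum_insert ha]
    exact (lintegral_union_le _ _ _).trans (by gcongr)

lemma lintegral_ball_le (R : ℝ) : ∃ N : ℕ, ∀ f : E3 → ℝ≥0∞, IsPeriodic f →
    ∫⁻ y in Metric.closedBall 0 R, f y ≤ N * ∫⁻ x in cell, f x := by
  choose c hc using exists_cell_nhds
  obtain ⟨t, -, ht⟩ := (isCompact_closedBall (0 : E3) R).elim_nhds_subcover (fun x => c x +ᵥ cell)
    fun x _ => hc x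
  refine ⟨t.card, fun f hf => ?_⟩
  have h1 : ∀ a : E3, ∫⁻ y in a +ᵥ cell, f y = ∫⁻ x in cell, f x := fun a =>
    (isAddFundamentalDomain_vadd_cell a).setLIntegral_eq isAddFundamentalDomain_cell
      _ hf.lattice_vadd
  calc ∫⁻ y in Metric.closedBall 0 R, f y ≤ ∫⁻ y in ⋃ x ∈ t, (c x +ᵥ cell), f y :=
        lintegral_mono_set ht
    _ ≤ ∑ x ∈ t, ∫⁻ y in c x +ᵥ cell, f y := lintegral_biUnion_finset_le _ _ _
    _ = t.card * ∫⁻ x in cell, f x := by simp [h1]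

lemma Ker.lintegral_bound {K : E3 → ℝ} (hK : Ker K) : ∃ C : ℝ, 0 ≤ C ∧ ∀ f : E3 → ℝ, IsPeriodic f →
    Integrable f cm → ∀ x, ∫ y, |K y * f (x - y)| ≤ C * ∫ x in cell, |f x| := by
  obtain ⟨R, hR0, hR⟩ := hK.exists_radius
  obtain ⟨M, hM⟩ := hK.2.exists_bound_of_continuous hK.continuous
  obtain ⟨N, hN⟩ := lintegral_ball_le R
  have hM0 : 0 ≤ M := (norm_nonneg _).trans (hM 0)
  refine ⟨M * N, by positivity, fun f hf hi x => ?_⟩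
  have hl := hf.locallyIntegrable hi
  have hp : IsPeriodic (fun y => ‖f (y + x)‖ₑ) := fun y i => by
    simp only [add_right_comm, hf _ i]
  have hp0 : IsPeriodic (fun y => ‖f y‖ₑ) := fun y i => by simp only [hf _ i]
  have h1 := hN _ hp
  rw [hp0.lintegral_add x] at h1
  have e1 : ∫ y, |K y * f (x - y)| = (∫⁻ y, ‖K y * f (x - y)‖ₑ).toReal :=
    integral_norm_eq_lintegral_enorm (hK.integrable_mul hl x).1
  have e2 : ∫ x in cell, |f x| = (∫⁻ x in cell, ‖f x‖ₑ).toReal := integral_norm_eq_lintegral_enorm hi.1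
  rw [e1, e2]
  have h2 : ∫⁻ y, ‖K y * f (x - y)‖ₑ ≤ ENNReal.ofReal M * (N * ∫⁻ x in cell, ‖f x‖ₑ) := by
    rw [← lintegral_neg_eq_self]
    calc ∫⁻ y, ‖K (-y) * f (x - -y)‖ₑ ≤
          ∫⁻ y, (Metric.closedBall 0 R).indicator (fun y => ENNReal.ofReal M * ‖f (y + x)‖ₑ) y := by
          refine lintegral_mono fun y => ?_
          by_cases hy : y ∈ Metric.closedBall (0:E3) R
          · rw [indicator_of_mem hy, enorm_mul, sub_neg_eq_add, add_comm x]
            gcongr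
            rw [← ofReal_norm]
            exact ENNReal.ofReal_le_ofReal (hM _)
          · have : K (-y) = 0 := by
              by_contra h
              exact hy (mem_closedBall_zero_iff.2 (by simpa using hR _ h))
            simp [this]
      _ = ∫⁻ y in Metric.closedBall 0 R, ENNReal.ofReal M * ‖f (y + x)‖ₑ :=
          lintegral_indicator measurableSet_closedBall _
      _ = ENNReal.ofReal M * ∫⁻ y in Metric.closedBall 0 R, ‖f (y + x)‖ₑ :=
          lintegral_const_mul' _ _ ENNReal.ofReal_ne_top
      _ ≤ _ := by gcongr
  have hfin : ∫⁻ x in cell, ‖f x‖ₑ ≠ ⊤ := hi.2.ne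
  refine (ENNReal.toReal_mono (by finiteness) h2).trans (le_of_eq ?_)
  simp [ENNReal.toReal_mul, hM0, mul_assoc]

lemma Ker.abs_cv_le {K : E3 → ℝ} (hK : Ker K) : ∃ C : ℝ, 0 ≤ C ∧ ∀ f : E3 → ℝ, IsPeriodic f →
    Integrable f cm → ∀ x, |cv K f x| ≤ C * ∫ x in cell, |f x| := by
  obtain ⟨C, hC0, hC⟩ := hK.lintegral_bound
  exact ⟨C, hC0, fun f hf hi x => (abs_integral_le_integral_abs).trans (hC f hf hi x)⟩

lemma integrable_cv_prod_rough {K f g : E3 → ℝ} (hK : Ker K) (hfp : IsPeriodic f)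
    (hf : Integrable f cm) (hg : Integrable g cm) :
    Integrable (fun z : E3 × E3 => K z.2 * f (z.1 - z.2) * g z.1) (cm.prod volume) := by
  have hl := hfp.locallyIntegrable hf
  have hm : AEStronglyMeasurable (fun z : E3 × E3 => K z.2 * f (z.1 - z.2)) (cm.prod volume) :=
    (hK.continuous.comp continuous_snd).aestronglyMeasurable.mul
      (aesm_comp_sub hl.aestronglyMeasurable)
  have hm2 := hm.mul hg.1.comp_fst
  obtain ⟨C, hC0, hC⟩ := hK.lintegral_bound
  refine (integrable_prod_iff hm2).2 ⟨ae_of_all _ fun x => (hK.integrable_mul hl x).mul_const (g x), ?_⟩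
  refine (hg.norm.const_mul (C * ∫ x in cell, |f x|)).mono' hm2.norm.integral_prod_right' ?_
  refine ae_of_all _ fun x => ?_
  rw [Real.norm_of_nonneg (integral_nonneg fun _ => norm_nonneg _)]
  simp only [Pi.mul_apply, norm_mul _ (g _), integral_mul_const]
  exact mul_le_mul_of_nonneg_right (hC f hfp hf x) (norm_nonneg _)

/-- The adjoint of convolution. -/
lemma integral_cv_mul_refl {K f g : E3 → ℝ} (hK : Ker K) (hfp : IsPeriodic f)
    (hf : Integrable f cm) (hgp : IsPeriodic g) (hg : Integrable g cm) :
    ∫ x in cell, cv K f x * g x = ∫ x in cell, f x * cv (fun y => K (-y)) g x := by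
  have hK' : Ker (fun y => K (-y)) := ⟨hK.1.comp contDiff_neg, hK.2.comp_homeomorph (Homeomorph.neg E3)⟩
  have h1 := integrable_cv_prod_rough hK hfp hf hg
  have h2 := integrable_cv_prod_rough hK' hgp hg hf
  have e1 : ∫ x in cell, cv K f x * g x = ∫ y, ∫ x in cell, K y * f (x - y) * g x := by
    simp only [cv, ← integral_mul_const]
    exact integral_integral_swap h1
  have e2 : ∫ x in cell, f x * cv (fun y => K (-y)) g x =
      ∫ y, ∫ x in cell, K (-y) * g (x - y) * f x := by
    simp only [mul_comm (f _), cv, ← integral_mul_const]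
    exact integral_integral_swap (f := fun x y => K (-y) * g (x - y) * f x) h2
  rw [e1, e2, ← integral_neg_eq_self (fun y => ∫ x in cell, K (-y) * g (x - y) * f x)]
  congr 1; ext y
  have hp : IsPeriodic (fun x => K y * f (x - y) * g x) := fun x i => by
    simp only [add_sub_right_comm, hfp _ i, hgp _ i]
  rw [← hp.integral_add y]
  congr 1; ext x
  simp only [neg_neg, add_sub_cancel_right, sub_neg_eq_add]; ring

lemma integral_cv_even {K f g : E3 → ℝ} (hK : Ker K) (he : ∀ x, K (-x) = K x) (hfp : IsPeriodic f)
    (hf : Integrable f cm) (hgp : IsPeriodic g) (hg : Integrable g cm) :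
    ∫ x in cell, cv K f x * g x = ∫ x in cell, f x * cv K g x := by
  rw [integral_cv_mul_refl hK hfp hf hgp hg, funext he]

lemma integral_pd_cv {K f g : E3 → ℝ} (hK : Ker K) (he : ∀ x, K (-x) = K x) (hfp : IsPeriodic f)
    (hf : Integrable f cm) (hgp : IsPeriodic g) (hg : Integrable g cm) (j : Fin 3) :
    ∫ x in cell, pd j (cv K f) x * g x = - ∫ x in cell, f x * pd j (cv K g) x := by
  rw [pd_cv hK (hfp.locallyIntegrable hf), integral_cv_mul_refl (hK.pd j) hfp hf hgp hg,
    funext (pd_even hK.1 he j), pd_cv hK (hgp.locallyIntegrable hg), ← integral_neg]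
  congr 1; ext x
  have : (fun y => -pd j K y) = fun y => (-1) * pd j K y := by ext y; ring
  rw [this, cv_const_mul_ker]; ring

/-! ### Time dependent fields -/

/-- Lebesgue measure on the time interval. -/
abbrev tm (T : ℝ) : Measure ℝ := volume.restrict (Ioo 0 T)

instance (T : ℝ) : IsFiniteMeasure (tm T) := ⟨by simp⟩

/-- The solenoidal mean free fields `U`, with Nikolskii norms of order `s` bounded in `L³` of time
by `A` and with `L¹` norms bounded by `M`. -/
structure Flow (T s : ℝ) (A : ℝ → ℝ) (M : ℝ) (U : Fin 3 → ℝ → E3 → ℝ) : Prop where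
  lt : 1 / 2 < s
  lt_one : s < 1
  per : ∀ i t, IsPeriodic (U i t)
  jm : ∀ i, JM (tm T) (U i)
  one_le : ∀ t, 1 ≤ A t
  memLp : MemLp A 3 (tm T)
  nik : ∀ᵐ t ∂(tm T), ∀ i, Nik s 3 (A t) (U i t)
  wdiv : ∀ᵐ t ∂(tm T), WDiv (fun i => U i t)
  mean : ∀ᵐ t ∂(tm T), ∀ i, ∫ x in cell, U i t x = 0
  bdd : ∀ᵐ t ∂(tm T), ∀ i, eLpNorm (U i t) 1 cm ≤ ENNReal.ofReal M

lemma sobolevNorm_mono {F G : Type*} [NormedAddCommGroup F] [NormedAddCommGroup G] {s p : ℝ}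
    (hp : 0 ≤ p) {f : E3 → F} {g : E3 → G} (h : ∀ x, ‖f x‖ₑ ≤ ‖g x‖ₑ)
    (h2 : ∀ x y, ‖f x - f y‖ₑ ≤ ‖g x - g y‖ₑ) : sobolevNorm s p f ≤ sobolevNorm s p g := by
  unfold sobolevNorm
  have := h
  refine ENNReal.rpow_le_rpow (add_le_add (lintegral_mono fun x => ?_)
    (lintegral_mono fun x => lintegral_mono fun ξ => ?_)) (by positivity)
  · exact ENNReal.rpow_le_rpow (h x) hp
  · exact ENNReal.div_le_div_right (ENNReal.rpow_le_rpow (h2 _ _) hp) _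

lemma sobolevNorm_co {s p : ℝ} (hp : 0 ≤ p) (V : E3 → E3) (i : Fin 3) :
    sobolevNorm s p (co V i) ≤ sobolevNorm s p V := by
  have h : ∀ v : E3, ‖v i‖ₑ ≤ ‖v‖ₑ := fun v => by
    rw [← ofReal_norm, ← ofReal_norm]
    exact ENNReal.ofReal_le_ofReal (PiLp.norm_apply_le v i)
  exact sobolevNorm_mono hp (fun x => h _) fun x y => h (V x - V y)

lemma memLpSobolevPlus_components {T : ℝ} {r : ℝ≥0∞} {s p : ℝ} (hp : 1 ≤ p) (hr : r ≠ 0) (hs : 0 ≤ s)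
    {u : ℝ → E3 → E3}
    (h : MemLpSobolevPlus T r s p u) :
    (∀ i t, IsPeriodic (co (u t) i)) ∧ (∀ i, JM (tm T) (fun t => co (u t) i)) ∧
    ∃ s', s < s' ∧ s' < 1 ∧ ∃ A : ℝ → ℝ, (∀ t, 0 ≤ A t) ∧ MemLp A r (tm T) ∧
      ∀ᵐ t ∂(tm T), ∀ i, Nik s' (ENNReal.ofReal p) (A t) (co (u t) i) := by
  obtain ⟨hper, hm, s', hs1, hs2, hfin⟩ := h
  have hjm : ∀ i, JM (tm T) (fun t => co (u t) i) := fun i =>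
    (EuclideanSpace.proj (𝕜 := ℝ) i).continuous.comp_aestronglyMeasurable hm
  have hcp : ∀ i t, IsPeriodic (co (u t) i) := fun i t x k => by simp only [co, hper t x k]
  obtain ⟨C, hC0, hC⟩ := sobolev_nik hp (s := s') (by linarith)
  have hN := aemeasurable_sobolevNorm (s := s') (p := p) hm
  refine ⟨hcp, hjm, s', hs1, hs2, fun t => C * (sobolevNorm s' p (u t)).toReal,
    fun t => by positivity, ?_, ?_⟩
  · refine MemLp.const_mul ⟨hN.ennreal_toReal.aestronglyMeasurable, ?_⟩ C
    refine (eLpNorm_mono_enorm fun t => ?_).trans_lt hfin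
    rw [Real.enorm_eq_ofReal ENNReal.toReal_nonneg]
    exact ENNReal.ofReal_toReal_le
  · have hlt : ∀ᵐ t ∂(tm T), sobolevNorm s' p (u t) < ⊤ := by
      rcases eq_or_ne r ⊤ with rfl | hrt
      · rw [eLpNorm_exponent_top] at hfin
        filter_upwards [ae_le_eLpNormEssSup (f := fun t => sobolevNorm s' p (u t)) (μ := tm T)]
          with t ht using lt_of_le_of_lt ht hfin
      · rw [eLpNorm_lt_top_iff_lintegral_rpow_enorm_lt_top hr hrt] at hfin
        filter_upwards [ae_lt_top' (hN.pow_const r.toReal) hfin.ne] with t ht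
        exact (ENNReal.rpow_lt_top_iff_of_pos (ENNReal.toReal_pos hr hrt)).1 ht
    have hma : ∀ᵐ t ∂(tm T), ∀ i, AEStronglyMeasurable (co (u t) i) volume :=
      ae_all_iff.2 fun i => (hjm i).ae_meas
    filter_upwards [hlt, hma] with t h1 h2 i
    have h3 := sobolevNorm_co (s := s') (p := p) (by linarith) (u t) i
    exact (hC _ (hcp i t) (h2 i) (h3.trans_lt h1)).mono
      (mul_le_mul_of_nonneg_left (ENNReal.toReal_mono h1.ne h3) hC0)

lemma gradient_inner (χ : E3 → ℝ) (v x : E3) :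
    inner ℝ v (gradient χ x) = ∑ i, v i * pd i χ x := by
  rw [real_inner_comm, inner_gradient_left]
  have : v = ∑ i, v i • basisVec i := by
    ext j; simp [basisVec, Pi.single_apply]
  conv_lhs => rw [this]
  simp [map_sum, pd]

lemma flow_of_solution {T : ℝ} {u : ℝ → E3 → E3} {ω : ℝ → VecDistribution}
    (hsol : IsFunctionalVorticitySolution T u ω) (hreg : MemLpSobolevPlus T 3 (1 / 2) 3 u) :
    ∃ s A M, Flow T s A M (fun i t => co (u t) i) := by
  obtain ⟨hper, hjm, s, hs1, hs2, A, hA0, hA, hnik⟩ :=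
    memLpSobolevPlus_components (by norm_num) (by norm_num) (by norm_num) hreg
  obtain ⟨-, -, s₂, -, -, A₂, hA20, hA2, hnik2⟩ :=
    memLpSobolevPlus_components (by norm_num) (by norm_num) (by norm_num) hsol.regular
  have e3 : ENNReal.ofReal 3 = 3 := by simp
  rw [e3] at hnik
  have h2 : 1 ≤ ENNReal.ofReal 2 := by simp
  refine ⟨s, fun t => A t + 1, (eLpNorm A₂ ⊤ (tm T)).toReal, hs1, hs2, hper, hjm,
    fun t => by linarith [hA0 t], hA.add (memLp_const 1), ?_, ?_, ?_, ?_⟩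
  · filter_upwards [hnik] with t h i using (h i).mono (by linarith)
  · filter_upwards [hsol.div_u] with t h χ hχ
    rw [← h χ hχ.1 hχ.2]
    simp only [gradient_inner]; rfl
  · filter_upwards [hsol.meanFree, hnik] with t h hn i
    have hi : Integrable (u t) cm := by
      refine Integrable.of_eval_piLp fun i => ?_
      exact (hn i).integrable one_le_three
    have := (EuclideanSpace.proj (𝕜 := ℝ) i).integral_comp_comm hi
    rw [h, map_zero] at this
    exact this
  · have hb : ∀ᵐ t ∂(tm T), A₂ t ≤ (eLpNorm A₂ ⊤ (tm T)).toReal := by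
      have hf := hA2.2
      rw [eLpNorm_exponent_top] at hf ⊢
      filter_upwards [ae_le_eLpNormEssSup (f := A₂) (μ := tm T)] with t ht
      rw [Real.enorm_eq_ofReal (hA20 t)] at ht
      exact (ENNReal.ofReal_le_iff_le_toReal hf.ne).1 ht
    filter_upwards [hnik2, hb] with t h hb i
    exact ((h i).mono_q h2).bd.trans (ENNReal.ofReal_le_ofReal hb)

/-! ### The pressure -/

/-- The pressure of a solenoidal field. -/
def pr (v : Fin 3 → E3 → ℝ) (x : E3) : ℝ := ∑ i, ∑ j, rz (rk i j) (fun y => v i y * v j y) x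

lemma JM.ser {α : Type*} [MeasurableSpace α] {μ : Measure α} {F : ℕ → α → E3 → ℝ}
    (hF : ∀ n, JM μ (F n)) : JM μ (fun a => Helicity.ser (fun n => F n a)) := by
  choose g hg hfg using hF
  refine ⟨fun z => limUnder atTop (fun N => ∑ n ∈ Finset.range N, g n z),
    StronglyMeasurable.limUnder fun N => Finset.stronglyMeasurable_fun_sum _ fun n _ => hg n, ?_⟩
  filter_upwards [ae_all_iff.2 hfg] with z hz
  simp only [Helicity.ser, hz]

lemma rz_periodic (κ : E3 → ℝ) {h : E3 → ℝ} (hh : IsPeriodic h) : IsPeriodic (rz κ h) := fun x i => by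
  have : ∀ n, blk κ n h (x + basisVec i) = blk κ n h x := fun n => by
    simp only [blk, cv_periodic _ hh x i]
  simp only [rz, ser, this]

lemma pr_periodic {v : Fin 3 → E3 → ℝ} (hv : ∀ i, IsPeriodic (v i)) : IsPeriodic (pr v) :=
  fun x k => by
    refine Finset.sum_congr rfl fun i _ => Finset.sum_congr rfl fun j _ => ?_
    exact rz_periodic _ (fun y l => by simp only [hv i y l, hv j y l]) x k

lemma JM.rz {α : Type*} [MeasurableSpace α] {μ : Measure α} {F : α → E3 → ℝ} {κ : E3 → ℝ}
    (hκ : Ker κ) (hF : JM μ F) : JM μ (fun a => Helicity.rz κ (F a)) :=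
  JM.ser fun n => (hF.cv (hκ.rescale (ε := (1 / 2) ^ n) (by positivity)).continuous).add
    (hF.cv (hκ.rescale (ε := 2 ^ (n + 1)) (by positivity)).continuous)

lemma JM.pr {α : Type*} [MeasurableSpace α] {μ : Measure α} {U : Fin 3 → α → E3 → ℝ}
    (hU : ∀ i, JM μ (U i)) : JM μ (fun a => Helicity.pr (fun i => U i a)) :=
  JM.sum fun i _ => JM.sum fun j _ => JM.rz (rk_ker i j) ((hU i).mul (hU j))

lemma Nik.mul_self {s A : ℝ} {f g : E3 → ℝ} (hf : Nik s 3 A f) (hg : Nik s 3 A g) :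
    Nik s (3 / 2) (2 * (A * A)) (fun x => f x * g x) := hf.mul hg one_le_three_half

lemma pr_nik {s s' : ℝ} (hs' : 0 ≤ s') (hs : s' < s) (hs1 : s ≤ 1) :
    ∃ C, 0 ≤ C ∧ ∀ {A : ℝ} {v : Fin 3 → E3 → ℝ}, (∀ i, Nik s 3 A (v i)) →
      Nik s' (3 / 2) (C * A ^ 2) (pr v) := by
  choose C hC0 hC using fun i j =>
    rz_nik (rk_ker i j) (rk_even i j) (rk_integral i j) hs' hs hs1
  refine ⟨∑ i, ∑ j, C i j * 2, Finset.sum_nonneg fun i _ => Finset.sum_nonneg fun j _ => by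
    have := hC0 i j; positivity, fun {A v} hv => ?_⟩
  have h : Nik s' (3 / 2) (∑ i, ∑ j, C i j * (2 * (A * A))) (pr v) :=
    Nik.sum one_le_three_half fun i _ => Nik.sum one_le_three_half fun j _ =>
      hC i j one_le_three_half ((hv i).mul_self (hv j))
  refine h.mono (le_of_eq ?_)
  simp only [Finset.sum_mul]
  refine Finset.sum_congr rfl fun i _ => Finset.sum_congr rfl fun j _ => ?_
  ring

section pr

variable {s A : ℝ} {v : Fin 3 → E3 → ℝ}

lemma rz_integrable (hs : 0 < s) (hs1 : s ≤ 1) (hv : ∀ i, Nik s 3 A (v i)) (i j : Fin 3) :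
    Integrable (rz (rk i j) (fun y => v i y * v j y)) cm := by
  obtain ⟨C, hC0, hC⟩ := rz_nik (rk_ker i j) (rk_even i j) (rk_integral i j) le_rfl hs hs1
  exact (hC one_le_three_half ((hv i).mul_self (hv j))).integrable one_le_three_half

lemma integral_pr (hs : 0 < s) (hs1 : s ≤ 1) (hv : ∀ i, Nik s 3 A (v i)) :
    ∫ x in cell, pr v x = 0 := by
  have hi := rz_integrable hs hs1 hv
  simp only [pr]
  rw [integral_finsetSum _ fun i _ => integrable_finsetSum _ fun j _ => hi i j]
  refine Finset.sum_eq_zero fun i _ => ?_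
  rw [integral_finsetSum _ fun j _ => hi i j]
  exact Finset.sum_eq_zero fun j _ => integral_rz (rk_ker i j) (rk_even i j) (rk_integral i j) hs hs1
    one_le_three_half ((hv i).mul_self (hv j))

lemma pr_poisson (hs : 0 < s) (hs1 : s ≤ 1) (hv : ∀ i, Nik s 3 A (v i)) {a : E3 → ℝ} (ha : SmP a) :
    ∫ x in cell, pr v x * ∑ k, pd k (pd k a) x =
      - ∑ i, ∑ j, ∫ x in cell, v i x * v j x * pd i (pd j a) x := by
  have hL : SmP (fun x => ∑ k, pd k (pd k a) x) := SmP.sum fun k _ => (ha.pd k).pd k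
  have hi := fun i j => Integrable.mul_smp (rz_integrable hs hs1 hv i j) hL
  simp only [pr, Finset.sum_mul]
  rw [integral_finsetSum _ fun i _ => integrable_finsetSum _ fun j _ => hi i j,
    ← Finset.sum_neg_distrib]
  refine Finset.sum_congr rfl fun i _ => ?_
  rw [integral_finsetSum _ fun j _ => hi i j, ← Finset.sum_neg_distrib]
  exact Finset.sum_congr rfl fun j _ => rz_poisson hs hs1 one_le_three_half
    ((hv i).mul_self (hv j)) ha i j

end pr

lemma Flow.pressure_regular {T s : ℝ} {A : ℝ → ℝ} {M : ℝ} {U : Fin 3 → ℝ → E3 → ℝ}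
    (h : Flow T s A M U) :
    MemLpSobolevPlus T (3 / 2) (1 / 2) (3 / 2) (fun t => pr (fun i => U i t)) := by
  have h1 := h.lt
  have h2 := h.lt_one
  set s₁ := (1 / 2 + s) / 2 with hs₁
  set s₂ := (1 / 2 + s₁) / 2 with hs₂
  obtain ⟨C, hC0, hC⟩ := pr_nik (s' := s₁) (s := s) (by linarith) (by linarith) h2.le
  obtain ⟨D, hD0, hD⟩ := nik_sobolev (p := 3 / 2) (s := s₁) (s' := s₂) (by norm_num) (by linarith)
  have e : ENNReal.ofReal (3 / 2) = 3 / 2 := by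
    rw [ENNReal.ofReal_div_of_pos (by norm_num)]; simp
  rw [e] at hD
  refine ⟨fun t => pr_periodic fun i => h.per i t, JM.pr h.jm, s₂, by linarith, by linarith, ?_⟩
  have hA2 : MemLp (fun t => D * (C * (A t * A t))) (3 / 2) (tm T) :=
    ((h.memLp.mul' h.memLp).const_mul C).const_mul D
  refine lt_of_le_of_lt (eLpNorm_mono_enorm_ae ?_) hA2.2
  filter_upwards [h.nik] with t ht
  rw [enorm_eq_self]
  refine (hD (hC ht)).trans_eq ?_
  have := h.one_le t
  rw [Real.enorm_eq_ofReal (by positivity), pow_two]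

/-! ### Calculus of space-time test functions -/

lemma fderiv_joint {F : Type*} [NormedAddCommGroup F] [NormedSpace ℝ F] {z : ℝ → E3 → F}
    (hz : Differentiable ℝ (fun w : ℝ × E3 => z w.1 w.2)) (t : ℝ) (x : E3) :
    fderiv ℝ (z t) x = (fderiv ℝ (fun w : ℝ × E3 => z w.1 w.2) (t, x)).comp
      (ContinuousLinearMap.inr ℝ ℝ E3) := by
  have h1 : HasFDerivAt (fun y : E3 => (t, y)) (ContinuousLinearMap.inr ℝ ℝ E3) x := by
    simpa using hasFDerivAt_prodMk_right t x
  exact ((hz (t, x)).hasFDerivAt.comp x h1).fderiv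

lemma timeDeriv_joint {F : Type*} [NormedAddCommGroup F] [NormedSpace ℝ F] {z : ℝ → E3 → F}
    (hz : Differentiable ℝ (fun w : ℝ × E3 => z w.1 w.2)) (t : ℝ) (x : E3) :
    HasDerivAt (fun τ => z τ x) (fderiv ℝ (fun w : ℝ × E3 => z w.1 w.2) (t, x) (1, 0)) t := by
  have h1 : HasFDerivAt (fun τ : ℝ => (τ, x)) (ContinuousLinearMap.inl ℝ ℝ E3) t := by
    simpa using hasFDerivAt_prodMk_left t x
  have := ((hz (t, x)).hasFDerivAt.comp t h1).hasDerivAt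
  simpa using! this

lemma fderiv_apply_comm {W : Type*} [NormedAddCommGroup W] [NormedSpace ℝ W] {f : W → ℝ}
    (hf : ContDiff ℝ (⊤ : ℕ∞) f) (a b : W) (x : W) :
    fderiv ℝ (fun y => fderiv ℝ f y a) x b = fderiv ℝ (fun y => fderiv ℝ f y b) x a := by
  have key : ∀ a b x, fderiv ℝ (fun y => fderiv ℝ f y a) x b = fderiv ℝ (fderiv ℝ f) x b a := by
    intro a b x
    have h : DifferentiableAt ℝ (fderiv ℝ f) x :=
      ((hf.fderiv_right (m := (⊤ : ℕ∞)) (by simp)).differentiable (by simp)) x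
    rw [fderiv_clm_apply h (differentiableAt_const _)]
    simp
  rw [key, key]
  exact (hf.contDiffAt.isSymmSndFDerivAt (by
    simp only [minSmoothness_of_isRCLikeNormedField]
    exact WithTop.coe_le_coe.2 (le_top : (2 : ℕ∞) ≤ ⊤))).eq _ _

lemma fderiv_apply_smooth {W F : Type*} [NormedAddCommGroup W] [NormedSpace ℝ W]
    [NormedAddCommGroup F] [NormedSpace ℝ F] {f : W → F}
    (hf : ContDiff ℝ (⊤ : ℕ∞) f) (a : W) : ContDiff ℝ (⊤ : ℕ∞) (fun y => fderiv ℝ f y a) :=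
  (hf.fderiv_right (m := (⊤ : ℕ∞)) (by simp)).clm_apply contDiff_const

namespace IsTest

variable {T : ℝ} {z y : ℝ → E3 → ℝ}

lemma diff (hz : IsTest T z) : Differentiable ℝ (fun w : ℝ × E3 => z w.1 w.2) :=
  hz.smooth.differentiable (by simp)

lemma smp (hz : IsTest T z) (t : ℝ) : SmP (z t) :=
  ⟨hz.smooth.comp (contDiff_const.prodMk contDiff_id), hz.periodic t⟩

lemma hasDerivAt (hz : IsTest T z) (t : ℝ) (x : E3) :
    HasDerivAt (fun τ => z τ x) (timeDeriv z t x) t :=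
  (timeDeriv_joint hz.diff t x).differentiableAt.hasDerivAt

lemma timeDeriv_eq (hz : IsTest T z) : timeDeriv z =
    fun t x => fderiv ℝ (fun w : ℝ × E3 => z w.1 w.2) (t, x) (1, 0) := by
  ext t x; exact (timeDeriv_joint hz.diff t x).deriv

lemma pd_eq (hz : IsTest T z) (j : Fin 3) : (fun t => Helicity.pd j (z t)) =
    fun t x => fderiv ℝ (fun w : ℝ × E3 => z w.1 w.2) (t, x) (0, basisVec j) := by
  ext t x
  simp [Helicity.pd, fderiv_joint hz.diff t x]

lemma td (hz : IsTest T z) : IsTest T (timeDeriv z) := by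
  refine ⟨?_, fun t x i => ?_, ?_⟩
  · rw [hz.timeDeriv_eq]; exact fderiv_apply_smooth hz.smooth _
  · simp only [timeDeriv, hz.periodic _ x i]
  · obtain ⟨a, b, ha, hb, h⟩ := hz.support
    refine ⟨a, b, ha, hb, fun t ht x => ?_⟩
    have : (fun τ => z τ x) =ᶠ[𝓝 t] fun _ => 0 := by
      filter_upwards [isClosed_Icc.isOpen_compl.mem_nhds ht] with τ hτ using h τ hτ x
    rw [timeDeriv, this.deriv_eq, deriv_const]

lemma pd (hz : IsTest T z) (j : Fin 3) : IsTest T (fun t => pd j (z t)) := by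
  refine ⟨?_, fun t => pd_periodic (hz.periodic t) j, ?_⟩
  · have := hz.pd_eq j
    have e : (fun w : ℝ × E3 => Helicity.pd j (z w.1) w.2) =
        fun w => fderiv ℝ (fun w : ℝ × E3 => z w.1 w.2) w (0, basisVec j) := by
      ext w; exact congrFun (congrFun this w.1) w.2
    rw [e]
    exact fderiv_apply_smooth hz.smooth _
  · obtain ⟨a, b, ha, hb, h⟩ := hz.support
    refine ⟨a, b, ha, hb, fun t ht x => ?_⟩
    have : z t = fun _ => 0 := funext (h t ht)
    rw [this, pd_const]

lemma td_pd (hz : IsTest T z) (j : Fin 3) :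
    timeDeriv (fun t => Helicity.pd j (z t)) = fun t => Helicity.pd j (timeDeriv z t) := by
  rw [(hz.pd j).timeDeriv_eq, hz.td.pd_eq, hz.timeDeriv_eq]
  ext t x
  have e := hz.pd_eq j
  have e' : (fun w : ℝ × E3 => Helicity.pd j (z w.1) w.2) =
        fun w => fderiv ℝ (fun w : ℝ × E3 => z w.1 w.2) w (0, basisVec j) := by
      ext w; exact congrFun (congrFun e w.1) w.2
  rw [e']
  exact fderiv_apply_comm hz.smooth _ _ _

lemma add (hz : IsTest T z) (hy : IsTest T y) : IsTest T (fun t x => z t x + y t x) := by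
  obtain ⟨a, b, ha, hb, h⟩ := hz.support
  obtain ⟨c, d, hc, hd, h'⟩ := hy.support
  refine ⟨hz.smooth.add hy.smooth, fun t x i => by simp only [hz.periodic t x i, hy.periodic t x i],
    min a c, max b d, lt_min ha hc, max_lt hb hd, fun t ht x => ?_⟩
  have h1 : t ∉ Icc a b := fun h => ht ⟨(min_le_left _ _).trans h.1, h.2.trans (le_max_left _ _)⟩
  have h2 : t ∉ Icc c d := fun h => ht ⟨(min_le_right _ _).trans h.1, h.2.trans (le_max_right _ _)⟩
  rw [h t h1, h' t h2, add_zero]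

lemma const_mul (hz : IsTest T z) (c : ℝ) : IsTest T (fun t x => c * z t x) := by
  obtain ⟨a, b, ha, hb, h⟩ := hz.support
  exact ⟨contDiff_const.mul hz.smooth, fun t x i => by simp only [hz.periodic t x i], a, b, ha, hb,
    fun t ht x => by rw [h t ht, mul_zero]⟩

lemma sub (hz : IsTest T z) (hy : IsTest T y) : IsTest T (fun t x => z t x - y t x) := by
  have := hz.add (hy.const_mul (-1))
  refine (by simpa [sub_eq_add_neg] using this)

lemma zero : IsTest T (fun (_ : ℝ) (_ : E3) => (0 : ℝ)) :=
  ⟨contDiff_const, fun _ _ _ => rfl, 1, T - 1, one_pos, by linarith, fun _ _ _ => rfl⟩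

/-- Multiplication by a smooth function of space and time. -/
lemma mul_smooth (hz : IsTest T z) {c : ℝ → E3 → ℝ}
    (hc : ContDiff ℝ (⊤ : ℕ∞) (fun w : ℝ × E3 => c w.1 w.2)) (hp : ∀ t, IsPeriodic (c t)) :
    IsTest T (fun t x => c t x * z t x) := by
  obtain ⟨a, b, ha, hb, h⟩ := hz.support
  exact ⟨hc.mul hz.smooth, fun t x i => by simp only [hz.periodic t x i, hp t x i], a, b, ha, hb,
    fun t ht x => by rw [h t ht, mul_zero]⟩

lemma exists_bound (hz : IsTest T z) : ∃ B, 0 ≤ B ∧ ∀ t x, |z t x| ≤ B := by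
  obtain ⟨a, b, ha, hb, h⟩ := hz.support
  have hc : ContinuousOn (fun w : ℝ × E3 => z w.1 w.2) (Icc a b ×ˢ Metric.closedBall 0 2) :=
    hz.smooth.continuous.continuousOn
  obtain ⟨C, hC⟩ := (isCompact_Icc.prod (isCompact_closedBall (0 : E3) 2)).exists_bound_of_continuousOn hc
  refine ⟨max C 0, le_max_right _ _, fun t x => ?_⟩
  by_cases ht : t ∈ Icc a b
  · obtain ⟨x', hx', e⟩ := (hz.periodic t).exists_mem_cell x
    rw [← e]
    exact (hC (t, x') ⟨ht, cell_subset_closedBall hx'⟩).trans (le_max_left _ _)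
  · rw [h t ht]; simp

lemma exists_lipschitz (hz : IsTest T z) : ∃ L, 0 ≤ L ∧ ∀ t x y, |z t x - z t y| ≤ L * ‖x - y‖ := by
  choose D hD0 hD using fun j => (hz.pd j).exists_bound
  refine ⟨∑ j, D j, Finset.sum_nonneg fun j _ => hD0 j, fun t x y => ?_⟩
  refine Convex.norm_image_sub_le_of_norm_fderiv_le (𝕜 := ℝ) (s := univ)
    (fun x _ => (hz.smp t).smooth.diff x) (fun x _ => ?_) convex_univ (mem_univ y) (mem_univ x)
  refine ContinuousLinearMap.opNorm_le_bound _ (Finset.sum_nonneg fun j _ => hD0 j) fun v => ?_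
  have hv : v = ∑ i, v i • basisVec i := by
    ext j; simp [basisVec, Pi.single_apply]
  conv_lhs => rw [hv]
  rw [map_sum, Finset.sum_mul]
  refine (norm_sum_le _ _).trans (Finset.sum_le_sum fun j _ => ?_)
  rw [map_smul, norm_smul, mul_comm]
  exact mul_le_mul (hD j t x) (PiLp.norm_apply_le v j) (norm_nonneg _) (hD0 j)

lemma exists_nik (hz : IsTest T z) {s : ℝ} (h0 : 0 ≤ s) (h1 : s ≤ 1) :
    ∃ B, 0 ≤ B ∧ ∀ t, Nik s ⊤ B (z t) := by
  obtain ⟨C, hC0, hC⟩ := hz.exists_bound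
  obtain ⟨L, -, hL⟩ := hz.exists_lipschitz
  exact ⟨2 * C + |L|, by positivity, fun t => Nik.of_lipschitz h0 h1 (hz.smp t) (hC t) (hL t)⟩

lemma jm (hz : IsTest T z) {μ : Measure ℝ} : JM μ z := hz.smooth.continuous.aestronglyMeasurable

lemma td_add (hz : IsTest T z) (hy : IsTest T y) :
    timeDeriv (fun t x => z t x + y t x) = fun t x => timeDeriv z t x + timeDeriv y t x := by
  ext t x; exact ((hz.hasDerivAt t x).add (hy.hasDerivAt t x)).deriv

lemma td_sub (hz : IsTest T z) (hy : IsTest T y) :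
    timeDeriv (fun t x => z t x - y t x) = fun t x => timeDeriv z t x - timeDeriv y t x := by
  ext t x; exact ((hz.hasDerivAt t x).sub (hy.hasDerivAt t x)).deriv

lemma td_const_mul (hz : IsTest T z) (c : ℝ) :
    timeDeriv (fun t x => c * z t x) = fun t x => c * timeDeriv z t x := by
  ext t x; exact ((hz.hasDerivAt t x).const_mul c).deriv

lemma cv (hz : IsTest T z) {K : E3 → ℝ} (hK : Ker K) : IsTest T (fun t => cv K (z t)) := by
  refine ⟨?_, fun t => cv_periodic K (hz.periodic t), ?_⟩
  · set g : (ℝ × E3) → E3 → ℝ := fun w y => K (-y) * z w.1 (w.2 + y) with hg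
    have h := contDiffOn_convolution_right_with_param_comp (n := ⊤) (μ := (volume : Measure E3))
      (ContinuousLinearMap.mul ℝ ℝ) (s := (univ : Set (ℝ × E3)))
      (v := fun _ => (0 : E3)) contDiffOn_const (f := fun _ : E3 => (1:ℝ)) (g := g)
      (k := -tsupport K) isOpen_univ hK.2.isCompact.neg (fun w y _ hy => by
        have : K (-y) = 0 := by
          by_contra h
          exact hy (subset_tsupport K h)
        simp [hg, this]) (continuous_const.locallyIntegrable) (by
        refine ContDiff.contDiffOn ?_
        have h1 : ContDiff ℝ (⊤ : ℕ∞) (fun q : (ℝ × E3) × E3 => K (-q.2)) :=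
          hK.1.comp (contDiff_snd.neg)
        have h2 : ContDiff ℝ (⊤ : ℕ∞) (fun q : (ℝ × E3) × E3 => z q.1.1 (q.1.2 + q.2)) :=
          hz.smooth.comp ((contDiff_fst.comp contDiff_fst).prodMk
            ((contDiff_snd.comp contDiff_fst).add contDiff_snd))
        exact h1.mul h2)
    rw [contDiffOn_univ] at h
    have e : (fun w : ℝ × E3 => Helicity.cv K (z w.1) w.2) =
        fun w => convolution (fun _ => (1:ℝ)) (g w) (ContinuousLinearMap.mul ℝ ℝ) volume 0 := by
      ext w
      simp [Helicity.cv, convolution, hg, sub_eq_add_neg]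
    rw [e]; exact h
  · obtain ⟨a, b, ha, hb, h⟩ := hz.support
    refine ⟨a, b, ha, hb, fun t ht x => ?_⟩
    simp [Helicity.cv, h t ht]

lemma td_cv (hz : IsTest T z) {K : E3 → ℝ} (hK : Ker K) :
    timeDeriv (fun t => Helicity.cv K (z t)) = fun t => Helicity.cv K (timeDeriv z t) := by
  ext t x
  obtain ⟨B, hB0, hB⟩ := hz.td.exists_bound
  refine (hasDerivAt_integral_of_dominated_loc_of_deriv_le (μ := volume)
    (F := fun τ y => K y * z τ (x - y)) (F' := fun τ y => K y * timeDeriv z τ (x - y))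
    (bound := fun y => |K y| * B) (s := univ) univ_mem ?_ ?_ ?_ ?_ ?_ ?_).2.deriv
  · refine Eventually.of_forall fun τ => Continuous.aestronglyMeasurable ?_
    exact hK.continuous.mul ((hz.smp τ).continuous.comp (continuous_const.sub continuous_id))
  · exact hK.integrable_mul (hz.smp t).1.locInt x
  · exact (hK.integrable_mul (hz.td.smp t).1.locInt x).1
  · refine ae_of_all _ fun y τ _ => ?_
    rw [norm_mul]
    exact mul_le_mul_of_nonneg_left (hB _ _) (norm_nonneg _)
  · exact hK.integrable.abs.mul_const B
  · exact ae_of_all _ fun y τ _ => (hz.hasDerivAt τ (x - y)).const_mul (K y)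

end IsTest

/-- The vector field with given components. -/
def vec (z : Fin 3 → E3 → ℝ) (x : E3) : E3 := WithLp.toLp 2 (fun i => z i x)

lemma isTest_vec {T : ℝ} {z : Fin 3 → ℝ → E3 → ℝ} (hz : ∀ i, IsTest T (z i)) :
    IsTest T (fun t => vec (fun i => z i t)) := by
  choose a b ha hb h using fun i => (hz i).support
  refine ⟨?_, fun t x k => ?_, min (a 0) (min (a 1) (a 2)), max (b 0) (max (b 1) (b 2)), ?_, ?_,
    fun t ht x => ?_⟩
  · rw [contDiff_euclidean]; exact fun i => (hz i).smooth
  · simp only [vec, (hz _).periodic t x k]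
  · simp [ha]
  · simp [hb]
  · ext i
    refine h i t (fun hi => ht ?_) x
    have h1 : min (a 0) (min (a 1) (a 2)) ≤ a i := by fin_cases i <;> simp
    have h2 : b i ≤ max (b 0) (max (b 1) (b 2)) := by fin_cases i <;> simp
    exact ⟨h1.trans hi.1, hi.2.trans h2⟩

lemma IsTest.component {T : ℝ} {ζ : ℝ → E3 → E3} (hζ : IsTest T ζ) (i : Fin 3) :
    IsTest T (fun t => co (ζ t) i) := by
  obtain ⟨a, b, ha, hb, h⟩ := hζ.support
  exact ⟨(EuclideanSpace.proj (𝕜 := ℝ) i).contDiff.comp hζ.smooth,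
    fun t x k => by simp only [co, hζ.periodic t x k], a, b, ha, hb,
    fun t ht x => by simp [co, h t ht]⟩

lemma IsTest.timeDeriv_component {T : ℝ} {ζ : ℝ → E3 → E3} (hζ : IsTest T ζ) (i : Fin 3) (t : ℝ) (x : E3) :
    timeDeriv ζ t x i = timeDeriv (fun t => co (ζ t) i) t x := by
  have h := timeDeriv_joint (hζ.smooth.differentiable (by simp)) t x
  have h2 := (EuclideanSpace.proj (𝕜 := ℝ) i).hasFDerivAt.comp_hasDerivAt t h
  rw [timeDeriv, h.deriv]
  exact h2.deriv.symm

lemma fderiv_component {V : E3 → E3} (hV : ∀ i, SmP (co V i)) (x v : E3) (i : Fin 3) :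
    fderiv ℝ V x v i = ∑ j, v j * pd j (co V i) x := by
  have hd := (mem_testFields_of_co hV).1
  have hv : v = ∑ i, v i • basisVec i := by
    ext j; simp [basisVec, Pi.single_apply]
  conv_lhs => rw [hv]
  simp only [map_sum, map_smul, PiLp.smul_apply, WithLp.ofLp_sum, Finset.sum_apply, smul_eq_mul]
  refine Finset.sum_congr rfl fun j _ => ?_
  rw [← partialD_eq hd j i x]; rfl

/-! ### The momentum functional at a fixed time -/

/-- The momentum functional `∫ v · w + v ⊗ v : ∇z + P div z`. -/
def mo (v : Fin 3 → E3 → ℝ) (P : E3 → ℝ) (w z : Fin 3 → E3 → ℝ) : ℝ :=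
  (∑ i, ∫ x in cell, v i x * w i x) + (∑ i, ∑ j, ∫ x in cell, v i x * v j x * pd j (z i) x) +
    ∑ i, ∫ x in cell, P x * pd i (z i) x

/-- The field `(∇ψ - ∇ψᵀ) v = (∇ × ψ) × v`. -/
def rot (ψ v : Fin 3 → E3 → ℝ) (i : Fin 3) (x : E3) : ℝ :=
  ∑ j, v j x * (pd j (ψ i) x - pd i (ψ j) x)

section

variable {s s' A D : ℝ} {v : Fin 3 → E3 → ℝ} {P : E3 → ℝ} {w w' z z' : Fin 3 → E3 → ℝ}

lemma Nik.abs_integral_le {q : ℝ≥0∞} {f g : E3 → ℝ} {B : ℝ} (hf : Nik s q A f) (hq : 1 ≤ q)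
    (hg : AEStronglyMeasurable g cm) (hB0 : 0 ≤ B) (hB : ∀ x, |g x| ≤ B) :
    |∫ x in cell, f x * g x| ≤ A * B := by
  have h3 : eLpNorm g ⊤ cm ≤ ENNReal.ofReal B := by
    rw [eLpNorm_exponent_top]
    exact eLpNormEssSup_le_of_ae_bound (ae_of_all _ hB)
  exact abs_integral_mul_le (p := 1) (q := ⊤) hf.meas' hg hf.nonneg hB0 (hf.mono_q hq).bd h3

lemma abs_mo_le (hv : ∀ i, Nik s 3 A (v i)) (hP : Nik s' (3 / 2) D P) {B : ℝ} (hB0 : 0 ≤ B)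
    (hw : ∀ i, SmP (w i)) (hz : ∀ i, SmP (z i)) (hwB : ∀ i x, |w i x| ≤ B)
    (hzB : ∀ i j x, |pd j (z i) x| ≤ B) : |mo v P w z| ≤ (3 * A + 18 * A ^ 2 + 3 * D) * B := by
  have h1 : |∑ i, ∫ x in cell, v i x * w i x| ≤ ∑ _i : Fin 3, A * B :=
    (Finset.abs_sum_le_sum_abs _ _).trans (Finset.sum_le_sum fun i _ =>
      (hv i).abs_integral_le one_le_three (hw i).continuous.aestronglyMeasurable hB0 (hwB i))
  have h2 : |∑ i, ∑ j, ∫ x in cell, v i x * v j x * pd j (z i) x| ≤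
      ∑ _i : Fin 3, ∑ _j : Fin 3, 2 * (A * A) * B :=
    (Finset.abs_sum_le_sum_abs _ _).trans (Finset.sum_le_sum fun i _ =>
      (Finset.abs_sum_le_sum_abs _ _).trans (Finset.sum_le_sum fun j _ =>
        ((hv i).mul_self (hv j)).abs_integral_le one_le_three_half
          ((hz i).pd j).continuous.aestronglyMeasurable hB0 (hzB i j)))
  have h3 : |∑ i, ∫ x in cell, P x * pd i (z i) x| ≤ ∑ _i : Fin 3, D * B :=
    (Finset.abs_sum_le_sum_abs _ _).trans (Finset.sum_le_sum fun i _ =>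
      hP.abs_integral_le one_le_three_half
        ((hz i).pd i).continuous.aestronglyMeasurable hB0 (hzB i i))
  simp only [Finset.sum_const, Finset.card_univ, Fintype.card_fin, nsmul_eq_mul] at h1 h2 h3
  push_cast at h1 h2 h3
  rw [mo]
  refine (abs_add_three _ _ _).trans ?_
  linarith

lemma integral_mul_sub {f g h : E3 → ℝ} (hf : Integrable f cm) (hg : SmP g) (hh : SmP h) :
    ∫ x in cell, f x * (g x - h x) = (∫ x in cell, f x * g x) - ∫ x in cell, f x * h x := by
  simp only [mul_sub]
  exact integral_sub (Integrable.mul_smp hf hg) (Integrable.mul_smp hf hh)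

lemma mo_sub (hv : ∀ i, Nik s 3 A (v i)) (hP : Nik s' (3 / 2) D P)
    (hw : ∀ i, SmP (w i)) (hz : ∀ i, SmP (z i)) (hw' : ∀ i, SmP (w' i)) (hz' : ∀ i, SmP (z' i)) :
    mo v P (fun i x => w i x - w' i x) (fun i x => z i x - z' i x) = mo v P w z - mo v P w' z' := by
  simp only [mo, pd_sub (hz _).1 (hz' _).1]
  have e1 := fun i => integral_mul_sub ((hv i).integrable one_le_three) (hw i) (hw' i)
  have e2 := fun i j => integral_mul_sub (((hv i).mul_self (hv j)).integrable one_le_three_half)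
    ((hz i).pd j) ((hz' i).pd j)
  have e3 := fun i => integral_mul_sub (hP.integrable one_le_three_half) ((hz i).pd i) ((hz' i).pd i)
  simp only [e1, e2, e3, Finset.sum_sub_distrib]
  ring

lemma mo_grad (hs : 0 < s) (hs1 : s ≤ 1) (hv : ∀ i, Nik s 3 A (v i)) (hd : WDiv v)
    {a a' : E3 → ℝ} (ha : SmP a) (ha' : SmP a') :
    mo v (pr v) (fun i => pd i a') (fun i => pd i a) = 0 := by
  have h1 := hd a' ha'
  rw [integral_finsetSum _ fun i _ => Integrable.mul_smp ((hv i).integrable one_le_three) (ha'.pd i)] at h1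
  have h2 := pr_poisson hs hs1 hv ha
  obtain ⟨C, hC0, hC⟩ := pr_nik le_rfl hs hs1
  simp only [Finset.mul_sum] at h2
  rw [integral_finsetSum _ fun i _ => Integrable.mul_smp ((hC hv).integrable one_le_three_half)
    ((ha.pd i).pd i)] at h2
  rw [mo, h1, h2]
  simp only [pd_comm ha.1]
  ring

lemma rot_smp {ψ : Fin 3 → E3 → ℝ} (hψ : ∀ i, SmP (ψ i)) (hv : ∀ i, SmP (v i)) (i : Fin 3) :
    SmP (rot ψ v i) :=
  SmP.sum fun j _ => (hv j).mul (((hψ i).pd j).sub ((hψ j).pd i))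

lemma Bc_rot_smooth {ψ : Fin 3 → E3 → ℝ} (hψ : ∀ i, SmP (ψ i)) (hv : ∀ i, SmP (v i))
    (hdiv : ∀ x, ∑ j, pd j (v j) x = 0) :
    Bc v (rot ψ v) = ∫ x in cell, ∑ i, ∑ j, v i x * v j x * pd j (curlS ψ i) x := by
  have hc := curlS_smp hψ
  have h1 := integral_tensor hv hdiv hc
  have hq := sq_smp hv
  have h2 := integral_transport hc (curlS_div hψ) (SmP.const 1) hq
  have h3 : ∫ x in cell, adv (sq v) (curlS ψ) x = 0 := by
    simpa [pd_const] using h2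
  rw [Bc_smooth hv (rot_smp hψ hv)]
  have e : ∀ x, ∑ i, curlS v i x * rot ψ v i x =
      1 / 2 * adv (sq v) (curlS ψ) x - ∑ i, divT v i x * curlS ψ i x := by
    intro x
    have hsq : ∀ k, pd k (sq v) x = ∑ j, 2 * (v j x * pd k (v j) x) := by
      intro k
      have := congrFun (pd_sum Finset.univ (f := fun j x => v j x * v j x)
        (fun j _ => ((hv j).mul (hv j)).1) k) x
      rw [show sq v = fun x => ∑ j, v j x * v j x from rfl, this]
      refine Finset.sum_congr rfl fun j _ => ?_
      rw [pd_mul (hv j).1 (hv j).1]; ring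
    simp only [adv, hsq, divT, rot, curlS, Fin.sum_univ_three, Matrix.cons_val]
    ring
  simp only [e]
  have i1 : Integrable (fun x => 1 / 2 * adv (sq v) (curlS ψ) x) cm :=
    (adv_smp hq hc).integrable.const_mul _
  have i2 : Integrable (fun x => ∑ i, divT v i x * curlS ψ i x) cm :=
    (SmP.sum fun i _ => (divT_smp hv i).mul (hc i)).integrable
  rw [integral_sub i1 i2, integral_const_mul, h3, ← h1]
  ring

lemma Bc_rot (hs : 1 / 2 < s) (hs1 : s ≤ 1) (hv : ∀ i, Nik s 3 A (v i)) (hd : WDiv v)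
    {ψ : Fin 3 → E3 → ℝ} (hψ : ∀ i, SmP (ψ i)) :
    Bc v (rot ψ v) = ∑ i, ∑ j, ∫ x in cell, v i x * v j x * pd j (curlS ψ i) x := by
  set r := (1 / 2 + s) / 2 with hr
  have hr0 : 1 / 2 < r := by linarith
  have hV : ∀ i, NT r 3 atTop (fun n => sm n (v i)) (v i) := fun i =>
    (hv i).sm_tendsto one_le_three (by linarith) (by linarith)
  have hsm : ∀ n i, SmP (sm n (v i)) := fun n i => sm_smp (hv i) one_le_three n
  have hdiv : ∀ n x, ∑ j, pd j (sm n (v j)) x = 0 := fun n x =>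
    hd.cv (fun i => (hv i).per) (fun i => (hv i).integrable one_le_three) (χk_ker n) (χk_even n) x
  have h1 := fun n => Bc_rot_smooth hψ (hsm n) (hdiv n)
  choose B hB using fun i j => (((hψ i).pd j).sub ((hψ j).pd i)).nik (s := r) (by linarith) (by linarith)
  choose E hE using fun i j => ((curlS_smp hψ i).pd j).nik (s := r) (by linarith) (by linarith)
  have hrot : ∀ i, NT r (3 / 2) atTop (fun n => rot ψ (fun i => sm n (v i)) i) (rot ψ v i) := by
    intro i
    have : NT r 3 atTop (fun n => rot ψ (fun i => sm n (v i)) i) (rot ψ v i) :=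
      NT.sum _ (fun j _ => NT.mul (hV j) (NT.const (hB i j)) le_top one_le_three) one_le_three
    exact this.mono_q (by
      rw [ENNReal.div_le_iff (by simp) (by simp)]
      norm_num)
  have t1 := Bc_tendsto hr0 one_le_three one_le_three_half hV hrot
  have t2 : ∀ i j, Tendsto (fun n => ∫ x in cell, sm n (v i) x * sm n (v j) x * pd j (curlS ψ i) x)
      atTop (𝓝 (∫ x in cell, v i x * v j x * pd j (curlS ψ i) x)) := by
    intro i j
    have h := NT.mul (r := 3 / 2) (NT.mul (r := 3 / 2) (hV i) (hV j) one_le_three one_le_three_half)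
      (NT.const (hE i j)) le_top one_le_three_half
    exact (h.mono_q one_le_three_half).tendsto_integral
  have t3 := tendsto_finsetSum Finset.univ fun i _ => tendsto_finsetSum Finset.univ fun j _ => t2 i j
  refine tendsto_nhds_unique t1 (t3.congr fun n => ?_)
  have hi : ∀ i j, Integrable (fun x => sm n (v i) x * sm n (v j) x * pd j (curlS ψ i) x) cm := fun i j =>
    (((hsm n i).mul (hsm n j)).mul ((curlS_smp hψ i).pd j)).integrable
  rw [h1, integral_finsetSum _ fun i _ => integrable_finsetSum _ fun j _ => hi i j]
  exact Finset.sum_congr rfl fun i _ => (integral_finsetSum _ fun j _ => hi i j).symm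

lemma mo_curl (hs : 1 / 2 < s) (hs1 : s ≤ 1) (hv : ∀ i, Nik s 3 A (v i)) (hd : WDiv v)
    (hP : Integrable P cm) {ψ ψ' : Fin 3 → E3 → ℝ} (hψ : ∀ i, SmP (ψ i)) (hψ' : ∀ i, SmP (ψ' i)) :
    mo v P (curlS ψ') (curlS ψ) = Bc v ψ' + Bc v (rot ψ v) := by
  have hc := curlS_smp hψ
  have e1 : ∑ i, ∫ x in cell, P x * pd i (curlS ψ i) x = 0 := by
    rw [← integral_finsetSum _ fun i _ => Integrable.mul_smp hP ((hc i).pd i)]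
    simp only [← Finset.mul_sum, curlS_div hψ, mul_zero, integral_zero]
  have e2 : Bc v ψ' = ∑ i, ∫ x in cell, v i x * curlS ψ' i x := by
    rw [Bc_smooth_right (p := 3) hs one_le_three hv hψ', integral_finsetSum _ fun i _ =>
      Integrable.mul_smp ((hv i).integrable one_le_three) (curlS_smp hψ' i)]
  rw [mo, e1, ← Bc_rot hs hs1 hv hd hψ, e2, add_zero]

end

/-! ### Decomposition of test fields -/

lemma curlS_curlS {g : Fin 3 → E3 → ℝ} (hg : ∀ i, SmP (g i)) (i : Fin 3) (x : E3) :
    ∑ k, pd k (pd k (g i)) x = pd i (fun y => ∑ k, pd k (g k) y) x - curlS (curlS g) i x := by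
  have h := fun i => (hg i).1
  have hs : pd i (fun y => ∑ k, pd k (g k) y) x = ∑ k, pd i (pd k (g k)) x :=
    congrFun (pd_sum Finset.univ (fun k _ => (h k).pd k) i) x
  rw [hs]
  fin_cases i <;>
  simp only [curlS, Fin.sum_univ_three, Matrix.cons_val, Fin.zero_eta, Fin.mk_one, Fin.reduceFinMk,
      pd_sub ((h _).pd _) ((h _).pd _)]
  · rw [pd_comm (h 0) 0 0, pd_comm (h 1) 1 0, pd_comm (h 2) 2 0]; ring
  · rw [pd_comm (h 0) 1 0, pd_comm (h 2) 2 1]; ring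
  · rw [pd_comm (h 0) 2 0, pd_comm (h 1) 2 1]; ring

/-! ### The momentum equation -/

lemma cv_abs_le {K f : E3 → ℝ} (hK : Ker K) {B : ℝ} (hf : ∀ x, |f x| ≤ B) (x : E3) :
    |cv K f x| ≤ (∫ y, |K y|) * B := by
  have e : ∫ y, |K y| * B = (∫ y, |K y|) * B := integral_mul_const _ _
  rw [← e]
  refine norm_integral_le_of_norm_le (f := fun y => K y * f (x - y)) (hK.integrable.abs.mul_const B) (ae_of_all _ fun y => ?_)
  rw [norm_mul]
  exact mul_le_mul_of_nonneg_left (hf _) (norm_nonneg _)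

lemma three_half_le_three : (3 / 2 : ℝ≥0∞) ≤ 3 := by
  rw [ENNReal.div_le_iff (by simp) (by simp)]
  norm_num

lemma rot_nik {s A B : ℝ} {v ψ : Fin 3 → E3 → ℝ} (hv : ∀ i, Nik s 3 A (v i))
    (hψ : ∀ i j, Nik s ⊤ B (pd j (ψ i))) (i : Fin 3) : Nik s (3 / 2) (12 * (A * B)) (rot ψ v i) := by
  have h : Nik s 3 (∑ _j : Fin 3, 2 * (A * (B + B))) (rot ψ v i) :=
    Nik.sum one_le_three fun j _ => (hv j).mul ((hψ i j).sub (hψ j i) le_top) one_le_three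
  refine (h.mono (le_of_eq ?_)).mono_q three_half_le_three
  simp; ring

/-- The weak momentum equation. -/
def MomentumEq (T : ℝ) (U : Fin 3 → ℝ → E3 → ℝ) : Prop :=
  ∀ z : Fin 3 → ℝ → E3 → ℝ, (∀ i, IsTest T (z i)) → ∫ t in Ioo 0 T,
    mo (fun i => U i t) (pr (fun i => U i t)) (fun i => timeDeriv (z i) t) (fun i => z i t) = 0

/-- The weak momentum equation tested with curls. -/
def CurlMomentumEq (T : ℝ) (U : Fin 3 → ℝ → E3 → ℝ) : Prop :=
  ∀ ψ : Fin 3 → ℝ → E3 → ℝ, (∀ i, IsTest T (ψ i)) → ∫ t in Ioo 0 T,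
    mo (fun i => U i t) (pr (fun i => U i t)) (curlS (fun i => timeDeriv (ψ i) t))
      (curlS (fun i => ψ i t)) = 0

namespace Flow

variable {T s M : ℝ} {A : ℝ → ℝ} {U : Fin 3 → ℝ → E3 → ℝ}

lemma integrable_cube (h : Flow T s A M U) : Integrable (fun t => A t ^ 3) (tm T) := by
  have := h.memLp.integrable_norm_pow (p := 3) (by norm_num)
  refine this.congr (ae_of_all _ fun t => ?_)
  simp only [Real.norm_of_nonneg (zero_le_one.trans (h.one_le t))]

lemma integrable_of_le (h : Flow T s A M U) {f : ℝ → ℝ} (hf : AEStronglyMeasurable f (tm T)) (c : ℝ)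
    (hc : ∀ᵐ t ∂(tm T), |f t| ≤ c * A t ^ 3) : Integrable f (tm T) :=
  (h.integrable_cube.const_mul c).mono' hf hc

lemma pr_nik (h : Flow T s A M U) {s' : ℝ} (hs' : 0 ≤ s') (hs : s' < s) : ∃ C, 0 ≤ C ∧
    ∀ᵐ t ∂(tm T), Nik s' (3 / 2) (C * A t ^ 2) (pr (fun i => U i t)) := by
  obtain ⟨C, hC0, hC⟩ := Helicity.pr_nik hs' hs h.lt_one.le
  exact ⟨C, hC0, h.nik.mono fun t ht => hC ht⟩

lemma abs_mo_bound (h : Flow T s A M U) : ∃ c, 0 ≤ c ∧ ∀ᵐ t ∂(tm T), ∀ B, 0 ≤ B →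
    ∀ w z : Fin 3 → E3 → ℝ, (∀ i, SmP (w i)) → (∀ i, SmP (z i)) → (∀ i x, |w i x| ≤ B) →
      (∀ i j x, |pd j (z i) x| ≤ B) →
      |mo (fun i => U i t) (pr (fun i => U i t)) w z| ≤ c * B * A t ^ 3 := by
  obtain ⟨C, hC0, hC⟩ := h.pr_nik le_rfl (by linarith [h.lt])
  refine ⟨21 + 3 * C, by positivity, ?_⟩
  filter_upwards [h.nik, hC] with t h1 h2 B hB0 w z hw hz hwB hzB
  refine (abs_mo_le h1 h2 hB0 hw hz hwB hzB).trans ?_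
  have := h.one_le t
  have e1 : A t ≤ A t ^ 3 := le_self_pow₀ this (by norm_num)
  have e2 : A t ^ 2 ≤ A t ^ 3 := pow_le_pow_right₀ this (by norm_num)
  calc (3 * A t + 18 * A t ^ 2 + 3 * (C * A t ^ 2)) * B
      ≤ (3 * A t ^ 3 + 18 * A t ^ 3 + 3 * (C * A t ^ 3)) * B := by gcongr
    _ = _ := by ring

lemma aesm_mo (h : Flow T s A M U) {w z : Fin 3 → ℝ → E3 → ℝ} (hw : ∀ i, IsTest T (w i))
    (hz : ∀ i, IsTest T (z i)) : AEStronglyMeasurable (fun t => mo (fun i => U i t)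
      (pr (fun i => U i t)) (fun i => w i t) (fun i => z i t)) (tm T) := by
  refine ((Finset.aestronglyMeasurable_fun_sum _ fun i _ => ?_).add
    (Finset.aestronglyMeasurable_fun_sum _ fun i _ =>
      Finset.aestronglyMeasurable_fun_sum _ fun j _ => ?_)).add
    (Finset.aestronglyMeasurable_fun_sum _ fun i _ => ?_)
  · exact JM.integral_cell (JM.mul (h.jm i) (hw i).jm)
  · exact JM.integral_cell (JM.mul (JM.mul (h.jm i) (h.jm j)) ((hz i).pd j).jm)
  · exact JM.integral_cell (JM.mul (JM.pr h.jm) ((hz i).pd i).jm)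

lemma _root_.Helicity.exists_common_bound {ι : Type*} [Fintype ι] {T : ℝ} {z : ι → ℝ → E3 → ℝ}
    (hz : ∀ i, IsTest T (z i)) : ∃ B, 0 ≤ B ∧ ∀ i t x, |z i t x| ≤ B := by
  choose B hB0 hB using fun i => (hz i).exists_bound
  obtain ⟨E, hE0, hE⟩ := exists_common_le B
  exact ⟨E, hE0, fun i t x => (hB i t x).trans (hE i)⟩

lemma _root_.Helicity.exists_common_bound₂ {T : ℝ} {w z : Fin 3 → ℝ → E3 → ℝ}
    (hw : ∀ i, IsTest T (w i)) (hz : ∀ i, IsTest T (z i)) :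
    ∃ B, 0 ≤ B ∧ (∀ i t x, |w i t x| ≤ B) ∧ ∀ i j t x, |pd j (z i t) x| ≤ B := by
  obtain ⟨B, hB0, hB⟩ := exists_common_bound hw
  obtain ⟨D, hD0, hD⟩ := exists_common_bound (z := fun (p : Fin 3 × Fin 3) t => pd p.2 (z p.1 t))
    fun p => (hz p.1).pd p.2
  exact ⟨B + D, by positivity, fun i t x => (hB i t x).trans (by linarith),
    fun i j t x => (hD (i, j) t x).trans (by linarith)⟩

lemma integrable_mo (h : Flow T s A M U) {w z : Fin 3 → ℝ → E3 → ℝ} (hw : ∀ i, IsTest T (w i))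
    (hz : ∀ i, IsTest T (z i)) : Integrable (fun t => mo (fun i => U i t)
      (pr (fun i => U i t)) (fun i => w i t) (fun i => z i t)) (tm T) := by
  obtain ⟨c, -, hc⟩ := h.abs_mo_bound
  obtain ⟨B, hB0, hB, hB'⟩ := exists_common_bound₂ hw hz
  refine h.integrable_of_le (h.aesm_mo hw hz) (c * B) ?_
  filter_upwards [hc] with t ht
  exact ht B hB0 _ _ (fun i => (hw i).smp t) (fun i => (hz i).smp t) (fun i => hB i t)
    (fun i j => hB' i j t)

/-- The momentum equation tested with a curl. -/
lemma momentum_curl {u : ℝ → E3 → E3} {ω : ℝ → VecDistribution}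
    (h : Flow T s A M (fun i t => co (u t) i)) (hcurl : ∀ᵐ t ∂(tm T), IsCurl (ω t) (u t))
    (heq : ∀ ψ : ℝ → E3 → E3, IsTest T ψ →
      (∫ t in Ioo 0 T, bracket (ω t) (timeDeriv ψ t)) +
      (∫ t in Ioo 0 T, bracket (ω t) (fun x =>
        fderiv ℝ (ψ t) x (u t x) -
          ContinuousLinearMap.adjoint (fderiv ℝ (ψ t) x) (u t x))) = 0) :
    CurlMomentumEq T (fun i t => co (u t) i) := by
  intro ψ hψ
  have hs := h.lt
  have hs1 := h.lt_one
  set Ψ : ℝ → E3 → E3 := fun t => vec (fun i => ψ i t) with hΨdef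
  have hΨ : IsTest T Ψ := isTest_vec hψ
  choose B hB0 hB using fun i => (hψ i).td.exists_nik (s := s) (by linarith) hs1.le
  choose D hD0 hD using fun i j => ((hψ i).pd j).exists_nik (s := s) (by linarith) hs1.le
  obtain ⟨E, hE0, hE⟩ := exists_common_le (Sum.elim B fun p : Fin 3 × Fin 3 => D p.1 p.2)
  have hBE := fun i => hE (.inl i)
  have hDE := fun i j => hE (.inr (i, j))
  have hco1 : ∀ t, co (timeDeriv Ψ t) = fun i => timeDeriv (ψ i) t := fun t => by
    ext i x; exact hΨ.timeDeriv_component i t x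
  have hco2 : ∀ t, co (fun x => fderiv ℝ (Ψ t) x (u t x) -
      ContinuousLinearMap.adjoint (fderiv ℝ (Ψ t) x) (u t x)) =
      rot (fun i => ψ i t) (co (u t)) := fun t => by
    ext i x
    have hsm : ∀ i, SmP (co (Ψ t) i) := fun i => (hψ i).smp t
    have e1 := fderiv_component hsm x (u t x) i
    have e2 : ContinuousLinearMap.adjoint (fderiv ℝ (Ψ t) x) (u t x) i =
        ∑ j, u t x j * pd i (ψ j t) x := by
      have e3 : ContinuousLinearMap.adjoint (fderiv ℝ (Ψ t) x) (u t x) i =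
          inner ℝ (ContinuousLinearMap.adjoint (fderiv ℝ (Ψ t) x) (u t x)) (basisVec i) := by
        simp [basisVec, EuclideanSpace.inner_single_right]
      rw [e3, ContinuousLinearMap.adjoint_inner_left, inner_eq_sum]
      refine Finset.sum_congr rfl fun j _ => ?_
      have e4 := partialD_eq (mem_testFields_of_co hsm).1 i j x
      exact congrArg _ e4
    simp only [co, PiLp.sub_apply, rot, mul_sub, Finset.sum_sub_distrib]
    exact congrArg₂ _ e1 e2
  obtain ⟨C, hC0, hC⟩ := Bc_bound hs
  have hn1 : ∀ t i, Nik s ⊤ E (timeDeriv (ψ i) t) := fun t i => (hB i t).mono (hBE i)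
  have hn2 : ∀ᵐ t ∂(tm T), ∀ i, Nik s (3 / 2) (12 * (A t * E)) (rot (fun i => ψ i t) (co (u t)) i) := by
    filter_upwards [h.nik] with t ht i
    exact rot_nik ht (fun i j => (hD i j t).mono (hDE i j)) i
  have b1 : ∀ᵐ t ∂(tm T), bracket (ω t) (timeDeriv Ψ t) = Bc (co (u t)) (fun i => timeDeriv (ψ i) t) := by
    filter_upwards [hcurl, h.nik] with t h1 h2
    rw [← hco1]
    refine bracket_eq (h1.hasBracket (p := 3) (q := 3 / 2) (B := E) hs one_le_three one_le_three_half
      h2 fun i => ?_)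
    rw [hco1]; exact (hn1 t i).mono_q le_top
  have b2 : ∀ᵐ t ∂(tm T), bracket (ω t) (fun x => fderiv ℝ (Ψ t) x (u t x) -
      ContinuousLinearMap.adjoint (fderiv ℝ (Ψ t) x) (u t x)) =
      Bc (co (u t)) (rot (fun i => ψ i t) (co (u t))) := by
    filter_upwards [hcurl, h.nik, hn2] with t h1 h2 h3
    rw [← hco2]
    refine bracket_eq (h1.hasBracket (p := 3) (q := 3 / 2) (B := 12 * (A t * E)) hs one_le_three
      one_le_three_half h2 fun i => ?_)
    rw [hco2]; exact h3 i
  have key := heq Ψ hΨ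
  rw [integral_congr_ae b1, integral_congr_ae b2] at key
  have i1 : Integrable (fun t => Bc (co (u t)) (fun i => timeDeriv (ψ i) t)) (tm T) := by
    refine h.integrable_of_le (JM.Bc (V := fun i t => co (u t) i) (F := fun i => timeDeriv (ψ i))
      (p := 3) (q := 3 / 2) hs one_le_three one_le_three_half h.jm (fun i => (hψ i).td.jm)
      (h.nik.mono fun t ht => ⟨_, ht⟩) (ae_of_all _ fun t => ⟨E, fun i => (hn1 t i).mono_q le_top⟩))
      (C * E) ?_
    filter_upwards [h.nik] with t ht
    refine (hC (p := 3) (q := 3 / 2) one_le_three one_le_three_half ht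
      fun i => (hn1 t i).mono_q le_top).trans ?_
    have h1 := h.one_le t
    have h2 : A t ≤ A t ^ 3 := le_self_pow₀ h1 (by norm_num)
    have h3 : 0 ≤ C * E := mul_nonneg hC0 hE0
    nlinarith
  have i2 : Integrable (fun t => Bc (co (u t)) (rot (fun i => ψ i t) (co (u t)))) (tm T) := by
    refine h.integrable_of_le (JM.Bc (V := fun i t => co (u t) i)
      (F := fun i t => rot (fun i => ψ i t) (co (u t)) i)
      (p := 3) (q := 3 / 2) hs one_le_three one_le_three_half h.jm
      (fun i => JM.sum fun j _ => JM.mul (h.jm j) (JM.sub ((hψ i).pd j).jm ((hψ j).pd i).jm))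
      (h.nik.mono fun t ht => ⟨_, ht⟩) (hn2.mono fun t ht => ⟨_, ht⟩))
      (C * (12 * E)) ?_
    filter_upwards [h.nik, hn2] with t ht ht2
    refine (hC (p := 3) (q := 3 / 2) one_le_three one_le_three_half ht ht2).trans ?_
    have h1 := h.one_le t
    have h2 : A t ^ 2 ≤ A t ^ 3 := pow_le_pow_right₀ h1 (by norm_num)
    have h3 : 0 ≤ C * E := mul_nonneg hC0 hE0
    nlinarith
  rw [← integral_add i1 i2] at key
  refine Eq.trans (integral_congr_ae ?_) key
  obtain ⟨D, hD0, hD⟩ := h.pr_nik le_rfl (by linarith)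
  filter_upwards [h.nik, h.wdiv, hD] with t h1 h2 h3
  exact mo_curl hs hs1.le h1 h2 (h3.integrable one_le_three_half) (fun i => (hψ i).smp t)
    fun i => (hψ i).td.smp t

end Flow

lemma IsTest.curl {T : ℝ} {ψ : Fin 3 → ℝ → E3 → ℝ} (hψ : ∀ i, IsTest T (ψ i)) (i : Fin 3) :
    IsTest T (fun t => curlS (fun k => ψ k t) i) := by
  fin_cases i
  · exact ((hψ 2).pd 1).sub ((hψ 1).pd 2)
  · exact ((hψ 0).pd 2).sub ((hψ 2).pd 0)
  · exact ((hψ 1).pd 0).sub ((hψ 0).pd 1)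

lemma IsTest.td_curl {T : ℝ} {ψ : Fin 3 → ℝ → E3 → ℝ} (hψ : ∀ i, IsTest T (ψ i)) (i : Fin 3) (t : ℝ) :
    timeDeriv (fun t => curlS (fun k => ψ k t) i) t = curlS (fun k => timeDeriv (ψ k) t) i := by
  have h := fun i j k l => IsTest.td_sub ((hψ i).pd j) ((hψ k).pd l)
  simp only [(hψ _).td_pd] at h
  fin_cases i
  · exact congrFun (h 2 1 1 2) t
  · exact congrFun (h 0 2 2 0) t
  · exact congrFun (h 1 0 0 1) t

lemma IsTest.pot {T : ℝ} {z : ℝ → E3 → ℝ} (hz : IsTest T z) {R : ℝ} (hR : 0 < R) :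
    IsTest T (fun t => pot R (z t)) := (hz.cv (Θ₀_ker.rescale hR)).const_mul _

lemma IsTest.td_pot {T : ℝ} {z : ℝ → E3 → ℝ} (hz : IsTest T z) {R : ℝ} (hR : 0 < R) :
    timeDeriv (fun t => Helicity.pot R (z t)) = fun t => Helicity.pot R (timeDeriv z t) := by
  have h := (hz.cv (Θ₀_ker.rescale hR)).td_const_mul (R ^ 2)
  rw [hz.td_cv (Θ₀_ker.rescale hR)] at h
  exact h

section

variable {s A D : ℝ} {v w z : Fin 3 → E3 → ℝ} {P : E3 → ℝ}

lemma mo_cv_eq (hz : ∀ i, SmP (z i)) {K : E3 → ℝ} (hK : Ker K) :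
    mo v P (fun i => cv K (w i)) (fun i => cv K (z i)) =
      (∑ i, ∫ x in cell, v i x * cv K (w i) x) +
      (∑ i, ∑ j, ∫ x in cell, v i x * v j x * cv K (pd j (z i)) x) +
        ∑ i, ∫ x in cell, P x * cv K (pd i (z i)) x := by
  have h : ∀ i j, pd j (cv K (z i)) = cv K (pd j (z i)) := fun i j => by
    rw [pd_cv hK (hz i).1.locInt, cv_pd hK (hz i).1]
  simp only [mo, h]

lemma mo_cv_small (hs : 0 < s) (hv : ∀ i, Nik s 3 A (v i)) (hP : Nik s (3 / 2) D P)
    (hw : ∀ i, SmP (w i)) (hz : ∀ i, SmP (z i)) :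
    Tendsto (fun N : ℕ => mo v P (fun i => cv (rescale χ₀ ((1 / 2) ^ N)) (w i))
      (fun i => cv (rescale χ₀ ((1 / 2) ^ N)) (z i))) atTop (𝓝 (mo v P w z)) := by
  simp only [fun N : ℕ => mo_cv_eq (v := v) (P := P) (w := w) hz
    (χ₀_moll.ker.rescale (ε := (1 / 2) ^ N) (by positivity))]
  exact ((tendsto_finsetSum _ fun i _ => tendsto_integral_cv_small hs one_le_three (hv i) (hw i)).add
    (tendsto_finsetSum _ fun i _ => tendsto_finsetSum _ fun j _ =>
      tendsto_integral_cv_small hs one_le_three_half ((hv i).mul_self (hv j)) ((hz i).pd j))).add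
    (tendsto_finsetSum _ fun i _ => tendsto_integral_cv_small hs one_le_three_half hP ((hz i).pd i))

lemma mo_cv_large (hv : ∀ i, Nik s 3 A (v i)) (hm : ∀ i, ∫ x in cell, v i x = 0)
    (hP : Nik s (3 / 2) D P) (hw : ∀ i, SmP (w i)) (hz : ∀ i, SmP (z i)) :
    Tendsto (fun N : ℕ => mo v P (fun i => cv (rescale χ₀ (2 ^ N)) (w i))
      (fun i => cv (rescale χ₀ (2 ^ N)) (z i))) atTop (𝓝 0) := by
  simp only [fun N : ℕ => mo_cv_eq (v := v) (P := P) (w := w) hz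
    (χ₀_moll.ker.rescale (ε := 2 ^ N) (by positivity))]
  have h := ((tendsto_finsetSum Finset.univ fun i _ =>
      tendsto_integral_cv_large one_le_three (hv i) (hw i)).add
    (tendsto_finsetSum Finset.univ fun i _ => tendsto_finsetSum Finset.univ fun j _ =>
      tendsto_integral_cv_large one_le_three_half ((hv i).mul_self (hv j)) ((hz i).pd j))).add
    (tendsto_finsetSum Finset.univ fun i _ =>
      tendsto_integral_cv_large one_le_three_half hP ((hz i).pd i))
  simpa [hm, integral_pd (hz _)] using h

end

namespace Flow

variable {T s M : ℝ} {A : ℝ → ℝ} {U : Fin 3 → ℝ → E3 → ℝ}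

lemma momentum_step (h : Flow T s A M U) (hcu : CurlMomentumEq T U) {z : Fin 3 → ℝ → E3 → ℝ}
    (hz : ∀ i, IsTest T (z i)) {R : ℝ}
    (hR : 0 < R) :
    ∫ t in Ioo 0 T, mo (fun i => U i t) (pr (fun i => U i t))
      (fun i => cv (rescale χ₀ R) (timeDeriv (z i) t)) (fun i => cv (rescale χ₀ R) (z i t)) =
    ∫ t in Ioo 0 T, mo (fun i => U i t) (pr (fun i => U i t))
      (fun i => cv (rescale χ₀ (1 / 2 * R)) (timeDeriv (z i) t))
      (fun i => cv (rescale χ₀ (1 / 2 * R)) (z i t)) := by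
  have k1 := χ₀_moll.ker.rescale hR
  have k2 := χ₀_moll.ker.rescale (ε := 1 / 2 * R) (by positivity)
  have i1 := h.integrable_mo (fun i => (hz i).td.cv k1) (fun i => (hz i).cv k1)
  have i2 := h.integrable_mo (fun i => (hz i).td.cv k2) (fun i => (hz i).cv k2)
  rw [← sub_eq_zero, ← integral_sub i1 i2]
  set g : Fin 3 → ℝ → E3 → ℝ := fun i t => pot R (z i t) with hg
  have hgt : ∀ i, IsTest T (g i) := fun i => (hz i).pot hR
  have hgd : ∀ i, timeDeriv (g i) = fun t => pot R (timeDeriv (z i) t) := fun i => (hz i).td_pot hR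
  have key := hcu _ (IsTest.curl hgt)
  rw [← neg_zero, ← key, ← integral_neg]
  obtain ⟨C, hC0, hC⟩ := h.pr_nik le_rfl (by linarith [h.lt])
  refine integral_congr_ae ?_
  filter_upwards [h.nik, h.wdiv, hC] with t h1 h2 h3
  have sg : ∀ i, SmP (g i t) := fun i => (hgt i).smp t
  have sg' : ∀ i, SmP (pot R (timeDeriv (z i) t)) := fun i => pot_smp hR ((hz i).td.smp t)
  have hdec : ∀ (f : Fin 3 → E3 → ℝ), (∀ i, SmP (f i)) →
      (fun i x => cv (rescale χ₀ R) (f i) x - cv (rescale χ₀ (1 / 2 * R)) (f i) x) =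
      fun i x => pd i (fun y => ∑ k, pd k (pot R (f k)) y) x -
        curlS (curlS (fun i => pot R (f i))) i x := by
    intro f hf
    ext i x
    rw [cv_sub_cv hR (hf i), curlS_curlS (fun i => pot_smp hR (hf i))]
  rw [← mo_sub h1 h3 (fun i => ((hz i).td.cv k1).smp t) (fun i => ((hz i).cv k1).smp t)
    (fun i => ((hz i).td.cv k2).smp t) (fun i => ((hz i).cv k2).smp t),
    hdec _ (fun i => (hz i).smp t), hdec _ (fun i => (hz i).td.smp t)]
  have sa : SmP (fun y => ∑ k, pd k (pot R (z k t)) y) := SmP.sum fun k _ => (sg k).pd k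
  have sa' : SmP (fun y => ∑ k, pd k (pot R (timeDeriv (z k) t)) y) := SmP.sum fun k _ => (sg' k).pd k
  rw [mo_sub h1 h3 (fun i => sa'.pd i) (fun i => sa.pd i) (curlS_smp (curlS_smp sg'))
    (curlS_smp (curlS_smp sg)), mo_grad (by linarith [h.lt]) h.lt_one.le h1 h2 sa sa', zero_sub]
  simp only [IsTest.td_curl hgt, hgd]

/-- The momentum equation. -/
lemma momentum (h : Flow T s A M U) (hcu : CurlMomentumEq T U) : MomentumEq T U := by
  intro z hz
  set F : ℝ → ℝ → ℝ := fun R t => mo (fun i => U i t) (pr (fun i => U i t))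
      (fun i => cv (rescale χ₀ R) (timeDeriv (z i) t)) (fun i => cv (rescale χ₀ R) (z i t)) with hF
  have hstep : ∀ {R : ℝ}, 0 < R → ∫ t in Ioo 0 T, F R t = ∫ t in Ioo 0 T, F (1 / 2 * R) t :=
    fun hR => h.momentum_step hcu hz hR
  have hsmall : ∀ N : ℕ, ∫ t in Ioo 0 T, F ((1 / 2) ^ N) t = ∫ t in Ioo 0 T, F 1 t := by
    intro N
    induction N with
    | zero => simp
    | succ n ih => rw [← ih, hstep (R := (1 / 2) ^ n) (by positivity), pow_succ']
  have hlarge : ∀ N : ℕ, ∫ t in Ioo 0 T, F (2 ^ N) t = ∫ t in Ioo 0 T, F 1 t := by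
    intro N
    induction N with
    | zero => simp
    | succ n ih =>
      have e : (1 / 2 : ℝ) * 2 ^ (n + 1) = 2 ^ n := by rw [pow_succ']; ring
      rw [← ih, hstep (R := 2 ^ (n + 1)) (by positivity), e]
  have hker : ∀ {R : ℝ}, 0 < R → Ker (rescale χ₀ R) := fun hR => χ₀_moll.ker.rescale hR
  have hmeas : ∀ {R : ℝ}, 0 < R → AEStronglyMeasurable (F R) (tm T) := fun hR =>
    h.aesm_mo (fun i => (hz i).td.cv (hker hR)) (fun i => (hz i).cv (hker hR))
  obtain ⟨c, hc0, hc⟩ := h.abs_mo_bound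
  obtain ⟨B, hB0, hB, hB'⟩ := exists_common_bound₂ (fun i => (hz i).td) hz
  set m := ∫ y, |χ₀ y| with hm
  have hm0 : 0 ≤ m := integral_nonneg fun _ => abs_nonneg _
  have hbd : ∀ {R : ℝ}, 0 < R → ∀ᵐ t ∂(tm T), ‖F R t‖ ≤ c * (m * B) * A t ^ 3 := by
    intro R hR
    filter_upwards [hc] with t ht
    refine ht (m * B) (by positivity) _ _ (fun i => ((hz i).td.smp t).cv (hker hR))
      (fun i => ((hz i).smp t).cv (hker hR)) (fun i x => ?_) fun i j x => ?_
    · rw [hm, ← integral_abs_rescale hR]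
      exact cv_abs_le (hker hR) (hB i t) x
    · rw [hm, ← integral_abs_rescale hR, pd_cv (hker hR) ((hz i).smp t).1.locInt,
        cv_pd (hker hR) ((hz i).smp t).1]
      exact cv_abs_le (hker hR) (hB' i j t) x
  have hint : Integrable (fun t => c * (m * B) * A t ^ 3) (tm T) := h.integrable_cube.const_mul _
  have hs := h.lt
  obtain ⟨C, hC0, hC⟩ := h.pr_nik (s' := 1 / 2) (by norm_num) hs
  have hlow : ∀ᵐ t ∂(tm T), ∀ i, Nik (1 / 2) 3 (2 * A t) (U i t) := h.nik.mono fun t ht i =>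
    (ht i).mono_s one_le_three (by norm_num) hs.le
  have l1 : Tendsto (fun N : ℕ => ∫ t in Ioo 0 T, F ((1 / 2) ^ N) t) atTop
      (𝓝 (∫ t in Ioo 0 T, mo (fun i => U i t) (pr (fun i => U i t))
        (fun i => timeDeriv (z i) t) (fun i => z i t))) := by
    refine tendsto_integral_of_dominated_convergence _ (fun N => hmeas (by positivity)) hint
      (fun N => hbd (by positivity)) ?_
    filter_upwards [hlow, hC] with t h1 h2
    exact mo_cv_small (by norm_num) h1 h2 (fun i => (hz i).td.smp t) fun i => (hz i).smp t
  have l2 : Tendsto (fun N : ℕ => ∫ t in Ioo 0 T, F (2 ^ N) t) atTop (𝓝 (∫ t in Ioo 0 T, (0:ℝ))) := by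
    refine tendsto_integral_of_dominated_convergence _ (fun N => hmeas (by positivity)) hint
      (fun N => hbd (by positivity)) ?_
    filter_upwards [hlow, hC, h.mean] with t h1 h2 h3
    exact mo_cv_large h1 h3 h2 (fun i => (hz i).td.smp t) fun i => (hz i).smp t
  simp only [hsmall, hlarge, integral_zero] at l1 l2
  exact tendsto_nhds_unique l1 l2

end Flow

lemma mo_eq_integral {s A D : ℝ} {v w z : Fin 3 → E3 → ℝ} {P : E3 → ℝ}
    (hv : ∀ i, Nik s 3 A (v i)) (hP : Nik s (3 / 2) D P)
    (hw : ∀ i, SmP (w i)) (hz : ∀ i, SmP (z i)) :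
    mo v P w z = ∫ x in cell, ((∑ i, v i x * w i x) + (∑ i, ∑ j, v i x * v j x * pd j (z i) x) +
      P x * ∑ i, pd i (z i) x) := by
  have i1 := fun i => Integrable.mul_smp ((hv i).integrable one_le_three) (hw i)
  have i2 := fun i j => Integrable.mul_smp
    (((hv i).mul_self (hv j)).integrable one_le_three_half) ((hz i).pd j)
  have i3 := fun i => Integrable.mul_smp (hP.integrable one_le_three_half) ((hz i).pd i)
  simp only [Finset.mul_sum]
  have j1 : Integrable (fun x => ∑ i, v i x * w i x) cm := integrable_finsetSum _ fun i _ => i1 i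
  have j2 : Integrable (fun x => ∑ i, ∑ j, v i x * v j x * pd j (z i) x) cm :=
    integrable_finsetSum _ fun i _ => integrable_finsetSum _ fun j _ => i2 i j
  have j12 : Integrable (fun x => (∑ i, v i x * w i x) +
    ∑ i, ∑ j, v i x * v j x * pd j (z i) x) cm := j1.add j2
  rw [integral_add j12 (integrable_finsetSum _ fun i _ => i3 i), integral_add j1 j2,
    integral_finsetSum _ fun i _ => i1 i, integral_finsetSum _ fun i _ => i3 i,
    integral_finsetSum _ fun i _ => integrable_finsetSum _ fun j _ => i2 i j, mo]
  congr 2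
  exact Finset.sum_congr rfl fun i _ => (integral_finsetSum _ fun j _ => i2 i j).symm

/-- The pressure of a functional vorticity solution. -/
lemma Flow.isPressure {T s M : ℝ} {A : ℝ → ℝ} {u : ℝ → E3 → E3}
    (h : Flow T s A M (fun i t => co (u t) i))
    (hmom : MomentumEq T (fun i t => co (u t) i)) :
    IsPressure T u (fun t => pr (co (u t))) := by
  have hs := h.lt
  refine ⟨h.pressure_regular, ?_, fun ζ hζ => ?_⟩
  · filter_upwards [h.nik] with t ht
    exact integral_pr (by linarith) h.lt_one.le ht
  · refine Eq.trans (integral_congr_ae ?_) (hmom _ hζ.component)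
    obtain ⟨C, hC0, hC⟩ := h.pr_nik (s' := 1 / 2) (by norm_num) hs
    filter_upwards [h.nik, hC] with t h1 h2
    have hsm := fun i => (hζ.component i).smp t
    rw [mo_eq_integral (fun i => (h1 i).mono_s one_le_three (by norm_num) hs.le) h2
      (fun i => (hζ.component i).td.smp t) hsm]
    refine integral_congr_ae (ae_of_all _ fun x => ?_)
    have hd := (mem_testFields_of_co hsm).1
    simp only [inner_eq_sum, hζ.timeDeriv_component, fderiv_component hsm, div, partialD_eq hd,
      Finset.sum_mul]
    congr 2
    refine Finset.sum_congr rfl fun i _ => Finset.sum_congr rfl fun j _ => ?_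
    simp only [co]; ring

/-! ### Regularisation in time -/

/-- A shrinking sequence of bump functions in time. -/
def timeBump (n : ℕ) : ContDiffBump (0 : ℝ) where
  rIn := 1 / (2 * (n + 1))
  rOut := 1 / (n + 1)
  rIn_pos := by positivity
  rIn_lt_rOut := by
    refine one_div_lt_one_div_of_lt (by positivity) ?_
    have : (0:ℝ) < n + 1 := by positivity
    linarith

/-- The associated time mollifiers. -/
def th (n : ℕ) : ℝ → ℝ := (timeBump n).normed volume

lemma th_smooth (n : ℕ) : ContDiff ℝ (⊤ : ℕ∞) (th n) := (timeBump n).contDiff_normed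

lemma th_even (n : ℕ) (t : ℝ) : th n (-t) = th n t := (timeBump n).normed_neg t

lemma th_nonneg (n : ℕ) (t : ℝ) : 0 ≤ th n t := (timeBump n).nonneg_normed t

lemma th_integral (n : ℕ) : ∫ t, th n t = 1 := (timeBump n).integral_normed

lemma th_integrable (n : ℕ) : Integrable (th n) := (timeBump n).integrable_normed

lemma th_zero (n : ℕ) {t : ℝ} (h : 1 / ((n : ℝ) + 1) ≤ |t|) : th n t = 0 := by
  by_contra h'
  have : t ∈ Function.support (th n) := h'
  rw [th, (timeBump n).support_normed_eq, mem_ball_zero_iff] at this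
  exact absurd this (not_lt.2 h)

lemma th_bound (n : ℕ) : ∃ B, 0 ≤ B ∧ ∀ t, |th n t| ≤ B ∧ |deriv (th n) t| ≤ B := by
  have hc : HasCompactSupport (th n) := (timeBump n).hasCompactSupport_normed
  obtain ⟨B, hB⟩ := hc.exists_bound_of_continuous (th_smooth n).continuous
  obtain ⟨D, hD⟩ := hc.deriv.exists_bound_of_continuous ((th_smooth n).continuous_deriv (by simp))
  have hB0 : 0 ≤ B := (norm_nonneg _).trans (hB 0)
  have hD0 : 0 ≤ D := (norm_nonneg _).trans (hD 0)
  exact ⟨B + D, by positivity, fun t => ⟨(hB t).trans (by linarith), (hD t).trans (by linarith)⟩⟩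

lemma th_deriv_odd (n : ℕ) (t : ℝ) : deriv (th n) (-t) = - deriv (th n) t := by
  have h : (fun t => th n (-t)) = th n := funext (th_even n)
  have := deriv_comp_neg (th n) t
  rw [h] at this
  rw [this, neg_neg]

/-- The time average of `h` over `(0,T)` with weight `th n` centred at `t`. -/
def tav (T : ℝ) (n : ℕ) (h : ℝ → ℝ) (t : ℝ) : ℝ := ∫ τ in Ioo 0 T, th n (t - τ) * h τ

lemma tav_tendsto {T : ℝ} {h : ℝ → ℝ} (hh : Integrable h (tm T)) :
    ∀ᵐ t ∂(tm T), Tendsto (fun n => tav T n h t) atTop (𝓝 (h t)) := by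
  have hi : Integrable ((Ioo 0 T).indicator h) volume := (integrable_indicator_iff measurableSet_Ioo).2 hh
  have h1 := ContDiffBump.ae_convolution_tendsto_right_of_locallyIntegrable (μ := volume)
    (φ := timeBump) (l := atTop) (K := 2) tendsto_one_div_add_atTop_nhds_zero_nat
    (Eventually.of_forall fun n => by
      have : (0:ℝ) < n + 1 := by positivity
      simp only [timeBump]; field_simp; norm_num) hi.locallyIntegrable
  filter_upwards [ae_restrict_of_ae h1, ae_restrict_mem measurableSet_Ioo] with t ht hmem
  rw [indicator_of_mem hmem] at ht
  refine ht.congr fun n => ?_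
  rw [convolution_eq_swap, tav, ← integral_indicator measurableSet_Ioo]
  congr 1; ext τ
  by_cases hτ : τ ∈ Ioo 0 T <;> simp [hτ, th]

lemma abs_tav_le {T C : ℝ} {h : ℝ → ℝ} (hC : ∀ᵐ τ ∂(tm T), |h τ| ≤ C) (hC0 : 0 ≤ C) (n : ℕ) (t : ℝ) :
    |tav T n h t| ≤ C := by
  have hi : Integrable (fun τ => th n (t - τ)) volume := (th_integrable n).comp_sub_left t
  have h1 : |tav T n h t| ≤ ∫ τ in Ioo 0 T, th n (t - τ) * C := by
    refine norm_integral_le_of_norm_le (f := fun τ => th n (t - τ) * h τ)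
      (hi.integrableOn.mul_const C) ?_
    filter_upwards [hC] with τ hτ
    rw [norm_mul, Real.norm_of_nonneg (th_nonneg _ _)]
    exact mul_le_mul_of_nonneg_left hτ (th_nonneg _ _)
  refine h1.trans ?_
  rw [integral_mul_const]
  refine mul_le_of_le_one_left hC0 ?_
  calc ∫ τ in Ioo 0 T, th n (t - τ) ≤ ∫ τ, th n (t - τ) :=
        setIntegral_le_integral hi (ae_of_all _ fun τ => th_nonneg _ _)
    _ = ∫ τ, th n τ := integral_sub_left_eq_self (th n) volume t
    _ = 1 := th_integral n

/-- Functions of two times whose double time averages converge to the integral over the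
diagonal. -/
structure Dg (T : ℝ) (Y : ℝ → ℝ → ℝ) : Prop where
  int : Integrable (fun p : ℝ × ℝ => Y p.1 p.2) ((tm T).prod (tm T))
  diag : Integrable (fun t => Y t t) (tm T)
  lim : Tendsto (fun n => ∫ p : ℝ × ℝ, th n (p.1 - p.2) * Y p.1 p.2 ∂((tm T).prod (tm T))) atTop
    (𝓝 (∫ t in Ioo 0 T, Y t t))

section Dg

variable {T : ℝ} {Y Y' : ℝ → ℝ → ℝ}

lemma integrable_kernel_mul {k : ℝ → ℝ} (hk : Continuous k) {B : ℝ} (hB : ∀ t, |k t| ≤ B)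
    (hY : Integrable (fun p : ℝ × ℝ => Y p.1 p.2) ((tm T).prod (tm T))) :
    Integrable (fun p : ℝ × ℝ => k (p.1 - p.2) * Y p.1 p.2) ((tm T).prod (tm T)) :=
  hY.bdd_mul (c := B) (Continuous.aestronglyMeasurable (by fun_prop)) (ae_of_all _ fun p => hB _)

lemma Dg.th_int (hY : Dg T Y) (n : ℕ) :
    Integrable (fun p : ℝ × ℝ => th n (p.1 - p.2) * Y p.1 p.2) ((tm T).prod (tm T)) := by
  obtain ⟨B, -, hB⟩ := th_bound n
  exact integrable_kernel_mul (th_smooth n).continuous (fun t => (hB t).1) hY.int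

lemma Dg.add (hY : Dg T Y) (hY' : Dg T Y') : Dg T (fun t τ => Y t τ + Y' t τ) := by
  refine ⟨hY.int.add hY'.int, hY.diag.add hY'.diag, ?_⟩
  rw [integral_add hY.diag hY'.diag]
  refine (hY.lim.add hY'.lim).congr fun n => ?_
  rw [← integral_add (hY.th_int n) (hY'.th_int n)]
  simp only [mul_add]

lemma Dg.const_mul (hY : Dg T Y) (c : ℝ) : Dg T (fun t τ => c * Y t τ) := by
  refine ⟨hY.int.const_mul c, hY.diag.const_mul c, ?_⟩
  rw [integral_const_mul]
  refine (hY.lim.const_mul c).congr fun n => ?_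
  rw [← integral_const_mul]
  simp only [mul_left_comm]

lemma Dg.zero : Dg T (fun _ _ => 0) := ⟨by simp, by simp, by simp⟩

lemma Dg.sum {ι : Type*} {S : Finset ι} {Z : ι → ℝ → ℝ → ℝ} (hZ : ∀ i ∈ S, Dg T (Z i)) :
    Dg T (fun t τ => ∑ i ∈ S, Z i t τ) := by
  classical
  induction S using Finset.induction_on with
  | empty => simpa using Dg.zero
  | insert a S ha ih =>
    have := (hZ a (Finset.mem_insert_self a S)).add
      (ih fun i hi => hZ i (Finset.mem_insert_of_mem hi))
    simpa only [Finset.sum_insert ha] using this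

lemma Dg.congr (hY : Dg T Y) {g : ℝ → Prop} (hg : ∀ᵐ t ∂(tm T), g t)
    (h : ∀ t τ, g t → g τ → Y t τ = Y' t τ) : Dg T Y' := by
  have e : ∀ᵐ p : ℝ × ℝ ∂((tm T).prod (tm T)), Y p.1 p.2 = Y' p.1 p.2 := by
    filter_upwards [Measure.quasiMeasurePreserving_fst.ae hg,
      Measure.quasiMeasurePreserving_snd.ae hg] with p h1 h2 using h _ _ h1 h2
  have e' : ∀ᵐ t ∂(tm T), Y t t = Y' t t := hg.mono fun t ht => h t t ht ht
  refine ⟨hY.int.congr e, hY.diag.congr e', ?_⟩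
  rw [← integral_congr_ae e']
  refine hY.lim.congr fun n => integral_congr_ae ?_
  filter_upwards [e] with p hp
  rw [hp]

/-- Bounded measurable families. -/
def BF (T : ℝ) (H : ℝ → E3 → ℝ) : Prop :=
  JM (tm T) H ∧ ∃ C, 0 ≤ C ∧ ∀ᵐ τ ∂(tm T), ∀ x, |H τ x| ≤ C

lemma BF.mul {H H' : ℝ → E3 → ℝ} (h : BF T H) (h' : BF T H') : BF T (fun τ x => H τ x * H' τ x) := by
  obtain ⟨hm, C, hC0, hC⟩ := h
  obtain ⟨hm', C', hC0', hC'⟩ := h'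
  refine ⟨hm.mul hm', C * C', by positivity, ?_⟩
  filter_upwards [hC, hC'] with τ a b x
  rw [abs_mul]; exact mul_le_mul (a x) (b x) (abs_nonneg _) hC0

lemma BF.sub {H H' : ℝ → E3 → ℝ} (h : BF T H) (h' : BF T H') : BF T (fun τ x => H τ x - H' τ x) := by
  obtain ⟨hm, C, hC0, hC⟩ := h
  obtain ⟨hm', C', hC0', hC'⟩ := h'
  refine ⟨hm.sub hm', C + C', by positivity, ?_⟩
  filter_upwards [hC, hC'] with τ a b x
  exact (abs_sub _ _).trans (add_le_add (a x) (b x))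

lemma BF.congr {H H' : ℝ → E3 → ℝ} (h : BF T H) (e : ∀ᵐ τ ∂(tm T), ∀ x, H τ x = H' τ x) : BF T H' := by
  obtain ⟨hm, C, hC0, hC⟩ := h
  refine ⟨hm.congr e, C, hC0, ?_⟩
  filter_upwards [hC, e] with τ a b x
  rw [← b]; exact a x

lemma integrable_mul_BF {G H : ℝ → E3 → ℝ} (hG : Integrable (fun p : ℝ × E3 => G p.1 p.2) ((tm T).prod cm))
    (hH : BF T H) : Integrable (fun p : ℝ × E3 => G p.1 p.2 * H p.1 p.2) ((tm T).prod cm) := by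
  obtain ⟨hm, C, hC0, hC⟩ := hH
  refine hG.mul_bdd (c := C) hm.to_cm ?_
  filter_upwards [Measure.quasiMeasurePreserving_fst.ae hC] with p hp using hp _

/-- The basic two-time functions. -/
lemma Dg.prod {G H : ℝ → E3 → ℝ} (hG : Integrable (fun p : ℝ × E3 => G p.1 p.2) ((tm T).prod cm))
    (hH : BF T H) : Dg T (fun t τ => ∫ x in cell, G t x * H τ x) := by
  have hHm := hH.1
  obtain ⟨C, hC0, hC⟩ := hH.2
  have hcomm : MeasurePreserving (fun q : (ℝ × ℝ) × E3 => ((q.1.1, q.2), q.1.2))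
      (((tm T).prod (tm T)).prod cm) (((tm T).prod cm).prod (tm T)) := by
    have h1 := measurePreserving_prodAssoc (tm T) (tm T) cm
    have h2 := (MeasurePreserving.id (tm T)).prod
      (Measure.measurePreserving_swap (μ := tm T) (ν := cm))
    have h3 := (measurePreserving_prodAssoc (tm T) cm (tm T)).symm
    exact (h3.comp (h2.comp h1))
  have hcemb : MeasurableEmbedding (fun q : (ℝ × ℝ) × E3 => ((q.1.1, q.2), q.1.2)) := by
    exact (((MeasurableEquiv.prodAssoc (α := ℝ) (β := ℝ) (γ := E3)).trans
      ((MeasurableEquiv.refl ℝ).prodCongr MeasurableEquiv.prodComm)).trans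
      (MeasurableEquiv.prodAssoc (α := ℝ) (β := E3) (γ := ℝ)).symm).measurableEmbedding
  have hHt : AEStronglyMeasurable (fun q : (ℝ × E3) × ℝ => H q.2 q.1.2) (((tm T).prod cm).prod (tm T)) := by
    have q1 : Measure.QuasiMeasurePreserving (fun q : (ℝ × E3) × ℝ => (q.2, q.1.2))
        (((tm T).prod cm).prod (tm T)) ((tm T).prod cm) :=
      (Measure.measurePreserving_swap (μ := cm) (ν := tm T)).quasiMeasurePreserving.comp
        (MeasureTheory.QuasiMeasurePreserving.prodMap Measure.quasiMeasurePreserving_snd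
          (Measure.QuasiMeasurePreserving.id (tm T)))
    exact hHm.to_cm.comp_quasiMeasurePreserving q1
  have hHb : ∀ᵐ q : (ℝ × E3) × ℝ ∂(((tm T).prod cm).prod (tm T)), ‖H q.2 q.1.2‖ ≤ C := by
    filter_upwards [Measure.quasiMeasurePreserving_snd.ae hC] with q hq using hq _
  have hGH : Integrable (fun q : (ℝ × E3) × ℝ => G q.1.1 q.1.2 * H q.2 q.1.2)
      (((tm T).prod cm).prod (tm T)) := (hG.comp_fst (tm T)).mul_bdd (c := C) hHt hHb
  have hGH' : Integrable (fun q : (ℝ × ℝ) × E3 => G q.1.1 q.2 * H q.1.2 q.2)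
      (((tm T).prod (tm T)).prod cm) := hcomm.integrable_comp_of_integrable hGH
  have hdiag := integrable_mul_BF hG hH
  refine ⟨hGH'.integral_prod_left, hdiag.integral_prod_left, ?_⟩
  have hthc : ∀ n, Integrable (fun q : (ℝ × E3) × ℝ => th n (q.1.1 - q.2) * (G q.1.1 q.1.2 * H q.2 q.1.2))
      (((tm T).prod cm).prod (tm T)) := fun n => by
    obtain ⟨B, -, hB⟩ := th_bound n
    refine hGH.bdd_mul (c := B) (Continuous.aestronglyMeasurable ?_) (ae_of_all _ fun q => (hB _).1)
    exact (th_smooth n).continuous.comp (by fun_prop)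
  have hF : ∀ n, Integrable (fun p : ℝ × E3 => G p.1 p.2 * tav T n (fun τ => H τ p.2) p.1)
      ((tm T).prod cm) := fun n => by
    refine (hthc n).integral_prod_left.congr (ae_of_all _ fun p => ?_)
    simp only [tav]
    rw [← integral_const_mul]
    congr 1; ext τ; ring
  have e : ∀ n, ∫ p : ℝ × ℝ, th n (p.1 - p.2) * (∫ x in cell, G p.1 x * H p.2 x) ∂((tm T).prod (tm T)) =
      ∫ x in cell, ∫ t in Ioo 0 T, G t x * tav T n (fun τ => H τ x) t := by
    intro n
    have h1 : ∫ p : ℝ × ℝ, th n (p.1 - p.2) * (∫ x in cell, G p.1 x * H p.2 x) ∂((tm T).prod (tm T)) =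
        ∫ q : (ℝ × ℝ) × E3, th n (q.1.1 - q.1.2) * (G q.1.1 q.2 * H q.1.2 q.2)
          ∂(((tm T).prod (tm T)).prod cm) := by
      have h := hcomm.integrable_comp_of_integrable (hthc n)
      simp only [Function.comp_def] at h
      rw [integral_prod _ h]
      simp only [integral_const_mul]
    have h2 := hcomm.integral_comp hcemb
      (fun q : (ℝ × E3) × ℝ => th n (q.1.1 - q.2) * (G q.1.1 q.1.2 * H q.2 q.1.2))
    rw [h1, h2, integral_prod _ (hthc n), ← integral_prod_symm _ (hF n)]
    refine integral_congr_ae (ae_of_all _ fun p => ?_)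
    simp only [tav]
    rw [← integral_const_mul]
    congr 1; ext τ; ring
  simp only [e]
  rw [← integral_prod (fun p : ℝ × E3 => G p.1 p.2 * H p.1 p.2) hdiag,
    integral_prod_symm (fun p : ℝ × E3 => G p.1 p.2 * H p.1 p.2) hdiag]
  have hGx := hG.prod_left_ae
  have hCx : ∀ x, ∀ᵐ τ ∂(tm T), |H τ x| ≤ C := fun x => hC.mono fun τ h => h x
  have hHx : ∀ᵐ x ∂cm, AEStronglyMeasurable (fun τ => H τ x) (tm T) := by
    have h1 : AEStronglyMeasurable (fun z : E3 × ℝ => H z.2 z.1) (cm.prod (tm T)) :=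
      hHm.to_cm.comp_quasiMeasurePreserving
        (Measure.measurePreserving_swap (μ := cm) (ν := tm T)).quasiMeasurePreserving
    exact h1.prodMk_left
  refine tendsto_integral_of_dominated_convergence (fun x => ∫ t in Ioo 0 T, ‖G t x‖ * C)
    (fun n => (hF n).integral_prod_right.1) (hG.norm.mul_const C).integral_prod_right ?_ ?_
  · intro n
    filter_upwards [hGx] with x hx
    refine norm_integral_le_of_norm_le (hx.norm.mul_const C) (ae_of_all _ fun t => ?_)
    rw [norm_mul]
    exact mul_le_mul_of_nonneg_left (abs_tav_le (hCx x) hC0 n t) (norm_nonneg _)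
  · have hFx : ∀ᵐ x ∂cm, ∀ n, Integrable (fun t => G t x * tav T n (fun τ => H τ x) t) (tm T) :=
      ae_all_iff.2 fun n => (hF n).prod_left_ae
    filter_upwards [hGx, hHx, hFx] with x hx hx2 hx3
    refine tendsto_integral_of_dominated_convergence (fun t => ‖G t x‖ * C) (fun n => (hx3 n).1)
      (hx.norm.mul_const C) (fun n => ae_of_all _ fun t => ?_) ?_
    · rw [norm_mul]
      exact mul_le_mul_of_nonneg_left (abs_tav_le (hCx x) hC0 n t) (norm_nonneg _)
    · have hi : Integrable (fun τ => H τ x) (tm T) := Integrable.of_bound hx2 C (hCx x)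
      filter_upwards [tav_tendsto hi] with t ht using ht.const_mul _

end Dg

/-! ### The two parts of the test field -/

/-- The part of `zeta` in which `φ` stands outside the convolution. -/
def zo (K φ : E3 → ℝ) (v : Fin 3 → E3 → ℝ) (i : Fin 3) (x : E3) : ℝ :=
  2 * (φ x * curlS (fun i => cv K (v i)) i x) + crossG φ (fun i => cv K (v i)) i x

/-- The part of `zeta` in which `φ` stands inside the convolution. -/
def zi (K φ : E3 → ℝ) (v : Fin 3 → E3 → ℝ) (i : Fin 3) (x : E3) : ℝ :=
  2 * curlS (fun i => cv K (fun y => φ y * v i y)) i x - cv K (crossG φ v i) x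

lemma zeta_split (K φ : E3 → ℝ) (v : Fin 3 → E3 → ℝ) :
    (fun i x => zo K φ v i x + zi K φ v i x) = zeta K φ v := by
  ext i x; simp only [zo, zi, zeta]; ring

section adjoint

variable {K φ : E3 → ℝ} {a b : Fin 3 → E3 → ℝ}

lemma integral_curl_cv (hK : Ker K) (he : ∀ x, K (-x) = K x)
    (hap : ∀ i, IsPeriodic (a i)) (ha : ∀ i, Integrable (a i) cm)
    (hbp : ∀ i, IsPeriodic (b i)) (hb : ∀ i, Integrable (b i) cm) :
    ∑ i, ∫ x in cell, a i x * curlS (fun i => cv K (b i)) i x =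
      ∑ i, ∫ x in cell, b i x * curlS (fun i => cv K (a i)) i x := by
  have sa : ∀ i j, SmP (pd j (cv K (a i))) := fun i j =>
    (cv_smp hK ((hap i).locallyIntegrable (ha i)) (hap i)).pd j
  have sb : ∀ i j, SmP (pd j (cv K (b i))) := fun i j =>
    (cv_smp hK ((hbp i).locallyIntegrable (hb i)) (hbp i)).pd j
  have q : ∀ i j k, ∫ x in cell, a i x * pd j (cv K (b k)) x =
      - ∫ x in cell, b k x * pd j (cv K (a i)) x := by
    intro i j k
    rw [← neg_eq_iff_eq_neg, ← integral_pd_cv hK he (hap i) (ha i) (hbp k) (hb k) j]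
    simp only [mul_comm]
  have ea := fun i k j l m => integral_mul_sub (ha i) (sb k j) (sb l m)
  have eb := fun i k j l m => integral_mul_sub (hb i) (sa k j) (sa l m)
  simp only [Fin.sum_univ_three, curlS, Matrix.cons_val, ea, eb, q]
  ring

lemma crossG_integrable (hφ : SmP φ) (hb : ∀ i, Integrable (b i) cm) (i : Fin 3) :
    Integrable (crossG φ b i) cm := by
  have h : ∀ j k, Integrable (fun x => pd j φ x * b k x) cm := fun j k =>
    (Integrable.mul_smp (hb k) (hφ.pd j)).congr (ae_of_all _ fun x => mul_comm _ _)
  fin_cases i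
  · exact (h 1 2).sub (h 2 1)
  · exact (h 2 0).sub (h 0 2)
  · exact (h 0 1).sub (h 1 0)

lemma crossG_periodic (hφ : SmP φ) (hb : ∀ i, IsPeriodic (b i)) (i : Fin 3) :
    IsPeriodic (crossG φ b i) := by
  intro x k
  fin_cases i <;> simp only [crossG, Matrix.cons_val, Fin.zero_eta, Fin.mk_one, Fin.reduceFinMk,
    (hφ.pd _).per x k, hb _ x k]

lemma integral_zi (hK : Ker K) (he : ∀ x, K (-x) = K x) (hφ : SmP φ)
    (hap : ∀ i, IsPeriodic (a i)) (ha : ∀ i, Integrable (a i) cm)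
    (hbp : ∀ i, IsPeriodic (b i)) (hb : ∀ i, Integrable (b i) cm) :
    ∑ i, ∫ x in cell, a i x * zi K φ b i x = ∑ i, ∫ x in cell, b i x * zo K φ a i x := by
  have sa : ∀ i, SmP (cv K (a i)) := fun i => cv_smp hK ((hap i).locallyIntegrable (ha i)) (hap i)
  have hφb : ∀ i, Integrable (fun x => φ x * b i x) cm := fun i =>
    (Integrable.mul_smp (hb i) hφ).congr (ae_of_all _ fun x => mul_comm _ _)
  have hφbp : ∀ i, IsPeriodic (fun x => φ x * b i x) := fun i x k => by simp only [hφ.per x k, hbp i x k]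
  have sb : ∀ i, SmP (cv K (fun x => φ x * b i x)) := fun i =>
    cv_smp hK ((hφbp i).locallyIntegrable (hφb i)) (hφbp i)
  have hci := crossG_integrable hφ hb
  have hcp := crossG_periodic hφ hbp
  have sc : ∀ i, SmP (cv K (crossG φ b i)) := fun i => cv_smp hK ((hcp i).locallyIntegrable (hci i)) (hcp i)
  have e1 : ∀ i, ∫ x in cell, a i x * zi K φ b i x =
      2 * (∫ x in cell, a i x * curlS (fun i => cv K (fun y => φ y * b i y)) i x) -
        ∫ x in cell, cv K (a i) x * crossG φ b i x := by
    intro i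
    have h := integral_mul_sub (ha i) ((curlS_smp sb i).const_mul 2) (sc i)
    have h2 := integral_cv_even hK he (hap i) (ha i) (hcp i) (hci i)
    rw [h2, ← integral_const_mul]
    simp only [zi]
    rw [h]
    simp only [mul_left_comm]
  have e2 : ∀ i, ∫ x in cell, b i x * zo K φ a i x =
      2 * (∫ x in cell, φ x * b i x * curlS (fun i => cv K (a i)) i x) +
        ∫ x in cell, b i x * crossG φ (fun i => cv K (a i)) i x := by
    intro i
    rw [← integral_const_mul, ← integral_add]
    · refine integral_congr_ae (ae_of_all _ fun x => ?_)
      simp only [zo]; ring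
    · exact (Integrable.mul_smp (hφb i) (curlS_smp sa i)).const_mul 2
    · exact Integrable.mul_smp (hb i) (crossG_smp hφ sa i)
  have e3 : ∑ i, ∫ x in cell, cv K (a i) x * crossG φ b i x =
      - ∑ i, ∫ x in cell, b i x * crossG φ (fun i => cv K (a i)) i x := by
    have i1 : ∀ i, Integrable (fun x => cv K (a i) x * crossG φ b i x) cm := fun i =>
      (Integrable.mul_smp (hci i) (sa i)).congr (ae_of_all _ fun x => mul_comm _ _)
    rw [← integral_finsetSum _ fun i _ => i1 i, ← integral_finsetSum _ fun i _ =>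
      Integrable.mul_smp (hb i) (crossG_smp hφ sa i), ← integral_neg]
    refine integral_congr_ae (ae_of_all _ fun x => ?_)
    simp only [Fin.sum_univ_three, crossG, Matrix.cons_val]
    ring
  simp only [e1, e2, Finset.sum_sub_distrib, Finset.sum_add_distrib, ← Finset.mul_sum, e3]
  rw [integral_curl_cv hK he hap ha hφbp hφb]
  ring

end adjoint

/-! ### Two-time fields -/

/-- Bounded families of integrable fields. -/
def LF (T : ℝ) (V : ℝ → E3 → ℝ) : Prop :=
  JM (tm T) V ∧ ∃ C, 0 ≤ C ∧ ∀ᵐ τ ∂(tm T), IsPeriodic (V τ) ∧ Integrable (V τ) cm ∧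
    ∫ x in cell, |V τ x| ≤ C

/-- Bounded families of smooth fields with bounded derivatives. -/
structure SF (T : ℝ) (F : ℝ → E3 → ℝ) : Prop where
  smp : ∀ᵐ τ ∂(tm T), SmP (F τ)
  bf : BF T F
  pd : ∀ j, BF T (fun τ => pd j (F τ))

/-- Two-time fields whose pairings with integrable fields have double time averages. -/
def TF (T : ℝ) (Z : ℝ → ℝ → E3 → ℝ) : Prop :=
  ∀ G : ℝ → E3 → ℝ, Integrable (fun p : ℝ × E3 => G p.1 p.2) ((tm T).prod cm) →
    (∃ g : ℝ → Prop, (∀ᵐ t ∂(tm T), g t) ∧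
      ∀ t τ, g t → g τ → Integrable (fun x => G t x * Z t τ x) cm) ∧
    Dg T (fun t τ => ∫ x in cell, G t x * Z t τ x)

/-- Smooth two-time fields. -/
structure TS (T : ℝ) (Z : ℝ → ℝ → E3 → ℝ) : Prop where
  tf : TF T Z
  pd : ∀ j, TF T (fun t τ => pd j (Z t τ))
  smp : ∃ g : ℝ → Prop, (∀ᵐ t ∂(tm T), g t) ∧ ∀ t τ, g t → g τ → SmP (Z t τ)

section classes

variable {T : ℝ} {V V' F F' a : ℝ → E3 → ℝ} {Z Z' : ℝ → ℝ → E3 → ℝ} {K : E3 → ℝ}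

lemma LF.sub (h : LF T V) (h' : LF T V') : LF T (fun τ x => V τ x - V' τ x) := by
  obtain ⟨hm, C, hC0, hC⟩ := h
  obtain ⟨hm', C', hC0', hC'⟩ := h'
  refine ⟨hm.sub hm', C + C', by positivity, ?_⟩
  filter_upwards [hC, hC'] with τ ⟨p1, i1, b1⟩ ⟨p2, i2, b2⟩
  refine ⟨fun x i => by simp only [p1 x i, p2 x i], i1.sub i2, ?_⟩
  refine (integral_mono (i1.sub i2).abs (i1.abs.add i2.abs) fun x => abs_sub _ _).trans ?_
  rw [integral_add' i1.abs i2.abs]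
  exact add_le_add b1 b2

lemma LF.test_mul {φ : ℝ → E3 → ℝ} (hφ : IsTest T φ) (h : LF T V) : LF T (fun τ x => φ τ x * V τ x) := by
  obtain ⟨hm, C, hC0, hC⟩ := h
  obtain ⟨B, hB0, hB⟩ := hφ.exists_bound
  refine ⟨hφ.jm.mul hm, B * C, by positivity, ?_⟩
  filter_upwards [hC] with τ ⟨p1, i1, b1⟩
  have hi : Integrable (fun x => φ τ x * V τ x) cm :=
    (Integrable.mul_smp i1 (hφ.smp τ)).congr (ae_of_all _ fun x => mul_comm _ _)
  refine ⟨fun x i => by simp only [p1 x i, hφ.periodic τ x i], hi, ?_⟩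
  refine (integral_mono hi.abs (i1.abs.const_mul B) fun x => ?_).trans ?_
  · simp only [abs_mul]
    exact mul_le_mul_of_nonneg_right (hB τ x) (abs_nonneg _)
  · rw [integral_const_mul]; gcongr

lemma LF.bf_cv (h : LF T V) (hK : Ker K) : BF T (fun τ => cv K (V τ)) := by
  obtain ⟨hm, C, hC0, hC⟩ := h
  obtain ⟨D, hD0, hD⟩ := hK.abs_cv_le
  refine ⟨hm.cv hK.continuous, D * C, by positivity, ?_⟩
  filter_upwards [hC] with τ ⟨p1, i1, b1⟩ x
  exact (hD _ p1 i1 x).trans (by gcongr)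

lemma LF.sf_cv (h : LF T V) (hK : Ker K) : SF T (fun τ => cv K (V τ)) := by
  obtain ⟨C, hC0, hC⟩ := h.2
  refine ⟨?_, h.bf_cv hK, fun j => (h.bf_cv (hK.pd j)).congr ?_⟩
  · filter_upwards [hC] with τ ⟨p1, i1, b1⟩ using cv_smp hK (p1.locallyIntegrable i1) p1
  · filter_upwards [hC] with τ ⟨p1, i1, b1⟩ x
    rw [pd_cv hK (p1.locallyIntegrable i1)]

lemma SF.congr (h : SF T F) (e : ∀ᵐ τ ∂(tm T), F τ = F' τ) : SF T F' := by
  refine ⟨?_, h.bf.congr (e.mono fun τ h x => congrFun h x),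
    fun j => (h.pd j).congr (e.mono fun τ h x => by rw [h])⟩
  filter_upwards [h.smp, e] with τ a b
  rwa [← b]

lemma LF.sf_pd_cv (h : LF T V) (hK : Ker K) (j : Fin 3) : SF T (fun τ => Helicity.pd j (cv K (V τ))) := by
  obtain ⟨C, hC0, hC⟩ := h.2
  refine (h.sf_cv (hK.pd j)).congr ?_
  filter_upwards [hC] with τ ⟨p1, i1, b1⟩
  rw [pd_cv hK (p1.locallyIntegrable i1)]

lemma SF.sub (h : SF T F) (h' : SF T F') : SF T (fun τ x => F τ x - F' τ x) := by
  refine ⟨?_, h.bf.sub h'.bf, fun j => ((h.pd j).sub (h'.pd j)).congr ?_⟩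
  · filter_upwards [h.smp, h'.smp] with τ a b using a.sub b
  · filter_upwards [h.smp, h'.smp] with τ a b x
    rw [pd_sub a.1 b.1]

lemma BF.const (c : ℝ) : BF T (fun _ _ => c) :=
  ⟨aestronglyMeasurable_const, |c|, abs_nonneg _, ae_of_all _ fun _ _ => le_rfl⟩

lemma SF.const_mul (h : SF T F) (c : ℝ) : SF T (fun τ x => c * F τ x) := by
  refine ⟨h.smp.mono fun τ a => a.const_mul c, (BF.const c).mul h.bf,
    fun j => ((BF.const c).mul (h.pd j)).congr ?_⟩
  filter_upwards [h.smp] with τ a x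
  rw [pd_const_mul a.1]

lemma SF.one : SF T (fun _ _ => 1) :=
  ⟨ae_of_all _ fun _ => SmP.const 1, BF.const 1, fun j => by simpa only [pd_const] using BF.const 0⟩

lemma IsTest.bf (hφ : IsTest T a) : BF T a := by
  obtain ⟨B, hB0, hB⟩ := hφ.exists_bound
  exact ⟨hφ.jm, B, hB0, ae_of_all _ fun t x => hB t x⟩

lemma IsTest.sf (hφ : IsTest T a) : SF T a :=
  ⟨ae_of_all _ fun t => hφ.smp t, hφ.bf, fun j => (hφ.pd j).bf⟩

lemma TF.add (h : TF T Z) (h' : TF T Z') : TF T (fun t τ x => Z t τ x + Z' t τ x) := fun G hG => by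
  obtain ⟨⟨g, hg, hi⟩, hd⟩ := h G hG
  obtain ⟨⟨g', hg', hi'⟩, hd'⟩ := h' G hG
  have hgg : ∀ᵐ t ∂(tm T), g t ∧ g' t := hg.and hg'
  refine ⟨⟨fun t => g t ∧ g' t, hgg, fun t τ a b => ?_⟩, (hd.add hd').congr hgg fun t τ a b => ?_⟩
  · simp only [mul_add]; exact (hi t τ a.1 b.1).add (hi' t τ a.2 b.2)
  · simp only [mul_add]; exact (integral_add (hi t τ a.1 b.1) (hi' t τ a.2 b.2)).symm

lemma TF.const_mul (h : TF T Z) (c : ℝ) : TF T (fun t τ x => c * Z t τ x) := fun G hG => by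
  obtain ⟨⟨g, hg, hi⟩, hd⟩ := h G hG
  refine ⟨⟨g, hg, fun t τ a b => ?_⟩, (hd.const_mul c).congr hg fun t τ a b => ?_⟩
  · simp only [mul_left_comm]; exact (hi t τ a b).const_mul c
  · simp only [mul_left_comm]; exact (integral_const_mul _ _).symm

lemma TF.congr (h : TF T Z) {g : ℝ → Prop} (hg : ∀ᵐ t ∂(tm T), g t)
    (e : ∀ t τ, g t → g τ → Z t τ = Z' t τ) : TF T Z' := fun G hG => by
  obtain ⟨⟨g', hg', hi⟩, hd⟩ := h G hG
  refine ⟨⟨fun t => g t ∧ g' t, hg.and hg', fun t τ a b => ?_⟩,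
    hd.congr hg fun t τ a b => by rw [e t τ a b]⟩
  rw [← e t τ a.1 b.1]; exact hi t τ a.2 b.2

lemma TF.base (ha : BF T a) (hF : BF T F) : TF T (fun t τ x => a t x * F τ x) := fun G hG => by
  have hd := Dg.prod (G := fun t x => G t x * a t x) (integrable_mul_BF hG ha) hF
  simp only [mul_assoc] at hd
  refine ⟨?_, hd⟩
  obtain ⟨hm, C, hC0, hC⟩ := hF
  refine ⟨fun t => (Integrable (fun x => G t x * a t x) cm) ∧
    (∀ x, |F t x| ≤ C) ∧ AEStronglyMeasurable (F t) volume, ?_, fun t τ p q => ?_⟩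
  · exact (integrable_mul_BF hG ha).prod_right_ae.and (hC.and hm.ae_meas)
  · have := p.1.mul_bdd (c := C) q.2.2.restrict (ae_of_all _ fun x => q.2.1 x)
    refine this.congr (ae_of_all _ fun x => ?_)
    simp only [mul_assoc]

lemma TS.add (h : TS T Z) (h' : TS T Z') : TS T (fun t τ x => Z t τ x + Z' t τ x) := by
  obtain ⟨g, hg, hs⟩ := h.smp
  obtain ⟨g', hg', hs'⟩ := h'.smp
  have hgg : ∀ᵐ t ∂(tm T), g t ∧ g' t := hg.and hg'
  refine ⟨h.tf.add h'.tf, fun j => ((h.pd j).add (h'.pd j)).congr hgg fun t τ a b => ?_,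
    fun t => g t ∧ g' t, hgg, fun t τ a b => (hs t τ a.1 b.1).add (hs' t τ a.2 b.2)⟩
  rw [pd_add (hs t τ a.1 b.1).1 (hs' t τ a.2 b.2).1]

lemma TS.const_mul (h : TS T Z) (c : ℝ) : TS T (fun t τ x => c * Z t τ x) := by
  obtain ⟨g, hg, hs⟩ := h.smp
  refine ⟨h.tf.const_mul c, fun j => ((h.pd j).const_mul c).congr hg fun t τ a b => ?_,
    g, hg, fun t τ a b => (hs t τ a b).const_mul c⟩
  rw [pd_const_mul (hs t τ a b).1]

lemma TS.sub (h : TS T Z) (h' : TS T Z') : TS T (fun t τ x => Z t τ x - Z' t τ x) := by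
  simpa only [neg_one_mul, ← sub_eq_add_neg] using h.add (h'.const_mul (-1))

lemma TS.base (ha : SF T a) (hF : SF T F) : TS T (fun t τ x => a t x * F τ x) := by
  have hg : ∀ᵐ t ∂(tm T), SmP (a t) ∧ SmP (F t) := ha.smp.and hF.smp
  refine ⟨TF.base ha.bf hF.bf, fun j => ((TF.base ha.bf (hF.pd j)).add
    (TF.base (ha.pd j) hF.bf)).congr hg fun t τ p q => ?_, _, hg, fun t τ p q => p.1.mul q.2⟩
  rw [pd_mul p.1.1 q.2.1]
  ext x; ring

lemma TS.of_sf (hF : SF T F) : TS T (fun _ τ => F τ) := by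
  simpa only [one_mul] using TS.base SF.one hF

variable {U : Fin 3 → ℝ → E3 → ℝ} {φ : ℝ → E3 → ℝ}

lemma zo_ts (hφ : IsTest T φ) (hU : ∀ i, LF T (U i)) (hK : Ker K) (i : Fin 3) :
    TS T (fun t τ => zo K (φ t) (fun i => U i τ) i) := by
  have c := fun i => (hU i).sf_cv hK
  have d := fun i j => (hU i).sf_pd_cv hK j
  have p := fun j => (hφ.pd j).sf
  fin_cases i
  · exact ((TS.base hφ.sf ((d 2 1).sub (d 1 2))).const_mul 2).add
      ((TS.base (p 1) (c 2)).sub (TS.base (p 2) (c 1)))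
  · exact ((TS.base hφ.sf ((d 0 2).sub (d 2 0))).const_mul 2).add
      ((TS.base (p 2) (c 0)).sub (TS.base (p 0) (c 2)))
  · exact ((TS.base hφ.sf ((d 1 0).sub (d 0 1))).const_mul 2).add
      ((TS.base (p 0) (c 1)).sub (TS.base (p 1) (c 0)))

lemma zi_ts (hφ : IsTest T φ) (hU : ∀ i, LF T (U i)) (hK : Ker K) (i : Fin 3) :
    TS T (fun _ τ => zi K (φ τ) (fun i => U i τ) i) := by
  have d := fun i j => (LF.test_mul hφ (hU i)).sf_pd_cv hK j
  have c := fun i j k l =>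
    ((LF.test_mul (hφ.pd i) (hU j)).sub (LF.test_mul (hφ.pd k) (hU l))).sf_cv hK
  refine TS.of_sf ?_
  fin_cases i
  · exact (((d 2 1).sub (d 1 2)).const_mul 2).sub (c 1 2 2 1)
  · exact (((d 0 2).sub (d 2 0)).const_mul 2).sub (c 2 0 0 2)
  · exact (((d 1 0).sub (d 0 1)).const_mul 2).sub (c 0 1 1 0)

end classes

/-! ### The momentum equation tested with the mollified vorticity -/

lemma mo_affine {v w z : Fin 3 → E3 → ℝ} {P : E3 → ℝ} (a b : ℝ)
    (hz : ∀ i, Integrable (fun x => v i x * z i x) cm)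
    (hw : ∀ i, Integrable (fun x => v i x * w i x) cm) (hd : ∀ i, Differentiable ℝ (z i)) :
    mo v P (fun i x => a * z i x + b * w i x) (fun i x => b * z i x) =
      a * (∑ i, ∫ x in cell, v i x * z i x) + b * mo v P w z := by
  have e1 : ∀ i, ∫ x in cell, v i x * (a * z i x + b * w i x) =
      a * (∫ x in cell, v i x * z i x) + b * ∫ x in cell, v i x * w i x := by
    intro i
    rw [← integral_const_mul, ← integral_const_mul, ← integral_add ((hz i).const_mul a)
      ((hw i).const_mul b)]
    refine integral_congr_ae (ae_of_all _ fun x => ?_)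
    simp only; ring
  have e2 : ∀ i j, pd j (fun x => b * z i x) = fun x => b * pd j (z i) x := by
    intro i j
    ext x
    simp only [pd]
    rw [fderiv_const_mul (hd i x)]
    rfl
  simp only [mo, e1, e2, mul_left_comm _ b, integral_const_mul, Finset.sum_add_distrib,
    ← Finset.mul_sum]
  ring

lemma Nik.integral_abs_le {s A : ℝ} {q : ℝ≥0∞} {f : E3 → ℝ} (hf : Nik s q A f) (hq : 1 ≤ q)
    (hA : 0 ≤ A) : ∫ x in cell, |f x| ≤ A := by
  have hi := hf.integrable hq
  have := (hf.mono_q hq).bd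
  rw [eLpNorm_one_eq_lintegral_enorm, ← ofReal_integral_norm_eq_lintegral_enorm hi,
    ENNReal.ofReal_le_ofReal_iff hA] at this
  exact this

section time

variable {T s M : ℝ} {A : ℝ → ℝ} {U : Fin 3 → ℝ → E3 → ℝ} {φ : ℝ → E3 → ℝ} {K : E3 → ℝ}

lemma Flow.lf (h : Flow T s A M U) (i : Fin 3) : LF T (U i) := by
  refine ⟨h.jm i, max M 0, le_max_right _ _, ?_⟩
  filter_upwards [h.nik, h.bdd] with t h1 h2
  have hi := (h1 i).integrable one_le_three
  refine ⟨h.per i t, hi, ?_⟩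
  have := (h2 i).trans (ENNReal.ofReal_le_ofReal (le_max_left M 0))
  rw [eLpNorm_one_eq_lintegral_enorm, ← ofReal_integral_norm_eq_lintegral_enorm hi,
    ENNReal.ofReal_le_ofReal_iff (le_max_right _ _)] at this
  exact this

lemma Flow.integrable_prod (h : Flow T s A M U) {G : ℝ → E3 → ℝ} (hG : JM (tm T) G) (c : ℝ)
    (hc : ∀ᵐ t ∂(tm T), Integrable (G t) cm ∧ ∫ x in cell, |G t x| ≤ c * A t ^ 3) :
    Integrable (fun p : ℝ × E3 => G p.1 p.2) ((tm T).prod cm) := by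
  have hm := hG.to_cm
  refine (integrable_prod_iff hm).2 ⟨hc.mono fun t h => h.1, ?_⟩
  refine h.integrable_of_le hm.norm.integral_prod_right' c ?_
  filter_upwards [hc] with t ht
  rw [abs_of_nonneg (integral_nonneg fun _ => norm_nonneg _)]
  exact ht.2

lemma hasDerivAt_th (n : ℕ) (τ t : ℝ) :
    HasDerivAt (fun t => th n (t - τ)) (deriv (th n) (t - τ)) t :=
  (((th_smooth n).differentiable (by simp)) (t - τ)).hasDerivAt.comp_sub_const t τ

lemma IsTest.th_mul {z : ℝ → E3 → ℝ} (hz : IsTest T z) (n : ℕ) (τ : ℝ) :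
    IsTest T (fun t x => th n (t - τ) * z t x) ∧
    timeDeriv (fun t x => th n (t - τ) * z t x) =
      fun t x => deriv (th n) (t - τ) * z t x + th n (t - τ) * timeDeriv z t x := by
  refine ⟨hz.mul_smooth (c := fun t _ => th n (t - τ)) ?_ fun t x i => rfl, ?_⟩
  · exact (th_smooth n).comp (contDiff_fst.sub contDiff_const)
  · ext t x
    exact ((hasDerivAt_th n τ t).mul (hz.hasDerivAt t x)).deriv

lemma isTest_th_mul_const {f : E3 → ℝ} (hf : SmP f) (n : ℕ) {τ : ℝ}
    (h0 : 1 / ((n : ℝ) + 1) < τ) (h1 : τ + 1 / ((n : ℝ) + 1) < T) :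
    IsTest T (fun t x => th n (t - τ) * f x) := by
  refine ⟨?_, fun t x i => by simp only [hf.per x i], τ - 1 / ((n : ℝ) + 1), τ + 1 / ((n : ℝ) + 1),
    by linarith, h1, fun t ht x => ?_⟩
  · exact ((th_smooth n).comp (contDiff_fst.sub contDiff_const)).mul (hf.1.comp contDiff_snd)
  · rw [th_zero, zero_mul]
    by_contra h'
    push Not at h'
    rw [abs_lt] at h'
    exact ht ⟨by linarith [h'.1], by linarith [h'.2]⟩

lemma timeDeriv_th_mul_const (f : E3 → ℝ) (n : ℕ) (τ : ℝ) :
    timeDeriv (fun t x => th n (t - τ) * f x) = fun t x => deriv (th n) (t - τ) * f x := by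
  ext t x
  exact ((hasDerivAt_th n τ t).mul_const (f x)).deriv

lemma IsTest.mul_smp {z : ℝ → E3 → ℝ} (hz : IsTest T z) {f : E3 → ℝ} (hf : SmP f) :
    IsTest T (fun t x => z t x * f x) ∧
    timeDeriv (fun t x => z t x * f x) = fun t x => timeDeriv z t x * f x := by
  constructor
  · simpa only [mul_comm] using hz.mul_smooth (c := fun _ => f) (hf.1.comp contDiff_snd) fun _ => hf.per
  · ext t x
    exact ((hz.hasDerivAt t x).mul_const (f x)).deriv

lemma IsTest.zo (hφ : IsTest T φ) {v : Fin 3 → E3 → ℝ} (hv : ∀ i, SmP (Helicity.cv K (v i))) (i : Fin 3) :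
    IsTest T (fun t => Helicity.zo K (φ t) v i) ∧
    timeDeriv (fun t => Helicity.zo K (φ t) v i) = fun t => Helicity.zo K (timeDeriv φ t) v i := by
  have hc := curlS_smp hv i
  have h1 := hφ.mul_smp hc
  have h2 := h1.1.const_mul 2
  have h2' := h1.1.td_const_mul 2
  have p := fun j k => (hφ.pd j).mul_smp (hv k)
  have q : ∀ j k l m, IsTest T (fun t x => Helicity.pd j (φ t) x * Helicity.cv K (v k) x -
        Helicity.pd l (φ t) x * Helicity.cv K (v m) x) ∧
      timeDeriv (fun t x => Helicity.pd j (φ t) x * Helicity.cv K (v k) x -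
        Helicity.pd l (φ t) x * Helicity.cv K (v m) x) = fun t x =>
      Helicity.pd j (timeDeriv φ t) x * Helicity.cv K (v k) x -
        Helicity.pd l (timeDeriv φ t) x * Helicity.cv K (v m) x := by
    intro j k l m
    refine ⟨(p j k).1.sub (p l m).1, ?_⟩
    rw [(p j k).1.td_sub (p l m).1, (p j k).2, (p l m).2, hφ.td_pd, hφ.td_pd]
  have r : ∀ {X : ℝ → E3 → ℝ} {Y : ℝ → E3 → ℝ}, IsTest T X ∧ timeDeriv X = Y →
      IsTest T (fun t x => 2 * (φ t x * curlS (fun i => Helicity.cv K (v i)) i x) + X t x) ∧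
      timeDeriv (fun t x => 2 * (φ t x * curlS (fun i => Helicity.cv K (v i)) i x) + X t x) =
        fun t x => 2 * (timeDeriv φ t x * curlS (fun i => Helicity.cv K (v i)) i x) + Y t x := by
    rintro X Y ⟨hX, rfl⟩
    refine ⟨h2.add hX, ?_⟩
    rw [h2.td_add hX, h2', h1.2]
  fin_cases i
  · exact r (q 1 2 2 1)
  · exact r (q 2 0 0 2)
  · exact r (q 0 1 1 0)

lemma zi_zero (K : E3 → ℝ) (v : Fin 3 → E3 → ℝ) (i : Fin 3) : zi K (fun _ => 0) v i = fun _ => 0 := by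
  ext x
  have h0 : cv K (fun _ => (0:ℝ)) = fun _ => 0 := by ext y; simp [cv]
  fin_cases i <;> simp [zi, curlS, crossG, h0, pd]

lemma zi_smp (hK : Ker K) {f : E3 → ℝ} (hf : SmP f) {v : Fin 3 → E3 → ℝ} (hvp : ∀ i, IsPeriodic (v i))
    (hv : ∀ i, Integrable (v i) cm) (i : Fin 3) : SmP (zi K f v i) := by
  have hfv : ∀ i, SmP (cv K (fun x => f x * v i x)) := fun i => by
    have hp : IsPeriodic (fun x => f x * v i x) := fun x k => by simp only [hf.per x k, hvp i x k]
    refine cv_smp hK (hp.locallyIntegrable ?_) hp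
    exact (Integrable.mul_smp (hv i) hf).congr (ae_of_all _ fun x => mul_comm _ _)
  exact ((curlS_smp hfv i).const_mul 2).sub (cv_smp hK ((crossG_periodic hf hvp i).locallyIntegrable
    (crossG_integrable hf hv i)) (crossG_periodic hf hvp i))

lemma Flow.dg_mo (h : Flow T s A M U) {W Z : Fin 3 → ℝ → ℝ → E3 → ℝ} (hW : ∀ i, TS T (W i))
    (hZ : ∀ i, TS T (Z i)) :
    Dg T (fun t τ => mo (fun i => U i t) (pr (fun i => U i t)) (fun i => W i t τ) (fun i => Z i t τ)) := by
  obtain ⟨C, hC0, hC⟩ := h.pr_nik le_rfl (by linarith [h.lt])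
  have p1 : ∀ t, A t ^ 2 ≤ A t ^ 3 := fun t => pow_le_pow_right₀ (h.one_le t) (by norm_num)
  have p2 : ∀ t, A t ≤ A t ^ 3 := fun t => le_self_pow₀ (h.one_le t) (by norm_num)
  have hU : ∀ i, Integrable (fun p : ℝ × E3 => U i p.1 p.2) ((tm T).prod cm) := fun i => by
    refine h.integrable_prod (h.jm i) 1 ?_
    filter_upwards [h.nik] with t ht
    refine ⟨(ht i).integrable one_le_three, ((ht i).integral_abs_le one_le_three
      (by linarith [h.one_le t])).trans ?_⟩
    rw [one_mul]; exact p2 t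
  have hUU : ∀ i j, Integrable (fun p : ℝ × E3 => U i p.1 p.2 * U j p.1 p.2) ((tm T).prod cm) :=
    fun i j => by
    refine h.integrable_prod (G := fun t x => U i t x * U j t x) ((h.jm i).mul (h.jm j)) 2 ?_
    filter_upwards [h.nik] with t ht
    have := (ht i).mul_self (ht j)
    refine ⟨this.integrable one_le_three_half, (this.integral_abs_le one_le_three_half
      (by nlinarith [h.one_le t])).trans ?_⟩
    have := p1 t
    rw [pow_two] at this
    linarith
  have hP : Integrable (fun p : ℝ × E3 => pr (fun i => U i p.1) p.2) ((tm T).prod cm) := by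
    refine h.integrable_prod (G := fun t => pr (fun i => U i t)) (JM.pr h.jm) C ?_
    filter_upwards [hC] with t ht
    exact ⟨ht.integrable one_le_three_half, (ht.integral_abs_le one_le_three_half
      (by positivity)).trans (mul_le_mul_of_nonneg_left (p1 t) hC0)⟩
  exact ((Dg.sum fun i _ => ((hW i).tf _ (hU i)).2).add
    (Dg.sum fun i _ => Dg.sum fun j _ => ((hZ i).pd j _ (hUU i j)).2)).add
    (Dg.sum fun i _ => ((hZ i).pd i _ hP).2)

lemma integral_th_deriv_mul {X : ℝ → ℝ → ℝ} (hX : ∀ᵐ p : ℝ × ℝ ∂((tm T).prod (tm T)), X p.1 p.2 = X p.2 p.1)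
    (n : ℕ) : ∫ p : ℝ × ℝ, deriv (th n) (p.1 - p.2) * X p.1 p.2 ∂((tm T).prod (tm T)) = 0 := by
  have h1 := integral_prod_swap (μ := tm T) (ν := tm T)
    (fun p : ℝ × ℝ => deriv (th n) (p.1 - p.2) * X p.1 p.2)
  have h2 : ∫ p : ℝ × ℝ, deriv (th n) (p.swap.1 - p.swap.2) * X p.swap.1 p.swap.2 ∂((tm T).prod (tm T)) =
      - ∫ p : ℝ × ℝ, deriv (th n) (p.1 - p.2) * X p.1 p.2 ∂((tm T).prod (tm T)) := by
    rw [← integral_neg]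
    refine integral_congr_ae ?_
    filter_upwards [hX] with p hp
    have : p.2 - p.1 = -(p.1 - p.2) := by ring
    simp only [Prod.fst_swap, Prod.snd_swap, ← hp, this, th_deriv_odd, neg_mul]
  linarith

lemma Flow.time_identity (h : Flow T s A M U) (hmom : MomentumEq T U)
    (hφ : IsTest T φ) (hK : Ker K) (he : ∀ x, K (-x) = K x) :
    ∫ t in Ioo 0 T, mo (fun i => U i t) (pr (fun i => U i t))
      (fun i => zo K (timeDeriv φ t) (fun i => U i t) i) (zeta K (φ t) (fun i => U i t)) = 0 := by
  set Z : Fin 3 → ℝ → ℝ → E3 → ℝ := fun i t τ x =>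
    zo K (φ t) (fun i => U i τ) i x + zi K (φ τ) (fun i => U i τ) i x with hZ
  set W : Fin 3 → ℝ → ℝ → E3 → ℝ := fun i t τ => zo K (timeDeriv φ t) (fun i => U i τ) i with hW
  set X : ℝ → ℝ → ℝ := fun t τ => ∑ i, ∫ x in cell, U i t x * Z i t τ x with hX
  set Y : ℝ → ℝ → ℝ := fun t τ => mo (fun i => U i t) (pr (fun i => U i t)) (fun i => W i t τ)
    (fun i => Z i t τ) with hY
  have hZt : ∀ i, TS T (Z i) := fun i => (zo_ts hφ h.lf hK i).add (zi_ts hφ h.lf hK i)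
  have hWt : ∀ i, TS T (W i) := fun i => zo_ts hφ.td h.lf hK i
  have dY : Dg T Y := h.dg_mo hWt hZt
  have dX : Dg T X := by
    have := h.dg_mo hZt (fun _ => (zi_ts IsTest.zero h.lf hK 0))
    simp only [mo, zi_zero, pd_const, mul_zero, integral_zero, Finset.sum_const_zero, add_zero] at this
    exact this
  have hgood : ∀ᵐ t ∂(tm T), ∀ i, IsPeriodic (U i t) ∧ Integrable (U i t) cm :=
    h.nik.mono fun t ht i => ⟨h.per i t, (ht i).integrable one_le_three⟩
  have hsm : ∀ t, (∀ i, IsPeriodic (U i t) ∧ Integrable (U i t) cm) → ∀ i, SmP (cv K (U i t)) :=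
    fun t ht i => cv_smp hK ((ht i).1.locallyIntegrable (ht i).2) (ht i).1
  have hsym : ∀ᵐ p : ℝ × ℝ ∂((tm T).prod (tm T)), X p.1 p.2 = X p.2 p.1 := by
    filter_upwards [Measure.quasiMeasurePreserving_fst.ae hgood,
      Measure.quasiMeasurePreserving_snd.ae hgood] with p h1 h2
    have key : ∀ t τ, (∀ i, IsPeriodic (U i t) ∧ Integrable (U i t) cm) →
        (∀ i, IsPeriodic (U i τ) ∧ Integrable (U i τ) cm) → X t τ =
        (∑ i, ∫ x in cell, U i τ x * zi K (φ t) (fun i => U i t) i x) +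
          ∑ i, ∫ x in cell, U i t x * zi K (φ τ) (fun i => U i τ) i x := by
      intro t τ ht hτ
      rw [integral_zi hK he (hφ.smp t) (fun i => (hτ i).1) (fun i => (hτ i).2) (fun i => (ht i).1)
        (fun i => (ht i).2), ← Finset.sum_add_distrib]
      refine Finset.sum_congr rfl fun i _ => ?_
      rw [← integral_add]
      · simp only [hZ, mul_add]
      · exact Integrable.mul_smp (ht i).2 (((hφ.zo (hsm τ hτ) i).1).smp t)
      · exact Integrable.mul_smp (ht i).2 (zi_smp hK (hφ.smp τ) (fun i => (hτ i).1) (fun i => (hτ i).2) i)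
    rw [key _ _ h1 h2, key _ _ h2 h1, add_comm]
  obtain ⟨a, b, ha, hb, hab⟩ := hφ.support
  have hev : ∀ᶠ n : ℕ in atTop, 1 / ((n : ℝ) + 1) < min a (T - b) :=
    (tendsto_order.1 tendsto_one_div_add_atTop_nhds_zero_nat).2 _ (lt_min ha (by linarith))
  have hzero : ∀ᶠ n : ℕ in atTop,
      ∫ p : ℝ × ℝ, th n (p.1 - p.2) * Y p.1 p.2 ∂((tm T).prod (tm T)) = 0 := by
    filter_upwards [hev] with n hn
    have hn1 := hn.trans_le (min_le_left _ _)
    have hn2 := hn.trans_le (min_le_right _ _)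
    obtain ⟨B, -, hB⟩ := th_bound n
    have iX := integrable_kernel_mul (k := deriv (th n)) ((th_smooth n).continuous_deriv (by simp))
      (fun t => (hB t).2) dX.int
    have iY := dY.th_int n
    have hsum : ∫ p : ℝ × ℝ, (deriv (th n) (p.1 - p.2) * X p.1 p.2 + th n (p.1 - p.2) * Y p.1 p.2)
        ∂((tm T).prod (tm T)) = 0 := by
      refine (integral_prod_symm _ (iX.add iY)).trans (integral_eq_zero_of_ae ?_)
      filter_upwards [hgood] with τ hτ
      have hzi : ∀ i, IsTest T (fun t x => th n (t - τ) * zi K (φ τ) (fun i => U i τ) i x) := by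
        intro i
        by_cases hτab : τ ∈ Icc a b
        · exact isTest_th_mul_const (zi_smp hK (hφ.smp τ) (fun i => (hτ i).1) (fun i => (hτ i).2) i) n
            (by linarith [hτab.1]) (by linarith [hτab.2])
        · have e : φ τ = fun _ => 0 := funext fun x => hab τ hτab x
          simp only [e, zi_zero, mul_zero]
          exact IsTest.zero
      have hzo := fun i => hφ.zo (hsm τ hτ) i
      have hzo' := fun i => (hzo i).1.th_mul n τ
      have hz : ∀ i, IsTest T (fun t x => th n (t - τ) * Z i t τ x) := fun i => by
        simpa only [hZ, mul_add] using (hzo' i).1.add (hzi i)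
      have hzd : ∀ i, timeDeriv (fun t x => th n (t - τ) * Z i t τ x) = fun t x =>
          deriv (th n) (t - τ) * Z i t τ x + th n (t - τ) * W i t τ x := fun i => by
        have := (hzo' i).1.td_add (hzi i)
        simp only [← mul_add] at this
        rw [this, (hzo' i).2, (hzo i).2, timeDeriv_th_mul_const]
        ext t x
        simp only [hZ, hW]; ring
      simp only [Pi.zero_apply]
      rw [← hmom _ hz]
      refine integral_congr_ae ?_
      filter_upwards [hgood] with t ht
      have sZ : ∀ i, SmP (Z i t τ) := fun i => ((hzo i).1.smp t).add
        (zi_smp hK (hφ.smp τ) (fun i => (hτ i).1) (fun i => (hτ i).2) i)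
      have sW : ∀ i, SmP (W i t τ) := fun i => ((hφ.td.zo (hsm τ hτ) i).1).smp t
      simp only [hzd]
      exact (mo_affine _ _ (fun i => Integrable.mul_smp (ht i).2 (sZ i))
        (fun i => Integrable.mul_smp (ht i).2 (sW i)) fun i => (sZ i).1.differentiable (by simp)).symm
    rw [integral_add iX iY, integral_th_deriv_mul hsym, zero_add] at hsum
    exact hsum
  refine Eq.trans ?_ (tendsto_nhds_unique (dY.lim.congr' hzero) tendsto_const_nhds)
  refine integral_congr_ae (ae_of_all _ fun t => ?_)
  simp only [hY, hW, hZ, ← zeta_split]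

end time

/-! ### The terms of the local balance -/

section static

variable {s A D : ℝ} {K φ P : E3 → ℝ} {v : Fin 3 → E3 → ℝ}

lemma sum_integral_zo (hs : 1 / 2 < s) (hv : ∀ i, Nik s 3 A (v i)) (hK : Ker K) (hφ : SmP φ) :
    ∑ i, ∫ x in cell, v i x * zo K φ v i x =
      Bc (fun i => cv K (v i)) (fun i x => φ x * v i x) + Bc v (fun i x => φ x * cv K (v i) x) := by
  have sv : ∀ i, SmP (cv K (v i)) := fun i => cv_smp hK ((hv i).locInt one_le_three) (hv i).per
  have hi := fun i => (hv i).integrable one_le_three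
  obtain ⟨s', hs', hs1⟩ : ∃ s', 1 / 2 < s' ∧ s' ≤ min s 1 :=
    ⟨min s 1, lt_min hs (by norm_num), le_rfl⟩
  have hv' : ∀ i, Nik s' 3 (2 * A) (v i) := fun i =>
    (hv i).mono_s one_le_three (by linarith) (hs1.trans (min_le_left _ _))
  obtain ⟨B, hB⟩ := hφ.nik (by linarith) (hs1.trans (min_le_right _ _))
  have h1 := Bc_smooth_left (q := 3) hs' one_le_three sv
    (fun i => hB.mul (r := 3) (hv' i) one_le_three)
  have h2 := Bc_smooth_right hs one_le_three hv (fun i => hφ.mul (sv i))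
  have sc := curlS_smp sv
  rw [h1, h2, ← integral_finsetSum, ← integral_add]
  · refine integral_congr_ae (ae_of_all _ fun x => ?_)
    simp only [curlS_mul hφ sv, zo, ← Finset.sum_add_distrib]
    exact Finset.sum_congr rfl fun i _ => by ring
  · refine integrable_finsetSum _ fun i _ => ?_
    refine (Integrable.mul_smp (hi i) ((sc i).mul hφ)).congr (ae_of_all _ fun x => ?_)
    simp only; ring
  · exact integrable_finsetSum _ fun i _ => Integrable.mul_smp (hi i) (curlS_smp (fun i => hφ.mul (sv i)) i)
  · exact fun i _ => Integrable.mul_smp (hi i) (((hφ.mul (sc i)).const_mul 2).add (crossG_smp hφ sv i))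

lemma div_zeta (hv : ∀ i, Nik s 3 A (v i)) (hK : Ker K) (hφ : SmP φ) (x : E3) :
    ∑ i, pd i (zeta K φ v i) x = (∑ i, pd i φ x * curlS (fun i => cv K (v i)) i x) -
      ∑ i, pd i (cv K (crossG φ v i)) x := by
  have hi := fun i => (hv i).integrable one_le_three
  have hp := fun i => (hv i).per
  have sv : ∀ i, SmP (cv K (v i)) := fun i => cv_smp hK ((hv i).locInt one_le_three) (hv i).per
  have sfv : ∀ i, SmP (cv K (fun x => φ x * v i x)) := fun i => by
    have hp' : IsPeriodic (fun x => φ x * v i x) := fun x k => by simp only [hφ.per x k, hp i x k]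
    exact cv_smp hK (hp'.locallyIntegrable
      ((Integrable.mul_smp (hi i) hφ).congr (ae_of_all _ fun x => mul_comm _ _))) hp'
  have sg : ∀ i, SmP (cv K (crossG φ v i)) := fun i => cv_smp hK
    ((crossG_periodic hφ hp i).locallyIntegrable (crossG_integrable hφ hi i)) (crossG_periodic hφ hp i)
  have sc := curlS_smp sv
  have e : ∀ i, pd i (zeta K φ v i) x = 2 * pd i (fun x => φ x * curlS (fun i => cv K (v i)) i x) x +
      pd i (crossG φ (fun i => cv K (v i)) i) x +
      2 * pd i (curlS (fun i => cv K (fun y => φ y * v i y)) i) x - pd i (cv K (crossG φ v i)) x := by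
    intro i
    have a1 := ((hφ.mul (sc i)).const_mul 2)
    have a2 := crossG_smp hφ sv i
    have a3 := (curlS_smp sfv i).const_mul 2
    have := pd_sub (j := i) ((a1.add a2).add a3).1 (sg i).1
    rw [pd_add (a1.add a2).1 a3.1, pd_add a1.1 a2.1, pd_const_mul (hφ.mul (sc i)).1,
      pd_const_mul (curlS_smp sfv i).1] at this
    exact congrFun this x
  have d : ∀ {f : Fin 3 → E3 → ℝ}, (∀ i, SmP (f i)) → ∑ i, pd i (curlS f i) x = 0 := by
    intro f hf
    simp only [Fin.sum_univ_three, curlS, Matrix.cons_val, pd_sub ((hf _).pd _).1 ((hf _).pd _).1,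
      pd_comm (hf _).1 1 0, pd_comm (hf _).1 2 0, pd_comm (hf _).1 2 1]
    ring
  have m : ∀ i, pd i (fun x => φ x * curlS (fun i => cv K (v i)) i x) x =
      φ x * pd i (curlS (fun i => cv K (v i)) i) x + pd i φ x * curlS (fun i => cv K (v i)) i x := by
    intro i
    rw [pd_mul hφ.1 (sc i).1]; ring
  have c : ∑ i, pd i (crossG φ (fun i => cv K (v i)) i) x =
      - ∑ i, pd i φ x * curlS (fun i => cv K (v i)) i x := by
    simp only [Fin.sum_univ_three, curlS, crossG, Matrix.cons_val,
      pd_sub ((hφ.pd _).mul (sv _)).1 ((hφ.pd _).mul (sv _)).1, pd_mul (hφ.pd _).1 (sv _).1,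
      pd_comm hφ.1 1 0, pd_comm hφ.1 2 0, pd_comm hφ.1 2 1]
    ring
  simp only [e, Finset.sum_add_distrib, Finset.sum_sub_distrib, ← Finset.mul_sum, d sfv, m, c, d sv]
  ring

lemma sum_integral_div_zeta (hs : 1 / 2 < s) (hs1 : s ≤ 1) (hv : ∀ i, Nik s 3 A (v i))
    (hP : Nik s (3 / 2) D P) (hK : Ker K) (he : ∀ x, K (-x) = K x) (hφ : SmP φ) :
    ∑ i, ∫ x in cell, P x * pd i (zeta K φ v i) x =
      Bc (fun i => cv K (v i)) (fun i x => P x * pd i φ x) + Bc v (fun i x => cv K P x * pd i φ x) := by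
  have hi := fun i => (hv i).integrable one_le_three
  have hPi := hP.integrable one_le_three_half
  have sv : ∀ i, SmP (cv K (v i)) := fun i => cv_smp hK ((hv i).locInt one_le_three) (hv i).per
  have sP : SmP (cv K P) := cv_smp hK (hP.locInt one_le_three_half) hP.per
  have hci := crossG_integrable hφ hi
  have hcp := crossG_periodic hφ fun i => (hv i).per
  have sg : ∀ i, SmP (cv K (crossG φ v i)) := fun i => cv_smp hK
    ((hcp i).locallyIntegrable (hci i)) (hcp i)
  obtain ⟨B, hB⟩ := exists_common_nik hφ.pd (by linarith) hs1
  have h1 := Bc_smooth_left (q := 3 / 2) hs one_le_three_half sv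
    (fun i => hP.mul (r := 3 / 2) (hB i) one_le_three_half)
  have h2 := Bc_smooth_right hs one_le_three hv (fun i => sP.mul (hφ.pd i))
  have sz : ∀ i, SmP (zeta K φ v i) := fun i => by
    have := (((hφ.mul (curlS_smp sv i)).const_mul 2).add (crossG_smp hφ sv i)).add
      (zi_smp hK hφ (fun i => (hv i).per) hi i)
    rwa [← zeta_split]
  have q : ∑ i, ∫ x in cell, P x * pd i (cv K (crossG φ v i)) x =
      - ∫ x in cell, ∑ i, v i x * curlS (fun i x => cv K P x * pd i φ x) i x := by
    rw [← integral_neg]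
    have : ∀ i, ∫ x in cell, P x * pd i (cv K (crossG φ v i)) x =
        ∫ x in cell, - (crossG φ v i x * pd i (cv K P) x) := fun i => by
      rw [integral_neg, ← neg_eq_iff_eq_neg, ← integral_pd_cv hK he hP.per hPi (hcp i) (hci i) i]
      simp only [mul_comm]
    simp only [this]
    refine (integral_finsetSum _ fun i _ => (Integrable.mul_smp (hci i) (sP.pd i)).neg).symm.trans ?_
    refine integral_congr_ae (ae_of_all _ fun x => ?_)
    simp only [Pi.neg_apply, pd_mul sP.1 (hφ.pd _).1, Fin.sum_univ_three, curlS, crossG, Matrix.cons_val,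
      pd_comm hφ.1 1 0, pd_comm hφ.1 2 0, pd_comm hφ.1 2 1]
    ring
  rw [h1, h2, ← integral_finsetSum _ fun i _ => Integrable.mul_smp hPi ((sz i).pd i)]
  simp only [← Finset.mul_sum, div_zeta hv hK hφ, mul_sub]
  rw [integral_sub]
  · simp only [Finset.mul_sum]
    rw [integral_finsetSum _ fun i _ => Integrable.mul_smp hPi ((sg i).pd i), q, sub_neg_eq_add]
    congr 1
    refine integral_congr_ae (ae_of_all _ fun x => Finset.sum_congr rfl fun i _ => by ring)
  · exact Integrable.mul_smp hPi (SmP.sum fun i _ => (hφ.pd i).mul (curlS_smp sv i))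
  · exact Integrable.mul_smp hPi (SmP.sum fun i _ => (sg i).pd i)

/-- The part of the local balance which has a limit for each time. -/
def lb (K χ φ P : E3 → ℝ) (v : Fin 3 → E3 → ℝ) : ℝ :=
  (Bc (fun i => cv K (v i)) (fun i x => χ x * v i x) + Bc v (fun i x => χ x * cv K (v i) x)) +
  (Bc (fun i => cv K (v i)) (fun i x => P x * pd i φ x) + Bc v (fun i x => cv K P x * pd i φ x)) +
    Bc v (fl K φ v)

lemma mo_zeta_eq (hs : 1 / 2 < s) (hs1 : s ≤ 1) (hv : ∀ i, Nik s 3 A (v i)) (hd : WDiv v)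
    (hP : Nik s (3 / 2) D P) (hK : Ker K) (he : ∀ x, K (-x) = K x) (hφ : SmP φ) {χ : E3 → ℝ}
    (hχ : SmP χ) :
    mo v P (fun i => zo K χ v i) (zeta K φ v) = lb K χ φ P v -
      (∫ ξ, Bc v (dn ξ (trip₁ v φ (gr K ξ) ξ))) + 1 / 2 * ∫ ξ, Bc v (dn ξ (trip₂ v φ (gr K ξ) ξ)) := by
  have h := balance_rough hs hs1 hv hd hK he hφ
  have sz : ∀ i, SmP (zeta K φ v i) := fun i => by
    have sv : ∀ i, SmP (cv K (v i)) := fun i => cv_smp hK ((hv i).locInt one_le_three) (hv i).per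
    have := (((hφ.mul (curlS_smp sv i)).const_mul 2).add (crossG_smp hφ sv i)).add
      (zi_smp hK hφ (fun i => (hv i).per) (fun i => (hv i).integrable one_le_three) i)
    rwa [← zeta_split]
  have hij := fun i j => Integrable.mul_smp
    (((hv i).mul_self (hv j)).integrable one_le_three_half) ((sz i).pd j)
  rw [integral_finsetSum _ fun i _ => integrable_finsetSum _ fun j _ => hij i j] at h
  simp only [integral_finsetSum _ fun j _ => hij _ j] at h
  rw [mo, sum_integral_zo hs hv hK hχ, sum_integral_div_zeta hs hs1 hv hP hK he hφ, lb]
  linarith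

end static

/-! ### Families of fields along the mollification -/

/-- Families of time-dependent fields, with bounds in `Nik s q` by a power of `A`, which converge
for almost every time. -/
structure Fam (T s : ℝ) (A : ℝ → ℝ) (q : ℝ≥0∞) (k : ℕ) (F : ℝ → ℝ → E3 → ℝ) (f : ℝ → E3 → ℝ) :
    Prop where
  jm : ∀ ε, 0 < ε → JM (tm T) (F ε)
  jm_lim : JM (tm T) f
  bd : ∃ C, 0 ≤ C ∧ ∀ᵐ t ∂(tm T), ∀ ε, 0 < ε → Nik s q (C * A t ^ k) (F ε t)
  bd_lim : ∃ C, 0 ≤ C ∧ ∀ᵐ t ∂(tm T), Nik s q (C * A t ^ k) (f t)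
  nt : ∀ᵐ t ∂(tm T), NT s q (𝓝[>] 0) (fun ε => F ε t) (f t)

namespace Fam

variable {T s s' : ℝ} {A : ℝ → ℝ} {p q r : ℝ≥0∞} {k l : ℕ} {F G : ℝ → ℝ → E3 → ℝ} {f g : ℝ → E3 → ℝ}

lemma const (hf : JM (tm T) f) (h : ∃ C, 0 ≤ C ∧ ∀ᵐ t ∂(tm T), Nik s q (C * A t ^ k) (f t)) :
    Fam T s A q k (fun _ => f) f := by
  obtain ⟨C, hC0, hC⟩ := h
  exact ⟨fun _ _ => hf, hf, ⟨C, hC0, hC.mono fun t h _ _ => h⟩, ⟨C, hC0, hC⟩,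
    hC.mono fun t h => NT.const h⟩

lemma add (hF : Fam T s A q k F f) (hG : Fam T s A q k G g) (hq : 1 ≤ q) :
    Fam T s A q k (fun ε t x => F ε t x + G ε t x) (fun t x => f t x + g t x) := by
  obtain ⟨C, hC0, hC⟩ := hF.bd
  obtain ⟨D, hD0, hD⟩ := hG.bd
  obtain ⟨C', hC0', hC'⟩ := hF.bd_lim
  obtain ⟨D', hD0', hD'⟩ := hG.bd_lim
  refine ⟨fun ε h => (hF.jm ε h).add (hG.jm ε h), hF.jm_lim.add hG.jm_lim,
    ⟨C + D, by positivity, ?_⟩, ⟨C' + D', by positivity, ?_⟩, ?_⟩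
  · filter_upwards [hC, hD] with t a b ε h
    exact ((a ε h).add (b ε h) hq).mono (by linarith)
  · filter_upwards [hC', hD'] with t a b
    exact (a.add b hq).mono (by linarith)
  · filter_upwards [hF.nt, hG.nt] with t a b using a.add b hq

lemma const_mul (hF : Fam T s A q k F f) (c : ℝ) :
    Fam T s A q k (fun ε t x => c * F ε t x) (fun t x => c * f t x) := by
  obtain ⟨C, hC0, hC⟩ := hF.bd
  obtain ⟨C', hC0', hC'⟩ := hF.bd_lim
  refine ⟨fun ε h => (hF.jm ε h).const_mul c, hF.jm_lim.const_mul c,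
    ⟨|c| * C, by positivity, ?_⟩, ⟨|c| * C', by positivity, ?_⟩, ?_⟩
  · filter_upwards [hC] with t a ε h
    exact ((a ε h).const_mul c).mono (by rw [mul_assoc])
  · filter_upwards [hC'] with t a
    exact (a.const_mul c).mono (by rw [mul_assoc])
  · filter_upwards [hF.nt] with t a using a.const_mul c

lemma sub (hF : Fam T s A q k F f) (hG : Fam T s A q k G g) (hq : 1 ≤ q) :
    Fam T s A q k (fun ε t x => F ε t x - G ε t x) (fun t x => f t x - g t x) := by
  simpa only [neg_one_mul, ← sub_eq_add_neg] using hF.add (hG.const_mul (-1)) hq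

lemma sum {F : Fin 3 → ℝ → ℝ → E3 → ℝ} {f : Fin 3 → ℝ → E3 → ℝ}
    (hF : ∀ j, Fam T s A q k (F j) (f j)) (hq : 1 ≤ q) :
    Fam T s A q k (fun ε t x => ∑ j, F j ε t x) (fun t x => ∑ j, f j t x) := by
  simpa only [Fin.sum_univ_three] using ((hF 0).add (hF 1) hq).add (hF 2) hq

lemma mul [ENNReal.HolderTriple p q r] (hF : Fam T s A p k F f) (hG : Fam T s A q l G g)
    (hq : 1 ≤ q) (hr : 1 ≤ r) :
    Fam T s A r (k + l) (fun ε t x => F ε t x * G ε t x) (fun t x => f t x * g t x) := by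
  obtain ⟨C, hC0, hC⟩ := hF.bd
  obtain ⟨D, hD0, hD⟩ := hG.bd
  obtain ⟨C', hC0', hC'⟩ := hF.bd_lim
  obtain ⟨D', hD0', hD'⟩ := hG.bd_lim
  have e : ∀ C D a : ℝ, 2 * (C * a ^ k * (D * a ^ l)) = 2 * C * D * a ^ (k + l) := fun C D a => by ring
  refine ⟨fun ε h => (hF.jm ε h).mul (hG.jm ε h), hF.jm_lim.mul hG.jm_lim,
    ⟨2 * C * D, by positivity, ?_⟩, ⟨2 * C' * D', by positivity, ?_⟩, ?_⟩
  · filter_upwards [hC, hD] with t a b ε h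
    rw [← e]; exact (a ε h).mul (b ε h) hr
  · filter_upwards [hC', hD'] with t a b
    rw [← e]; exact a.mul b hr
  · filter_upwards [hF.nt, hG.nt] with t a b using a.mul b hq hr

lemma mollify (hF : Fam T s A q k (fun _ => f) f) (hq : 1 ≤ q) (h0 : 0 ≤ s') (h : s' < s) {K : E3 → ℝ}
    (hK : Ker K) (hK1 : ∫ y, K y = 1) :
    Fam T s' A q k (fun ε t => cv (rescale K ε) (f t)) f := by
  obtain ⟨C, hC0, hC⟩ := hF.bd_lim
  refine ⟨fun ε h => hF.jm_lim.cv (hK.rescale h).continuous, hF.jm_lim,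
    ⟨2 * (∫ y, |K y|) * C, by positivity, ?_⟩, ⟨2 * C, by positivity, ?_⟩, ?_⟩
  · filter_upwards [hC] with t a ε hε
    refine ((a.cv hq (hK.rescale hε)).mono_s hq h0 h.le).mono (le_of_eq ?_)
    rw [integral_abs_rescale hε]; ring
  · filter_upwards [hC] with t a
    exact (a.mono_s hq h0 h.le).mono (by rw [mul_assoc])
  · filter_upwards [hC] with t a using a.mollify hq h0 h hK hK1

lemma lower (hF : Fam T s A q k (fun _ => f) f) (hq : 1 ≤ q) (h0 : 0 ≤ s') (h : s' ≤ s) :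
    Fam T s' A q k (fun _ => f) f := by
  obtain ⟨C, hC0, hC⟩ := hF.bd_lim
  refine const hF.jm_lim ⟨2 * C, by positivity, ?_⟩
  filter_upwards [hC] with t a
  exact (a.mono_s hq h0 h).mono (by rw [mul_assoc])

lemma lift (hF : Fam T s A 3 1 F f) (hA : ∀ t, 1 ≤ A t) : Fam T s A (3 / 2) 2 F f := by
  obtain ⟨C, hC0, hC⟩ := hF.bd
  obtain ⟨D, hD0, hD⟩ := hF.bd_lim
  have hA2 : ∀ t, A t ^ 1 ≤ A t ^ 2 := fun t => pow_le_pow_right₀ (hA t) (by norm_num)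
  exact ⟨hF.jm, hF.jm_lim,
    ⟨C, hC0, hC.mono fun t a ε hε => ((a ε hε).mono_q three_half_le_three).mono
      (mul_le_mul_of_nonneg_left (hA2 t) hC0)⟩,
    ⟨D, hD0, hD.mono fun t a => (a.mono_q three_half_le_three).mono
      (mul_le_mul_of_nonneg_left (hA2 t) hD0)⟩,
    hF.nt.mono fun t a => a.mono_q three_half_le_three⟩

end Fam

lemma IsTest.fam {T s : ℝ} {A : ℝ → ℝ} {z : ℝ → E3 → ℝ} (hz : IsTest T z) (h0 : 0 ≤ s) (h1 : s ≤ 1) :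
    Fam T s A ⊤ 0 (fun _ => z) z := by
  obtain ⟨B, hB0, hB⟩ := hz.exists_nik h0 h1
  exact Fam.const hz.jm ⟨B, hB0, ae_of_all _ fun t => by simpa using hB t⟩

namespace Flow

variable {T s s' M : ℝ} {A : ℝ → ℝ} {U : Fin 3 → ℝ → E3 → ℝ} {V F : Fin 3 → ℝ → ℝ → E3 → ℝ}
  {f : Fin 3 → ℝ → E3 → ℝ}

lemma fam (h : Flow T s A M U) (h0 : 0 ≤ s') (h1 : s' ≤ s) (i : Fin 3) :
    Fam T s' A 3 1 (fun _ => U i) (U i) := by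
  refine Fam.const (h.jm i) ⟨2, by norm_num, ?_⟩
  filter_upwards [h.nik] with t ht
  simpa using (ht i).mono_s one_le_three h0 h1

lemma fam_pr (h : Flow T s A M U) (h0 : 0 ≤ s') (h1 : s' < s) :
    Fam T s' A (3 / 2) 2 (fun _ t => pr (fun i => U i t)) (fun t => pr (fun i => U i t)) :=
  Fam.const (JM.pr h.jm) (h.pr_nik h0 h1)

lemma integrable_Bc_of (h : Flow T s A M U) (hs' : 1 / 2 < s') {v g : Fin 3 → ℝ → E3 → ℝ}
    (hv : ∀ i, JM (tm T) (v i)) (hg : ∀ i, JM (tm T) (g i)) {C D : ℝ}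
    (hC : ∀ᵐ t ∂(tm T), ∀ i, Nik s' 3 (C * A t) (v i t))
    (hD : ∀ᵐ t ∂(tm T), ∀ i, Nik s' (3 / 2) (D * A t ^ 2) (g i t)) :
    Integrable (fun t => Bc (fun i => v i t) (fun i => g i t)) (tm T) := by
  obtain ⟨c, hc0, hc⟩ := Bc_bound hs'
  refine h.integrable_of_le (JM.Bc hs' one_le_three one_le_three_half hv hg
    (hC.mono fun t a => ⟨_, a⟩) (hD.mono fun t a => ⟨_, a⟩)) (c * (C * D)) ?_
  filter_upwards [hC, hD] with t a b
  refine (hc (p := 3) (q := 3 / 2) one_le_three one_le_three_half a b).trans (le_of_eq ?_)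
  ring

lemma _root_.Helicity.Fam.common {q : ℝ≥0∞} {k : ℕ} (hF : ∀ i, Fam T s' A q k (F i) (f i))
    (hA : ∀ t, 1 ≤ A t) : ∃ C, 0 ≤ C ∧ ∀ᵐ t ∂(tm T), ∀ i,
      (∀ ε, 0 < ε → Nik s' q (C * A t ^ k) (F i ε t)) ∧ Nik s' q (C * A t ^ k) (f i t) := by
  choose C hC0 hC using fun i => (hF i).bd
  choose D hD0 hD using fun i => (hF i).bd_lim
  obtain ⟨E, hE0, hE⟩ := exists_common_le (Sum.elim C D)
  refine ⟨E, hE0, ?_⟩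
  filter_upwards [ae_all_iff.2 hC, ae_all_iff.2 hD] with t a b i
  have := hA t
  exact ⟨fun ε h => (a i ε h).mono (by gcongr; exact hE (.inl i)), (b i).mono (by gcongr; exact hE (.inr i))⟩

lemma tendsto_Bc (h : Flow T s A M U) (hs' : 1 / 2 < s') {v : Fin 3 → ℝ → E3 → ℝ}
    (hV : ∀ i, Fam T s' A 3 1 (V i) (v i)) (hF : ∀ i, Fam T s' A (3 / 2) 2 (F i) (f i)) :
    (∀ ε, 0 < ε → Integrable (fun t => Bc (fun i => V i ε t) (fun i => F i ε t)) (tm T)) ∧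
    Integrable (fun t => Bc (fun i => v i t) (fun i => f i t)) (tm T) ∧
    Tendsto (fun ε => ∫ t in Ioo 0 T, Bc (fun i => V i ε t) (fun i => F i ε t)) (𝓝[>] 0)
      (𝓝 (∫ t in Ioo 0 T, Bc (fun i => v i t) (fun i => f i t))) := by
  obtain ⟨C, hC0, hC⟩ := Fam.common hV h.one_le
  obtain ⟨D, hD0, hD⟩ := Fam.common hF h.one_le
  simp only [pow_one] at hC
  have i1 : ∀ ε, 0 < ε → Integrable (fun t => Bc (fun i => V i ε t) (fun i => F i ε t)) (tm T) :=
    fun ε hε => h.integrable_Bc_of hs' (fun i => (hV i).jm ε hε) (fun i => (hF i).jm ε hε)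
      (hC.mono fun t a i => (a i).1 ε hε) (hD.mono fun t a i => (a i).1 ε hε)
  refine ⟨i1, h.integrable_Bc_of hs' (fun i => (hV i).jm_lim) (fun i => (hF i).jm_lim)
    (hC.mono fun t a i => (a i).2) (hD.mono fun t a i => (a i).2), ?_⟩
  obtain ⟨c, hc0, hc⟩ := Bc_bound hs'
  refine tendsto_integral_filter_of_dominated_convergence (fun t => c * (C * D) * A t ^ 3) ?_ ?_
    (h.integrable_cube.const_mul _) ?_
  · filter_upwards [self_mem_nhdsWithin] with ε hε using (i1 ε hε).aestronglyMeasurable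
  · filter_upwards [self_mem_nhdsWithin] with ε hε
    filter_upwards [hC, hD] with t a b
    refine (hc (p := 3) (q := 3 / 2) one_le_three one_le_three_half (fun i => (a i).1 ε hε)
      (fun i => (b i).1 ε hε)).trans (le_of_eq ?_)
    ring
  · filter_upwards [ae_all_iff.2 fun i => (hV i).nt, ae_all_iff.2 fun i => (hF i).nt] with t a b
    exact Bc_tendsto (V := fun i ε => V i ε t) (F := fun i ε => F i ε t) hs' one_le_three
      one_le_three_half a b

/-- The limit of `fl`. -/
lemma fam_fl (h : Flow T s A M U) {r : ℝ} (h0 : 0 ≤ s') (hr : s' < r) (hrs : r ≤ s) {φ : ℝ → E3 → ℝ}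
    (hφ : IsTest T φ) {K : E3 → ℝ} (hK : Ker K) (hK1 : ∫ y, K y = 1) (i : Fin 3) :
    Fam T s' A (3 / 2) 2 (fun ε t => fl (rescale K ε) (φ t) (fun i => U i t) i)
      (fun t x => 2 * (adv (φ t) (fun i => U i t) x * U i t x) -
        sq (fun i => U i t) x * pd i (φ t) x) := by
  have h3 := one_le_three
  have h32 := one_le_three_half
  have hr0 := h0.trans hr.le
  have hr1 := hrs.trans h.lt_one.le
  have u := fun i => h.fam hr0 hrs i
  have p := fun j => (hφ.pd j).fam (A := A) hr0 hr1
  have ad : Fam T r A 3 1 (fun _ t => adv (φ t) (fun i => U i t)) (fun t => adv (φ t) (fun i => U i t)) :=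
    Fam.sum (fun j => (u j).mul (r := 3) (p j) le_top h3) h3
  have sqf : Fam T r A (3 / 2) 2 (fun _ t => sq (fun i => U i t)) (fun t => sq (fun i => U i t)) :=
    Fam.sum (fun j => (u j).mul (r := 3 / 2) (u j) h3 h32) h32
  have u' := fun i => (u i).lower h3 h0 hr.le
  have p' := fun j => (p j).lower le_top h0 hr.le
  have ad' := ad.lower h3 h0 hr.le
  have sq' := sqf.lower h32 h0 hr.le
  have um := fun i => (u i).mollify h3 h0 hr hK hK1
  have pm := fun j => (p j).mollify le_top h0 hr hK hK1
  have f1 := (u' i).mul (r := 3 / 2)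
    (Fam.sum (fun j => (u' j).mul (r := 3) (pm j) le_top h3) h3) h3 h32
  have f2 := (u' i).mul (r := 3 / 2) (ad.mollify h3 h0 hr hK hK1) h3 h32
  have f3 := ((u i).mul (r := 3 / 2) ad h3 h32).mollify h32 h0 hr hK hK1
  have f4 := ad'.mul (r := 3 / 2) (um i) h3 h32
  have f5 := (sq'.mul (r := 3 / 2) (pm i) le_top h32).const_mul (1 / 2)
  have f6 := ((p' i).mul (r := 3 / 2) (sqf.mollify h32 h0 hr hK hK1) h32 h32).const_mul (1 / 2)
  have f7 := (p' i).mul (r := 3 / 2)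
    (Fam.sum (fun j => (u' j).mul (r := 3 / 2) (um j) h3 h32) h32) h32 h32
  have := (((((f1.sub f2 h32).add f3 h32).add f4 h32).sub f5 h32).add f6 h32).sub f7 h32
  refine Eq.subst (motive := Fam T s' A (3 / 2) 2 _) (funext fun t => funext fun x => ?_) this
  have e1 : ∑ j, U j t x * pd j (φ t) x = adv (φ t) (fun i => U i t) x := rfl
  have e2 : ∑ j, U j t x * U j t x = sq (fun i => U i t) x := rfl
  simp only [e1, e2]
  ring

/-- The local helicity balance, once the defects vanish. -/
lemma helicity_balance (h : Flow T s A M U) (hmom : MomentumEq T U)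
    {φ : ℝ → E3 → ℝ} (hφ : IsTest T φ) {K : E3 → ℝ} (hK : Ker K) (he : ∀ x, K (-x) = K x)
    (hK1 : ∫ y, K y = 1) {d₁ d₂ : ℝ → ℝ → ℝ}
    (hd₁ : ∀ ε t, d₁ ε t = ∫ ξ, Bc (fun i => U i t)
      (dn ξ (trip₁ (fun i => U i t) (φ t) (gr (rescale K ε) ξ) ξ)))
    (hd₂ : ∀ ε t, d₂ ε t = ∫ ξ, Bc (fun i => U i t)
      (dn ξ (trip₂ (fun i => U i t) (φ t) (gr (rescale K ε) ξ) ξ)))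
    (hi₁ : ∀ ε, 0 < ε → Integrable (d₁ ε) (tm T)) (hi₂ : ∀ ε, 0 < ε → Integrable (d₂ ε) (tm T))
    (hl₁ : Tendsto (fun ε => ∫ t in Ioo 0 T, d₁ ε t) (𝓝[>] 0) (𝓝 0))
    (hl₂ : Tendsto (fun ε => ∫ t in Ioo 0 T, d₂ ε t) (𝓝[>] 0) (𝓝 0)) :
    2 * (∫ t in Ioo 0 T, Bc (fun i => U i t) (fun i x => timeDeriv φ t x * U i t x)) +
      2 * (∫ t in Ioo 0 T, Bc (fun i => U i t) (fun i x => pr (fun i => U i t) x * pd i (φ t) x)) +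
      ∫ t in Ioo 0 T, Bc (fun i => U i t) (fun i x => 2 * (adv (φ t) (fun i => U i t) x * U i t x) -
        sq (fun i => U i t) x * pd i (φ t) x) = 0 := by
  have h3 := one_le_three
  have h32 := one_le_three_half
  obtain ⟨r, hr, hrs⟩ := exists_between h.lt
  obtain ⟨r', hr', hrr⟩ := exists_between hr
  have h0 : 0 ≤ r' := by linarith
  have h0' : 0 ≤ r := by linarith
  have h1 : r ≤ 1 := hrs.le.trans h.lt_one.le
  have u := fun i => h.fam h0' hrs.le i
  have u' := fun i => (u i).lower h3 h0 hrr.le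
  have um := fun i => (u i).mollify h3 h0 hrr hK hK1
  have χ' := hφ.td.fam (A := A) h0 (hrr.le.trans h1)
  have g' := fun i => (hφ.pd i).fam (A := A) h0 (hrr.le.trans h1)
  have P := h.fam_pr h0' hrs
  obtain ⟨i1, j1, l1⟩ := h.tendsto_Bc hr' um fun i => (χ'.mul (r := 3) (u' i) h3 h3).lift h.one_le
  obtain ⟨i2, -, l2⟩ := h.tendsto_Bc hr' u' fun i => (χ'.mul (r := 3) (um i) h3 h3).lift h.one_le
  obtain ⟨i3, j3, l3⟩ := h.tendsto_Bc hr' um fun i =>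
    (P.lower h32 h0 hrr.le).mul (r := 3 / 2) (g' i) le_top h32
  obtain ⟨i4, -, l4⟩ := h.tendsto_Bc hr' u' fun i =>
    (P.mollify h32 h0 hrr hK hK1).mul (r := 3 / 2) (g' i) le_top h32
  obtain ⟨i5, j5, l5⟩ := h.tendsto_Bc hr' u' fun i => h.fam_fl h0 hrr hrs.le hφ hK hK1 i
  have hzero : ∀ ε, 0 < ε → (∫ t in Ioo 0 T, lb (rescale K ε) (timeDeriv φ t) (φ t)
      (pr (fun i => U i t)) (fun i => U i t)) - (∫ t in Ioo 0 T, d₁ ε t) +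
        1 / 2 * ∫ t in Ioo 0 T, d₂ ε t = 0 := by
    intro ε hε
    have il : Integrable (fun t => lb (rescale K ε) (timeDeriv φ t) (φ t)
      (pr (fun i => U i t)) (fun i => U i t)) (tm T) :=
      (((i1 ε hε).add (i2 ε hε)).add ((i3 ε hε).add (i4 ε hε))).add (i5 ε hε)
    have e1 := integral_sub' il (hi₁ ε hε)
    have e2 := integral_add' (il.sub (hi₁ ε hε)) ((hi₂ ε hε).const_mul (1 / 2))
    rw [integral_const_mul, e1] at e2
    refine (e2.symm.trans ?_).trans (h.time_identity hmom hφ (hK.rescale hε) (rescale_even he))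
    obtain ⟨C, hC0, hC⟩ := h.pr_nik h0' hrs
    refine integral_congr_ae ?_
    filter_upwards [h.nik, h.wdiv, hC] with t a b c
    have a' : ∀ i, Nik r 3 (2 * (A t + C * A t ^ 2)) (U i t) := fun i =>
      ((a i).mono_s h3 h0' hrs.le).mono (by have := (a 0).nonneg; nlinarith [mul_nonneg hC0 (sq_nonneg (A t))])
    rw [mo_zeta_eq hr h1 a' b c (hK.rescale hε) (rescale_even he) (hφ.smp t) (hφ.td.smp t)]
    simp only [Pi.add_apply, Pi.sub_apply, hd₁, hd₂]
  have hlim := (((((l1.add l2).add (l3.add l4)).add l5).sub hl₁).add (hl₂.const_mul (1 / 2)))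
  have hlim0 := hlim.congr' (f₂ := fun _ => (0:ℝ)) (by
    filter_upwards [self_mem_nhdsWithin] with ε hε
    refine Eq.trans ?_ (hzero ε hε)
    have k1 := (i1 ε hε).add (i2 ε hε)
    have k2 := (i3 ε hε).add (i4 ε hε)
    have e := integral_add' (k1.add k2) (i5 ε hε)
    rw [integral_add' k1 k2, integral_add' (i1 ε hε) (i2 ε hε), integral_add' (i3 ε hε) (i4 ε hε)] at e
    rw [← e]
    rfl)
  have := tendsto_nhds_unique hlim0 tendsto_const_nhds
  linarith

end Flow

/-! ### The defects -/

lemma gradient_apply (K : E3 → ℝ) (ξ : E3) (j : Fin 3) : gradient K ξ j = gr K ξ j := by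
  have := gradient_inner K (basisVec j) ξ
  rw [basisVec, EuclideanSpace.inner_single_left] at this
  simpa [gr, Pi.single_apply] using this

lemma norm_sq_eq_sum (a : E3) : ‖a‖ ^ 2 = ∑ i, a i * a i := by
  rw [← real_inner_self_eq_norm_sq, inner_eq_sum]

section bracket

variable {s A : ℝ} {w : VecDistribution} {V : E3 → E3}

lemma IsCurl.cubic₁ (hw : IsCurl w V) (hs : 1 / 2 < s) (hs1 : s ≤ 1) (hV : ∀ i, Nik s 3 A (co V i))
    {φ : E3 → E3} (hφ : φ ∈ testFields) (ξ : E3) :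
    HasBracket w (incr (-ξ) (cubic₁ V ξ φ)) (Bc (co V) (co (incr (-ξ) (Helicity.cubic₁ V ξ φ)))) := by
  obtain ⟨B, hB⟩ := exists_common_nik (co_smp hφ) (by linarith) hs1
  have hF := fun i => (Nik.sum one_le_three fun j (_ : j ∈ Finset.univ) =>
    ((hV j).incr one_le_three ξ).mul (r := 3) (hB j) one_le_three).mul (r := 3 / 2)
      ((hV i).incr one_le_three ξ) one_le_three_half
  have hn := fun i => Nik.dn one_le_three_half hF ξ i
  have e : ∀ i, dn ξ (fun i x => (∑ k, (co V k (x + ξ) - co V k x) * co φ k x) * (co V i (x + ξ) - co V i x)) i =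
      co (incr (-ξ) (Helicity.cubic₁ V ξ φ)) i := fun i => by
    ext x
    simp [co, incr, Helicity.cubic₁, dn, inner_eq_sum]
  simp only [e] at hn
  exact hw.hasBracket hs (p := 3) (q := 3 / 2) one_le_three one_le_three_half hV hn

lemma IsCurl.cubic₂ (hw : IsCurl w V) (hs : 1 / 2 < s) (hs1 : s ≤ 1) (hV : ∀ i, Nik s 3 A (co V i))
    {φ : E3 → E3} (hφ : φ ∈ testFields) (ξ : E3) :
    HasBracket w (incr (-ξ) (cubic₂ V ξ φ)) (Bc (co V) (co (incr (-ξ) (Helicity.cubic₂ V ξ φ)))) := by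
  obtain ⟨B, hB⟩ := exists_common_nik (co_smp hφ) (by linarith) hs1
  have hF := fun i => (Nik.sum one_le_three_half fun j (_ : j ∈ Finset.univ) =>
    ((hV j).incr one_le_three ξ).mul (r := 3 / 2) ((hV j).incr one_le_three ξ)
      one_le_three_half).mul (r := 3 / 2) (hB i) one_le_three_half
  have hn := fun i => Nik.dn one_le_three_half hF ξ i
  have e : ∀ i, dn ξ (fun i x => (∑ k, (co V k (x + ξ) - co V k x) * (co V k (x + ξ) - co V k x)) * co φ i x) i =
      co (incr (-ξ) (Helicity.cubic₂ V ξ φ)) i := fun i => by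
    ext x
    simp [co, incr, Helicity.cubic₂, dn, norm_sq_eq_sum]
  simp only [e] at hn
  exact hw.hasBracket hs (p := 3) (q := 3 / 2) one_le_three one_le_three_half hV hn

lemma SmP.smul_mem {φ : E3 → ℝ} (hφ : SmP φ) (g : E3) : (fun x => φ x • g) ∈ testFields :=
  mem_testFields_of_co fun i => by
    have e : co (fun x => φ x • g) i = fun x => g i * φ x := by ext x; simp [co, mul_comm]
    rw [e]
    exact hφ.const_mul (g i)

lemma tripleBracket₁_eq (hw : IsCurl w V) (hs : 1 / 2 < s) (hs1 : s ≤ 1)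
    (hV : ∀ i, Nik s 3 A (co V i)) {φ : E3 → ℝ} (hφ : SmP φ) (g ξ : E3) :
    tripleBracket₁ w V ξ (fun x => φ x • g) = Bc (co V) (dn ξ (trip₁ (co V) φ (fun j => g j) ξ)) := by
  rw [tripleBracket₁, incrBracket, bracket_eq (hw.cubic₁ hs hs1 hV (hφ.smul_mem g) ξ)]
  congr 1
  ext i x
  simp [co, incr, cubic₁, dn, trip₁, inner_eq_sum]

lemma tripleBracket₂_eq (hw : IsCurl w V) (hs : 1 / 2 < s) (hs1 : s ≤ 1)
    (hV : ∀ i, Nik s 3 A (co V i)) {φ : E3 → ℝ} (hφ : SmP φ) (g ξ : E3) :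
    tripleBracket₂ w V ξ (fun x => φ x • g) = Bc (co V) (dn ξ (trip₂ (co V) φ (fun j => g j) ξ)) := by
  rw [tripleBracket₂, incrBracket, bracket_eq (hw.cubic₂ hs hs1 hV (hφ.smul_mem g) ξ)]
  congr 1
  ext i x
  simp [co, incr, cubic₂, dn, trip₂, norm_sq_eq_sum]

end bracket

section

variable {T s M : ℝ} {A : ℝ → ℝ} {U : Fin 3 → ℝ → E3 → ℝ} {φ : ℝ → E3 → ℝ}

lemma Flow.integrable_trip (h : Flow T s A M U) (hφ : IsTest T φ) {K : E3 → ℝ} (hK : Ker K) :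
    Integrable (fun z : ℝ × E3 => Bc (fun i => U i z.1)
      (dn z.2 (trip₁ (fun i => U i z.1) (φ z.1) (gr K z.2) z.2))) ((tm T).prod volume) ∧
    Integrable (fun z : ℝ × E3 => Bc (fun i => U i z.1)
      (dn z.2 (trip₂ (fun i => U i z.1) (φ z.1) (gr K z.2) z.2))) ((tm T).prod volume) := by
  have h0 : 0 ≤ s := by linarith [h.lt]
  obtain ⟨B, hB0, hB⟩ := hφ.exists_nik h0 h.lt_one.le
  obtain ⟨C, hC0, hC⟩ := trip_bounds h.lt
  have V : ∀ i, JM ((tm T).prod volume) (fun a : ℝ × E3 => U i a.1) := fun i => (h.jm i).comp_fst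
  have Φ : JM ((tm T).prod volume) (fun a : ℝ × E3 => φ a.1) := hφ.jm.comp_fst
  have δ := fun i => ((V i).shift measurable_snd).sub (V i)
  have G : ∀ j, JM ((tm T).prod volume) (fun (a : ℝ × E3) _ => gr K a.2 j) := fun j =>
    JM.of_left ((hK.pd j).continuous.comp continuous_snd).aestronglyMeasurable
  have t1 := fun i => (JM.sum fun j (_ : j ∈ Finset.univ) => (δ j).mul (Φ.mul (G j))).mul (δ i)
  have t2 := fun i => (JM.sum fun j (_ : j ∈ Finset.univ) => (δ j).mul (δ j)).mul (Φ.mul (G i))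
  have d1 := fun i => ((t1 i).shift measurable_snd.neg).sub (t1 i)
  have d2 := fun i => ((t2 i).shift measurable_snd.neg).sub (t2 i)
  have hn : ∀ᵐ a : ℝ × E3 ∂((tm T).prod volume), ∀ i, Nik s 3 (A a.1) (U i a.1) :=
    Measure.quasiMeasurePreserving_fst.ae h.nik
  have hi : Integrable (fun z : ℝ × E3 => C * B * (A z.1 ^ 3 * ∑ j, |gr K z.2 j|))
      ((tm T).prod volume) :=
    (h.integrable_cube.mul_prod (integrable_finsetSum _ fun j _ => (hK.pd j).integrable.abs)).const_mul _
  constructor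
  · refine hi.mono' (JM.Bc h.lt one_le_three one_le_three_half V d1 (hn.mono fun a b => ⟨_, b⟩)
      (hn.mono fun a b => ⟨_, fun i => Nik.dn one_le_three_half (Nik.trip₁ b (hB a.1) _ _) a.2 i⟩)) ?_
    filter_upwards [hn] with a b
    exact ((hC b (hB a.1) _ _).1).trans (le_of_eq (by ring))
  · refine hi.mono' (JM.Bc h.lt one_le_three one_le_three_half V d2 (hn.mono fun a b => ⟨_, b⟩)
      (hn.mono fun a b => ⟨_, fun i => Nik.dn one_le_three_half (Nik.trip₂ b (hB a.1) _ _) a.2 i⟩)) ?_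
    filter_upwards [hn] with a b
    exact ((hC b (hB a.1) _ _).2).trans (le_of_eq (by ring))

lemma halfHolderNorm_nonneg (φ : E3 → E3) : 0 ≤ halfHolderNorm φ :=
  add_nonneg (Real.iSup_nonneg fun _ => norm_nonneg _) (Real.iSup_nonneg fun _ => by positivity)

lemma IsTest.exists_halfHolderNorm_le (hφ : IsTest T φ) : ∃ L, 0 ≤ L ∧ ∀ t g,
    halfHolderNorm (fun x => φ t x • g) ≤ L * ‖g‖ := by
  obtain ⟨B, hB0, hB⟩ := hφ.exists_bound
  obtain ⟨L, hL0, hL⟩ := hφ.exists_lipschitz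
  refine ⟨B + (L + 2 * B), by positivity, fun t g => ?_⟩
  rw [add_mul]
  refine add_le_add (Real.iSup_le (fun x => ?_) (by positivity)) (Real.iSup_le (fun z => ?_) (by positivity))
  · rw [norm_smul]
    exact mul_le_mul_of_nonneg_right (hB t x) (norm_nonneg _)
  · rw [← sub_smul, norm_smul, mul_div_right_comm]
    refine mul_le_mul_of_nonneg_right ?_ (norm_nonneg _)
    rcases eq_or_ne z.1 z.2 with e | e
    · simp only [e, sub_self, norm_zero, zero_div]; positivity
    have hr : 0 < ‖z.1 - z.2‖ := norm_pos_iff.2 (sub_ne_zero.2 e)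
    rw [div_le_iff₀ (by positivity), Real.norm_eq_abs]
    rcases le_total ‖z.1 - z.2‖ 1 with h | h
    · have : ‖z.1 - z.2‖ ≤ ‖z.1 - z.2‖ ^ (1 / 2 : ℝ) := by
        simpa using Real.rpow_le_rpow_of_exponent_ge hr h (by norm_num : (1 / 2 : ℝ) ≤ 1)
      refine (hL t _ _).trans ?_
      nlinarith [norm_nonneg (z.1 - z.2)]
    · have : 1 ≤ ‖z.1 - z.2‖ ^ (1 / 2 : ℝ) := Real.one_le_rpow h (by norm_num)
      have h2 := abs_sub (φ t z.1) (φ t z.2)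
      nlinarith [hB t z.1, hB t z.2]

lemma tendsto_defect {b : ℝ → E3 → (E3 → E3) → ℝ} {C σ : ℝ → ℝ} (hφ : IsTest T φ)
    (hC : IntegrableOn C (Ioo 0 T)) (hσ0 : Tendsto σ (𝓝[>] 0) (𝓝 0))
    (hb0 : ∀ᵐ t ∂(tm T), ∀ ξ, b t ξ (fun x => φ t x • (0 : E3)) = 0)
    (hb : ∀ᵐ t ∂(tm T), ∀ ξ ∈ centredCell, ∀ ψ ∈ testFields,
      |b t ξ ψ| ≤ C t * ‖ξ‖ * σ ‖ξ‖ * halfHolderNorm ψ) {K : E3 → ℝ} (hK : Ker K) :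
    Tendsto (fun ε => ∫ t in Ioo 0 T, ∫ ξ, b t ξ (fun x => φ t x • gradient (rescale K ε) ξ))
      (𝓝[>] 0) (𝓝 0) := by
  obtain ⟨L, hL0, hL⟩ := hφ.exists_halfHolderNorm_le
  choose R hR0 hR using fun j => (hK.pd j).exists_radius
  set r := ∑ j, R j with hr
  have hr0 : 0 < r := Finset.sum_pos (fun j _ => hR0 j) ⟨0, Finset.mem_univ _⟩
  set m := ∑ j, ∫ x, |pd j K x| with hm
  have hm0 : 0 ≤ m := Finset.sum_nonneg fun j _ => integral_nonneg fun _ => abs_nonneg _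
  set c := (∫ t in Ioo 0 T, |C t|) * (r * L * m) with hc
  have hC0 : 0 ≤ ∫ t in Ioo 0 T, |C t| := integral_nonneg fun _ => abs_nonneg _
  have hc0 : 0 ≤ c := by positivity
  rw [Metric.tendsto_nhds]
  intro δ hδ
  set η := δ / (c + 1) with hη
  have hη0 : 0 < η := by positivity
  obtain ⟨ρ, hρ0, hρ⟩ := Metric.tendsto_nhdsWithin_nhds.1 hσ0 η hη0
  have hσρ : ∀ x, 0 < x → x < ρ → |σ x| ≤ η := fun x h1 h2 => by
    have := hρ h1 (by simpa [abs_of_pos h1] using h2)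
    simpa using this.le
  have hev : ∀ᶠ ε : ℝ in 𝓝[>] 0, r * ε < min ρ (1 / 2) := by
    have : Tendsto (fun ε : ℝ => r * ε) (𝓝[>] 0) (𝓝 0) := by
      have : Tendsto (fun ε : ℝ => r * ε) (𝓝 0) (𝓝 (r * 0)) := tendsto_id.const_mul r
      rw [mul_zero] at this
      exact this.mono_left nhdsWithin_le_nhds
    exact this.eventually (gt_mem_nhds (lt_min hρ0 (by norm_num)))
  filter_upwards [hev, self_mem_nhdsWithin] with ε hε hε0
  have hε0 : 0 < ε := hε0
  have kε := hK.rescale hε0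
  set S : E3 → ℝ := fun ξ => ∑ j, |gr (rescale K ε) ξ j| with hS
  have hSi : Integrable S := integrable_finsetSum _ fun j _ => (kε.pd j).integrable.abs
  have hSint : ∫ ξ, S ξ = ε⁻¹ * m := by
    refine (integral_finsetSum _ fun j _ => (kε.pd j).integrable.abs).trans ?_
    rw [hm, Finset.mul_sum]
    refine Finset.sum_congr rfl fun j _ => ?_
    rw [← integral_abs_rescale (K := pd j K) hε0, ← integral_const_mul]
    simp only [pd_rescale hK.smooth, abs_mul, abs_of_pos (inv_pos.2 hε0)]
  have hSg : ∀ ξ, ‖gradient (rescale K ε) ξ‖ ≤ S ξ := fun ξ => by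
    rw [EuclideanSpace.norm_eq]
    refine (Real.sqrt_le_sqrt (Finset.sum_sq_le_sq_sum_of_nonneg fun i _ => norm_nonneg _)).trans ?_
    rw [Real.sqrt_sq (Finset.sum_nonneg fun i _ => norm_nonneg _)]
    simp only [gradient_apply, Real.norm_eq_abs, hS, le_refl]
  have hsupp : ∀ ξ, gradient (rescale K ε) ξ ≠ 0 → ‖ξ‖ ≤ r * ε := fun ξ hξ => by
    obtain ⟨j, hj⟩ : ∃ j, gr (rescale K ε) ξ j ≠ 0 := by
      by_contra h'
      push Not at h'
      exact hξ (by ext j; rw [gradient_apply, h' j]; rfl)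
    rw [gr, pd_rescale hK.smooth] at hj
    refine (rescale_support hε0 (hR j) ξ (right_ne_zero_of_mul hj)).trans ?_
    exact mul_le_mul_of_nonneg_right (Finset.single_le_sum (fun i _ => (hR0 i).le) (Finset.mem_univ j)) hε0.le
  have hpt : ∀ᵐ t ∂(tm T), ∀ ξ, |b t ξ (fun x => φ t x • gradient (rescale K ε) ξ)| ≤
      |C t| * (r * ε * η * L) * S ξ := by
    filter_upwards [hb0, hb] with t h0 h1 ξ
    have hS0 : 0 ≤ S ξ := (norm_nonneg _).trans (hSg ξ)
    by_cases hg : gradient (rescale K ε) ξ = 0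
    · rw [hg, h0, abs_zero]; positivity
    have hξ := hsupp ξ hg
    have hcell : ξ ∈ centredCell := ball_subset_centredCell
      (mem_ball_zero_iff.2 (hξ.trans_lt (hε.trans_le (min_le_right _ _))))
    have hsm : ‖ξ‖ * |σ ‖ξ‖| ≤ r * ε * η := by
      rcases (norm_nonneg ξ).eq_or_lt with e | e
      · rw [← e, zero_mul]; positivity
      · exact mul_le_mul hξ (hσρ _ e (hξ.trans_lt (hε.trans_le (min_le_left _ _)))) (abs_nonneg _)
          (by positivity)
    refine (h1 ξ hcell _ ((hφ.smp t).smul_mem _)).trans ((mul_le_mul (le_abs_self _)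
      (hL t _) (halfHolderNorm_nonneg _) (abs_nonneg _)).trans ?_)
    rw [abs_mul, abs_mul, abs_norm]
    calc _ = |C t| * ((‖ξ‖ * |σ ‖ξ‖|) * L) * ‖gradient (rescale K ε) ξ‖ := by ring
      _ ≤ |C t| * ((r * ε * η) * L) * S ξ := by
        gcongr
        exact hSg ξ
  have hin : ∀ᵐ t ∂(tm T), ‖∫ ξ, b t ξ (fun x => φ t x • gradient (rescale K ε) ξ)‖ ≤
      |C t| * (r * L * m * η) := by
    filter_upwards [hpt] with t ht
    refine (norm_integral_le_of_norm_le (hSi.const_mul (|C t| * (r * ε * η * L))) (ae_of_all _ ht)).trans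
      (le_of_eq ?_)
    rw [integral_const_mul, hSint]
    field_simp
  have hfin := norm_integral_le_of_norm_le (hC.abs.mul_const (r * L * m * η)) hin
  rw [integral_mul_const] at hfin
  rw [dist_zero_right]
  refine hfin.trans_lt ?_
  calc (∫ t in Ioo 0 T, |C t|) * (r * L * m * η) = c / (c + 1) * δ := by rw [hη]; ring
    _ < δ := mul_lt_of_lt_one_left hδ ((div_lt_one (by positivity)).2 (by linarith))

end

section defects

variable {T s M : ℝ} {A : ℝ → ℝ} {u : ℝ → E3 → E3} {ω : ℝ → VecDistribution} {C σ : ℝ → ℝ}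

lemma Flow.isDefect₁ (h : Flow T s A M (fun i t => co (u t) i))
    (hcurl : ∀ᵐ t ∂(tm T), IsCurl (ω t) (u t)) (hC : IntegrableOn C (Ioo 0 T))
    (hσ0 : Tendsto σ (𝓝[>] 0) (𝓝 0))
    (hb : ∀ᵐ t ∂(tm T), ∀ ξ ∈ centredCell, ∀ φ ∈ testFields,
      |tripleBracket₁ (ω t) (u t) ξ φ| ≤ C t * ‖ξ‖ * σ ‖ξ‖ * halfHolderNorm φ) :
    IsDefect₁ T u ω (fun _ => 0) := by
  have hgood : ∀ᵐ t ∂(tm T), IsCurl (ω t) (u t) ∧ ∀ i, Nik s 3 (A t) (co (u t) i) := hcurl.and h.nik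
  refine ⟨hgood.mono fun t a ξ φ hφ => ⟨_, a.1.cubic₁ h.lt h.lt_one.le a.2 hφ ξ⟩, ?_, ?_⟩
  · intro ρ hρ φ hφ ε hε
    refine (h.integrable_trip hφ (hρ.ker.rescale hε)).1.congr ?_
    filter_upwards [Measure.quasiMeasurePreserving_fst.ae hgood] with z a
    rw [tripleBracket₁_eq a.1 h.lt h.lt_one.le a.2 (hφ.smp z.1)]
    simp only [gradient_apply]
  · intro ρ hρ φ hφ
    refine tendsto_defect (b := fun t => tripleBracket₁ (ω t) (u t)) hφ hC hσ0 ?_ hb hρ.ker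
    obtain ⟨c, -, hc⟩ := trip_bounds h.lt
    obtain ⟨B, hB0, hB⟩ := hφ.exists_nik (by linarith [h.lt]) h.lt_one.le
    filter_upwards [hgood] with t a ξ
    rw [tripleBracket₁_eq a.1 h.lt h.lt_one.le a.2 (hφ.smp t)]
    simpa using (hc a.2 (hB t) (fun j => (0 : E3) j) ξ).1

lemma Flow.isDefect₂ (h : Flow T s A M (fun i t => co (u t) i))
    (hcurl : ∀ᵐ t ∂(tm T), IsCurl (ω t) (u t)) (hC : IntegrableOn C (Ioo 0 T))
    (hσ0 : Tendsto σ (𝓝[>] 0) (𝓝 0))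
    (hb : ∀ᵐ t ∂(tm T), ∀ ξ ∈ centredCell, ∀ φ ∈ testFields,
      |tripleBracket₂ (ω t) (u t) ξ φ| ≤ C t * ‖ξ‖ * σ ‖ξ‖ * halfHolderNorm φ) :
    IsDefect₂ T u ω (fun _ => 0) := by
  have hgood : ∀ᵐ t ∂(tm T), IsCurl (ω t) (u t) ∧ ∀ i, Nik s 3 (A t) (co (u t) i) := hcurl.and h.nik
  refine ⟨hgood.mono fun t a ξ φ hφ => ⟨_, a.1.cubic₂ h.lt h.lt_one.le a.2 hφ ξ⟩, ?_, ?_⟩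
  · intro ρ hρ φ hφ ε hε
    refine (h.integrable_trip hφ (hρ.ker.rescale hε)).2.congr ?_
    filter_upwards [Measure.quasiMeasurePreserving_fst.ae hgood] with z a
    rw [tripleBracket₂_eq a.1 h.lt h.lt_one.le a.2 (hφ.smp z.1)]
    simp only [gradient_apply]
  · intro ρ hρ φ hφ
    refine tendsto_defect (b := fun t => tripleBracket₂ (ω t) (u t)) hφ hC hσ0 ?_ hb hρ.ker
    obtain ⟨c, -, hc⟩ := trip_bounds h.lt
    obtain ⟨B, hB0, hB⟩ := hφ.exists_nik (by linarith [h.lt]) h.lt_one.le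
    filter_upwards [hgood] with t a ξ
    rw [tripleBracket₂_eq a.1 h.lt h.lt_one.le a.2 (hφ.smp t)]
    simpa using (hc a.2 (hB t) (fun j => (0 : E3) j) ξ).2

end defects

/-! ### Conservation of helicity -/

lemma Bc_two_mul_sub {s A B : ℝ} {v f g : Fin 3 → E3 → ℝ} (hs : 1 / 2 < s) (hv : ∀ i, Nik s 3 A (v i))
    (hf : ∀ i, Nik s (3 / 2) B (f i)) (hg : ∀ i, Nik s (3 / 2) B (g i)) :
    Bc v (fun i x => 2 * f i x - g i x) = 2 * Bc v f - Bc v g := by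
  have e : ∀ i j k, bf j (v i) (fun x => 2 * f k x - g k x) = 2 * bf j (v i) (f k) - bf j (v i) (g k) := by
    intro i j k
    have h := bf_add_right hs one_le_three one_le_three_half (hv i) ((hf k).const_mul 2)
      ((hg k).const_mul (-1)) j
    rw [bf_const_mul_right hs one_le_three one_le_three_half (hv i) (hf k),
      bf_const_mul_right hs one_le_three one_le_three_half (hv i) (hg k)] at h
    simpa only [neg_one_mul, ← sub_eq_add_neg] using h
  simp only [Bc, e]
  ring

section

variable {T s s' M : ℝ} {A : ℝ → ℝ} {u : ℝ → E3 → E3} {ω : ℝ → VecDistribution}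

lemma Flow.bracket_fam (h : Flow T s A M (fun i t => co (u t) i))
    (hcurl : ∀ᵐ t ∂(tm T), IsCurl (ω t) (u t)) (hs' : 1 / 2 < s') (hss : s' ≤ s) {f : ℝ → E3 → E3}
    {F : Fin 3 → ℝ → E3 → ℝ} (e : ∀ i t x, f t x i = F i t x)
    (hF : ∀ i, Fam T s' A (3 / 2) 2 (fun _ => F i) (F i)) :
    (∀ᵐ t ∂(tm T), BracketDefined (ω t) (f t)) ∧
    (∀ᵐ t ∂(tm T), bracket (ω t) (f t) = Bc (co (u t)) (fun i => F i t)) ∧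
    IntegrableOn (fun t => bracket (ω t) (f t)) (Ioo 0 T) := by
  have hco : ∀ t, co (f t) = fun i => F i t := fun t => by ext i x; exact e i t x
  obtain ⟨C, hC0, hC⟩ := Fam.common hF h.one_le
  have hb : ∀ᵐ t ∂(tm T), HasBracket (ω t) (f t) (Bc (co (u t)) (fun i => F i t)) := by
    filter_upwards [hcurl, h.nik, hC] with t a b c
    rw [← hco]
    refine a.hasBracket hs' (p := 3) (q := 3 / 2) (B := C * A t ^ 2) one_le_three one_le_three_half
      (fun i => (b i).mono_s one_le_three (by linarith) hss) fun i => ?_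
    rw [hco]
    exact (c i).2
  have hb' := hb.mono fun t a => bracket_eq a
  refine ⟨hb.mono fun t a => ⟨_, a⟩, hb', ?_⟩
  exact (h.tendsto_Bc hs' (fun i => h.fam (by linarith) hss i) hF).2.1.congr
    (hb'.mono fun t a => a.symm)

lemma Flow.conservesLocalHelicity (h : Flow T s A M (fun i t => co (u t) i))
    (hcurl : ∀ᵐ t ∂(tm T), IsCurl (ω t) (u t))
    (hmom : MomentumEq T (fun i t => co (u t) i))
    (hd₁ : IsDefect₁ T u ω (fun _ => 0)) (hd₂ : IsDefect₂ T u ω (fun _ => 0)) :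
    ConservesLocalHelicity T u ω (fun t => pr (co (u t))) := by
  obtain ⟨r, hr, hrs⟩ := exists_between h.lt
  have h0 : 0 ≤ r := by linarith
  have h1 : r ≤ 1 := hrs.le.trans h.lt_one.le
  have h3 := one_le_three
  have h32 := one_le_three_half
  have U := fun i => h.fam h0 hrs.le i
  have P := h.fam_pr h0 hrs
  have g := fun φ (hφ : IsTest T φ) i => (hφ.pd i).fam (A := A) h0 h1
  have ad : ∀ φ, IsTest T φ →
      Fam T r A 3 1 (fun _ t => adv (φ t) (co (u t))) (fun t => adv (φ t) (co (u t))) := fun φ hφ =>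
    Fam.sum (fun j => (U j).mul (r := 3) (g φ hφ j) le_top h3) h3
  have sqf : Fam T r A (3 / 2) 2 (fun _ t => sq (co (u t))) (fun t => sq (co (u t))) :=
    Fam.sum (fun j => (U j).mul (r := 3 / 2) (U j) h3 h32) h32
  have f3 := fun φ (hφ : IsTest T φ) i => (ad φ hφ).mul (r := 3 / 2) (U i) h3 h32
  have f4 := fun φ (hφ : IsTest T φ) i => sqf.mul (r := 3 / 2) (g φ hφ i) le_top h32
  have b1 := fun φ (hφ : IsTest T φ) => h.bracket_fam hcurl hr hrs.le
    (f := fun t x => timeDeriv φ t x • u t x) (fun i t x => by simp [co])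
    fun i => ((hφ.td.fam h0 h1).mul (r := 3) (U i) h3 h3).lift h.one_le
  have b2 := fun φ (hφ : IsTest T φ) => h.bracket_fam hcurl hr hrs.le
    (f := fun t x => pr (co (u t)) x • gradient (φ t) x)
    (fun i t x => by simp [gradient_apply, gr]) fun i => P.mul (r := 3 / 2) (g φ hφ i) le_top h32
  have b3 := fun φ (hφ : IsTest T φ) => h.bracket_fam hcurl hr hrs.le
    (f := fun t x => (inner ℝ (u t x) (gradient (φ t) x) : ℝ) • u t x)
    (fun i t x => by rw [gradient_inner]; rfl) (f3 φ hφ)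
  have b4 := fun φ (hφ : IsTest T φ) => h.bracket_fam hcurl hr hrs.le
    (f := fun t x => ‖u t x‖ ^ 2 • gradient (φ t) x)
    (fun i t x => by simp [gradient_apply, gr, norm_sq_eq_sum, sq, co]) (f4 φ hφ)
  refine ⟨fun φ hφ => ?_, fun φ hφ => ⟨(b1 φ hφ).2.2, (b2 φ hφ).2.2, (b3 φ hφ).2.2, (b4 φ hφ).2.2⟩,
    fun φ hφ => ?_⟩
  · filter_upwards [(b1 φ hφ).1, (b2 φ hφ).1, (b3 φ hφ).1, (b4 φ hφ).1] with t a b c d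
      using ⟨a, b, c, d⟩
  have e₁ : ∀ ε, 0 < ε → ∀ᵐ t ∂(tm T), ∫ ξ, tripleBracket₁ (ω t) (u t) ξ
      (fun x => φ t x • gradient (rescale χ₀ ε) ξ) =
      ∫ ξ, Bc (co (u t)) (dn ξ (trip₁ (co (u t)) (φ t) (gr (rescale χ₀ ε) ξ) ξ)) := fun ε hε => by
    filter_upwards [hcurl, h.nik] with t a b
    simp only [tripleBracket₁_eq a h.lt h.lt_one.le b (hφ.smp t), gradient_apply]
  have e₂ : ∀ ε, 0 < ε → ∀ᵐ t ∂(tm T), ∫ ξ, tripleBracket₂ (ω t) (u t) ξ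
      (fun x => φ t x • gradient (rescale χ₀ ε) ξ) =
      ∫ ξ, Bc (co (u t)) (dn ξ (trip₂ (co (u t)) (φ t) (gr (rescale χ₀ ε) ξ) ξ)) := fun ε hε => by
    filter_upwards [hcurl, h.nik] with t a b
    simp only [tripleBracket₂_eq a h.lt h.lt_one.le b (hφ.smp t), gradient_apply]
  have bal := h.helicity_balance hmom hφ χ₀_moll.ker χ₀_moll.even χ₀_moll.integral_eq
    (fun _ _ => rfl) (fun _ _ => rfl)
    (fun ε hε => (h.integrable_trip hφ (χ₀_moll.ker.rescale hε)).1.integral_prod_left)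
    (fun ε hε => (h.integrable_trip hφ (χ₀_moll.ker.rescale hε)).2.integral_prod_left)
    ((hd₁.limit χ₀ χ₀_moll φ hφ).congr' (by
      filter_upwards [self_mem_nhdsWithin] with ε hε using integral_congr_ae (e₁ ε hε)))
    ((hd₂.limit χ₀ χ₀_moll φ hφ).congr' (by
      filter_upwards [self_mem_nhdsWithin] with ε hε using integral_congr_ae (e₂ ε hε)))
  obtain ⟨C, hC0, hC⟩ := Fam.common (f3 φ hφ) h.one_le
  obtain ⟨D, hD0, hD⟩ := Fam.common (f4 φ hφ) h.one_le
  have e3 : ∀ᵐ t ∂(tm T), Bc (co (u t)) (fun i x => 2 * (adv (φ t) (co (u t)) x * co (u t) i x) -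
      sq (co (u t)) x * pd i (φ t) x) = 2 * bracket (ω t)
        (fun x => (inner ℝ (u t x) (gradient (φ t) x) : ℝ) • u t x) -
        bracket (ω t) (fun x => ‖u t x‖ ^ 2 • gradient (φ t) x) := by
    filter_upwards [(b3 φ hφ).2.1, (b4 φ hφ).2.1, hC, hD, h.nik] with t a b c d n
    have hA := pow_nonneg (zero_le_one.trans (h.one_le t)) 2
    rw [a, b]
    exact Bc_two_mul_sub hr (fun i => (n i).mono_s h3 h0 hrs.le)
      (fun i => ((c i).2).mono (mul_le_mul_of_nonneg_right (le_add_of_nonneg_right hD0) hA))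
      (fun i => ((d i).2).mono (mul_le_mul_of_nonneg_right (le_add_of_nonneg_left hC0) hA))
  rw [integral_congr_ae e3, ← integral_congr_ae (b1 φ hφ).2.1, ← integral_congr_ae (b2 φ hφ).2.1] at bal
  have i1 := (b1 φ hφ).2.2.const_mul 2
  have i2 := (b2 φ hφ).2.2.const_mul 2
  have i3 := ((b3 φ hφ).2.2.const_mul 2).sub (b4 φ hφ).2.2
  have e := integral_add' (i1.add i2) i3
  rw [integral_add' i1 i2, integral_const_mul, integral_const_mul] at e
  exact e.trans bal

end

end Helicity

end


theorem mainTheorem2 (T : ℝ) (hT : 0 < T)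
    (u : ℝ → Helicity.E3 → Helicity.E3) (ω : ℝ → Helicity.VecDistribution)
    (hsol : Helicity.IsFunctionalVorticitySolution T u ω)
    (hreg : Helicity.MemLpSobolevPlus T 3 (1 / 2) 3 u)
    (C : ℝ → ℝ) (hC : IntegrableOn C (Ioo 0 T))
    (σ : ℝ → ℝ) (hσ : ∀ K : Set ℝ, IsCompact K → MemLp σ ⊤ (volume.restrict K))
    (hσ0 : Tendsto σ (𝓝[>] 0) (𝓝 0))
    (h₁ : ∀ᵐ t ∂(volume.restrict (Ioo 0 T)), ∀ ξ ∈ Helicity.centredCell,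
      ∀ φ ∈ Helicity.testFields,
        |Helicity.tripleBracket₁ (ω t) (u t) ξ φ| ≤
          C t * ‖ξ‖ * σ ‖ξ‖ * Helicity.halfHolderNorm φ)
    (h₂ : ∀ᵐ t ∂(volume.restrict (Ioo 0 T)), ∀ ξ ∈ Helicity.centredCell,
      ∀ φ ∈ Helicity.testFields,
        |Helicity.tripleBracket₂ (ω t) (u t) ξ φ| ≤
          C t * ‖ξ‖ * σ ‖ξ‖ * Helicity.halfHolderNorm φ) :
    Helicity.IsDefect₁ T u ω (fun _ => 0) ∧
    Helicity.IsDefect₂ T u ω (fun _ => 0) ∧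
    ∃ p : ℝ → Helicity.E3 → ℝ,
      Helicity.IsPressure T u p ∧ Helicity.ConservesLocalHelicity T u ω p := by
  obtain ⟨s, A, M, h⟩ := Helicity.flow_of_solution hsol hreg
  have hcurl : ∀ᵐ t ∂(Helicity.tm T), Helicity.IsCurl (ω t) (u t) := hsol.curl_eq
  have hmom := h.momentum (h.momentum_curl hcurl hsol.equation)
  have hd₁ := h.isDefect₁ hcurl hC hσ0 h₁
  have hd₂ := h.isDefect₂ hcurl hC hσ0 h₂
  exact ⟨hd₁, hd₂, _, h.isPressure hmom, h.conservesLocalHelicity hcurl hmom hd₁ hd₂⟩
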